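/- Let $\Sigma$ be a compact connected smooth Riemannian $3$-manifold with non-empty boundary $\partial\Sigma$. Suppose that there is a smooth function $f:\Sigma\to(0,\infty)$ such that $$\operatorname{Ric}(v,v) - f^{-1}\Delta f + \tfrac12\,|\nabla \ln f|^2 > 0$$ for every point of $\Sigma$ and every unit tangent vector $v$ at that point, and such that $$\partial_\eta f = -f\,H_{\partial\Sigma}\qquad\text{on }\partial\Sigma,$$ where $\eta$ is the outward unit normal of $\partial\Sigma$, $\Delta$ is the Laplace–Beltrami operator (the trace of the Hessian), and $H_{\partial\Sigma}$ is the mean curvature of $\partial\Sigma$ with respect to $\eta$, i.e. the trace of $(X,Y)\mapsto\langle\nabla_X\eta,Y\rangle$ over the tangent space of $\partial\Sigma$ (so that the unit ball in $\mathbb R^3$ has $H=2$). Then $\partial\Sigma$ is connected. -/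

import Mathlib

open Set Bundle
open scoped Manifold ContDiff Bundle

/-!
Riemannian geometry of an `n`-dimensional smooth manifold with boundary, in local coordinates.
The manifold is modelled on the half-space `{x ∈ ℝⁿ | 0 ≤ x₀}`, its Riemannian metric is the inner
product that Mathlib's `RiemannianBundle` puts on the tangent spaces, and `φ` denotes a chart of the
smooth maximal atlas with coordinates `x₀, …, xₙ₋₁`. Coordinate indices run over `Fin n`, and the
boundary is `{x₀ = 0}` in any chart. The quantities below are those of the Levi-Civita connection;
their values at a point of the manifold do not depend on the chart `φ` around that point.
-/

namespace RiemannCoord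

noncomputable section

/-- The partial derivative `∂ᵢ u` at `y` of a function of the coordinates. The derivative is taken
within the half-space, so that it is the usual one in the interior, and it makes sense at the
boundary. -/
def pderiv {n : ℕ} [NeZero n] (i : Fin n) (u : EuclideanSpace ℝ (Fin n) → ℝ)
    (y : EuclideanSpace ℝ (Fin n)) : ℝ :=
  fderivWithin ℝ u (range (𝓡∂ n)) y (EuclideanSpace.single i 1)

section Manifold

variable {n : ℕ} [NeZero n] {M : Type*} [TopologicalSpace M]
  [ChartedSpace (EuclideanHalfSpace n) M]

/-- A function on the manifold, read in the coordinates of `φ`. -/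
def read (φ : OpenPartialHomeomorph M (EuclideanHalfSpace n)) (f : M → ℝ) :
    EuclideanSpace ℝ (Fin n) → ℝ :=
  fun y => f ((φ.extend (𝓡∂ n)).symm y)

/-- The coordinate vector field `∂ᵢ` of the chart `φ`, at the point with coordinates `y`. -/
def frame (φ : OpenPartialHomeomorph M (EuclideanHalfSpace n)) (i : Fin n)
    (y : EuclideanSpace ℝ (Fin n)) : TangentSpace (𝓡∂ n) ((φ.extend (𝓡∂ n)).symm y) :=
  mfderivWithin 𝓘(ℝ, EuclideanSpace ℝ (Fin n)) (𝓡∂ n) (φ.extend (𝓡∂ n)).symm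
    (range (𝓡∂ n)) y (EuclideanSpace.single i (1 : ℝ) : EuclideanSpace ℝ (Fin n))

/-- The component `vⁱ = dxⁱ(v)` of a tangent vector `v` at `p` in the chart `φ`. -/
def comp (φ : OpenPartialHomeomorph M (EuclideanHalfSpace n)) (p : M)
    (v : TangentSpace (𝓡∂ n) p) (i : Fin n) : ℝ :=
  (show EuclideanSpace ℝ (Fin n) from
    mfderiv (𝓡∂ n) 𝓘(ℝ, EuclideanSpace ℝ (Fin n)) (φ.extend (𝓡∂ n)) p v) i

variable [RiemannianBundle (fun x : M => TangentSpace (𝓡∂ n) x)]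

/-- The matrix `gᵢⱼ = ⟨∂ᵢ, ∂ⱼ⟩` of the metric in the chart `φ`; its inverse is `gⁱʲ`. -/
def gram (φ : OpenPartialHomeomorph M (EuclideanHalfSpace n))
    (y : EuclideanSpace ℝ (Fin n)) : Matrix (Fin n) (Fin n) ℝ :=
  Matrix.of fun i j => inner ℝ (frame φ i y) (frame φ j y)

/-- The Christoffel symbol
`Γᵏᵢⱼ = ½ ∑ₗ gᵏˡ (∂ᵢ gⱼₗ + ∂ⱼ gᵢₗ - ∂ₗ gᵢⱼ)` of the Levi-Civita connection. -/
def christoffel (φ : OpenPartialHomeomorph M (EuclideanHalfSpace n)) (k i j : Fin n)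
    (y : EuclideanSpace ℝ (Fin n)) : ℝ :=
  1 / 2 * ∑ l, (gram φ y)⁻¹ k l *
    (pderiv i (fun z => gram φ z j l) y + pderiv j (fun z => gram φ z i l) y
      - pderiv l (fun z => gram φ z i j) y)

/-- The components of the Ricci tensor,
`Ricᵢⱼ = ∑ₖ (∂ₖ Γᵏᵢⱼ - ∂ⱼ Γᵏᵢₖ) + ∑ₖₗ (Γᵏₖₗ Γˡᵢⱼ - Γᵏⱼₗ Γˡᵢₖ)`
(so that round spheres have positive Ricci curvature). -/
def ricciComp (φ : OpenPartialHomeomorph M (EuclideanHalfSpace n)) (i j : Fin n)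
    (y : EuclideanSpace ℝ (Fin n)) : ℝ :=
  ∑ k, (pderiv k (christoffel φ k i j) y - pderiv j (christoffel φ k i k) y)
    + ∑ k, ∑ l, (christoffel φ k k l y * christoffel φ l i j y
      - christoffel φ k j l y * christoffel φ l i k y)

/-- The Ricci curvature `Ric(v, v)` of a tangent vector `v` at `p`. -/
def ricci (φ : OpenPartialHomeomorph M (EuclideanHalfSpace n)) (p : M)
    (v : TangentSpace (𝓡∂ n) p) : ℝ :=
  ∑ i, ∑ j, ricciComp φ i j (φ.extend (𝓡∂ n) p) * comp φ p v i * comp φ p v j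

/-- The Laplacian `Δf = ∑ᵢⱼ gⁱʲ (∂ᵢ∂ⱼ f - ∑ₖ Γᵏᵢⱼ ∂ₖ f)` at `p`, the trace of the Hessian. -/
def laplacian (φ : OpenPartialHomeomorph M (EuclideanHalfSpace n)) (f : M → ℝ) (p : M) : ℝ :=
  ∑ i, ∑ j, (gram φ (φ.extend (𝓡∂ n) p))⁻¹ i j *
    (pderiv i (pderiv j (read φ f)) (φ.extend (𝓡∂ n) p)
      - ∑ k, christoffel φ k i j (φ.extend (𝓡∂ n) p)
        * pderiv k (read φ f) (φ.extend (𝓡∂ n) p))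

/-- The squared length `|∇f|² = ∑ᵢⱼ gⁱʲ ∂ᵢf ∂ⱼf` of the gradient at `p`. -/
def gradNormSq (φ : OpenPartialHomeomorph M (EuclideanHalfSpace n)) (f : M → ℝ) (p : M) : ℝ :=
  ∑ i, ∑ j, (gram φ (φ.extend (𝓡∂ n) p))⁻¹ i j *
    pderiv i (read φ f) (φ.extend (𝓡∂ n) p) * pderiv j (read φ f) (φ.extend (𝓡∂ n) p)

/-- The components `ηᵏ = -gᵏ⁰ / √g⁰⁰` of the unit normal to the hypersurfaces `x₀ = const` that
points to decreasing `x₀`, i.e. `-∇x₀ / |∇x₀|`. On the boundary this is the outward unit normal. -/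
def normal (φ : OpenPartialHomeomorph M (EuclideanHalfSpace n))
    (y : EuclideanSpace ℝ (Fin n)) (k : Fin n) : ℝ :=
  -(gram φ y)⁻¹ k 0 / √((gram φ y)⁻¹ 0 0)

/-- The outward normal derivative `∂_η f = ∑ₖ ηᵏ ∂ₖf` at a boundary point `p`. -/
def normalDeriv (φ : OpenPartialHomeomorph M (EuclideanHalfSpace n)) (f : M → ℝ) (p : M) : ℝ :=
  ∑ k, normal φ (φ.extend (𝓡∂ n) p) k * pderiv k (read φ f) (φ.extend (𝓡∂ n) p)

/-- The second fundamental form `A(∂ᵢ, ∂ⱼ) = ⟨∇_{∂ᵢ} η, ∂ⱼ⟩ = -⟨η, ∇_{∂ᵢ} ∂ⱼ⟩ = -∑ₖₗ gₖₗ ηᵏ Γˡᵢⱼ`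
of the boundary with respect to the outward unit normal (for `∂ᵢ`, `∂ⱼ` tangent to the
boundary, i.e. `i, j ≠ 0`). -/
def secondForm (φ : OpenPartialHomeomorph M (EuclideanHalfSpace n)) (i j : Fin n)
    (y : EuclideanSpace ℝ (Fin n)) : ℝ :=
  -∑ k, ∑ l, gram φ y k l * normal φ y k * christoffel φ l i j y

/-- The mean curvature `H` of the boundary at `p` with respect to the outward unit normal, i.e. the
trace of the second fundamental form over the tangent space of the boundary (the unit ball of
`ℝⁿ` has `H = n - 1`). The matrix `gⁱʲ - ηⁱηʲ` vanishes if `i = 0` or `j = 0`, and on the remaining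
indices it is the inverse of the metric of the boundary. -/
def meanCurvature (φ : OpenPartialHomeomorph M (EuclideanHalfSpace n)) (p : M) : ℝ :=
  ∑ i, ∑ j, ((gram φ (φ.extend (𝓡∂ n) p))⁻¹ i j
    - normal φ (φ.extend (𝓡∂ n) p) i * normal φ (φ.extend (𝓡∂ n) p) j)
      * secondForm φ i j (φ.extend (𝓡∂ n) p)

end Manifold

end

end RiemannCoord

/-!
Suppose that `∂M` is the disjoint union of two nonempty closed sets `C₁` and `C₂`. A shortest curve
`γ` from `C₁` to `C₂` for the conformal metric `f² g` is a smooth geodesic that meets the boundary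
only at its ends, and perpendicularly there. Let `u` be its velocity, of length `f⁻¹` for `g`, and
let `V₀`, `V₁` be fields along `γ`, orthogonal to `u` and with `g(Vᵢ, Vⱼ) = f⁻¹ δᵢⱼ`, that solve
`D_u V = -½ (df(u)/f) V - (df(V)/f) u`. The second variations of the energy in the directions `V₀`
and `V₁` have a sum that is a boundary term minus the integral of an expression that is at least
`f⁻¹ (Ric(f u, f u) - f⁻¹ Δf + ½ |∇ ln f|²) > 0`. At either end the boundary term is a multiple of
`f H + ∂_η f`, which vanishes by the boundary condition. So the sum of the second variations is
negative, and one of the varied curves is a shorter connection of `C₁` and `C₂`: a contradiction.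

The fields need not be defined on all of `γ` at once. Let `d₁` be the distance to `C₁`. What is
carried along `γ`, from chart to chart, is the inequality `WeightedMetric.Barrier`, namely
`∑ᵢ ∑± d₁(γ(t) ± s Vᵢ + ½ s² Wᵢ) ≤ 4 t + s² (B(t) - κ + ε)` for all `ε > 0` and all small `s`. Here
`B = ∑ᵢ f² g(Wᵢ + Γ(Vᵢ, Vᵢ), u) - df(u)` is the boundary term `WeightedMetric.endTerm`, which does
not depend on the coordinates. The inequality holds for `t = 0` with `κ = 0`
(`Minimizer.hasBarrier_zero`); the second variation within a chart increases `κ`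
(`WeightedMetric.Geodesic.exists_barrier`, by way of `WeightedMetric.secondEnergy_fieldMap`); a
change of coordinates keeps it (`WeightedMetric.IsIsometryAt.exists_barrier`, where `W` absorbs the
second derivative of the transition map); and for `t = L` it fails if `κ > 0`, as `d₁ ≥ L` on `C₂`
(`Minimizer.not_barrier_end`).

The analysis in charts is done for a `WeightedMetric`, a metric and a weight on a relatively open
subset of a half-space, with the Christoffel symbols and the derivatives that occur as part of the
data; `chartMetric` is the instance given by a chart of `M`. The distance enters through
`LengthDist`, whose properties are shared by Mathlib's Riemannian distance for `f² g`
(`nonempty_conformalDist`). Shortest curves exist by compactness (`LengthDist.exists_isometric`).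
They are `C¹` since the parallelogram law bounds the second differences `x(t+h) - 2 x(t) + x(t-h)`
by a multiple of `h^(3/2)` (`WeightedMetric.IsChartDist.second_difference_le`), and they are
geodesics by the lemma of du Bois-Reymond (`Minimizer.geodesic`). Near the boundary the variations
stay in the half-space because the fields are tangent to the boundary where the curve, which is
transversal to it, reaches it (`WeightedMetric.exists_mem_of_dominated`).
-/

set_option linter.unusedSectionVars false

/-! ### Smoothness of the metric in a chart -/


noncomputable section

open scoped Topology

section ChartFrame

variable {E : Type*} [NormedAddCommGroup E] [NormedSpace ℝ E] {H : Type*} [TopologicalSpace H]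
  {I : ModelWithCorners ℝ E H} {M : Type*} [TopologicalSpace M] [ChartedSpace H M]

lemma mfderivWithin_target_eq_range [IsManifold I 1 M] (x₀ : M) {y : E}
    (hy : y ∈ (extChartAt I x₀).target) :
    mfderivWithin 𝓘(ℝ, E) I (extChartAt I x₀).symm (extChartAt I x₀).target y =
      mfderivWithin 𝓘(ℝ, E) I (extChartAt I x₀).symm (range I) y := by
  apply mfderivWithin_subset (extChartAt_target_subset_range x₀)
  · exact (uniqueDiffOn_extChartAt_target x₀).uniqueMDiffOn y hy
  · exact mdifferentiableWithinAt_extChartAt_symm hy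

lemma contMDiffOn_symm_mfderiv_const [IsManifold I ∞ M] (x₀ : M) (v : E) :
    ContMDiffOn 𝓘(ℝ, E) I.tangent ∞
      (fun y => (⟨(extChartAt I x₀).symm y,
        mfderivWithin 𝓘(ℝ, E) I (extChartAt I x₀).symm (range I) y v⟩ :
        TangentBundle I M)) (extChartAt I x₀).target := by
  have h1 := (contMDiffOn_extChartAt_symm (I := I) (n := ∞) x₀).contMDiffOn_tangentMapWithin
    (m := ∞) (by simp) ((uniqueDiffOn_extChartAt_target x₀).uniqueMDiffOn)
  have h2 : ContMDiff 𝓘(ℝ, E) 𝓘(ℝ, E).tangent ∞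
      (fun y => (⟨y, v⟩ : TangentBundle 𝓘(ℝ, E) E)) := by
    apply contMDiff_vectorSpace_iff_contDiff.2
    exact contDiff_const
  refine (h1.comp h2.contMDiffOn (s := (extChartAt I x₀).target) ?_).congr ?_
  · intro y hy; exact hy
  · intro y hy
    have : IsManifold I 1 M := IsManifold.of_le (n := ∞) (by simp)
    simp only [Function.comp, tangentMapWithin]
    rw [mfderivWithin_target_eq_range x₀ hy]

end ChartFrame

namespace RiemannCoord

variable {n : ℕ} [NeZero n] {M : Type*} [TopologicalSpace M]
  [ChartedSpace (EuclideanHalfSpace n) M]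

/-- The covector `∑ᵢ ∂ᵢu dxⁱ`: the differential of `u` taken within the half-space. -/
def coordDiff (u : EuclideanSpace ℝ (Fin n) → ℝ) (y : EuclideanSpace ℝ (Fin n)) :
    EuclideanSpace ℝ (Fin n) →L[ℝ] ℝ :=
  ∑ i, pderiv i u y • (EuclideanSpace.proj i : EuclideanSpace ℝ (Fin n) →L[ℝ] ℝ)

lemma sum_smul_single (u : EuclideanSpace ℝ (Fin n)) :
    ∑ i, u i • (EuclideanSpace.single i (1 : ℝ) : EuclideanSpace ℝ (Fin n)) = u := by
  ext k
  simp [Pi.single_apply]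

lemma coordDiff_eq (u : EuclideanSpace ℝ (Fin n) → ℝ) (y : EuclideanSpace ℝ (Fin n)) :
    coordDiff u y = fderivWithin ℝ u (range (𝓡∂ n)) y := by
  ext v
  conv_rhs => rw [← sum_smul_single v, map_sum]
  simp [coordDiff, pderiv, mul_comm]

/-- The coordinates, in the preferred chart at `x₀`, of the points off the boundary. -/
def interiorTarget (x₀ : M) : Set (EuclideanSpace ℝ (Fin n)) :=
  (extChartAt (𝓡∂ n) x₀).target ∩ {y | 0 < y 0}

lemma range_model : range (𝓡∂ n) = {y : EuclideanSpace ℝ (Fin n) | 0 ≤ y 0} :=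
  range_euclideanHalfSpace n

lemma range_mem_nhds {y : EuclideanSpace ℝ (Fin n)} (hy : 0 < y 0) :
    range (𝓡∂ n) ∈ 𝓝 y := by
  rw [range_model, ← mem_interior_iff_mem_nhds, interior_halfSpace]
  exact hy

lemma target_mem_nhdsWithin (x₀ : M) {y : EuclideanSpace ℝ (Fin n)}
    (hy : y ∈ (extChartAt (𝓡∂ n) x₀).target) :
    (extChartAt (𝓡∂ n) x₀).target ∈ 𝓝[range (𝓡∂ n)] y :=
  extChartAt_target_mem_nhdsWithin_of_mem hy

lemma target_mem_nhds (x₀ : M) {y : EuclideanSpace ℝ (Fin n)} (hy : y ∈ interiorTarget x₀) :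
    (extChartAt (𝓡∂ n) x₀).target ∈ 𝓝 y := by
  have h := target_mem_nhdsWithin x₀ hy.1
  rwa [nhdsWithin_eq_nhds.2 (range_mem_nhds hy.2)] at h

lemma isOpen_interiorTarget (x₀ : M) : IsOpen (interiorTarget (n := n) x₀) := by
  rw [isOpen_iff_mem_nhds]
  intro y hy
  refine Filter.inter_mem (target_mem_nhds x₀ hy) ?_
  have : IsOpen {y : EuclideanSpace ℝ (Fin n) | 0 < y 0} :=
    isOpen_lt continuous_const (EuclideanSpace.proj (𝕜 := ℝ) (0 : Fin n)).continuous
  exact this.mem_nhds hy.2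

section Derivatives

variable {x₀ : M} {u : EuclideanSpace ℝ (Fin n) → ℝ}

lemma contDiffOn_pderiv (hu : ContDiffOn ℝ ∞ u (extChartAt (𝓡∂ n) x₀).target) (i : Fin n) :
    ContDiffOn ℝ ∞ (pderiv i u) (extChartAt (𝓡∂ n) x₀).target := by
  have h := hu.fderivWithin (uniqueDiffOn_extChartAt_target x₀) (m := ∞) (by simp)
  refine (h.clm_apply contDiffOn_const (g := fun _ => EuclideanSpace.single i (1 : ℝ))).congr ?_
  intro y hy
  have hmem := target_mem_nhdsWithin x₀ hy
  rw [pderiv, fderivWithin_of_mem_nhdsWithin hmem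
    ((𝓡∂ n).uniqueDiffOn y (extChartAt_target_subset_range x₀ hy))
    ((hu y hy).differentiableWithinAt (by simp))]

lemma hasFDerivAt_coordDiff (hu : ContDiffOn ℝ ∞ u (extChartAt (𝓡∂ n) x₀).target)
    {y : EuclideanSpace ℝ (Fin n)} (hy : y ∈ interiorTarget x₀) :
    HasFDerivAt u (coordDiff u y) y := by
  rw [coordDiff_eq, fderivWithin_of_mem_nhds (range_mem_nhds hy.2)]
  exact ((hu.contDiffAt (target_mem_nhds x₀ hy)).differentiableAt (by simp)).hasFDerivAt

lemma continuousOn_coordDiff (hu : ContDiffOn ℝ ∞ u (extChartAt (𝓡∂ n) x₀).target) :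
    ContinuousOn (coordDiff u) (extChartAt (𝓡∂ n) x₀).target := by
  unfold coordDiff
  exact continuousOn_finsetSum _ fun i _ =>
    ((contDiffOn_pderiv hu i).continuousOn).smul continuousOn_const

end Derivatives

variable [RiemannianBundle (fun x : M => TangentSpace (𝓡∂ n) x)]

/-- The metric in the coordinates of `φ` as a bilinear form: `(u, v) ↦ ∑ᵢⱼ gᵢⱼ uⁱ vʲ`. -/
def pullForm (φ : OpenPartialHomeomorph M (EuclideanHalfSpace n)) (y : EuclideanSpace ℝ (Fin n)) :
    EuclideanSpace ℝ (Fin n) →L[ℝ] EuclideanSpace ℝ (Fin n) →L[ℝ] ℝ :=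
  ∑ i, ∑ j, gram φ y i j •
    (EuclideanSpace.proj i : EuclideanSpace ℝ (Fin n) →L[ℝ] ℝ).smulRight
      (EuclideanSpace.proj j : EuclideanSpace ℝ (Fin n) →L[ℝ] ℝ)

lemma pullForm_apply (φ : OpenPartialHomeomorph M (EuclideanHalfSpace n))
    (y u v : EuclideanSpace ℝ (Fin n)) :
    pullForm φ y u v = ∑ i, ∑ j, gram φ y i j * (u i * v j) := by
  simp [pullForm]

lemma pullForm_eq_inner (φ : OpenPartialHomeomorph M (EuclideanHalfSpace n))
    (y u v : EuclideanSpace ℝ (Fin n)) :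
    pullForm φ y u v = inner ℝ
      (mfderivWithin 𝓘(ℝ, EuclideanSpace ℝ (Fin n)) (𝓡∂ n) (φ.extend (𝓡∂ n)).symm
        (range (𝓡∂ n)) y u)
      (mfderivWithin 𝓘(ℝ, EuclideanSpace ℝ (Fin n)) (𝓡∂ n) (φ.extend (𝓡∂ n)).symm
        (range (𝓡∂ n)) y v) := by
  rw [pullForm_apply]
  have key : ∀ u : EuclideanSpace ℝ (Fin n),
      mfderivWithin 𝓘(ℝ, EuclideanSpace ℝ (Fin n)) (𝓡∂ n) (φ.extend (𝓡∂ n)).symm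
        (range (𝓡∂ n)) y u = ∑ i, u i • frame φ i y := by
    intro u
    conv_lhs => rw [← sum_smul_single u]
    erw [map_sum]
    refine Finset.sum_congr rfl fun i _ => ?_
    erw [map_smul]
    rfl
  rw [key u, key v, sum_inner]
  refine Finset.sum_congr rfl fun i _ => ?_
  rw [inner_sum]
  refine Finset.sum_congr rfl fun j _ => ?_
  rw [real_inner_smul_left, real_inner_smul_right]
  simp only [gram, Matrix.of_apply]; ring

lemma pullForm_symm (φ : OpenPartialHomeomorph M (EuclideanHalfSpace n))
    (y u v : EuclideanSpace ℝ (Fin n)) : pullForm φ y u v = pullForm φ y v u := by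
  rw [pullForm_eq_inner, pullForm_eq_inner, real_inner_comm]

lemma gram_symm (φ : OpenPartialHomeomorph M (EuclideanHalfSpace n))
    (y : EuclideanSpace ℝ (Fin n)) (i j : Fin n) : gram φ y i j = gram φ y j i := by
  simp only [gram, Matrix.of_apply, real_inner_comm]

variable [IsManifold (𝓡∂ n) ∞ M]

lemma pullForm_pos (x₀ : M) {y : EuclideanSpace ℝ (Fin n)}
    (hy : y ∈ (extChartAt (𝓡∂ n) x₀).target) {v : EuclideanSpace ℝ (Fin n)} (hv : v ≠ 0) :
    0 < pullForm (chartAt (EuclideanHalfSpace n) x₀) y v v := by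
  rw [pullForm_eq_inner]
  apply real_inner_self_pos.2
  have : IsManifold (𝓡∂ n) 1 M := IsManifold.of_le (n := ∞) (by simp)
  have h := isInvertible_mfderivWithin_extChartAt_symm (I := 𝓡∂ n) (x := x₀) hy
  intro h0
  apply hv
  apply h.injective
  exact h0.trans (map_zero _).symm

lemma gram_mulVec_dotProduct (φ : OpenPartialHomeomorph M (EuclideanHalfSpace n))
    (y v : EuclideanSpace ℝ (Fin n)) :
    dotProduct v.ofLp ((gram φ y).mulVec v.ofLp) = pullForm φ y v v := by
  rw [pullForm_apply]
  simp only [dotProduct, Matrix.mulVec, Finset.mul_sum]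
  exact Finset.sum_congr rfl fun i _ => Finset.sum_congr rfl fun j _ => by ring

lemma isUnit_gram_det (x₀ : M) {y : EuclideanSpace ℝ (Fin n)}
    (hy : y ∈ (extChartAt (𝓡∂ n) x₀).target) :
    IsUnit (gram (chartAt (EuclideanHalfSpace n) x₀) y).det := by
  rw [isUnit_iff_ne_zero]
  intro h0
  obtain ⟨v, hv, hv0⟩ := Matrix.exists_mulVec_eq_zero_iff.2 h0
  have hne : (WithLp.toLp 2 v : EuclideanSpace ℝ (Fin n)) ≠ 0 := by
    intro h
    apply hv
    simpa using congrArg WithLp.ofLp h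
  have hpos := pullForm_pos x₀ hy hne
  rw [← gram_mulVec_dotProduct] at hpos
  simp [hv0] at hpos

variable [IsContMDiffRiemannianBundle (𝓡∂ n) ∞ (EuclideanSpace ℝ (Fin n))
    (fun x : M => TangentSpace (𝓡∂ n) x)]

lemma contDiffOn_gram (x₀ : M) (i j : Fin n) :
    ContDiffOn ℝ ∞ (fun y => gram (chartAt (EuclideanHalfSpace n) x₀) y i j)
      (extChartAt (𝓡∂ n) x₀).target := by
  have h := (contMDiffOn_symm_mfderiv_const (I := 𝓡∂ n) x₀
    (EuclideanSpace.single i (1 : ℝ))).inner_bundle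
    (contMDiffOn_symm_mfderiv_const (I := 𝓡∂ n) x₀ (EuclideanSpace.single j (1 : ℝ)))
  exact contMDiffOn_iff_contDiffOn.1 h

lemma contDiffOn_det {ι : Type*} [Fintype ι] [DecidableEq ι] {F : Type*} [NormedAddCommGroup F]
    [NormedSpace ℝ F] {s : Set F} {A : F → Matrix ι ι ℝ}
    (hA : ∀ i j, ContDiffOn ℝ ∞ (fun y => A y i j) s) :
    ContDiffOn ℝ ∞ (fun y => (A y).det) s := by
  simp only [Matrix.det_apply]
  exact ContDiffOn.sum fun σ _ => (contDiffOn_prod fun i _ => hA _ _).const_smul _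

lemma contDiffOn_gram_inv (x₀ : M) (i j : Fin n) :
    ContDiffOn ℝ ∞ (fun y => (gram (chartAt (EuclideanHalfSpace n) x₀) y)⁻¹ i j)
      (extChartAt (𝓡∂ n) x₀).target := by
  have hG := contDiffOn_gram (n := n) x₀
  simp only [Matrix.inv_def, Matrix.smul_apply, Matrix.adjugate_apply, smul_eq_mul,
    Ring.inverse_eq_inv']
  refine ((contDiffOn_det hG).inv fun y hy => (isUnit_gram_det x₀ hy).ne_zero).mul
    (contDiffOn_det fun k l => ?_)
  by_cases hk : k = j
  · subst hk
    simp only [Matrix.updateRow_self]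
    exact contDiffOn_const
  · simp only [Matrix.updateRow_ne hk]
    exact hG k l

lemma contDiffOn_christoffel (x₀ : M) (k i j : Fin n) :
    ContDiffOn ℝ ∞ (christoffel (chartAt (EuclideanHalfSpace n) x₀) k i j)
      (extChartAt (𝓡∂ n) x₀).target := by
  unfold christoffel
  refine contDiffOn_const.mul (ContDiffOn.sum fun l _ => (contDiffOn_gram_inv x₀ k l).mul ?_)
  exact ((contDiffOn_pderiv (contDiffOn_gram x₀ j l) i).add
    (contDiffOn_pderiv (contDiffOn_gram x₀ i l) j)).sub
    (contDiffOn_pderiv (contDiffOn_gram x₀ i j) l)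

end RiemannCoord

end

noncomputable section
open scoped Topology

/-! ### Weighted metrics in coordinates -/

section Abstract

variable {E : Type*} [NormedAddCommGroup E] [NormedSpace ℝ E]

/-- A Riemannian metric `g` with a positive weight `f` in a coordinate domain `U`, together with
the Levi-Civita connection, the first derivative of `Γ` and the first two derivatives of `f`. The
set `O` is the part of `U` off the boundary; derivatives are taken there, and they extend
continuously to `U`. Differentiability is recorded as the rule for differentiating along a curve
in `O`; for `g` this rule is the compatibility of the connection with the metric. -/
structure WeightedMetric (U O : Set E) where
  /-- the metric -/
  g : E → E →L[ℝ] E →L[ℝ] ℝ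
  /-- the Christoffel symbols, as a bilinear map with values in vectors -/
  Γ : E → E →L[ℝ] E →L[ℝ] E
  /-- the derivative of `Γ`; the second argument is the direction of differentiation -/
  dΓ : E → E → E →L[ℝ] E →L[ℝ] E
  /-- the weight -/
  f : E → ℝ
  /-- the differential of the weight -/
  df : E → E →L[ℝ] ℝ
  /-- the second derivative of the weight in coordinates -/
  ddf : E → E →L[ℝ] E →L[ℝ] ℝ
  isOpen_O : IsOpen O
  O_subset : O ⊆ U
  g_symm : ∀ y a b, g y a b = g y b a
  g_pos : ∀ y ∈ U, ∀ v, v ≠ 0 → 0 < g y v v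
  Γ_symm : ∀ y a b, Γ y a b = Γ y b a
  f_pos : ∀ y ∈ U, 0 < f y
  continuousOn_g : ContinuousOn (fun p : E × E × E => g p.1 p.2.1 p.2.2) (U ×ˢ univ)
  continuousOn_Γ : ContinuousOn (fun p : E × E × E => Γ p.1 p.2.1 p.2.2) (U ×ˢ univ)
  continuousOn_dΓ : ContinuousOn (fun p : E × E × E × E => dΓ p.1 p.2.1 p.2.2.1 p.2.2.2)
    (U ×ˢ univ)
  continuousOn_f : ContinuousOn f U
  continuousOn_df : ContinuousOn (fun p : E × E => df p.1 p.2) (U ×ˢ univ)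
  continuousOn_ddf : ContinuousOn (fun p : E × E × E => ddf p.1 p.2.1 p.2.2) (U ×ˢ univ)
  contDiffOn_g : ∀ a b, ContDiffOn ℝ 2 (fun y => g y a b) O
  hasDerivAt_g : ∀ {c a b : ℝ → E} {c' a' b' : E} {t : ℝ}, c t ∈ O → HasDerivAt c c' t →
    HasDerivAt a a' t → HasDerivAt b b' t → HasDerivAt (fun s => g (c s) (a s) (b s))
      (g (c t) (a' + Γ (c t) c' (a t)) (b t) + g (c t) (a t) (b' + Γ (c t) c' (b t))) t
  hasDerivAt_Γ : ∀ {c a b : ℝ → E} {c' a' b' : E} {t : ℝ}, c t ∈ O → HasDerivAt c c' t →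
    HasDerivAt a a' t → HasDerivAt b b' t → HasDerivAt (fun s => Γ (c s) (a s) (b s))
      (dΓ (c t) c' (a t) (b t) + Γ (c t) a' (b t) + Γ (c t) (a t) b') t
  hasDerivAt_f : ∀ {c : ℝ → E} {c' : E} {t : ℝ}, c t ∈ O → HasDerivAt c c' t →
    HasDerivAt (fun s => f (c s)) (df (c t) c') t
  hasDerivAt_df : ∀ {c a : ℝ → E} {c' a' : E} {t : ℝ}, c t ∈ O → HasDerivAt c c' t →
    HasDerivAt a a' t → HasDerivAt (fun s => df (c s) (a s))
      (ddf (c t) c' (a t) + df (c t) a') t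

namespace WeightedMetric

variable {U O : Set E} (G : WeightedMetric U O)

/-- The curvature `R(w, z)a = ∇_w ∇_z a - ∇_z ∇_w a` in coordinates. -/
def curv (y w z a : E) : E :=
  G.dΓ y w z a - G.dΓ y z w a + (G.Γ y w (G.Γ y z a) - G.Γ y z (G.Γ y w a))

lemma hasDerivAt_line (y w : E) : HasDerivAt (fun s : ℝ => y + s • w) w 0 := by
  simpa using ((hasDerivAt_id (0 : ℝ)).smul_const w).const_add y

/-- The curvature `R(w, z)` is skew-adjoint: this is the symmetry of the second derivatives of
`y ↦ g(a, a)` for a vector `a` with constant coordinates. -/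
lemma curv_self {y : E} (hy : y ∈ O) (w z a : E) : G.g y (G.curv y w z a) a = 0 := by
  set φ : E → ℝ := fun x => G.g x a a
  have hsmooth : ContDiffOn ℝ 2 φ O := G.contDiffOn_g a a
  have hD : ∀ x ∈ O, ∀ v, fderiv ℝ φ x v = 2 * G.g x (G.Γ x v a) a := by
    intro x hx v
    have hx' : x + (0 : ℝ) • v ∈ O := by simpa using hx
    have h1 := G.hasDerivAt_g hx' (hasDerivAt_line x v) (hasDerivAt_const 0 a)
      (hasDerivAt_const 0 a)
    have h2 : HasFDerivAt φ (fderiv ℝ φ x) (x + (0 : ℝ) • v) := by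
      simpa using ((hsmooth.contDiffAt (G.isOpen_O.mem_nhds hx)).differentiableAt
        (by simp)).hasFDerivAt
    have h3 : HasDerivAt (fun s : ℝ => φ (x + s • v)) (fderiv ℝ φ x v) 0 :=
      HasFDerivAt.comp_hasDerivAt (f := fun s : ℝ => x + s • v) (0 : ℝ) h2 (hasDerivAt_line x v)
    have h4 := h3.unique h1
    simp only [zero_smul, add_zero, zero_add] at h4
    rw [h4, G.g_symm x a]
    ring
  have hsym := (hsmooth.contDiffAt (G.isOpen_O.mem_nhds hy)).isSymmSndFDerivAt (by simp)
  -- The difference of this formula and the one with `w`, `z` exchanged is `2 g(R(w, z)a, a)`.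
  have hdd : ∀ w z, fderiv ℝ (fderiv ℝ φ) y w z =
      2 * (G.g y (G.dΓ y w z a + G.Γ y w (G.Γ y z a)) a + G.g y (G.Γ y z a) (G.Γ y w a)) := by
    intro w z
    have hy' : y + (0 : ℝ) • w ∈ O := by simpa using hy
    have hΓ := G.hasDerivAt_Γ hy' (hasDerivAt_line y w) (hasDerivAt_const 0 z)
      (hasDerivAt_const 0 a)
    have h1 := (G.hasDerivAt_g hy' (hasDerivAt_line y w) hΓ (hasDerivAt_const 0 a)).const_mul 2
    have hdiff : DifferentiableAt ℝ (fderiv ℝ φ) y :=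
      ((hsmooth.contDiffAt (G.isOpen_O.mem_nhds hy)).fderiv_right (m := 1)
        (by norm_num)).differentiableAt (by simp)
    have hd : DifferentiableAt ℝ (fun x => fderiv ℝ φ x z) y :=
      hdiff.clm_apply (differentiableAt_const z)
    have hd' : fderiv ℝ (fun x => fderiv ℝ φ x z) y w = fderiv ℝ (fderiv ℝ φ) y w z := by
      rw [fderiv_clm_apply hdiff (differentiableAt_const z)]
      simp
    have h2 : HasFDerivAt (fun x => fderiv ℝ φ x z) (fderiv ℝ (fun x => fderiv ℝ φ x z) y)
        (y + (0 : ℝ) • w) := by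
      simpa using hd.hasFDerivAt
    have h3 : HasDerivAt (fun s : ℝ => fderiv ℝ φ (y + s • w) z)
        (fderiv ℝ (fun x => fderiv ℝ φ x z) y w) 0 :=
      HasFDerivAt.comp_hasDerivAt (f := fun s : ℝ => y + s • w) (0 : ℝ) h2 (hasDerivAt_line y w)
    rw [hd'] at h3
    have hev : (fun s : ℝ => fderiv ℝ φ (y + s • w) z) =ᶠ[𝓝 0]
        fun s => 2 * G.g (y + s • w) (G.Γ (y + s • w) z a) a := by
      have hc := (hasDerivAt_line y w).continuousAt
      filter_upwards [hc.preimage_mem_nhds (G.isOpen_O.mem_nhds hy')] with s hs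
      exact hD _ hs z
    have h4 := (h3.congr_of_eventuallyEq hev.symm).unique h1
    simpa using h4
  have h := hsym w z
  rw [hdd, hdd] at h
  simp only [curv, map_add, map_sub, add_apply, sub_apply] at h ⊢
  have e5 := G.g_symm y (G.Γ y w a) (G.Γ y z a)
  linarith

/-- `g(R(w, z)a, b) = -g(R(w, z)b, a)`. -/
lemma curv_skew {y : E} (hy : y ∈ O) (w z a b : E) :
    G.g y (G.curv y w z a) b = -G.g y (G.curv y w z b) a := by
  have h := G.curv_self hy w z (a + b)
  have h1 := G.curv_self hy w z a
  have h2 := G.curv_self hy w z b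
  have hadd : G.curv y w z (a + b) = G.curv y w z a + G.curv y w z b := by
    simp only [curv, map_add]; abel
  rw [hadd] at h
  simp only [map_add, add_apply] at h
  linarith

end WeightedMetric

end Abstract

namespace RiemannCoord

variable {n : ℕ} [NeZero n] {M : Type*} [TopologicalSpace M]
  [ChartedSpace (EuclideanHalfSpace n) M]
  [RiemannianBundle (fun x : M => TangentSpace (𝓡∂ n) x)]

/-- The Christoffel symbols as a bilinear map: `(u, v) ↦ ∑ Γᵏᵢⱼ uⁱ vʲ ∂ₖ`. -/
def christoffelMap (φ : OpenPartialHomeomorph M (EuclideanHalfSpace n))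
    (y : EuclideanSpace ℝ (Fin n)) :
    EuclideanSpace ℝ (Fin n) →L[ℝ] EuclideanSpace ℝ (Fin n) →L[ℝ] EuclideanSpace ℝ (Fin n) :=
  ∑ k, ∑ i, ∑ j, christoffel φ k i j y •
    (EuclideanSpace.proj i : EuclideanSpace ℝ (Fin n) →L[ℝ] ℝ).smulRight
      ((EuclideanSpace.proj j : EuclideanSpace ℝ (Fin n) →L[ℝ] ℝ).smulRight
        (EuclideanSpace.single k (1 : ℝ)))

/-- The derivative of `christoffelMap` in the direction `z`. -/
def christoffelMapDeriv (φ : OpenPartialHomeomorph M (EuclideanHalfSpace n))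
    (y z : EuclideanSpace ℝ (Fin n)) :
    EuclideanSpace ℝ (Fin n) →L[ℝ] EuclideanSpace ℝ (Fin n) →L[ℝ] EuclideanSpace ℝ (Fin n) :=
  ∑ k, ∑ i, ∑ j, coordDiff (christoffel φ k i j) y z •
    (EuclideanSpace.proj i : EuclideanSpace ℝ (Fin n) →L[ℝ] ℝ).smulRight
      ((EuclideanSpace.proj j : EuclideanSpace ℝ (Fin n) →L[ℝ] ℝ).smulRight
        (EuclideanSpace.single k (1 : ℝ)))

lemma christoffelMap_apply (φ : OpenPartialHomeomorph M (EuclideanHalfSpace n))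
    (y u v : EuclideanSpace ℝ (Fin n)) : christoffelMap φ y u v =
      ∑ k, ∑ i, ∑ j, (christoffel φ k i j y * (u i * v j)) •
        (EuclideanSpace.single k (1 : ℝ) : EuclideanSpace ℝ (Fin n)) := by
  simp [christoffelMap, smul_smul, mul_assoc]

lemma christoffelMapDeriv_apply (φ : OpenPartialHomeomorph M (EuclideanHalfSpace n))
    (y z u v : EuclideanSpace ℝ (Fin n)) : christoffelMapDeriv φ y z u v =
      ∑ k, ∑ i, ∑ j, (coordDiff (christoffel φ k i j) y z * (u i * v j)) •
        (EuclideanSpace.single k (1 : ℝ) : EuclideanSpace ℝ (Fin n)) := by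
  simp [christoffelMapDeriv, smul_smul, mul_assoc]

lemma christoffelMap_coord (φ : OpenPartialHomeomorph M (EuclideanHalfSpace n))
    (y u v : EuclideanSpace ℝ (Fin n)) (k : Fin n) :
    christoffelMap φ y u v k = ∑ i, ∑ j, christoffel φ k i j y * (u i * v j) := by
  rw [christoffelMap_apply]
  simp [Pi.single_apply]

lemma christoffelMapDeriv_coord (φ : OpenPartialHomeomorph M (EuclideanHalfSpace n))
    (y z u v : EuclideanSpace ℝ (Fin n)) (k : Fin n) : christoffelMapDeriv φ y z u v k =
      ∑ i, ∑ j, coordDiff (christoffel φ k i j) y z * (u i * v j) := by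
  rw [christoffelMapDeriv_apply]
  simp [Pi.single_apply]

lemma christoffel_symm (φ : OpenPartialHomeomorph M (EuclideanHalfSpace n)) (k i j : Fin n)
    (y : EuclideanSpace ℝ (Fin n)) : christoffel φ k i j y = christoffel φ k j i y := by
  simp only [christoffel]
  congr 1
  refine Finset.sum_congr rfl fun l _ => ?_
  rw [show (fun z => gram φ z i j) = fun z => gram φ z j i from
    funext fun z => gram_symm φ z i j]
  ring

lemma christoffelMap_symm (φ : OpenPartialHomeomorph M (EuclideanHalfSpace n))
    (y u v : EuclideanSpace ℝ (Fin n)) : christoffelMap φ y u v = christoffelMap φ y v u := by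
  ext k
  rw [christoffelMap_coord, christoffelMap_coord, Finset.sum_comm]
  refine Finset.sum_congr rfl fun i _ => Finset.sum_congr rfl fun j _ => ?_
  rw [christoffel_symm]; ring

variable [IsManifold (𝓡∂ n) ∞ M]

/-- The Koszul formula: the Christoffel symbols with the upper index lowered. -/
lemma sum_gram_mul_christoffel (x₀ : M) {y : EuclideanSpace ℝ (Fin n)}
    (hy : y ∈ (extChartAt (𝓡∂ n) x₀).target) (l i j : Fin n) :
    ∑ k, gram (chartAt (EuclideanHalfSpace n) x₀) y l k *
        christoffel (chartAt (EuclideanHalfSpace n) x₀) k i j y =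
      1 / 2 * (pderiv i (fun z => gram (chartAt (EuclideanHalfSpace n) x₀) z j l) y
        + pderiv j (fun z => gram (chartAt (EuclideanHalfSpace n) x₀) z i l) y
        - pderiv l (fun z => gram (chartAt (EuclideanHalfSpace n) x₀) z i j) y) := by
  set φ := chartAt (EuclideanHalfSpace n) x₀
  set w : Fin n → ℝ := fun m => pderiv i (fun z => gram φ z j m) y
    + pderiv j (fun z => gram φ z i m) y - pderiv m (fun z => gram φ z i j) y
  have h1 : (gram φ y).mulVec ((gram φ y)⁻¹.mulVec w) = w := by
    rw [Matrix.mulVec_mulVec, Matrix.mul_nonsing_inv _ (isUnit_gram_det x₀ hy), Matrix.one_mulVec]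
  have h2 := congrFun h1 l
  have h3 : ∀ k, christoffel φ k i j y = 1 / 2 * ((gram φ y)⁻¹.mulVec w) k := fun k => rfl
  have h4 : ∑ k, gram φ y l k * christoffel φ k i j y =
      1 / 2 * (gram φ y).mulVec ((gram φ y)⁻¹.mulVec w) l := by
    simp only [h3]
    rw [Matrix.mulVec, dotProduct, Finset.mul_sum]
    exact Finset.sum_congr rfl fun k _ => by ring
  rw [h4, h2]

/-- The metric is parallel, in indices: `∂ₘ gᵢⱼ = gⱼₖ Γᵏₘᵢ + gᵢₖ Γᵏₘⱼ`. -/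
lemma pderiv_gram (x₀ : M) {y : EuclideanSpace ℝ (Fin n)}
    (hy : y ∈ (extChartAt (𝓡∂ n) x₀).target) (m i j : Fin n) :
    pderiv m (fun z => gram (chartAt (EuclideanHalfSpace n) x₀) z i j) y =
      ∑ k, gram (chartAt (EuclideanHalfSpace n) x₀) y j k *
          christoffel (chartAt (EuclideanHalfSpace n) x₀) k m i y +
        ∑ k, gram (chartAt (EuclideanHalfSpace n) x₀) y i k *
          christoffel (chartAt (EuclideanHalfSpace n) x₀) k m j y := by
  rw [sum_gram_mul_christoffel x₀ hy, sum_gram_mul_christoffel x₀ hy]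
  have hs : ∀ a b, (fun z => gram (chartAt (EuclideanHalfSpace n) x₀) z a b) =
      fun z => gram (chartAt (EuclideanHalfSpace n) x₀) z b a :=
    fun a b => funext fun z => gram_symm _ z a b
  rw [hs j i, hs m j, hs m i]
  ring

lemma coordDiff_apply (u : EuclideanSpace ℝ (Fin n) → ℝ) (y z : EuclideanSpace ℝ (Fin n)) :
    coordDiff u y z = ∑ i, pderiv i u y * z i := by
  simp [coordDiff]

lemma sum_coordDiff_gram (x₀ : M) {y : EuclideanSpace ℝ (Fin n)}
    (hy : y ∈ (extChartAt (𝓡∂ n) x₀).target) (z a b : EuclideanSpace ℝ (Fin n)) :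
    ∑ i, ∑ j, coordDiff (fun z => gram (chartAt (EuclideanHalfSpace n) x₀) z i j) y z *
        (a i * b j) =
      pullForm (chartAt (EuclideanHalfSpace n) x₀) y
          (christoffelMap (chartAt (EuclideanHalfSpace n) x₀) y z a) b +
        pullForm (chartAt (EuclideanHalfSpace n) x₀) y a
          (christoffelMap (chartAt (EuclideanHalfSpace n) x₀) y z b) := by
  set φ := chartAt (EuclideanHalfSpace n) x₀
  have h1 : ∀ a b : EuclideanSpace ℝ (Fin n), pullForm φ y a (christoffelMap φ y z b) =
      ∑ i, ∑ j, ∑ m, (∑ k, gram φ y i k * christoffel φ k m j y) * (z m * (a i * b j)) := by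
    intro a b
    rw [pullForm_apply]
    refine Finset.sum_congr rfl fun i _ => ?_
    calc ∑ k, gram φ y i k * (a i * christoffelMap φ y z b k)
        = ∑ k, ∑ m, ∑ j, gram φ y i k * christoffel φ k m j y * (z m * (a i * b j)) := by
          refine Finset.sum_congr rfl fun k _ => ?_
          rw [christoffelMap_coord, Finset.mul_sum, Finset.mul_sum]
          refine Finset.sum_congr rfl fun m _ => ?_
          rw [Finset.mul_sum, Finset.mul_sum]
          exact Finset.sum_congr rfl fun j _ => by ring
      _ = ∑ m, ∑ k, ∑ j, gram φ y i k * christoffel φ k m j y * (z m * (a i * b j)) :=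
          Finset.sum_comm
      _ = ∑ m, ∑ j, ∑ k, gram φ y i k * christoffel φ k m j y * (z m * (a i * b j)) :=
          Finset.sum_congr rfl fun m _ => Finset.sum_comm
      _ = ∑ j, ∑ m, ∑ k, gram φ y i k * christoffel φ k m j y * (z m * (a i * b j)) :=
          Finset.sum_comm
      _ = _ := by simp only [Finset.sum_mul]
  rw [pullForm_symm φ y _ b, h1, h1]
  rw [Finset.sum_comm (f := fun i j => ∑ m, (∑ k, gram φ y i k * christoffel φ k m j y) *
    (z m * (b i * a j)))]
  rw [← Finset.sum_add_distrib]
  refine Finset.sum_congr rfl fun i _ => ?_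
  rw [← Finset.sum_add_distrib]
  refine Finset.sum_congr rfl fun j _ => ?_
  rw [← Finset.sum_add_distrib, coordDiff_apply, Finset.sum_mul]
  refine Finset.sum_congr rfl fun m _ => ?_
  rw [pderiv_gram x₀ hy m i j]
  ring

variable [IsContMDiffRiemannianBundle (𝓡∂ n) ∞ (EuclideanSpace ℝ (Fin n))
    (fun x : M => TangentSpace (𝓡∂ n) x)]

lemma contDiffOn_read (x₀ : M) {f : M → ℝ} (hf : ContMDiff (𝓡∂ n) 𝓘(ℝ, ℝ) ∞ f) :
    ContDiffOn ℝ ∞ (read (chartAt (EuclideanHalfSpace n) x₀) f) (extChartAt (𝓡∂ n) x₀).target :=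
  contMDiffOn_iff_contDiffOn.1
    (hf.comp_contMDiffOn (contMDiffOn_extChartAt_symm (I := 𝓡∂ n) (n := ∞) x₀))

lemma hasDerivAt_comp_coordDiff {x₀ : M} {u : EuclideanSpace ℝ (Fin n) → ℝ}
    (hu : ContDiffOn ℝ ∞ u (extChartAt (𝓡∂ n) x₀).target) {c : ℝ → EuclideanSpace ℝ (Fin n)}
    {c' : EuclideanSpace ℝ (Fin n)} {t : ℝ} (hO : c t ∈ interiorTarget x₀)
    (hc : HasDerivAt c c' t) : HasDerivAt (fun s => u (c s)) (coordDiff u (c t) c') t :=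
  (hasFDerivAt_coordDiff hu hO).comp_hasDerivAt t hc

lemma hasDerivAt_coord {a : ℝ → EuclideanSpace ℝ (Fin n)} {a' : EuclideanSpace ℝ (Fin n)}
    {t : ℝ} (ha : HasDerivAt a a' t) (i : Fin n) : HasDerivAt (fun s => a s i) (a' i) t :=
  (EuclideanSpace.proj (𝕜 := ℝ) i).hasFDerivAt.comp_hasDerivAt t ha

lemma continuousOn_coord {X : Type*} [TopologicalSpace X] {s : Set X}
    {a : X → EuclideanSpace ℝ (Fin n)} (ha : ContinuousOn a s) (i : Fin n) :
    ContinuousOn (fun x => a x i) s :=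
  (EuclideanSpace.proj (𝕜 := ℝ) i).continuous.comp_continuousOn ha

/-- The second derivative of `u` in coordinates: `(z, a) ↦ ∑ ∂ᵢ∂ⱼu zⁱ aʲ`. -/
def coordHess (u : EuclideanSpace ℝ (Fin n) → ℝ) (y : EuclideanSpace ℝ (Fin n)) :
    EuclideanSpace ℝ (Fin n) →L[ℝ] EuclideanSpace ℝ (Fin n) →L[ℝ] ℝ :=
  ∑ j, (coordDiff (pderiv j u) y).smulRight
    (EuclideanSpace.proj j : EuclideanSpace ℝ (Fin n) →L[ℝ] ℝ)

lemma coordHess_apply (u : EuclideanSpace ℝ (Fin n) → ℝ) (y z a : EuclideanSpace ℝ (Fin n)) :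
    coordHess u y z a = ∑ j, coordDiff (pderiv j u) y z * a j := by
  simp [coordHess]

/-- The metric of `M` in the preferred chart at `x₀`, with the weight `f`. -/
def chartMetric (x₀ : M) {f : M → ℝ} (hf : ContMDiff (𝓡∂ n) 𝓘(ℝ, ℝ) ∞ f) (hpos : ∀ p, 0 < f p) :
    WeightedMetric (extChartAt (𝓡∂ n) x₀).target (interiorTarget x₀) where
  g := pullForm (chartAt (EuclideanHalfSpace n) x₀)
  Γ := christoffelMap (chartAt (EuclideanHalfSpace n) x₀)
  dΓ := christoffelMapDeriv (chartAt (EuclideanHalfSpace n) x₀)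
  f := read (chartAt (EuclideanHalfSpace n) x₀) f
  df := coordDiff (read (chartAt (EuclideanHalfSpace n) x₀) f)
  ddf := coordHess (read (chartAt (EuclideanHalfSpace n) x₀) f)
  isOpen_O := isOpen_interiorTarget x₀
  O_subset := inter_subset_left
  g_symm := pullForm_symm _
  g_pos := fun y hy v hv => pullForm_pos x₀ hy hv
  Γ_symm := christoffelMap_symm _
  f_pos := fun y _ => hpos _
  continuousOn_g := by
    simp only [pullForm_apply]
    refine continuousOn_finsetSum _ fun i _ => continuousOn_finsetSum _ fun j _ =>
      ContinuousOn.mul ?_ ((continuousOn_coord (continuous_fst.comp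
        continuous_snd).continuousOn i).mul (continuousOn_coord (continuous_snd.comp
        continuous_snd).continuousOn j))
    exact (contDiffOn_gram x₀ i j).continuousOn.comp continuousOn_fst fun p hp => hp.1
  continuousOn_Γ := by
    simp only [christoffelMap_apply]
    refine continuousOn_finsetSum _ fun k _ => continuousOn_finsetSum _ fun i _ =>
      continuousOn_finsetSum _ fun j _ =>
      ContinuousOn.smul (ContinuousOn.mul ?_ ((continuousOn_coord (continuous_fst.comp
        continuous_snd).continuousOn i).mul (continuousOn_coord (continuous_snd.comp
        continuous_snd).continuousOn j))) continuousOn_const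
    exact (contDiffOn_christoffel x₀ k i j).continuousOn.comp continuousOn_fst fun p hp => hp.1
  continuousOn_dΓ := by
    simp only [christoffelMapDeriv_apply]
    refine continuousOn_finsetSum _ fun k _ => continuousOn_finsetSum _ fun i _ =>
      continuousOn_finsetSum _ fun j _ =>
      ContinuousOn.smul (ContinuousOn.mul ?_ ((continuousOn_coord (continuous_fst.comp
        (continuous_snd.comp continuous_snd)).continuousOn i).mul (continuousOn_coord
        (continuous_snd.comp (continuous_snd.comp continuous_snd)).continuousOn j)))
        continuousOn_const
    have h := continuousOn_coordDiff (contDiffOn_christoffel (n := n) x₀ k i j)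
    exact (h.comp continuousOn_fst fun p hp => hp.1).clm_apply
      (continuous_fst.comp continuous_snd).continuousOn
  continuousOn_f := (contDiffOn_read x₀ hf).continuousOn
  continuousOn_df :=
    ((continuousOn_coordDiff (contDiffOn_read x₀ hf)).comp continuousOn_fst
      fun p hp => hp.1).clm_apply continuousOn_snd
  continuousOn_ddf := by
    simp only [coordHess_apply]
    refine continuousOn_finsetSum _ fun j _ => ContinuousOn.mul ?_
      (continuousOn_coord (continuous_snd.comp continuous_snd).continuousOn j)
    have h := continuousOn_coordDiff (contDiffOn_pderiv (contDiffOn_read x₀ hf) j)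
    exact (h.comp continuousOn_fst fun p hp => hp.1).clm_apply
      (continuous_fst.comp continuous_snd).continuousOn
  contDiffOn_g := fun a b => by
    simp only [pullForm_apply]
    exact ContDiffOn.sum fun i _ => ContDiffOn.sum fun j _ =>
      ((contDiffOn_infty.1 (contDiffOn_gram x₀ i j) 2).mono inter_subset_left).mul
        contDiffOn_const
  hasDerivAt_g := by
    intro c a b c' a' b' t hO hc ha hb
    have h : HasDerivAt (fun s => ∑ i, ∑ j, gram (chartAt (EuclideanHalfSpace n) x₀) (c s) i j *
        (a s i * b s j)) (∑ i, ∑ j,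
        (coordDiff (fun z => gram (chartAt (EuclideanHalfSpace n) x₀) z i j) (c t) c' *
          (a t i * b t j) + gram (chartAt (EuclideanHalfSpace n) x₀) (c t) i j *
          (a' i * b t j + a t i * b' j))) t :=
      HasDerivAt.fun_sum fun i _ => HasDerivAt.fun_sum fun j _ =>
        (hasDerivAt_comp_coordDiff (contDiffOn_gram x₀ i j) hO hc).mul
          ((hasDerivAt_coord ha i).mul (hasDerivAt_coord hb j))
    simp only [pullForm_apply] at h ⊢
    convert! h using 1
    simp only [Finset.sum_add_distrib, mul_add]
    rw [sum_coordDiff_gram x₀ hO.1]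
    simp only [← pullForm_apply, map_add, add_apply]
    ring
  hasDerivAt_Γ := by
    intro c a b c' a' b' t hO hc ha hb
    have h : HasDerivAt (fun s => ∑ k, ∑ i, ∑ j,
        (christoffel (chartAt (EuclideanHalfSpace n) x₀) k i j (c s) * (a s i * b s j)) •
          (EuclideanSpace.single k (1 : ℝ) : EuclideanSpace ℝ (Fin n)))
        (∑ k, ∑ i, ∑ j, (coordDiff (christoffel (chartAt (EuclideanHalfSpace n) x₀) k i j)
          (c t) c' * (a t i * b t j) + christoffel (chartAt (EuclideanHalfSpace n) x₀) k i j (c t) *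
          (a' i * b t j + a t i * b' j)) •
          (EuclideanSpace.single k (1 : ℝ) : EuclideanSpace ℝ (Fin n))) t :=
      HasDerivAt.fun_sum fun k _ => HasDerivAt.fun_sum fun i _ => HasDerivAt.fun_sum fun j _ =>
        (((hasDerivAt_comp_coordDiff (contDiffOn_christoffel x₀ k i j) hO hc).mul
          ((hasDerivAt_coord ha i).mul (hasDerivAt_coord hb j)))).smul_const _
    simp only [christoffelMap_apply, christoffelMapDeriv_apply]
    convert! h using 1
    simp only [Finset.sum_add_distrib, mul_add, add_smul]
    abel
  hasDerivAt_f := fun hO hc => hasDerivAt_comp_coordDiff (contDiffOn_read x₀ hf) hO hc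
  hasDerivAt_df := by
    intro c a c' a' t hO hc ha
    have h : HasDerivAt (fun s => ∑ j,
        pderiv j (read (chartAt (EuclideanHalfSpace n) x₀) f) (c s) * a s j)
        (∑ j, (coordDiff (pderiv j (read (chartAt (EuclideanHalfSpace n) x₀) f)) (c t) c' * a t j +
          pderiv j (read (chartAt (EuclideanHalfSpace n) x₀) f) (c t) * a' j)) t :=
      HasDerivAt.fun_sum fun j _ =>
        (hasDerivAt_comp_coordDiff (contDiffOn_pderiv (contDiffOn_read x₀ hf) j) hO hc).mul
          (hasDerivAt_coord ha j)
    have e : ∀ s, coordDiff (read (chartAt (EuclideanHalfSpace n) x₀) f) (c s) (a s) =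
        ∑ j, pderiv j (read (chartAt (EuclideanHalfSpace n) x₀) f) (c s) * a s j :=
      fun s => coordDiff_apply _ _ _
    simp only [e]
    convert! h using 1
    rw [Finset.sum_add_distrib, coordDiff_apply _ _ a', coordHess_apply]

end RiemannCoord
end

noncomputable section
open scoped Topology

/-! ### Lengths of curves in a chart -/

section ChartLength

open Manifold MeasureTheory
open scoped ENNReal NNReal

variable {E : Type*} [NormedAddCommGroup E] [NormedSpace ℝ E] {H : Type*} [TopologicalSpace H]
  {I : ModelWithCorners ℝ E H} {M : Type*} [TopologicalSpace M] [ChartedSpace H M]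
  [IsManifold I 1 M]

lemma mfderivWithin_extChartAt_symm_comp (x₀ : M) {c : ℝ → E} {c' : E} {a b t : ℝ}
    (hab : a < b) (ht : t ∈ Icc a b) (hc : HasDerivWithinAt c c' (Icc a b) t)
    (hmem : ∀ s ∈ Icc a b, c s ∈ (extChartAt I x₀).target) :
    mfderivWithin 𝓘(ℝ, ℝ) I (fun s => (extChartAt I x₀).symm (c s)) (Icc a b) t (1 : ℝ) =
      mfderivWithin 𝓘(ℝ, E) I (extChartAt I x₀).symm (range I) (c t) c' := by
  have hdiff : MDifferentiableWithinAt 𝓘(ℝ, ℝ) 𝓘(ℝ, E) c (Icc a b) t :=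
    hc.differentiableWithinAt.mdifferentiableWithinAt
  have huniq : UniqueMDiffWithinAt 𝓘(ℝ, ℝ) (Icc a b) t := by
    rw [uniqueMDiffWithinAt_iff_uniqueDiffWithinAt]
    exact uniqueDiffOn_Icc hab t ht
  have h1 : mfderivWithin 𝓘(ℝ, ℝ) I ((extChartAt I x₀).symm ∘ c) (Icc a b) t =
      (mfderivWithin 𝓘(ℝ, E) I (extChartAt I x₀).symm (range I) (c t)).comp
        (mfderivWithin 𝓘(ℝ, ℝ) 𝓘(ℝ, E) c (Icc a b) t) :=
    mfderivWithin_comp t (mdifferentiableWithinAt_extChartAt_symm (hmem t ht)) hdiff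
      (fun s hs => extChartAt_target_subset_range x₀ (hmem s hs)) huniq
  have h2 : mfderivWithin 𝓘(ℝ, ℝ) 𝓘(ℝ, E) c (Icc a b) t (1 : ℝ) = c' := by
    have h3 : fderivWithin ℝ c (Icc a b) t 1 = c' := by
      rw [fderivWithin_derivWithin, hc.derivWithin (uniqueDiffOn_Icc hab t ht)]
    rw [mfderivWithin_eq_fderivWithin]
    exact h3
  change mfderivWithin 𝓘(ℝ, ℝ) I ((extChartAt I x₀).symm ∘ c) (Icc a b) t (1 : ℝ) = _
  rw [h1]
  exact congrArg (mfderivWithin 𝓘(ℝ, E) I (extChartAt I x₀).symm (range I) (c t)) h2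

variable [RiemannianBundle (fun x : M => TangentSpace I x)]

/-- The Riemannian distance is at most the length of a `C¹` curve given in a chart. -/
lemma riemannianEDist_chart_le (x₀ : M) {c c₁ : ℝ → E} {a b : ℝ} (hab : a < b)
    (hc : ∀ t ∈ Icc a b, HasDerivWithinAt c (c₁ t) (Icc a b) t) (hc₁ : ContinuousOn c₁ (Icc a b))
    (hmem : ∀ s ∈ Icc a b, c s ∈ (extChartAt I x₀).target) :
    riemannianEDist I ((extChartAt I x₀).symm (c a)) ((extChartAt I x₀).symm (c b)) ≤
      ∫⁻ t in Icc a b,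
        ‖mfderivWithin 𝓘(ℝ, E) I (extChartAt I x₀).symm (range I) (c t) (c₁ t)‖ₑ := by
  have hcd : ContDiffOn ℝ 1 c (Icc a b) := by
    rw [show (1 : WithTop ℕ∞) = 0 + 1 by simp,
      contDiffOn_succ_iff_derivWithin (uniqueDiffOn_Icc hab)]
    refine ⟨fun t ht => (hc t ht).differentiableWithinAt, by simp, ?_⟩
    rw [contDiffOn_zero]
    exact hc₁.congr fun t ht => (hc t ht).derivWithin (uniqueDiffOn_Icc hab t ht)
  have hsm : ContMDiffOn 𝓘(ℝ, ℝ) I 1 ((extChartAt I x₀).symm ∘ c) (Icc a b) :=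
    (contMDiffOn_extChartAt_symm x₀).comp (contMDiffOn_iff_contDiffOn.2 hcd) hmem
  refine (riemannianEDist_le_pathELength hsm rfl rfl hab.le).trans_eq ?_
  rw [pathELength_eq_lintegral_mfderivWithin_Icc]
  refine setLIntegral_congr_fun measurableSet_Icc fun t ht => ?_
  exact congrArg (fun v => ‖v‖ₑ) (mfderivWithin_extChartAt_symm_comp x₀ hab ht (hc t ht) hmem)

/-- The length of a curve that stays in a part of the chart domain where the metric is at least
`κ²` times the constant metric pulled back by `T` is at least `κ` times the distance of the end
points in that metric. -/
lemma le_pathELength_of_mem {V : Type*} [NormedAddCommGroup V] [NormedSpace ℝ V] (T : E →L[ℝ] V)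
    (x₀ : M) {K : Set E} {κ : ℝ≥0} (hK : ∀ y ∈ K, ∀ v : E,
      (κ : ℝ) * ‖T v‖ ≤ ‖mfderivWithin 𝓘(ℝ, E) I (extChartAt I x₀).symm (range I) y v‖)
    {γ : ℝ → M} {b : ℝ} (hb : 0 ≤ b) (hγ : ContMDiffOn 𝓘(ℝ, ℝ) I 1 γ (Icc 0 b))
    (hmem : ∀ t ∈ Icc 0 b, γ t ∈ (extChartAt I x₀).source ∧ extChartAt I x₀ (γ t) ∈ K) :
    ENNReal.ofReal (κ * ‖T (extChartAt I x₀ (γ b) - extChartAt I x₀ (γ 0))‖) ≤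
      pathELength I γ 0 b := by
  rcases hb.eq_or_lt with rfl | hb
  · simp
  set c : ℝ → E := fun t => extChartAt I x₀ (γ t)
  have hcm : ContMDiffOn 𝓘(ℝ, ℝ) 𝓘(ℝ, E) 1 c (Icc 0 b) :=
    contMDiffOn_extChartAt.comp hγ fun t ht => by
      simpa [extChartAt_source] using (hmem t ht).1
  have hcd : ContDiffOn ℝ 1 c (Icc 0 b) := contMDiffOn_iff_contDiffOn.1 hcm
  have hder : ∀ t ∈ Icc 0 b, HasDerivWithinAt c (derivWithin c (Icc 0 b) t) (Icc 0 b) t :=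
    fun t ht => (hcd.differentiableOn one_ne_zero t ht).hasDerivWithinAt
  have hTd : ContDiffOn ℝ 1 (fun t => T (c t)) (Icc 0 b) := T.contDiff.comp_contDiffOn hcd
  have h1 := enorm_sub_le_lintegral_derivWithin_Icc_of_contDiffOn_Icc hTd hb.le
  have htgt : ∀ s ∈ Icc 0 b, c s ∈ (extChartAt I x₀).target :=
    fun s hs => (extChartAt I x₀).map_source (hmem s hs).1
  have hsp : ∀ t ∈ Icc 0 b, (κ : ℝ≥0∞) * ‖derivWithin (fun t => T (c t)) (Icc 0 b) t‖ₑ ≤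
      ‖mfderivWithin 𝓘(ℝ, ℝ) I γ (Icc 0 b) t (1 : ℝ)‖ₑ := by
    intro t ht
    have e1 : derivWithin (fun t => T (c t)) (Icc 0 b) t = T (derivWithin c (Icc 0 b) t) :=
      (T.hasFDerivAt.comp_hasDerivWithinAt t (hder t ht)).derivWithin
        (uniqueDiffOn_Icc hb t ht)
    have e2 : mfderivWithin 𝓘(ℝ, ℝ) I γ (Icc 0 b) t (1 : ℝ) =
        mfderivWithin 𝓘(ℝ, ℝ) I (fun s => (extChartAt I x₀).symm (c s)) (Icc 0 b) t (1 : ℝ) := by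
      have hcg : ∀ s ∈ Icc 0 b, γ s = (extChartAt I x₀).symm (c s) := fun s hs =>
        ((extChartAt I x₀).left_inv (hmem s hs).1).symm
      have := mfderivWithin_congr (I := 𝓘(ℝ, ℝ)) (I' := I) hcg (hcg t ht)
      exact congrArg (fun (L : ℝ →L[ℝ] E) => L 1) this
    have e3 := mfderivWithin_extChartAt_symm_comp x₀ hb ht (hder t ht) htgt
    have e4 := hK (c t) (hmem t ht).2 (derivWithin c (Icc 0 b) t)
    rw [← e3] at e4
    rw [e1]
    have e5 : ‖mfderivWithin 𝓘(ℝ, ℝ) I γ (Icc 0 b) t (1 : ℝ)‖ =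
        ‖mfderivWithin 𝓘(ℝ, ℝ) I (fun s => (extChartAt I x₀).symm (c s)) (Icc 0 b) t (1 : ℝ)‖ := by
      have hcg : γ t = (extChartAt I x₀).symm (c t) :=
        ((extChartAt I x₀).left_inv (hmem t ht).1).symm
      -- The two vectors live in the tangent spaces at points that are only propositionally equal.
      have aux : ∀ (p q : M) (h : p = q) (v : E), ‖(show TangentSpace I p from v)‖ =
          ‖(show TangentSpace I q from v)‖ := by
        rintro p q rfl v; rfl
      rw [e2]
      exact aux _ _ hcg _
    rw [← e5] at e4
    rw [← ofReal_norm, ← ofReal_norm, ← ENNReal.ofReal_coe_nnreal,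
      ← ENNReal.ofReal_mul κ.coe_nonneg]
    exact ENNReal.ofReal_le_ofReal e4
  rw [ENNReal.ofReal_mul κ.coe_nonneg, ofReal_norm, ENNReal.ofReal_coe_nnreal, map_sub,
    pathELength_eq_lintegral_mfderivWithin_Icc]
  calc (κ : ℝ≥0∞) * ‖T (c b) - T (c 0)‖ₑ
      ≤ κ * ∫⁻ t in Icc 0 b, ‖derivWithin (fun t => T (c t)) (Icc 0 b) t‖ₑ := by gcongr
    _ = ∫⁻ t in Icc 0 b, κ * ‖derivWithin (fun t => T (c t)) (Icc 0 b) t‖ₑ :=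
        (lintegral_const_mul' _ _ ENNReal.coe_ne_top).symm
    _ ≤ _ := setLIntegral_mono' measurableSet_Icc hsp

/-- A lower bound for the Riemannian distance of two points of a chart: a curve between them
either stays in a ball around `z₀`, or leaves it and is therefore not short. -/
lemma le_riemannianEDist_chart [T2Space M] [ProperSpace E] {V : Type*} [NormedAddCommGroup V]
    [NormedSpace ℝ V] (T : E →L[ℝ] V) (x₀ : M) {z₀ : E} {R r m : ℝ} {κ : ℝ≥0}
    (htgt : Metric.closedBall z₀ R ∩ range I ⊆ (extChartAt I x₀).target)
    (hK : ∀ y ∈ Metric.closedBall z₀ R ∩ range I, ∀ v : E,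
      (κ : ℝ) * ‖T v‖ ≤ ‖mfderivWithin 𝓘(ℝ, E) I (extChartAt I x₀).symm (range I) y v‖)
    (hm : 0 ≤ m) (hT : ∀ v, m * ‖v‖ ≤ ‖T v‖) (hrR : r < R) {y z : E} (hy : y ∈ range I)
    (hz : z ∈ (extChartAt I x₀).target) (hyr : ‖y - z₀‖ ≤ r) :
    ENNReal.ofReal (κ * min ‖T (z - y)‖ (m * (R - r))) ≤
      riemannianEDist I ((extChartAt I x₀).symm y) ((extChartAt I x₀).symm z) := by
  set e := extChartAt I x₀ with he
  have hyK : y ∈ Metric.closedBall z₀ R ∩ range I :=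
    ⟨by rw [mem_closedBall_iff_norm]; linarith, hy⟩
  set S : Set M := e.symm '' (Metric.closedBall z₀ R ∩ range I)
  have hScl : IsClosed S := by
    apply IsCompact.isClosed
    apply ((isCompact_closedBall z₀ R).inter_right I.isClosed_range).image_of_continuousOn
    exact (continuousOn_extChartAt_symm x₀).mono htgt
  have hSK : ∀ p ∈ S, p ∈ e.source ∧ e p ∈ Metric.closedBall z₀ R ∩ range I := by
    rintro p ⟨w, hw, rfl⟩
    exact ⟨e.map_target (htgt hw), by rwa [e.right_inv (htgt hw)]⟩
  refine le_of_forall_gt fun ρ hρ => ?_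
  obtain ⟨γ, hγ0, hγ1, hγs, hγ⟩ := exists_lt_of_riemannianEDist_lt hρ
  refine lt_of_le_of_lt ?_ hγ
  have key : ∀ b ∈ Icc (0 : ℝ) 1, (∀ t ∈ Icc 0 b, γ t ∈ S) →
      ENNReal.ofReal (κ * ‖T (e (γ b) - y)‖) ≤ pathELength I γ 0 1 := by
    intro b hb hmem
    have h := le_pathELength_of_mem T x₀ hK hb.1 (hγs.mono (Icc_subset_Icc_right hb.2))
      fun t ht => hSK _ (hmem t ht)
    rw [hγ0, ← he, e.right_inv (htgt hyK)] at h
    exact h.trans (pathELength_mono le_rfl hb.2)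
  by_cases hall : ∀ t ∈ Icc (0 : ℝ) 1, γ t ∈ S
  · refine le_trans (ENNReal.ofReal_le_ofReal ?_) (key 1 (right_mem_Icc.2 zero_le_one) hall)
    rw [hγ1, e.right_inv hz]
    gcongr
    exact min_le_left _ _
  · push Not at hall
    obtain ⟨t₀, ht₀, ht₀S⟩ := hall
    set W : Set M := e.source ∩ e ⁻¹' Metric.ball z₀ R
    have hWo : IsOpen W := isOpen_extChartAt_preimage' x₀ Metric.isOpen_ball
    have hWS : W ⊆ S := fun p hp => ⟨e p, ⟨Metric.ball_subset_closedBall hp.2,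
      extChartAt_target_subset_range x₀ (e.map_source hp.1)⟩, e.left_inv hp.1⟩
    -- The curve leaves the ball; `t₁` is the first exit time, and up to then the curve stays in the
    -- closed ball, at whose boundary it has arrived.
    set B : Set ℝ := Icc 0 1 ∩ γ ⁻¹' Wᶜ
    have hBcl : IsClosed B := hγs.continuousOn.preimage_isClosed_of_isClosed isClosed_Icc
      hWo.isClosed_compl
    have hBne : B.Nonempty := ⟨t₀, ht₀, fun h => ht₀S (hWS h)⟩
    have hBbd : BddBelow B := ⟨0, fun t ht => ht.1.1⟩
    set t₁ := sInf B
    have ht₁B : t₁ ∈ B := hBcl.csInf_mem hBne hBbd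
    have hlt : ∀ t ∈ Ico 0 t₁, γ t ∈ W := by
      intro t ht
      by_contra hcon
      exact absurd (csInf_le hBbd (show t ∈ B from
        ⟨⟨ht.1, ht.2.le.trans ht₁B.1.2⟩, hcon⟩)) (not_le.2 ht.2)
    have h0 : 0 < t₁ := by
      refine ht₁B.1.1.lt_of_ne fun h => ht₁B.2 ?_
      rw [← h, hγ0]
      refine ⟨e.map_target (htgt hyK), ?_⟩
      rw [mem_preimage, e.right_inv (htgt hyK), mem_ball_iff_norm]
      linarith
    have hmem : ∀ t ∈ Icc 0 t₁, γ t ∈ S := by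
      have hcl : closure (Ico 0 t₁) = Icc 0 t₁ := closure_Ico h0.ne
      intro t ht
      have hct : ContinuousWithinAt γ (Ico 0 t₁) t :=
        ((hγs.continuousOn.mono (Icc_subset_Icc_right ht₁B.1.2)) t ht).mono Ico_subset_Icc_self
      have := hct.mem_closure_image (by rwa [hcl])
      refine hScl.closure_subset_iff.2 ?_ this
      rintro _ ⟨s, hs, rfl⟩
      exact hWS (hlt s hs)
    refine le_trans (ENNReal.ofReal_le_ofReal ?_) (key t₁ ht₁B.1 hmem)
    have hsph : R ≤ ‖e (γ t₁) - z₀‖ := by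
      by_contra hcon
      exact ht₁B.2 ⟨(hSK _ (hmem t₁ (right_mem_Icc.2 h0.le))).1, by
        rw [mem_preimage, mem_ball_iff_norm]; linarith⟩
    have h3 : R - r ≤ ‖e (γ t₁) - y‖ := by
      have := norm_sub_le_norm_sub_add_norm_sub (e (γ t₁)) y z₀
      linarith
    gcongr
    exact (min_le_right _ _).trans ((mul_le_mul_of_nonneg_left h3 hm).trans (hT _))

/-- Curves that almost realize the Riemannian distance. -/
lemma exists_almost_minimizing {p q : M} (hpq : riemannianEDist I p q ≠ ⊤) {ε : ℝ≥0∞}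
    (hε : ε ≠ 0) : ∃ γ : ℝ → M, ContinuousOn γ (Icc 0 1) ∧ γ 0 = p ∧ γ 1 = q ∧
      ∀ τ₁ ∈ Icc (0 : ℝ) 1, ∀ τ₂ ∈ Icc τ₁ 1, riemannianEDist I p (γ τ₁) +
        riemannianEDist I (γ τ₁) (γ τ₂) + riemannianEDist I (γ τ₂) q ≤
          riemannianEDist I p q + ε := by
  obtain ⟨γ, hγ0, hγ1, hγs, hγ⟩ :=
    exists_lt_of_riemannianEDist_lt (ENNReal.lt_add_right hpq hε)
  refine ⟨γ, hγs.continuousOn, hγ0, hγ1, fun τ₁ h₁ τ₂ h₂ => ?_⟩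
  have hle : ∀ a b, 0 ≤ a → a ≤ b → b ≤ 1 →
      riemannianEDist I (γ a) (γ b) ≤ pathELength I γ a b := fun a b h0 hab h1 =>
    riemannianEDist_le_pathELength (hγs.mono (Icc_subset_Icc h0 h1)) rfl rfl hab
  rw [← pathELength_add (h₁.1.trans h₂.1) h₂.2, ← pathELength_add h₁.1 h₂.1] at hγ
  refine le_trans ?_ hγ.le
  have e1 := hle 0 τ₁ le_rfl h₁.1 h₁.2
  have e2 := hle τ₁ τ₂ h₁.1 h₂.1 h₂.2
  have e3 := hle τ₂ 1 (h₁.1.trans h₂.1) h₂.2 le_rfl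
  rw [hγ0] at e1
  rw [hγ1] at e3
  gcongr

end ChartLength
end

noncomputable section
open scoped Topology

/-! ### The conformal distance -/

namespace WeightedMetric

variable {E : Type*} [NormedAddCommGroup E] [NormedSpace ℝ E] {U O : Set E}
  (G : WeightedMetric U O)

/-- The squared length of `v` at `y` for the conformal metric `f² g`. -/
def energy (y v : E) : ℝ := G.f y ^ 2 * G.g y v v

lemma energy_nonneg {y : E} (hy : y ∈ U) (v : E) : 0 ≤ G.energy y v := by
  rcases eq_or_ne v 0 with rfl | hv
  · simp [energy]
  · exact mul_nonneg (sq_nonneg _) (G.g_pos y hy v hv).le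

lemma energy_pos {y : E} (hy : y ∈ U) {v : E} (hv : v ≠ 0) : 0 < G.energy y v :=
  mul_pos (pow_pos (G.f_pos y hy) 2) (G.g_pos y hy v hv)

lemma energy_smul (y : E) (a : ℝ) (v : E) : G.energy y (a • v) = a ^ 2 * G.energy y v := by
  simp [energy]; ring

lemma continuousOn_energy : ContinuousOn (fun p : E × E => G.energy p.1 p.2) (U ×ˢ univ) := by
  refine ((G.continuousOn_f.comp continuousOn_fst fun p hp => hp.1).pow 2).mul ?_
  exact G.continuousOn_g.comp (f := fun p : E × E => (p.1, p.2, p.2)) (by fun_prop)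
    fun p hp => ⟨hp.1, mem_univ _⟩

/-- On compact sets the conformal metric is comparable with the norm. -/
lemma exists_energy_bounds [ProperSpace E] {K : Set E} (hK : IsCompact K) (hKU : K ⊆ U) :
    ∃ m > 0, ∃ B > 0, ∀ y ∈ K, ∀ v,
      m ^ 2 * ‖v‖ ^ 2 ≤ G.energy y v ∧ G.energy y v ≤ B ^ 2 * ‖v‖ ^ 2 := by
  have hc : IsCompact (K ×ˢ Metric.sphere (0 : E) 1) := hK.prod (isCompact_sphere 0 1)
  have hcont : ContinuousOn (fun p : E × E => G.energy p.1 p.2) (K ×ˢ Metric.sphere (0 : E) 1) :=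
    G.continuousOn_energy.mono (prod_mono hKU (subset_univ _))
  obtain ⟨m, hm, hml⟩ : ∃ m > 0, ∀ p ∈ K ×ˢ Metric.sphere (0 : E) 1, m ≤ G.energy p.1 p.2 := by
    rcases (K ×ˢ Metric.sphere (0 : E) 1).eq_empty_or_nonempty with h | h
    · exact ⟨1, one_pos, by simp [h]⟩
    · obtain ⟨p, hp, hmin⟩ := hc.exists_isMinOn h hcont
      refine ⟨G.energy p.1 p.2, G.energy_pos (hKU hp.1) ?_, fun q hq => hmin hq⟩
      intro h0
      have := hp.2
      simp [h0] at this
  obtain ⟨B, hB⟩ := (hc.image_of_continuousOn hcont).bddAbove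
  refine ⟨√m, Real.sqrt_pos.2 hm, √(max B 1), Real.sqrt_pos.2 (by positivity), fun y hy v => ?_⟩
  rw [Real.sq_sqrt hm.le, Real.sq_sqrt (by positivity)]
  rcases eq_or_ne v 0 with rfl | hv
  · simp [energy]
  have hv' : ‖v‖ ≠ 0 := norm_ne_zero_iff.2 hv
  have hu : (y, ‖v‖⁻¹ • v) ∈ K ×ˢ Metric.sphere (0 : E) 1 :=
    ⟨hy, by simp [norm_smul, hv']⟩
  have e : G.energy y v = ‖v‖ ^ 2 * G.energy y (‖v‖⁻¹ • v) := by
    rw [energy_smul]; field_simp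
  rw [e]
  have h1 := hml _ hu
  have h2 := (hB (mem_image_of_mem _ hu)).trans (le_max_left B 1)
  simp only at h1 h2
  constructor <;> nlinarith [sq_nonneg ‖v‖]

end WeightedMetric

namespace RiemannCoord

open Manifold MeasureTheory
open scoped ENNReal NNReal

variable {n : ℕ} [NeZero n] {M : Type*} [TopologicalSpace M]
  [ChartedSpace (EuclideanHalfSpace n) M] [IsManifold (𝓡∂ n) ∞ M]

section

variable [RiemannianBundle (fun x : M => TangentSpace (𝓡∂ n) x)]

lemma norm_mfderivWithin_symm (x₀ : M) (y v : EuclideanSpace ℝ (Fin n)) :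
    ‖mfderivWithin 𝓘(ℝ, EuclideanSpace ℝ (Fin n)) (𝓡∂ n) (extChartAt (𝓡∂ n) x₀).symm
      (range (𝓡∂ n)) y v‖ = √(pullForm (chartAt (EuclideanHalfSpace n) x₀) y v v) := by
  rw [pullForm_eq_inner]
  exact norm_eq_sqrt_real_inner _

/-- The Riemannian distance is bounded below by the distance of the metric frozen at a point, up
to a factor that tends to `1` linearly in the distance to that point. -/
lemma le_riemannianEDist_of_lipschitz [T2Space M] (x₀ : M) {y₀ : EuclideanSpace ℝ (Fin n)}
    {ρ m B C : ℝ} (hρ : 0 < ρ) (hm : 0 < m) (hB : 0 < B) (hC : 0 < C)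
    (htgt : Metric.closedBall y₀ ρ ∩ range (𝓡∂ n) ⊆ (extChartAt (𝓡∂ n) x₀).target)
    (hbd : ∀ y ∈ Metric.closedBall y₀ ρ ∩ range (𝓡∂ n), ∀ v,
      m ^ 2 * ‖v‖ ^ 2 ≤ pullForm (chartAt (EuclideanHalfSpace n) x₀) y v v ∧
      pullForm (chartAt (EuclideanHalfSpace n) x₀) y v v ≤ B ^ 2 * ‖v‖ ^ 2)
    (hlip : ∀ y ∈ Metric.closedBall y₀ ρ ∩ range (𝓡∂ n),
      ∀ z ∈ Metric.closedBall y₀ ρ ∩ range (𝓡∂ n), ∀ v,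
      |pullForm (chartAt (EuclideanHalfSpace n) x₀) y v v -
        pullForm (chartAt (EuclideanHalfSpace n) x₀) z v v| ≤ C * ‖y - z‖ * ‖v‖ ^ 2) :
    ∃ C' > 0, ∃ ρ' > 0, ∀ z₀ y z : EuclideanSpace ℝ (Fin n), ∀ r : ℝ, 0 < r →
      z₀ ∈ Metric.ball y₀ ρ' ∩ (extChartAt (𝓡∂ n) x₀).target →
      y ∈ (extChartAt (𝓡∂ n) x₀).target → z ∈ (extChartAt (𝓡∂ n) x₀).target →
      ‖y - z₀‖ ≤ r → ‖z - z₀‖ ≤ r →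
      ENNReal.ofReal ((1 - C' * r) *
        √(pullForm (chartAt (EuclideanHalfSpace n) x₀) z₀ (z - y) (z - y))) ≤
      riemannianEDist (𝓡∂ n) ((extChartAt (𝓡∂ n) x₀).symm y)
        ((extChartAt (𝓡∂ n) x₀).symm z) := by
  have : IsManifold (𝓡∂ n) 1 M := IsManifold.of_le (n := ∞) (by simp)
  -- The factor `A` is so large that a curve that leaves the ball of radius `A r` around `z₀` is
  -- no shorter, for the metric at `z₀`, than the segment from `y` to `z`.
  set A : ℝ := 1 + 2 * B / m with hA
  have hA1 : 1 < A := by rw [hA]; have : 0 < 2 * B / m := by positivity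
                         linarith
  have hC' : 0 < max (2 * A / ρ) (C * A / m ^ 2) := lt_max_of_lt_left (by positivity)
  refine ⟨max (2 * A / ρ) (C * A / m ^ 2), hC', ρ / 2, by positivity, ?_⟩
  intro z₀ y z r hr hz₀ hy hz hyr hzr
  rcases le_or_gt 1 (max (2 * A / ρ) (C * A / m ^ 2) * r) with hbig | hsmall
  · rw [ENNReal.ofReal_of_nonpos]
    · exact zero_le
    · exact mul_nonpos_of_nonpos_of_nonneg (by linarith) (Real.sqrt_nonneg _)
  set κ : ℝ := 1 - C * A / m ^ 2 * r with hκ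
  have h1 : 2 * A / ρ * r < 1 := lt_of_le_of_lt
    (mul_le_mul_of_nonneg_right (le_max_left _ _) hr.le) hsmall
  have h2 : C * A / m ^ 2 * r < 1 := lt_of_le_of_lt
    (mul_le_mul_of_nonneg_right (le_max_right _ _) hr.le) hsmall
  have hAr : A * r < ρ / 2 := by
    rw [div_mul_eq_mul_div, div_lt_one hρ] at h1
    linarith
  have hκ0 : 0 < κ := by rw [hκ]; linarith
  have hκ1 : κ ≤ 1 := by
    rw [hκ]
    have : 0 < C * A / m ^ 2 * r := by positivity
    linarith
  have hz₀K : z₀ ∈ Metric.closedBall y₀ ρ ∩ range (𝓡∂ n) :=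
    ⟨Metric.ball_subset_closedBall (Metric.ball_subset_ball (by linarith) hz₀.1),
      extChartAt_target_subset_range x₀ hz₀.2⟩
  have hsub : Metric.closedBall z₀ (A * r) ∩ range (𝓡∂ n) ⊆
      Metric.closedBall y₀ ρ ∩ range (𝓡∂ n) := by
    refine inter_subset_inter_left _ (Metric.closedBall_subset_closedBall' ?_)
    have := Metric.mem_ball.1 hz₀.1
    linarith
  have hT : ∀ v : EuclideanSpace ℝ (Fin n),
      m * ‖v‖ ≤ √(pullForm (chartAt (EuclideanHalfSpace n) x₀) z₀ v v) := fun v => by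
    apply Real.le_sqrt_of_sq_le
    rw [mul_pow]
    exact (hbd z₀ hz₀K v).1
  obtain ⟨κ', hκ'⟩ : ∃ κ' : ℝ≥0, (κ' : ℝ) = κ := ⟨⟨κ, hκ0.le⟩, rfl⟩
  have hTK : ∀ w ∈ Metric.closedBall z₀ (A * r) ∩ range (𝓡∂ n), ∀ v : EuclideanSpace ℝ (Fin n),
      κ * √(pullForm (chartAt (EuclideanHalfSpace n) x₀) z₀ v v) ≤
        √(pullForm (chartAt (EuclideanHalfSpace n) x₀) w v v) := by
    intro w hw v
    apply Real.le_sqrt_of_sq_le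
    have hw' := hsub hw
    have hb := hbd z₀ hz₀K v
    have hl := abs_le.1 (hlip w hw' z₀ hz₀K v)
    have hwz : ‖w - z₀‖ ≤ A * r := mem_closedBall_iff_norm.1 hw.1
    have hP : 0 ≤ pullForm (chartAt (EuclideanHalfSpace n) x₀) z₀ v v :=
      le_trans (by positivity) hb.1
    have h3 : C * ‖w - z₀‖ * ‖v‖ ^ 2 ≤ C * A / m ^ 2 * r *
        pullForm (chartAt (EuclideanHalfSpace n) x₀) z₀ v v := by
      calc C * ‖w - z₀‖ * ‖v‖ ^ 2 ≤ C * (A * r) * ‖v‖ ^ 2 := by gcongr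
        _ = C * A / m ^ 2 * r * (m ^ 2 * ‖v‖ ^ 2) := by field_simp
        _ ≤ _ := by
          gcongr
          exact hb.1
    rw [mul_pow, Real.sq_sqrt hP]
    nlinarith
  let T : EuclideanSpace ℝ (Fin n) →L[ℝ]
      TangentSpace (𝓡∂ n) ((extChartAt (𝓡∂ n) x₀).symm z₀) :=
    mfderivWithin 𝓘(ℝ, EuclideanSpace ℝ (Fin n)) (𝓡∂ n) (extChartAt (𝓡∂ n) x₀).symm
      (range (𝓡∂ n)) z₀
  have hTn : ∀ v : EuclideanSpace ℝ (Fin n),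
      ‖T v‖ = √(pullForm (chartAt (EuclideanHalfSpace n) x₀) z₀ v v) :=
    norm_mfderivWithin_symm x₀ z₀
  have hK : ∀ y ∈ Metric.closedBall z₀ (A * r) ∩ range (𝓡∂ n),
      ∀ v : EuclideanSpace ℝ (Fin n), (κ' : ℝ) * ‖T v‖ ≤
        ‖mfderivWithin 𝓘(ℝ, EuclideanSpace ℝ (Fin n)) (𝓡∂ n) (extChartAt (𝓡∂ n) x₀).symm
          (range (𝓡∂ n)) y v‖ := by
    intro w hw v
    rw [hTn, norm_mfderivWithin_symm, hκ']
    exact hTK w hw v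
  have key := le_riemannianEDist_chart (E := EuclideanSpace ℝ (Fin n)) (I := 𝓡∂ n) (T := T)
    (κ := κ') (m := m) (r := r) (R := A * r) (y := y) (z := z) (z₀ := z₀) x₀ (hsub.trans htgt) hK
    hm.le (fun v => (hT v).trans_eq (hTn v).symm) (by nlinarith)
    (extChartAt_target_subset_range x₀ hy) hz hyr
  refine le_trans (ENNReal.ofReal_le_ofReal ?_) key
  rw [hTn, hκ']
  have hmin : √(pullForm (chartAt (EuclideanHalfSpace n) x₀) z₀ (z - y) (z - y)) ≤
      m * (A * r - r) := by
    rw [Real.sqrt_le_left (mul_nonneg hm.le (by nlinarith))]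
    refine (hbd z₀ hz₀K _).2.trans ?_
    have h4 : ‖z - y‖ ≤ 2 * r := by
      have := norm_sub_le (z - z₀) (y - z₀)
      rw [sub_sub_sub_cancel_right] at this
      linarith
    have h5 : m * (A * r - r) = B * (2 * r) := by rw [hA]; field_simp; ring
    rw [h5, ← mul_pow]
    gcongr
  rw [min_eq_left hmin]
  refine mul_le_mul_of_nonneg_right ?_ (Real.sqrt_nonneg _)
  rw [hκ]
  have := mul_le_mul_of_nonneg_right (le_max_right (2 * A / ρ) (C * A / m ^ 2)) hr.le
  linarith

end

/-- Smooth functions in a chart are locally Lipschitz, also at the boundary. -/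
lemma exists_lipschitz_nhds (x₀ : M) {u : EuclideanSpace ℝ (Fin n) → ℝ}
    (hu : ContDiffOn ℝ ∞ u (extChartAt (𝓡∂ n) x₀).target) {y₀ : EuclideanSpace ℝ (Fin n)}
    (hy₀ : y₀ ∈ (extChartAt (𝓡∂ n) x₀).target) : ∃ C ≥ 0, ∀ᶠ ρ in 𝓝[>] (0 : ℝ),
      ∀ y ∈ Metric.closedBall y₀ ρ ∩ range (𝓡∂ n), ∀ z ∈ Metric.closedBall y₀ ρ ∩ range (𝓡∂ n),
        |u y - u z| ≤ C * ‖y - z‖ := by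
  have h1 : ContDiffWithinAt ℝ 1 u (range (𝓡∂ n)) y₀ :=
    ((contDiffOn_infty.1 hu 1) y₀ hy₀).mono_of_mem_nhdsWithin (target_mem_nhdsWithin x₀ hy₀)
  obtain ⟨C, t, ht, hlip⟩ := h1.exists_lipschitzOnWith (𝓡∂ n).convex_range
  obtain ⟨ρ, hρ, hsub⟩ := Metric.mem_nhdsWithin_iff.1 ht
  refine ⟨C, C.coe_nonneg, ?_⟩
  filter_upwards [Ioo_mem_nhdsGT hρ] with σ hσ y hy z hz
  have hb : Metric.closedBall y₀ σ ∩ range (𝓡∂ n) ⊆ t :=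
    (inter_subset_inter_left _ (Metric.closedBall_subset_ball hσ.2)).trans hsub
  have := hlip.dist_le_mul y (hb hy) z (hb hz)
  rwa [Real.dist_eq, dist_eq_norm] at this

lemma eventually_closedBall_subset_target (x₀ : M) {y₀ : EuclideanSpace ℝ (Fin n)}
    (hy₀ : y₀ ∈ (extChartAt (𝓡∂ n) x₀).target) : ∀ᶠ ρ in 𝓝[>] (0 : ℝ),
      Metric.closedBall y₀ ρ ∩ range (𝓡∂ n) ⊆ (extChartAt (𝓡∂ n) x₀).target := by
  obtain ⟨ρ, hρ, hsub⟩ := Metric.mem_nhdsWithin_iff.1 (target_mem_nhdsWithin x₀ hy₀)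
  filter_upwards [Ioo_mem_nhdsGT hρ] with σ hσ
  exact (inter_subset_inter_left _ (Metric.closedBall_subset_ball hσ.2)).trans hsub

end RiemannCoord
end

noncomputable section
open scoped Topology

namespace RiemannCoord

open Manifold MeasureTheory
open scoped ENNReal NNReal

variable {n : ℕ} [NeZero n] {M : Type*} [TopologicalSpace M]
  [ChartedSpace (EuclideanHalfSpace n) M] [IsManifold (𝓡∂ n) ∞ M]

/-- A distance function on `M` together with the properties that relate it to the lengths of
curves in the charts; `F x₀ y v` is the squared length of the vector `v` at the point with
coordinates `y` in the chart at `x₀`. -/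
structure LengthDist (F : M → EuclideanSpace ℝ (Fin n) → EuclideanSpace ℝ (Fin n) → ℝ) where
  /-- the distance of two points -/
  d : M → M → ℝ
  self_eq_zero : ∀ p, d p p = 0
  nonneg : ∀ p q, 0 ≤ d p q
  symm : ∀ p q, d p q = d q p
  triangle : ∀ p q r, d p r ≤ d p q + d q r
  eq_of_eq_zero : ∀ {p q}, d p q = 0 → p = q
  continuous : Continuous fun p : M × M => d p.1 p.2
  le_integral : ∀ (x₀ : M) {c c₁ : ℝ → EuclideanSpace ℝ (Fin n)} {a b : ℝ}, a < b →
    (∀ t ∈ Icc a b, HasDerivWithinAt c (c₁ t) (Icc a b) t) → ContinuousOn c₁ (Icc a b) →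
    (∀ t ∈ Icc a b, c t ∈ (extChartAt (𝓡∂ n) x₀).target) →
    d ((extChartAt (𝓡∂ n) x₀).symm (c a)) ((extChartAt (𝓡∂ n) x₀).symm (c b)) ≤
      ∫ t in a..b, √(F x₀ (c t) (c₁ t))
  local_lower : ∀ (x₀ : M), ∀ y₀ ∈ (extChartAt (𝓡∂ n) x₀).target, ∃ C > 0, ∃ ρ > 0,
    ∀ z₀ y z : EuclideanSpace ℝ (Fin n), ∀ r : ℝ, 0 < r →
      z₀ ∈ Metric.ball y₀ ρ ∩ (extChartAt (𝓡∂ n) x₀).target →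
      y ∈ (extChartAt (𝓡∂ n) x₀).target → z ∈ (extChartAt (𝓡∂ n) x₀).target →
      ‖y - z₀‖ ≤ r → ‖z - z₀‖ ≤ r →
      (1 - C * r) * √(F x₀ z₀ (z - y)) ≤
        d ((extChartAt (𝓡∂ n) x₀).symm y) ((extChartAt (𝓡∂ n) x₀).symm z)
  almost_min : ∀ p q, ∀ ε > 0, ∃ γ : ℝ → M, ContinuousOn γ (Icc 0 1) ∧ γ 0 = p ∧ γ 1 = q ∧
    ∀ τ₁ ∈ Icc (0 : ℝ) 1, ∀ τ₂ ∈ Icc τ₁ 1,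
      d p (γ τ₁) + d (γ τ₁) (γ τ₂) + d (γ τ₂) q ≤ d p q + ε

section Distance

variable [RiemannianBundle (fun x : M => TangentSpace (𝓡∂ n) x)]
  [IsContinuousRiemannianBundle (EuclideanSpace ℝ (Fin n))
    (fun x : M => TangentSpace (𝓡∂ n) x)]

lemma riemannianEDist_ne_top [ConnectedSpace M] (p q : M) :
    riemannianEDist (𝓡∂ n) p q ≠ ⊤ := by
  have : IsManifold (𝓡∂ n) 1 M := IsManifold.of_le (n := ∞) (by simp)
  have hball : ∀ q : M, {y | riemannianEDist (𝓡∂ n) q y < 1} ∈ 𝓝 q := fun q =>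
    eventually_riemannianEDist_lt (𝓡∂ n) q one_pos
  have hopen : IsOpen {y : M | riemannianEDist (𝓡∂ n) p y ≠ ⊤} := by
    rw [isOpen_iff_mem_nhds]
    intro y hy
    filter_upwards [hball y] with z hz
    exact ne_top_of_le_ne_top (ENNReal.add_ne_top.2 ⟨hy, (hz.trans ENNReal.one_lt_top).ne⟩)
      riemannianEDist_triangle
  have hclosed : IsClosed {y : M | riemannianEDist (𝓡∂ n) p y ≠ ⊤} := by
    rw [← isOpen_compl_iff, isOpen_iff_mem_nhds]
    intro y hy
    filter_upwards [hball y] with z hz hz'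
    have hzy : riemannianEDist (𝓡∂ n) z y ≠ ⊤ := by
      rw [riemannianEDist_comm]
      exact (hz.trans ENNReal.one_lt_top).ne
    exact hy (ne_top_of_le_ne_top (ENNReal.add_ne_top.2 ⟨hz', hzy⟩) riemannianEDist_triangle)
  have huniv := IsClopen.eq_univ ⟨hclosed, hopen⟩ ⟨p, by simp [riemannianEDist_self]⟩
  have : q ∈ {y : M | riemannianEDist (𝓡∂ n) p y ≠ ⊤} := huniv ▸ mem_univ q
  exact this

lemma toReal_riemannianEDist_triangle [ConnectedSpace M] (p q r : M) :
    (riemannianEDist (𝓡∂ n) p r).toReal ≤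
      (riemannianEDist (𝓡∂ n) p q).toReal + (riemannianEDist (𝓡∂ n) q r).toReal := by
  rw [← ENNReal.toReal_add (riemannianEDist_ne_top _ _) (riemannianEDist_ne_top _ _)]
  exact ENNReal.toReal_mono (ENNReal.add_ne_top.2
    ⟨riemannianEDist_ne_top _ _, riemannianEDist_ne_top _ _⟩) riemannianEDist_triangle

lemma eq_of_toReal_riemannianEDist_eq_zero [ConnectedSpace M] [CompactSpace M] [T2Space M]
    {p q : M} (h : (riemannianEDist (𝓡∂ n) p q).toReal = 0) : p = q := by
  have : IsManifold (𝓡∂ n) 1 M := IsManifold.of_le (n := ∞) (by simp)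
  have h0 : riemannianEDist (𝓡∂ n) p q = 0 :=
    ((ENNReal.toReal_eq_zero_iff _).1 h).resolve_right (riemannianEDist_ne_top p q)
  by_contra hne
  obtain ⟨c, hc, hsub⟩ := setOfPred_riemannianEDist_lt_subset_nhds' (𝓡∂ n)
    (isOpen_compl_singleton.mem_nhds hne : ({q}ᶜ : Set M) ∈ 𝓝 p)
  exact hsub (show riemannianEDist (𝓡∂ n) p q < c by rwa [h0]) rfl

lemma continuous_toReal_riemannianEDist [ConnectedSpace M] :
    Continuous fun p : M × M => (riemannianEDist (𝓡∂ n) p.1 p.2).toReal := by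
  have : IsManifold (𝓡∂ n) 1 M := IsManifold.of_le (n := ∞) (by simp)
  rw [continuous_iff_continuousAt]
  rintro ⟨p, q⟩
  rw [ContinuousAt, Metric.tendsto_nhds]
  intro ε hε
  have hb : ∀ q : M, ∀ᶠ y in 𝓝 q, (riemannianEDist (𝓡∂ n) q y).toReal < ε / 2 := by
    intro q
    filter_upwards [eventually_riemannianEDist_lt (𝓡∂ n) q
      (ENNReal.ofReal_pos.2 (half_pos hε))] with y hy
    exact ENNReal.toReal_lt_of_lt_ofReal hy
  rw [nhds_prod_eq]
  filter_upwards [(hb p).prod_mk (hb q)] with z hz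
  have c : ∀ a b : M, (riemannianEDist (𝓡∂ n) a b).toReal =
      (riemannianEDist (𝓡∂ n) b a).toReal := fun a b => by rw [riemannianEDist_comm]
  have t := @toReal_riemannianEDist_triangle n _ M _ _ _ _ _ _
  rw [Real.dist_eq, abs_lt]
  have t1 := t z.1 p z.2
  have t2 := t p q z.2
  have t3 := t p z.1 q
  have t4 := t z.1 z.2 q
  have c1 := c z.1 p
  have c2 := c z.2 q
  constructor <;> linarith [hz.1, hz.2]

lemma continuousOn_sqrt_comp {E X : Type*} [TopologicalSpace E] [TopologicalSpace X]
    {Q : E → E → ℝ} {U : Set E} (hQ : ContinuousOn (fun p : E × E => Q p.1 p.2) (U ×ˢ univ))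
    {c c₁ : X → E} {s : Set X} (hc : ContinuousOn c s) (hc₁ : ContinuousOn c₁ s)
    (hmem : ∀ t ∈ s, c t ∈ U) : ContinuousOn (fun t => √(Q (c t) (c₁ t))) s :=
  Real.continuous_sqrt.comp_continuousOn
    (hQ.comp (f := fun t => (c t, c₁ t)) (hc.prodMk hc₁) fun t ht => ⟨hmem t ht, mem_univ _⟩)

lemma toReal_riemannianEDist_le_integral (x₀ : M)
    (hcont : ContinuousOn (fun p : EuclideanSpace ℝ (Fin n) × EuclideanSpace ℝ (Fin n) =>
      pullForm (chartAt (EuclideanHalfSpace n) x₀) p.1 p.2 p.2)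
      ((extChartAt (𝓡∂ n) x₀).target ×ˢ univ)) {c c₁ : ℝ → EuclideanSpace ℝ (Fin n)}
    {a b : ℝ} (hab : a < b) (hc : ∀ t ∈ Icc a b, HasDerivWithinAt c (c₁ t) (Icc a b) t)
    (hc₁ : ContinuousOn c₁ (Icc a b)) (hmem : ∀ t ∈ Icc a b, c t ∈ (extChartAt (𝓡∂ n) x₀).target) :
    (riemannianEDist (𝓡∂ n) ((extChartAt (𝓡∂ n) x₀).symm (c a))
      ((extChartAt (𝓡∂ n) x₀).symm (c b))).toReal ≤
      ∫ t in a..b, √(pullForm (chartAt (EuclideanHalfSpace n) x₀) (c t) (c₁ t) (c₁ t)) := by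
  have : IsManifold (𝓡∂ n) 1 M := IsManifold.of_le (n := ∞) (by simp)
  have h := riemannianEDist_chart_le (E := EuclideanSpace ℝ (Fin n)) (I := 𝓡∂ n) x₀ hab hc hc₁ hmem
  refine ENNReal.toReal_le_of_le_ofReal
    (intervalIntegral.integral_nonneg hab.le fun t _ => Real.sqrt_nonneg _) (h.trans ?_)
  have hcc : ContinuousOn c (Icc a b) := fun t ht => (hc t ht).continuousWithinAt
  have hcont : ContinuousOn (fun t =>
      √(pullForm (chartAt (EuclideanHalfSpace n) x₀) (c t) (c₁ t) (c₁ t))) (Icc a b) :=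
    continuousOn_sqrt_comp
      (Q := fun y v => pullForm (chartAt (EuclideanHalfSpace n) x₀) y v v) hcont hcc hc₁ hmem
  rw [intervalIntegral.integral_of_le hab.le, ← integral_Icc_eq_integral_Ioc,
    ofReal_integral_eq_lintegral_ofReal (hcont.integrableOn_Icc)
      (Filter.Eventually.of_forall fun t => Real.sqrt_nonneg _)]
  have e : ∀ t, ‖mfderivWithin 𝓘(ℝ, EuclideanSpace ℝ (Fin n)) (𝓡∂ n) (extChartAt (𝓡∂ n) x₀).symm
      (range (𝓡∂ n)) (c t) (c₁ t)‖ₑ = ENNReal.ofReal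
        √(pullForm (chartAt (EuclideanHalfSpace n) x₀) (c t) (c₁ t) (c₁ t)) := fun t => by
    rw [← norm_mfderivWithin_symm]
    exact (ofReal_norm _).symm
  exact (lintegral_congr e).le

lemma exists_almost_minimizing_toReal [ConnectedSpace M] (p q : M) {ε : ℝ} (hε : 0 < ε) :
    ∃ γ : ℝ → M, ContinuousOn γ (Icc 0 1) ∧ γ 0 = p ∧ γ 1 = q ∧
    ∀ τ₁ ∈ Icc (0 : ℝ) 1, ∀ τ₂ ∈ Icc τ₁ 1, (riemannianEDist (𝓡∂ n) p (γ τ₁)).toReal +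
      (riemannianEDist (𝓡∂ n) (γ τ₁) (γ τ₂)).toReal + (riemannianEDist (𝓡∂ n) (γ τ₂) q).toReal ≤
        (riemannianEDist (𝓡∂ n) p q).toReal + ε := by
  have : IsManifold (𝓡∂ n) 1 M := IsManifold.of_le (n := ∞) (by simp)
  obtain ⟨γ, h1, h2, h3, h4⟩ := exists_almost_minimizing (I := 𝓡∂ n)
    (riemannianEDist_ne_top (n := n) p q) (ENNReal.ofReal_pos.2 hε).ne'
  refine ⟨γ, h1, h2, h3, fun τ₁ hτ₁ τ₂ hτ₂ => ?_⟩
  have h := h4 τ₁ hτ₁ τ₂ hτ₂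
  have hf := @riemannianEDist_ne_top n _ M _ _ _ _ _ _
  rw [← ENNReal.toReal_add (hf _ _) (hf _ _),
    ← ENNReal.toReal_add (ENNReal.add_ne_top.2 ⟨hf _ _, hf _ _⟩) (hf _ _),
    ← ENNReal.toReal_ofReal hε.le, ← ENNReal.toReal_add (hf _ _) ENNReal.ofReal_ne_top]
  exact ENNReal.toReal_mono (ENNReal.add_ne_top.2 ⟨hf _ _, ENNReal.ofReal_ne_top⟩)
    (by simpa [ENNReal.toReal_ofReal hε.le] using h)

/-- The Riemannian distance is a `LengthDist`, if the squared length `F` of the metric in charts is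
locally Lipschitz in the base point. -/
lemma nonempty_lengthDist [CompactSpace M] [T2Space M] [ConnectedSpace M]
    {F : M → EuclideanSpace ℝ (Fin n) → EuclideanSpace ℝ (Fin n) → ℝ}
    (hF : ∀ x₀ y v, pullForm (chartAt (EuclideanHalfSpace n) x₀) y v v = F x₀ y v)
    (hcont : ∀ x₀, ContinuousOn (fun p : EuclideanSpace ℝ (Fin n) × EuclideanSpace ℝ (Fin n) =>
      F x₀ p.1 p.2) ((extChartAt (𝓡∂ n) x₀).target ×ˢ univ))
    (hlip : ∀ (x₀ : M), ∀ y₀ ∈ (extChartAt (𝓡∂ n) x₀).target, ∃ ρ > 0, ∃ m > 0, ∃ B > 0, ∃ C > 0,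
      Metric.closedBall y₀ ρ ∩ range (𝓡∂ n) ⊆ (extChartAt (𝓡∂ n) x₀).target ∧
      (∀ y ∈ Metric.closedBall y₀ ρ ∩ range (𝓡∂ n), ∀ v,
        m ^ 2 * ‖v‖ ^ 2 ≤ F x₀ y v ∧ F x₀ y v ≤ B ^ 2 * ‖v‖ ^ 2) ∧
      ∀ y ∈ Metric.closedBall y₀ ρ ∩ range (𝓡∂ n), ∀ z ∈ Metric.closedBall y₀ ρ ∩ range (𝓡∂ n),
        ∀ v, |F x₀ y v - F x₀ z v| ≤ C * ‖y - z‖ * ‖v‖ ^ 2) :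
    Nonempty (LengthDist F) := by
  simp only [← hF] at hcont hlip
  refine ⟨{ d := fun p q => (riemannianEDist (𝓡∂ n) p q).toReal
            self_eq_zero := fun p => by simp [riemannianEDist_self]
            nonneg := fun p q => ENNReal.toReal_nonneg
            symm := fun p q => by rw [riemannianEDist_comm]
            triangle := toReal_riemannianEDist_triangle
            eq_of_eq_zero := eq_of_toReal_riemannianEDist_eq_zero
            continuous := continuous_toReal_riemannianEDist
            le_integral := fun x₀ c c₁ a b hab hc hc₁ hmem => by
              simp only [← hF]
              exact toReal_riemannianEDist_le_integral x₀ (hcont x₀) hab hc hc₁ hmem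
            local_lower := fun x₀ y₀ hy₀ => ?_
            almost_min := fun p q ε hε => exists_almost_minimizing_toReal p q hε }⟩
  obtain ⟨ρ, hρ, m, hm, B, hB, C, hC, h1, h2, h3⟩ := hlip x₀ y₀ hy₀
  obtain ⟨C', hC', ρ', hρ', h⟩ := le_riemannianEDist_of_lipschitz x₀ hρ hm hB hC h1 h2 h3
  refine ⟨C', hC', ρ', hρ', fun z₀ y z r hr hz₀ hy hz hyr hzr => ?_⟩
  rw [← hF]
  exact (ENNReal.ofReal_le_iff_le_toReal (riemannianEDist_ne_top _ _)).1
    (h z₀ y z r hr hz₀ hy hz hyr hzr)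

end Distance

variable [RiemannianBundle (fun x : M => TangentSpace (𝓡∂ n) x)]
  [IsContMDiffRiemannianBundle (𝓡∂ n) ∞ (EuclideanSpace ℝ (Fin n))
    (fun x : M => TangentSpace (𝓡∂ n) x)]

/-- The conformal metric `f² g`. -/
lemma exists_conformal_metric {f : M → ℝ} (hf : ContMDiff (𝓡∂ n) 𝓘(ℝ, ℝ) ∞ f)
    (hpos : ∀ p, 0 < f p) :
    ∃ G : ContinuousRiemannianMetric (EuclideanSpace ℝ (Fin n))
      (fun x : M => TangentSpace (𝓡∂ n) x),
      ∀ p (v w : TangentSpace (𝓡∂ n) p), G.inner p v w = f p ^ 2 * inner ℝ v w := by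
  obtain ⟨g, hg, hgi⟩ := IsContMDiffRiemannianBundle.exists_contMDiff (IB := 𝓡∂ n) (n := ∞)
    (F := EuclideanSpace ℝ (Fin n)) (E := fun x : M => TangentSpace (𝓡∂ n) x)
  refine ⟨{ inner := fun p => f p ^ 2 • g p
            symm := fun p v w => ?_
            pos := fun p v hv => ?_
            isVonNBounded := fun p => ?_
            continuous := ?_ }, fun p v w => ?_⟩
  · simp only [smul_apply, ← hgi, real_inner_comm]
  · simp only [smul_apply, ← hgi, smul_eq_mul]
    exact mul_pos (pow_pos (hpos p) 2) (real_inner_self_pos.2 hv)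
  · have hsub : {v : TangentSpace (𝓡∂ n) p | (f p ^ 2 • g p) v v < 1} ⊆
        Metric.ball (0 : TangentSpace (𝓡∂ n) p) (f p)⁻¹ := by
      intro v hv
      simp only [smul_apply, ← hgi, smul_eq_mul, mem_ofPred_eq, real_inner_self_eq_norm_sq] at hv
      rw [mem_ball_zero_iff, inv_eq_one_div, lt_div_iff₀ (hpos p)]
      nlinarith [norm_nonneg v, hpos p]
    exact (NormedSpace.isVonNBounded_ball ℝ (TangentSpace (𝓡∂ n) p) (f p)⁻¹).subset hsub
  · exact (ContMDiff.smul_section (hf.pow 2) hg).continuous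
  · simp [smul_apply, ← hgi]

lemma exists_lipschitz_energy {f : M → ℝ} (hf : ContMDiff (𝓡∂ n) 𝓘(ℝ, ℝ) ∞ f)
    (hpos : ∀ p, 0 < f p) (x₀ : M) {y₀ : EuclideanSpace ℝ (Fin n)}
    (hy₀ : y₀ ∈ (extChartAt (𝓡∂ n) x₀).target) : ∃ C > 0, ∀ᶠ ρ in 𝓝[>] (0 : ℝ),
      ∀ y ∈ Metric.closedBall y₀ ρ ∩ range (𝓡∂ n), ∀ z ∈ Metric.closedBall y₀ ρ ∩ range (𝓡∂ n),
        ∀ v, |(chartMetric x₀ hf hpos).energy y v - (chartMetric x₀ hf hpos).energy z v| ≤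
          C * ‖y - z‖ * ‖v‖ ^ 2 := by
  have hsm : ∀ i j, ContDiffOn ℝ ∞ (fun y => read (chartAt (EuclideanHalfSpace n) x₀) f y ^ 2 *
      gram (chartAt (EuclideanHalfSpace n) x₀) y i j) (extChartAt (𝓡∂ n) x₀).target :=
    fun i j => ((contDiffOn_read x₀ hf).pow 2).mul (contDiffOn_gram x₀ i j)
  choose C hC0 hC using fun i j => exists_lipschitz_nhds x₀ (hsm i j) hy₀
  refine ⟨∑ i, ∑ j, C i j + 1, ?_, ?_⟩
  · have : 0 ≤ ∑ i, ∑ j, C i j :=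
      Finset.sum_nonneg fun i _ => Finset.sum_nonneg fun j _ => hC0 i j
    linarith
  have hall : ∀ᶠ ρ in 𝓝[>] (0 : ℝ), ∀ i j, ∀ y ∈ Metric.closedBall y₀ ρ ∩ range (𝓡∂ n),
      ∀ z ∈ Metric.closedBall y₀ ρ ∩ range (𝓡∂ n), _ :=
    Filter.eventually_all.2 fun i => Filter.eventually_all.2 fun j => hC i j
  filter_upwards [hall] with ρ hρ y hy z hz v
  have e : ∀ y, (chartMetric x₀ hf hpos).energy y v =
      ∑ i, ∑ j, (read (chartAt (EuclideanHalfSpace n) x₀) f y ^ 2 *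
        gram (chartAt (EuclideanHalfSpace n) x₀) y i j) * (v i * v j) := by
    intro y
    change _ * pullForm (chartAt (EuclideanHalfSpace n) x₀) y v v = _
    rw [pullForm_apply, Finset.mul_sum]
    refine Finset.sum_congr rfl fun i _ => ?_
    rw [Finset.mul_sum]
    exact Finset.sum_congr rfl fun j _ => (mul_assoc _ _ _).symm
  rw [e, e, ← Finset.sum_sub_distrib]
  simp only [← Finset.sum_sub_distrib, ← sub_mul]
  have hv : ∀ i, |v i| ≤ ‖v‖ := fun i => by
    simpa using PiLp.norm_apply_le v i
  have hb : ∀ i j, |(read (chartAt (EuclideanHalfSpace n) x₀) f y ^ 2 *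
        gram (chartAt (EuclideanHalfSpace n) x₀) y i j -
        read (chartAt (EuclideanHalfSpace n) x₀) f z ^ 2 *
        gram (chartAt (EuclideanHalfSpace n) x₀) z i j) * (v i * v j)| ≤
        C i j * (‖y - z‖ * ‖v‖ ^ 2) := by
    intro i j
    rw [abs_mul, abs_mul]
    calc _ ≤ (C i j * ‖y - z‖) * (‖v‖ * ‖v‖) :=
          mul_le_mul (hρ i j y hy z hz) (mul_le_mul (hv i) (hv j) (abs_nonneg _) (norm_nonneg _))
            (by positivity) (mul_nonneg (hC0 i j) (norm_nonneg _))
      _ = _ := by ring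
  calc _ ≤ ∑ i, ∑ j, C i j * (‖y - z‖ * ‖v‖ ^ 2) :=
        (Finset.abs_sum_le_sum_abs _ _).trans (Finset.sum_le_sum fun i _ =>
          (Finset.abs_sum_le_sum_abs _ _).trans (Finset.sum_le_sum fun j _ => hb i j))
    _ = (∑ i, ∑ j, C i j) * (‖y - z‖ * ‖v‖ ^ 2) := by simp only [Finset.sum_mul]
    _ ≤ (∑ i, ∑ j, C i j + 1) * (‖y - z‖ * ‖v‖ ^ 2) := by gcongr; linarith
    _ = _ := by ring

variable {f : M → ℝ}

/-- The distance function of the conformal metric `f² g`. -/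
abbrev ConformalDist (hf : ContMDiff (𝓡∂ n) 𝓘(ℝ, ℝ) ∞ f) (hpos : ∀ p, 0 < f p) :=
  LengthDist fun x₀ : M => (chartMetric x₀ hf hpos).energy

/-- The Riemannian distance of the metric `f² g` is a `ConformalDist`. -/
theorem nonempty_conformalDist [CompactSpace M] [T2Space M] [ConnectedSpace M]
    (hf : ContMDiff (𝓡∂ n) 𝓘(ℝ, ℝ) ∞ f) (hpos : ∀ p, 0 < f p) :
    Nonempty (ConformalDist hf hpos) := by
  obtain ⟨G, hG⟩ := exists_conformal_metric hf hpos
  have hen : ∀ (x₀ : M) (y v : EuclideanSpace ℝ (Fin n)),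
      @pullForm n _ M _ _ ⟨G.toRiemannianMetric⟩ (chartAt (EuclideanHalfSpace n) x₀) y v v =
      (chartMetric x₀ hf hpos).energy y v := by
    intro x₀ y v
    rw [@pullForm_eq_inner n _ M _ _ ⟨G.toRiemannianMetric⟩]
    refine Eq.trans (hG _ _ _) ?_
    change _ = _ * pullForm (chartAt (EuclideanHalfSpace n) x₀) y v v
    rw [pullForm_eq_inner]
    rfl
  -- The tangent bundle carries the metric `g` as an instance; the results on the Riemannian
  -- distance are applied to `f² g` by passing that metric explicitly.
  refine @nonempty_lengthDist n _ M _ _ _ ⟨G.toRiemannianMetric⟩ _ _ _ _ _ hen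
    (fun x₀ => (chartMetric x₀ hf hpos).continuousOn_energy) fun x₀ y₀ hy₀ => ?_
  obtain ⟨C, hC, hlip⟩ := exists_lipschitz_energy hf hpos x₀ hy₀
  obtain ⟨ρ, ⟨hρ1, hρ2⟩, hρ⟩ := ((hlip.and (eventually_closedBall_subset_target x₀ hy₀)).and
    self_mem_nhdsWithin).exists
  obtain ⟨m, hm, B, hB, hbd⟩ := (chartMetric x₀ hf hpos).exists_energy_bounds
    ((isCompact_closedBall y₀ ρ).inter_right (𝓡∂ n).isClosed_range) hρ2
  exact ⟨ρ, hρ, m, hm, B, hB, C, hC, hρ2, hbd, hρ1⟩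

end RiemannCoord
end

noncomputable section
open scoped Topology

/-! ### Minimizing curves -/

namespace RiemannCoord.LengthDist

open Filter

variable {n : ℕ} [NeZero n] {M : Type*} [TopologicalSpace M] [CompactSpace M]
  [ChartedSpace (EuclideanHalfSpace n) M]
  {F : M → EuclideanSpace ℝ (Fin n) → EuclideanSpace ℝ (Fin n) → ℝ} (D : LengthDist F)

/-- Almost minimizing curves, parametrized by the distance from `p`, are almost isometric. -/
lemma exists_almost_isometric (p q : M) {ε : ℝ} (hε : 0 < ε) :
    ∃ x : ℝ → M, D.d p (x 0) ≤ ε ∧ D.d (x (D.d p q)) q ≤ ε ∧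
      ∀ s ∈ Icc 0 (D.d p q), ∀ t ∈ Icc 0 (D.d p q),
        |s - t| ≤ D.d (x s) (x t) ∧ D.d (x s) (x t) ≤ |s - t| + ε := by
  obtain ⟨γ, hγ, h0, h1, h⟩ := D.almost_min p q ε hε
  have hcont : ContinuousOn (fun τ => D.d p (γ τ)) (Icc 0 1) :=
    D.continuous.comp_continuousOn (f := fun τ => (p, γ τ)) (continuousOn_const.prodMk hγ)
  have hivt : ∀ s ∈ Icc 0 (D.d p q), ∃ τ ∈ Icc (0 : ℝ) 1, D.d p (γ τ) = s := by
    intro s hs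
    have := intermediate_value_Icc zero_le_one hcont
    simp only [h0, h1, D.self_eq_zero] at this
    exact this hs
  choose! τ hτ hτd using hivt
  have hL := D.nonneg p q
  -- the point at distance `t` from `p` is almost at distance `L - t` from `q`
  have hle : ∀ s ∈ Icc 0 (D.d p q), ∀ t ∈ Icc 0 (D.d p q), τ s ≤ τ t →
      D.d (γ (τ s)) (γ (τ t)) ≤ |s - t| + ε := by
    intro s hs t ht hst
    have h2 := h (τ s) (hτ s hs) (τ t) ⟨hst, (hτ t ht).2⟩
    have h3 := D.triangle p (γ (τ t)) q
    have h4 := hτd s hs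
    have h5 := hτd t ht
    have := neg_le_abs (s - t)
    linarith
  refine ⟨fun s => γ (τ s), ?_, ?_, fun s hs t ht => ⟨?_, ?_⟩⟩
  · rw [hτd 0 ⟨le_rfl, hL⟩]; exact hε.le
  · have hLm : D.d p q ∈ Icc 0 (D.d p q) := ⟨hL, le_rfl⟩
    have h2 := h (τ (D.d p q)) (hτ _ hLm) (τ (D.d p q)) ⟨le_rfl, (hτ _ hLm).2⟩
    have h3 := hτd _ hLm
    have h4 := D.self_eq_zero (γ (τ (D.d p q)))
    linarith
  · rw [abs_le']
    have h2 := D.triangle p (γ (τ s)) (γ (τ t))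
    have h3 := D.triangle p (γ (τ t)) (γ (τ s))
    rw [D.symm (γ (τ t)), hτd s hs, hτd t ht] at h3
    rw [hτd s hs, hτd t ht] at h2
    constructor <;> linarith
  · rcases le_total (τ s) (τ t) with hst | hst
    · exact hle s hs t ht hst
    · rw [D.symm, abs_sub_comm]
      exact hle t ht s hs hst

/-- Any two points are joined by an isometric copy of an interval: a limit of almost isometric
curves, by compactness of the space of all maps. -/
lemma exists_isometric (p q : M) :
    ∃ x : ℝ → M, x 0 = p ∧ x (D.d p q) = q ∧
      ∀ s ∈ Icc 0 (D.d p q), ∀ t ∈ Icc 0 (D.d p q), D.d (x s) (x t) = |s - t| := by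
  set S : ℕ → Set (ℝ → M) := fun k => {x | D.d p (x 0) ≤ 1 / (k + 1) ∧
    D.d (x (D.d p q)) q ≤ 1 / (k + 1) ∧ ∀ s ∈ Icc 0 (D.d p q), ∀ t ∈ Icc 0 (D.d p q),
      |s - t| ≤ D.d (x s) (x t) ∧ D.d (x s) (x t) ≤ |s - t| + 1 / (k + 1)} with hS
  have hd : ∀ s t : ℝ, Continuous fun x : ℝ → M => D.d (x s) (x t) := fun s t =>
    D.continuous.comp (f := fun x : ℝ → M => (x s, x t))
      ((continuous_apply s).prodMk (continuous_apply t))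
  have hdp : Continuous fun x : ℝ → M => D.d p (x 0) :=
    D.continuous.comp (f := fun x : ℝ → M => (p, x 0))
      (continuous_const.prodMk (continuous_apply 0))
  have hdq : Continuous fun x : ℝ → M => D.d (x (D.d p q)) q :=
    D.continuous.comp (f := fun x : ℝ → M => (x (D.d p q), q))
      ((continuous_apply (D.d p q)).prodMk continuous_const)
  have hcl : ∀ k, IsClosed (S k) := by
    intro k
    refine (isClosed_le hdp continuous_const).inter
      ((isClosed_le hdq continuous_const).inter ?_)
    have e : {x : ℝ → M | ∀ s ∈ Icc 0 (D.d p q), ∀ t ∈ Icc 0 (D.d p q),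
        |s - t| ≤ D.d (x s) (x t) ∧ D.d (x s) (x t) ≤ |s - t| + 1 / ((k : ℝ) + 1)} =
        ⋂ s ∈ Icc 0 (D.d p q), ⋂ t ∈ Icc 0 (D.d p q), {x : ℝ → M | |s - t| ≤ D.d (x s) (x t) ∧
          D.d (x s) (x t) ≤ |s - t| + 1 / ((k : ℝ) + 1)} := by
      ext x; simp only [mem_iInter, mem_ofPred_eq]
    have h : IsClosed (⋂ s ∈ Icc 0 (D.d p q), ⋂ t ∈ Icc 0 (D.d p q),
        {x : ℝ → M | |s - t| ≤ D.d (x s) (x t) ∧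
          D.d (x s) (x t) ≤ |s - t| + 1 / ((k : ℝ) + 1)}) :=
      isClosed_iInter fun s => isClosed_iInter fun _ => isClosed_iInter fun t =>
        isClosed_iInter fun _ => (isClosed_le continuous_const (hd s t)).inter
          (isClosed_le (hd s t) continuous_const)
    rw [← e] at h
    exact h
  have hmono : ∀ k, S (k + 1) ⊆ S k := by
    intro k x hx
    have hk : (1 : ℝ) / ((k + 1 : ℕ) + 1) ≤ 1 / (k + 1) := by
      push_cast
      gcongr
      linarith
    exact ⟨hx.1.trans hk, hx.2.1.trans hk, fun s hs t ht => ⟨(hx.2.2 s hs t ht).1,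
      (hx.2.2 s hs t ht).2.trans (by gcongr)⟩⟩
  obtain ⟨x, hx⟩ := IsCompact.nonempty_iInter_of_sequence_nonempty_isCompact_isClosed S hmono
    (fun k => D.exists_almost_isometric p q (by positivity)) (hcl 0).isCompact hcl
  rw [mem_iInter] at hx
  have hlim : ∀ a b : ℝ, (∀ k : ℕ, a ≤ b + 1 / (k + 1)) → a ≤ b := by
    intro a b h
    refine le_of_forall_pos_le_add fun ε hε => ?_
    obtain ⟨k, hk⟩ := exists_nat_one_div_lt hε
    exact (h k).trans (by linarith)
  refine ⟨x, ?_, ?_, fun s hs t ht => le_antisymm ?_ ((hx 0).2.2 s hs t ht).1⟩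
  · exact (D.eq_of_eq_zero (le_antisymm (hlim _ _ fun k => by simpa using (hx k).1)
      (D.nonneg _ _))).symm
  · exact D.eq_of_eq_zero (le_antisymm (hlim _ _ fun k => by simpa using (hx k).2.1)
      (D.nonneg _ _))
  · exact hlim _ _ fun k => ((hx k).2.2 s hs t ht).2

lemma continuousOn_of_isometric {x : ℝ → M} {s : Set ℝ}
    (hx : ∀ a ∈ s, ∀ b ∈ s, D.d (x a) (x b) = |a - b|) : ContinuousOn x s := by
  intro a ha
  rw [ContinuousWithinAt, (nhds_basis_opens (x a)).tendsto_right_iff]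
  rintro V ⟨haV, hV⟩
  rcases (Vᶜ).eq_empty_or_nonempty with h | h
  · rw [compl_empty_iff] at h
    simp [h]
  obtain ⟨y, hy, hmin⟩ := hV.isClosed_compl.isCompact.exists_isMinOn h
    (D.continuous.comp (Continuous.prodMk_right (x a))).continuousOn
  have hpos : 0 < D.d (x a) y := by
    refine (D.nonneg _ _).lt_of_ne fun h0 => hy ?_
    rwa [← D.eq_of_eq_zero h0.symm]
  filter_upwards [self_mem_nhdsWithin,
    mem_nhdsWithin_of_mem_nhds (Metric.ball_mem_nhds a hpos)] with b hb hba
  by_contra hcon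
  have h1 : D.d (x a) y ≤ D.d (x a) (x b) := hmin hcon
  rw [hx a ha b hb, abs_sub_comm] at h1
  rw [Metric.mem_ball, Real.dist_eq] at hba
  linarith

/-- A shortest curve between two disjoint compact sets. -/
lemma exists_minimizer {C₁ C₂ : Set M} (h₁ : IsClosed C₁) (h₂ : IsClosed C₂)
    (hn₁ : C₁.Nonempty) (hn₂ : C₂.Nonempty) (hdisj : Disjoint C₁ C₂) :
    ∃ L > 0, ∃ x : ℝ → M, x 0 ∈ C₁ ∧ x L ∈ C₂ ∧ ContinuousOn x (Icc 0 L) ∧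
      (∀ s ∈ Icc 0 L, ∀ t ∈ Icc 0 L, D.d (x s) (x t) = |s - t|) ∧
      (∀ t ∈ Ioo 0 L, x t ∉ C₁ ∪ C₂) ∧ ∀ p ∈ C₁, ∀ q ∈ C₂, L ≤ D.d p q := by
  obtain ⟨⟨p, q⟩, hpq, hmin⟩ := (h₁.isCompact.prod h₂.isCompact).exists_isMinOn
    (hn₁.prod hn₂) D.continuous.continuousOn
  have hle : ∀ p' ∈ C₁, ∀ q' ∈ C₂, D.d p q ≤ D.d p' q' := fun p' hp' q' hq' =>
    hmin (mk_mem_prod hp' hq')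
  have hL : 0 < D.d p q := by
    refine (D.nonneg _ _).lt_of_ne fun h0 => ?_
    have h := D.eq_of_eq_zero h0.symm
    exact hdisj.le_bot ⟨hpq.1, by rw [show p = q from h]; exact hpq.2⟩
  obtain ⟨x, hx0, hxL, hx⟩ := D.exists_isometric p q
  refine ⟨D.d p q, hL, x, by rw [hx0]; exact hpq.1, by rw [hxL]; exact hpq.2,
    D.continuousOn_of_isometric hx, hx, fun t ht hmem => ?_, hle⟩
  have ht' : t ∈ Icc 0 (D.d p q) := Ioo_subset_Icc_self ht
  rcases hmem with hm | hm
  · have h1 := hle _ hm _ hpq.2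
    have h2 := hx t ht' _ ⟨hL.le, le_rfl⟩
    rw [hxL, abs_of_nonpos (by linarith [ht.2])] at h2
    simp only at h1
    linarith [ht.1]
  · have h1 := hle _ hpq.1 _ hm
    have h2 := hx 0 ⟨le_rfl, hL.le⟩ t ht'
    rw [hx0, abs_of_nonpos (by linarith [ht.1])] at h2
    simp only at h1
    linarith [ht.2]

end RiemannCoord.LengthDist
end

noncomputable section
open scoped Topology

/-! ### Differentiability from a bound on second differences -/

section SecondDifference

open Filter MeasureTheory

variable {E : Type*} [NormedAddCommGroup E] [NormedSpace ℝ E] [CompleteSpace E]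

/-- A continuous curve whose dyadic difference quotients converge uniformly is `C¹`. -/
lemma exists_hasDerivWithinAt_of_dyadic {x : ℝ → E} (hx : Continuous x) {a c h₀ C : ℝ}
    (hac : a < c) (hh₀ : 0 < h₀) (hC : 0 ≤ C)
    (h : ∀ t h, 0 < h → a ≤ t - h → t + h ≤ c + h₀ →
      ‖x (t + h) + x (t - h) - (2 : ℝ) • x t‖ ≤ C * (h * √h)) :
    ∃ u : ℝ → E, ContinuousOn u (Icc a c) ∧
      ∀ t ∈ Icc a c, HasDerivWithinAt x (u t) (Icc a c) t := by
  set s : ℕ → ℝ := fun k => h₀ * (1 / 2) ^ k with hs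
  have hs0 : ∀ k, 0 < s k := fun k => by positivity
  have hs1 : ∀ k, s k ≤ h₀ := fun k =>
    mul_le_of_le_one_right hh₀.le (pow_le_one₀ (by norm_num) (by norm_num))
  set D : ℕ → ℝ → E := fun k t => (s k)⁻¹ • (x (t + s k) - x t) with hD
  set r : ℝ := √(1 / 2) with hr
  have hr0 : 0 ≤ r := Real.sqrt_nonneg _
  have hr1 : r < 1 := by rw [hr, Real.sqrt_lt' one_pos]; norm_num
  have hsq : ∀ k, √(s k) = √h₀ * r ^ k := fun k => by
    rw [hs, Real.sqrt_mul hh₀.le, ← Real.sqrt_sq (pow_nonneg hr0 k), ← pow_mul, mul_comm k 2,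
      pow_mul, hr, Real.sq_sqrt (by norm_num)]
  have hstep : ∀ t ∈ Icc a c, ∀ k, dist (D k t) (D (k + 1) t) ≤ C * √h₀ * r ^ k := by
    intro t ht k
    have hk : s k = 2 * s (k + 1) := by simp only [hs, pow_succ]; ring
    have hp := hs0 (k + 1)
    have h1 := h (t + s (k + 1)) (s (k + 1)) hp (by linarith [ht.1])
      (by linarith [ht.2, hs1 k])
    -- Successive dyadic difference quotients differ by a multiple of a second difference.
    have e : D k t - D (k + 1) t = (2 * s (k + 1))⁻¹ • (x (t + s (k + 1) + s (k + 1)) +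
        x (t + s (k + 1) - s (k + 1)) - (2 : ℝ) • x (t + s (k + 1))) := by
      simp only [hD, hk, add_sub_cancel_right, show t + 2 * s (k + 1) =
        t + s (k + 1) + s (k + 1) by ring]
      have e1 : (s (k + 1))⁻¹ = (2 * s (k + 1))⁻¹ * 2 := by field_simp
      rw [e1, mul_smul]
      simp only [smul_sub, smul_add, smul_smul]
      module
    rw [dist_eq_norm, e, norm_smul, Real.norm_of_nonneg (by positivity)]
    calc (2 * s (k + 1))⁻¹ * _ ≤ (2 * s (k + 1))⁻¹ * (C * (s (k + 1) * √(s (k + 1)))) := by gcongr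
      _ = C / 2 * √(s (k + 1)) := by field_simp
      _ = C * √h₀ * r ^ k * (r / 2) := by rw [hsq, pow_succ]; ring
      _ ≤ C * √h₀ * r ^ k * 1 := by gcongr; linarith
      _ = _ := mul_one _
  have hlim : ∀ t, ∃ u, t ∈ Icc a c → Tendsto (fun k => D k t) atTop (𝓝 u) := by
    intro t
    by_cases ht : t ∈ Icc a c
    · obtain ⟨u, hu⟩ := cauchySeq_tendsto_of_complete
        (cauchySeq_of_le_geometric r _ hr1 (hstep t ht))
      exact ⟨u, fun _ => hu⟩
    · exact ⟨0, fun h => absurd h ht⟩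
  choose u hu using hlim
  have hrate : ∀ t ∈ Icc a c, ∀ k, dist (D k t) (u t) ≤ C * √h₀ * r ^ k / (1 - r) :=
    fun t ht => dist_le_of_le_geometric_of_tendsto r _ hr1 (hstep t ht) (hu t ht)
  have hrate0 : Tendsto (fun k => C * √h₀ * r ^ k / (1 - r)) atTop (𝓝 0) := by
    have := ((tendsto_pow_atTop_nhds_zero_of_lt_one hr0 hr1).const_mul (C * √h₀)).div_const (1 - r)
    simpa using this
  have hunif : TendstoUniformlyOn D u atTop (Icc a c) := by
    rw [Metric.tendstoUniformlyOn_iff]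
    intro ε hε
    filter_upwards [hrate0.eventually_lt_const hε] with k hk t ht
    rw [dist_comm]
    exact (hrate t ht k).trans_lt hk
  have hDc : ∀ k, Continuous (D k) := fun k => by fun_prop
  have hucont : ContinuousOn u (Icc a c) :=
    hunif.continuousOn (Frequently.of_forall fun k => (hDc k).continuousOn)
  set v : ℝ → E := IccExtend hac.le ((Icc a c).domRestrict u) with hv
  have hvc : Continuous v := hucont.domRestrict.Icc_extend'
  have huv : ∀ t ∈ Icc a c, v t = u t := fun t ht => by
    rw [hv, IccExtend_of_mem _ _ ht]; rfl
  have hX : ∀ t, Tendsto (fun k => (s k)⁻¹ • ∫ τ in t..t + s k, x τ) atTop (𝓝 (x t)) := by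
    intro t
    have h1 : HasDerivAt (fun z => ∫ τ in t..z, x τ) (x t) t :=
      (hx.integral_hasStrictDerivAt t t).hasDerivAt
    have h2 : Tendsto s atTop (𝓝[≠] 0) := by
      refine tendsto_nhdsWithin_iff.2 ⟨?_, Eventually.of_forall fun k => (hs0 k).ne'⟩
      have h3 := (tendsto_pow_atTop_nhds_zero_of_lt_one (r := (1 / 2 : ℝ)) (by norm_num)
        (by norm_num)).const_mul h₀
      simpa only [mul_zero] using h3
    have h4 := h1.tendsto_slope_zero.comp h2
    simpa [Function.comp_def] using h4
  -- The integral of a difference quotient is a difference of mean values of `x`, so the limit of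
  -- the quotients is a derivative by the fundamental theorem of calculus.
  have hftc : ∀ t ∈ Icc a c, x t = x a + ∫ τ in a..t, v τ := by
    intro t ht
    have h1 : Tendsto (fun k => ∫ τ in a..t, D k τ) atTop (𝓝 (∫ τ in a..t, v τ)) := by
      rw [tendsto_iff_dist_tendsto_zero]
      refine squeeze_zero (fun _ => dist_nonneg) (fun k => ?_)
        (g := fun k => C * √h₀ * r ^ k / (1 - r) * |t - a|) (by simpa using hrate0.mul_const _)
      rw [dist_eq_norm, ← intervalIntegral.integral_sub ((hDc k).intervalIntegrable _ _)
        (hvc.intervalIntegrable _ _)]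
      refine intervalIntegral.norm_integral_le_of_norm_le_const fun τ hτ => ?_
      rw [uIoc_of_le ht.1] at hτ
      have hτ' : τ ∈ Icc a c := ⟨hτ.1.le, hτ.2.trans ht.2⟩
      rw [huv τ hτ', ← dist_eq_norm]
      exact hrate τ hτ' k
    have h2 : ∀ k, ∫ τ in a..t, D k τ =
        (s k)⁻¹ • (∫ τ in t..t + s k, x τ) - (s k)⁻¹ • ∫ τ in a..a + s k, x τ := by
      intro k
      have hi : ∀ p q, IntervalIntegrable x volume p q := fun p q => hx.intervalIntegrable _ _
      have hxs : Continuous fun τ => x (τ + s k) := by fun_prop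
      simp only [hD]
      rw [intervalIntegral.integral_smul, intervalIntegral.integral_sub
        (hxs.intervalIntegrable _ _) (hi _ _), intervalIntegral.integral_comp_add_right, ← smul_sub,
        intervalIntegral.integral_interval_sub_interval_comm (hi _ _) (hi _ _) (hi _ _)]
      congr 1
      rw [intervalIntegral.integral_symm (a + s k) a, intervalIntegral.integral_symm (t + s k) t]
      abel
    have h3 := tendsto_nhds_unique h1 (by simpa only [h2] using (hX t).sub (hX a))
    rw [h3]
    abel
  refine ⟨u, hucont, fun t ht => ?_⟩
  have h1 : HasDerivAt (fun z => x a + ∫ τ in a..z, v τ) (v t) t :=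
    ((hvc.integral_hasStrictDerivAt a t).hasDerivAt).const_add _
  rw [← huv t ht]
  exact h1.hasDerivWithinAt.congr hftc (hftc t ht)

/-- The version of `exists_hasDerivWithinAt_of_dyadic` up to the right end of the interval. -/
lemma exists_hasDerivWithinAt_of_second_difference {x : ℝ → E} {a b C : ℝ} (hab : a < b)
    (hx : ContinuousOn x (Icc a b)) (hC : 0 ≤ C)
    (h : ∀ t h, 0 < h → a ≤ t - h → t + h ≤ b →
      ‖x (t + h) + x (t - h) - (2 : ℝ) • x t‖ ≤ C * (h * √h)) :
    ContinuousOn (derivWithin x (Icc a b)) (Icc a b) ∧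
      ∀ t ∈ Icc a b, HasDerivWithinAt x (derivWithin x (Icc a b) t) (Icc a b) t := by
  have key : ∀ {x : ℝ → E} {a b : ℝ}, a < b → ContinuousOn x (Icc a b) →
      (∀ t h, 0 < h → a ≤ t - h → t + h ≤ b →
        ‖x (t + h) + x (t - h) - (2 : ℝ) • x t‖ ≤ C * (h * √h)) → ∀ t ∈ Ico a b,
      ContinuousWithinAt (derivWithin x (Icc a b)) (Icc a b) t ∧
        DifferentiableWithinAt ℝ x (Icc a b) t := by
    intro x a b hab hx h t ht
    set y : ℝ → E := IccExtend hab.le ((Icc a b).domRestrict x) with hy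
    have hyc : Continuous y := hx.domRestrict.Icc_extend'
    have hxy : ∀ t ∈ Icc a b, y t = x t := fun t ht => by
      rw [hy, IccExtend_of_mem _ _ ht]; rfl
    -- The dyadic quotients at `t` look ahead by `b - c`, which leaves room up to a point `c > t`.
    obtain ⟨c, hc⟩ := exists_between ht.2
    obtain ⟨u, huc, hu⟩ := exists_hasDerivWithinAt_of_dyadic hyc (a := a) (c := c) (h₀ := b - c)
      (C := C) (ht.1.trans_lt hc.1) (by linarith [hc.2]) hC (fun s k hk h1 h2 => by
        rw [hxy _ ⟨by linarith, by linarith⟩, hxy _ ⟨by linarith, by linarith⟩,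
          hxy _ ⟨by linarith, by linarith⟩]
        exact h s k hk h1 (by linarith))
    have hd : ∀ s ∈ Ico a c, HasDerivWithinAt x (u s) (Icc a b) s := by
      intro s hs
      have h1 := (hu s (Ico_subset_Icc_self hs)).congr (f₁ := x)
        (fun z hz => (hxy z ⟨hz.1, hz.2.trans hc.2.le⟩).symm)
        (hxy s ⟨hs.1, hs.2.le.trans hc.2.le⟩).symm
      refine h1.mono_of_mem_nhdsWithin ?_
      filter_upwards [self_mem_nhdsWithin, mem_nhdsWithin_of_mem_nhds (Iio_mem_nhds hs.2)]
        with z hz hz'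
      exact ⟨hz.1, le_of_lt hz'⟩
    refine ⟨?_, (hd t ⟨ht.1, hc.1⟩).differentiableWithinAt⟩
    have hmem : Ico a c ∈ 𝓝[Icc a b] t := by
      filter_upwards [self_mem_nhdsWithin, mem_nhdsWithin_of_mem_nhds (Iio_mem_nhds hc.1)]
        with z hz hz'
      exact ⟨hz.1, hz'⟩
    have h1 : ContinuousWithinAt u (Icc a b) t :=
      ((huc t ⟨ht.1, hc.1.le⟩).mono Ico_subset_Icc_self).mono_of_mem_nhdsWithin hmem
    refine h1.congr_of_eventuallyEq ?_ ?_
    · filter_upwards [hmem] with s hs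
      exact (hd s hs).derivWithin (uniqueDiffOn_Icc hab s ⟨hs.1, hs.2.le.trans hc.2.le⟩)
    · exact (hd t ⟨ht.1, hc.1⟩).derivWithin (uniqueDiffOn_Icc hab t ⟨ht.1, ht.2.le⟩)
  -- the same for the reversed curve takes care of the right end
  have hrev : ∀ t ∈ Ioc a b, ContinuousWithinAt (derivWithin x (Icc a b)) (Icc a b) t ∧
      DifferentiableWithinAt ℝ x (Icc a b) t := by
    intro t ht
    have hpre : ∀ s, -s ∈ Icc a b ↔ s ∈ Icc (-b) (-a) := fun s => by
      constructor <;> exact fun h => ⟨by linarith [h.2], by linarith [h.1]⟩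
    have hk := key (x := fun s => x (-s)) (a := -b) (b := -a) (by linarith)
      (hx.comp continuousOn_neg fun s hs => (hpre s).2 hs) (fun s k hk h1 h2 => by
        have := h (-s) k hk (by linarith) (by linarith)
        rwa [show -s + k = -(s - k) by ring, show -s - k = -(s + k) by ring,
          add_comm (x _) (x _)] at this) (-t) ⟨by linarith [ht.2], by linarith [ht.1]⟩
    have hneg : ContinuousWithinAt (fun s : ℝ => -s) (Icc a b) t :=
      continuous_neg.continuousWithinAt
    have hmaps : MapsTo (fun s : ℝ => -s) (Icc a b) (Icc (-b) (-a)) := fun s hs =>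
      (hpre (-s)).1 (by simpa using hs)
    have hdx : ∀ s ∈ Icc a b, derivWithin x (Icc a b) s =
        -derivWithin (fun s => x (-s)) (Icc (-b) (-a)) (-s) := by
      intro s hs
      rw [derivWithin_comp_neg, neg_neg, neg_neg, Set.neg_Icc, neg_neg, neg_neg]
    refine ⟨?_, ?_⟩
    · refine ((hk.1.comp hneg hmaps).neg).congr hdx (hdx t ⟨ht.1.le, ht.2⟩)
    · have := hk.2.comp t (differentiableWithinAt_id.neg (s := Icc a b)) hmaps
      simpa [Function.comp_def] using this
  refine ⟨fun t ht => ?_, fun t ht => ?_⟩ <;> rcases ht.2.lt_or_eq with h1 | h1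
  · exact (key hab hx h t ⟨ht.1, h1⟩).1
  · exact (hrev t ⟨h1 ▸ hab, ht.2⟩).1
  · exact (key hab hx h t ⟨ht.1, h1⟩).2.hasDerivWithinAt
  · exact (hrev t ⟨h1 ▸ hab, ht.2⟩).2.hasDerivWithinAt

lemma exists_hasDerivWithinAt_of_local_second_difference {x : ℝ → E} {a b : ℝ} (hab : a < b)
    (hx : ContinuousOn x (Icc a b))
    (h : ∀ t₀ ∈ Icc a b, ∃ ε > 0, ∃ C ≥ 0, ∀ t h, 0 < h → a ≤ t - h → t + h ≤ b →
      t₀ - ε ≤ t - h → t + h ≤ t₀ + ε →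
      ‖x (t + h) + x (t - h) - (2 : ℝ) • x t‖ ≤ C * (h * √h)) :
    ContinuousOn (derivWithin x (Icc a b)) (Icc a b) ∧
      ∀ t ∈ Icc a b, HasDerivWithinAt x (derivWithin x (Icc a b) t) (Icc a b) t := by
  have key : ∀ t₀ ∈ Icc a b, ContinuousWithinAt (derivWithin x (Icc a b)) (Icc a b) t₀ ∧
      DifferentiableWithinAt ℝ x (Icc a b) t₀ := by
    intro t₀ ht₀
    obtain ⟨ε, hε, C, hC, hb⟩ := h t₀ ht₀
    set a' := max a (t₀ - ε)
    set b' := min b (t₀ + ε)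
    have hab' : a' < b' := by
      rcases ht₀.1.lt_or_eq with h1 | h1
      · exact (max_lt h1 (by linarith)).trans_le (le_min ht₀.2 (by linarith))
      · exact (max_le h1.le (by linarith)).trans_lt (lt_min (h1 ▸ hab) (by linarith))
    have hsub : Icc a' b' ⊆ Icc a b := Icc_subset_Icc (le_max_left _ _) (min_le_left _ _)
    obtain ⟨h1, h2⟩ := exists_hasDerivWithinAt_of_second_difference hab' (hx.mono hsub) hC
      fun t k hk h1 h2 => hb t k hk ((le_max_left _ _).trans h1) (h2.trans (min_le_left _ _))
        ((le_max_right _ _).trans h1) (h2.trans (min_le_right _ _))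
    have hnear : ∀ s ∈ Ioo (t₀ - ε) (t₀ + ε), s ∈ Icc a b → s ∈ Icc a' b' ∧
        Icc a' b' ∈ 𝓝[Icc a b] s := by
      intro s hs hs'
      refine ⟨⟨max_le hs'.1 hs.1.le, le_min hs'.2 hs.2.le⟩, ?_⟩
      filter_upwards [self_mem_nhdsWithin, mem_nhdsWithin_of_mem_nhds (Ioo_mem_nhds hs.1 hs.2)]
        with z hz hz'
      exact ⟨max_le hz.1 hz'.1.le, le_min hz.2 hz'.2.le⟩
    have hd : ∀ s ∈ Ioo (t₀ - ε) (t₀ + ε), s ∈ Icc a b →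
        HasDerivWithinAt x (derivWithin x (Icc a' b') s) (Icc a b) s := fun s hs hs' =>
      (h2 s (hnear s hs hs').1).mono_of_mem_nhdsWithin (hnear s hs hs').2
    have ht₀' : t₀ ∈ Ioo (t₀ - ε) (t₀ + ε) := ⟨by linarith, by linarith⟩
    refine ⟨?_, (hd t₀ ht₀' ht₀).differentiableWithinAt⟩
    refine ((h1 t₀ (hnear t₀ ht₀' ht₀).1).mono_of_mem_nhdsWithin
      (hnear t₀ ht₀' ht₀).2).congr_of_eventuallyEq ?_
      ((hd t₀ ht₀' ht₀).derivWithin (uniqueDiffOn_Icc hab _ ht₀))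
    filter_upwards [self_mem_nhdsWithin, mem_nhdsWithin_of_mem_nhds
      (Ioo_mem_nhds ht₀'.1 ht₀'.2)] with s hs hs'
    exact (hd s hs' hs).derivWithin (uniqueDiffOn_Icc hab _ hs)
  exact ⟨fun t ht => (key t ht).1, fun t ht => (key t ht).2.hasDerivWithinAt⟩

end SecondDifference
end

noncomputable section
open scoped Topology

/-! ### Regularity of minimizing curves -/

namespace WeightedMetric

open Filter MeasureTheory

variable {E : Type*} [NormedAddCommGroup E] [NormedSpace ℝ E] {U O : Set E}

/-- A function `δ` on a coordinate domain `U`, relatively open in the closed convex set `H`, that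
is related to the lengths of curves for the conformal metric `f² g` as the distance is: it is at
most the length of curves in `U`, and infinitesimally it agrees with the norm. -/
structure IsChartDist (G : WeightedMetric U O) (H : Set E) (δ : E → E → ℝ) : Prop where
  convex : Convex ℝ H
  isClosed : IsClosed H
  subset : U ⊆ H
  mem_nhdsWithin : ∀ y ∈ U, U ∈ 𝓝[H] y
  le_integral : ∀ {c c₁ : ℝ → E} {a b : ℝ}, a < b →
    (∀ t ∈ Icc a b, HasDerivWithinAt c (c₁ t) (Icc a b) t) → ContinuousOn c₁ (Icc a b) →
    (∀ t ∈ Icc a b, c t ∈ U) → δ (c a) (c b) ≤ ∫ t in a..b, √(G.energy (c t) (c₁ t))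
  local_lower : ∀ y₀ ∈ U, ∃ C > 0, ∃ ρ > 0, ∀ z₀ y z : E, ∀ r : ℝ, 0 < r →
    z₀ ∈ Metric.ball y₀ ρ ∩ U → y ∈ U → z ∈ U → ‖y - z₀‖ ≤ r → ‖z - z₀‖ ≤ r →
    (1 - C * r) * √(G.energy z₀ (z - y)) ≤ δ y z
  lipschitz : ∀ y₀ ∈ U, ∃ C > 0, ∀ᶠ ρ in 𝓝[>] (0 : ℝ), ∀ y ∈ Metric.closedBall y₀ ρ ∩ H,
    ∀ z ∈ Metric.closedBall y₀ ρ ∩ H, ∀ v, |G.energy y v - G.energy z v| ≤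
      C * ‖y - z‖ * ‖v‖ ^ 2

namespace IsChartDist

variable {G : WeightedMetric U O} {H : Set E} {δ : E → E → ℝ} (hδ : G.IsChartDist H δ)

include hδ

lemma eventually_closedBall_subset {y₀ : E} (hy₀ : y₀ ∈ U) :
    ∀ᶠ ρ in 𝓝[>] (0 : ℝ), Metric.closedBall y₀ ρ ∩ H ⊆ U := by
  obtain ⟨ρ, hρ, hsub⟩ := Metric.mem_nhdsWithin_iff.1 (hδ.mem_nhdsWithin y₀ hy₀)
  filter_upwards [Ioo_mem_nhdsGT hρ] with σ hσ
  exact (inter_subset_inter_left _ (Metric.closedBall_subset_ball hσ.2)).trans hsub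

/-- Near a point the distance is, up to a relative error that is linear in the size of the
neighbourhood, the norm of the metric frozen at that point. -/
lemma exists_local_estimate [ProperSpace E] {y₀ : E} (hy₀ : y₀ ∈ U) :
    ∃ C > 0, ∃ ρ > 0, ∃ m > 0, ∀ z₀ ∈ Metric.ball y₀ ρ ∩ U,
      (∀ v, m * ‖v‖ ≤ √(G.energy z₀ v)) ∧ ∀ y ∈ Metric.ball y₀ ρ ∩ U, ∀ z ∈ Metric.ball y₀ ρ ∩ U,
        ∀ r > 0, ‖y - z₀‖ ≤ r → ‖z - z₀‖ ≤ r →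
        (1 - C * r) * √(G.energy z₀ (z - y)) ≤ δ y z ∧
        δ y z ≤ (1 + C * r) * √(G.energy z₀ (z - y)) := by
  obtain ⟨C₁, hC₁, ρ₁, hρ₁, hlow⟩ := hδ.local_lower y₀ hy₀
  obtain ⟨C₂, hC₂, hlip⟩ := hδ.lipschitz y₀ hy₀
  obtain ⟨ρ, ⟨⟨hlip, hρU⟩, hρρ⟩, hρ⟩ := (((hlip.and (hδ.eventually_closedBall_subset hy₀)).and
    (Ioo_mem_nhdsGT hρ₁)).and self_mem_nhdsWithin).exists
  obtain ⟨m, hm, B, hB, hbd⟩ := G.exists_energy_bounds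
    ((isCompact_closedBall y₀ ρ).inter_right hδ.isClosed) hρU
  have hK : ∀ y ∈ Metric.ball y₀ ρ ∩ U, y ∈ Metric.closedBall y₀ ρ ∩ H := fun y hy =>
    ⟨Metric.ball_subset_closedBall hy.1, hδ.subset hy.2⟩
  refine ⟨max C₁ (C₂ / m ^ 2), lt_max_of_lt_left hC₁, ρ, hρ, m, hm, fun z₀ hz₀ =>
    ⟨fun v => ?_, fun y hy z hz r hr hyr hzr => ⟨?_, ?_⟩⟩⟩
  · apply Real.le_sqrt_of_sq_le
    rw [mul_pow]
    exact (hbd z₀ (hK z₀ hz₀) v).1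
  · refine le_trans ?_ (hlow z₀ y z r hr ⟨Metric.ball_subset_ball hρρ.2.le hz₀.1, hz₀.2⟩
      hy.2 hz.2 hyr hzr)
    have := mul_le_mul_of_nonneg_right (le_max_left C₁ (C₂ / m ^ 2)) hr.le
    gcongr
  · set c : ℝ → E := fun τ => y + τ • (z - y) with hc
    have hcK : ∀ τ ∈ Icc (0 : ℝ) 1, c τ ∈ Metric.closedBall y₀ ρ ∩ H ∧ ‖c τ - z₀‖ ≤ r := by
      intro τ hτ
      refine ⟨((convex_closedBall y₀ ρ).inter hδ.convex).add_smul_sub_mem (hK y hy)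
        (hK z hz) hτ, ?_⟩
      rw [← mem_closedBall_iff_norm]
      exact (convex_closedBall z₀ r).add_smul_sub_mem (mem_closedBall_iff_norm.2 hyr)
        (mem_closedBall_iff_norm.2 hzr) hτ
    have h1 := hδ.le_integral (c := c) (c₁ := fun _ => z - y) zero_lt_one
      (fun t _ => by
        have h := ((hasDerivAt_id t).smul_const (z - y)).const_add y
        rw [one_smul] at h
        exact h.hasDerivWithinAt) continuousOn_const (fun τ hτ => hρU (hcK τ hτ).1)
    have hsp : ∀ τ ∈ Icc (0 : ℝ) 1, √(G.energy (c τ) (z - y)) ≤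
        (1 + max C₁ (C₂ / m ^ 2) * r) * √(G.energy z₀ (z - y)) := by
      intro τ hτ
      have hb := hbd z₀ (hK z₀ hz₀) (z - y)
      have hl := (abs_le.1 (hlip _ (hcK τ hτ).1 z₀ (hK z₀ hz₀) (z - y))).2
      have hP : 0 ≤ G.energy z₀ (z - y) := le_trans (by positivity) hb.1
      have hq : 0 ≤ max C₁ (C₂ / m ^ 2) * r :=
        mul_nonneg (le_max_of_le_left hC₁.le) hr.le
      rw [Real.sqrt_le_left (by positivity), mul_pow, Real.sq_sqrt hP]
      have h3 : C₂ * ‖c τ - z₀‖ * ‖z - y‖ ^ 2 ≤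
          max C₁ (C₂ / m ^ 2) * r * G.energy z₀ (z - y) := by
        calc C₂ * ‖c τ - z₀‖ * ‖z - y‖ ^ 2 ≤ C₂ * r * ‖z - y‖ ^ 2 := by
              gcongr
              exact (hcK τ hτ).2
          _ = C₂ / m ^ 2 * r * (m ^ 2 * ‖z - y‖ ^ 2) := by field_simp
          _ ≤ _ := by
            gcongr
            · exact le_max_right _ _
            · exact hb.1
      nlinarith [mul_nonneg hq hP, mul_nonneg (mul_nonneg hq hq) hP]
    have hcont : ContinuousOn (fun τ => √(G.energy (c τ) (z - y))) (Icc 0 1) :=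
      RiemannCoord.continuousOn_sqrt_comp (Q := G.energy) G.continuousOn_energy
        (by fun_prop) continuousOn_const fun τ hτ => hρU (hcK τ hτ).1
    have h2 := intervalIntegral.integral_mono_on zero_le_one
      (hcont.intervalIntegrable_of_Icc zero_le_one)
        (continuous_const.intervalIntegrable (μ := volume) 0 1) hsp
    simp only [hc, zero_smul, add_zero, one_smul, add_sub_cancel] at h1
    refine h1.trans (h2.trans ?_)
    simp

omit hδ in
lemma _root_.WeightedMetric.energy_sub_add (z a b : E) : G.energy z (a - b) + G.energy z (a + b) =
    2 * G.energy z a + 2 * G.energy z b := by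
  simp only [energy, map_add, map_sub, add_apply, sub_apply]
  ring

section Isometric

variable [ProperSpace E] {x : ℝ → E} {a b : ℝ} (hx : ContinuousOn x (Icc a b))
  (hU : ∀ t ∈ Icc a b, x t ∈ U)
  (hiso : ∀ s ∈ Icc a b, ∀ t ∈ Icc a b, δ (x s) (x t) = |s - t|)

include hx hU hiso

/-- The estimates at a point of a curve on which `δ` is the distance of the parameters. -/
lemma exists_chord_estimate {t₀ : ℝ} (ht₀ : t₀ ∈ Icc a b) :
    ∃ ε > 0, ∃ C > 0, ∃ m > 0, ∀ t ∈ Icc a b, |t - t₀| ≤ ε →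
      (∀ v, m * ‖v‖ ≤ √(G.energy (x t) v)) ∧
      ∀ p ∈ Icc a b, ∀ q ∈ Icc a b, |p - t₀| ≤ ε → |q - t₀| ≤ ε →
        ∀ r > 0, |p - t| ≤ r → |q - t| ≤ r →
          (1 - C * r) * √(G.energy (x t) (x q - x p)) ≤ |p - q| ∧
          |p - q| ≤ (1 + C * r) * √(G.energy (x t) (x q - x p)) := by
  obtain ⟨C, hC, ρ, hρ, m, hm, hest⟩ := hδ.exists_local_estimate (hU t₀ ht₀)
  -- In a ball of this radius the relative error of the estimates is at most `1 / 2`.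
  set σ := min ρ (1 / (4 * C))
  have hσ0 : 0 < σ := by positivity
  obtain ⟨ε, hε, hball⟩ := Metric.continuousWithinAt_iff.1 (hx t₀ ht₀) σ hσ0
  have hmem : ∀ t ∈ Icc a b, |t - t₀| ≤ ε / 2 → x t ∈ Metric.ball (x t₀) σ := fun t ht h =>
    hball ht (by rw [Real.dist_eq]; linarith)
  have hmem' : ∀ t ∈ Icc a b, |t - t₀| ≤ ε / 2 → x t ∈ Metric.ball (x t₀) ρ ∩ U := fun t ht h =>
    ⟨Metric.ball_subset_ball (min_le_left _ _) (hmem t ht h), hU t ht⟩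
  have hLip : ∀ p ∈ Icc a b, ∀ t ∈ Icc a b, |p - t₀| ≤ ε / 2 → |t - t₀| ≤ ε / 2 →
      ‖x p - x t‖ ≤ 2 / m * |p - t| := by
    intro p hp t ht hpε htε
    rcases eq_or_ne (x p) (x t) with h | h
    · rw [h, sub_self, norm_zero]; positivity
    have hr : 0 < ‖x p - x t‖ := norm_pos_iff.2 (sub_ne_zero.2 h)
    have h1 := ((hest (x t) (hmem' t ht htε)).2 (x t) (hmem' t ht htε) (x p) (hmem' p hp hpε)
      ‖x p - x t‖ hr (by simp) le_rfl).1
    have h2 := (hest (x t) (hmem' t ht htε)).1 (x p - x t)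
    rw [hiso t ht p hp, abs_sub_comm] at h1
    have h3 : C * ‖x p - x t‖ ≤ 1 / 2 := by
      have d1 := Metric.mem_ball.1 (hmem p hp hpε)
      have d2 := Metric.mem_ball.1 (hmem t ht htε)
      have d3 : ‖x p - x t‖ ≤ 2 * (1 / (4 * C)) := by
        rw [← dist_eq_norm]
        have := dist_triangle_right (x p) (x t) (x t₀)
        have := min_le_right ρ (1 / (4 * C))
        linarith
      calc C * ‖x p - x t‖ ≤ C * (2 * (1 / (4 * C))) := by gcongr
        _ = 1 / 2 := by field_simp; norm_num
    rw [div_mul_eq_mul_div, le_div_iff₀ hm]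
    nlinarith [Real.sqrt_nonneg (G.energy (x t) (x p - x t))]
  have hm' : 0 < 2 / m := by positivity
  refine ⟨ε / 2, by positivity, C * (2 / m), by positivity, m, hm, fun t ht htε =>
    ⟨(hest _ (hmem' t ht htε)).1, fun p hp q hq hpε hqε r hr hpr hqr => ?_⟩⟩
  have h1 := (hest (x t) (hmem' t ht htε)).2 (x p) (hmem' p hp hpε) (x q) (hmem' q hq hqε)
    (2 / m * r) (by positivity) ((hLip p hp t ht hpε htε).trans (by gcongr))
    ((hLip q hq t ht hqε htε).trans (by gcongr))
  rw [hiso p hp q hq, ← mul_assoc] at h1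
  exact h1

/-- The parallelogram law turns the estimates for the three chords between `x (t - h)`, `x t` and
`x (t + h)` into a bound for the second difference. -/
lemma second_difference_le {t₀ : ℝ} (ht₀ : t₀ ∈ Icc a b) :
    ∃ ε > 0, ∃ C ≥ 0, ∀ t h, 0 < h → a ≤ t - h → t + h ≤ b → t₀ - ε ≤ t - h → t + h ≤ t₀ + ε →
      ‖x (t + h) + x (t - h) - (2 : ℝ) • x t‖ ≤ C * (h * √h) := by
  obtain ⟨ε, hε, C, hC, m, hm, hest⟩ := hδ.exists_chord_estimate hx hU hiso ht₀
  refine ⟨min ε (1 / (2 * C)), by positivity, √(32 * C) / m, by positivity,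
    fun t h hh h1 h2 h3 h4 => ?_⟩
  have e1 := min_le_left ε (1 / (2 * C))
  have e2 := min_le_right ε (1 / (2 * C))
  have hu : C * h ≤ 1 / 2 := by
    have : h ≤ 1 / (2 * C) := by linarith
    calc C * h ≤ C * (1 / (2 * C)) := by gcongr
      _ = 1 / 2 := by field_simp
  have ht : t ∈ Icc a b := ⟨by linarith, by linarith⟩
  have hp : t - h ∈ Icc a b := ⟨by linarith, by linarith⟩
  have hq : t + h ∈ Icc a b := ⟨by linarith, by linarith⟩
  have htε : |t - t₀| ≤ ε := abs_le.2 ⟨by linarith, by linarith⟩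
  have hpε : |t - h - t₀| ≤ ε := abs_le.2 ⟨by linarith, by linarith⟩
  have hqε : |t + h - t₀| ≤ ε := abs_le.2 ⟨by linarith, by linarith⟩
  obtain ⟨hmb, hch⟩ := hest t ht htε
  have hab1 : |t - h - t| ≤ h := by rw [abs_le]; constructor <;> linarith
  have hab2 : |t + h - t| ≤ h := by rw [abs_le]; constructor <;> linarith
  have k1 := (hch t ht (t + h) hq htε hqε h hh (by simpa using hh.le) hab2).1
  have k2 := (hch (t - h) hp t ht hpε htε h hh hab1 (by simpa using hh.le)).1
  have k3 := (hch (t - h) hp (t + h) hq hpε hqε h hh hab1 hab2).2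
  rw [show t - (t + h) = -h by ring, abs_neg, abs_of_pos hh] at k1
  rw [show t - h - t = -h by ring, abs_neg, abs_of_pos hh] at k2
  rw [show t - h - (t + h) = -(2 * h) by ring, abs_neg, abs_of_pos (by linarith)] at k3
  have hpar := G.energy_sub_add (x t) (x (t + h) - x t) (x t - x (t - h))
  rw [show x (t + h) - x t + (x t - x (t - h)) = x (t + h) - x (t - h) by abel,
    show x (t + h) - x t - (x t - x (t - h)) = x (t + h) + x (t - h) - (2 : ℝ) • x t by
      rw [two_smul]; abel] at hpar
  have hsq : ∀ v, √(G.energy (x t) v) ^ 2 = G.energy (x t) v := fun v =>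
    Real.sq_sqrt (G.energy_nonneg (hU t ht) v)
  rw [← hsq, ← hsq (x (t + h) - x (t - h)), ← hsq (x (t + h) - x t),
    ← hsq (x t - x (t - h))] at hpar
  set p := √(G.energy (x t) (x (t + h) - x t))
  set q := √(G.energy (x t) (x t - x (t - h)))
  set s := √(G.energy (x t) (x (t + h) - x (t - h)))
  set w := √(G.energy (x t) (x (t + h) + x (t - h) - (2 : ℝ) • x t))
  have hp0 : 0 ≤ p := Real.sqrt_nonneg _
  have hq0 : 0 ≤ q := Real.sqrt_nonneg _
  have hs0 : 0 ≤ s := Real.sqrt_nonneg _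
  set u := C * h with hudef
  have hu0 : 0 < u := by positivity
  -- With relative error `u = C h`, the half chords have squares at most `h² (1 + 6 u)`, the full
  -- chord has square at least `4 h² (1 - 2 u)`, and the parallelogram law leaves `O(u h²)`.
  have up : ∀ p : ℝ, 0 ≤ p → (1 - u) * p ≤ h → p ^ 2 ≤ h ^ 2 * (1 + 6 * u) := by
    intro p hp0 hk
    have a1 : ((1 - u) * p) ^ 2 ≤ h ^ 2 := by
      apply pow_le_pow_left₀ _ hk
      exact mul_nonneg (by linarith) hp0
    have a2 : 1 ≤ (1 - u) ^ 2 * (1 + 6 * u) := by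
      have : 0 ≤ u * (1 - 2 * u) * (4 - 3 * u) :=
        mul_nonneg (mul_nonneg hu0.le (by linarith)) (by linarith)
      linarith
    calc p ^ 2 ≤ p ^ 2 * ((1 - u) ^ 2 * (1 + 6 * u)) := le_mul_of_one_le_right (sq_nonneg _) a2
      _ = ((1 - u) * p) ^ 2 * (1 + 6 * u) := by ring
      _ ≤ _ := by gcongr
  have a3 : 4 * h ^ 2 * (1 - 2 * u) ≤ s ^ 2 := by
    have b1 : (2 * h) ^ 2 ≤ ((1 + u) * s) ^ 2 := by gcongr
    have b2 : (1 + u) ^ 2 * (1 - 2 * u) ≤ 1 := by nlinarith [sq_nonneg u]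
    calc 4 * h ^ 2 * (1 - 2 * u) = (2 * h) ^ 2 * (1 - 2 * u) := by ring
      _ ≤ ((1 + u) * s) ^ 2 * (1 - 2 * u) := by gcongr; linarith
      _ = s ^ 2 * ((1 + u) ^ 2 * (1 - 2 * u)) := by ring
      _ ≤ s ^ 2 * 1 := by gcongr
      _ = _ := mul_one _
  have hw : w ^ 2 ≤ 32 * C * (h ^ 2 * h) := by
    have c1 := up p hp0 k1
    have c2 := up q hq0 k2
    have : 32 * C * (h ^ 2 * h) = 32 * u * h ^ 2 := by rw [hudef]; ring
    rw [this]
    linarith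
  have hw2 : w ≤ √(32 * C) * (h * √h) := by
    refine (pow_le_pow_iff_left₀ (Real.sqrt_nonneg _) (by positivity) two_ne_zero).1 ?_
    rw [mul_pow, mul_pow, Real.sq_sqrt (show 0 ≤ 32 * C by positivity),
     Real.sq_sqrt hh.le]
    exact hw
  have := hmb (x (t + h) + x (t - h) - (2 : ℝ) • x t)
  rw [div_mul_eq_mul_div, le_div_iff₀ hm]
  linarith

/-- A curve on which `δ` is the distance of the parameters is `C¹` and has unit speed. -/
lemma hasDerivWithinAt_of_isometric (hab : a < b) :
    ContinuousOn (derivWithin x (Icc a b)) (Icc a b) ∧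
      (∀ t ∈ Icc a b, HasDerivWithinAt x (derivWithin x (Icc a b) t) (Icc a b) t) ∧
      ∀ t ∈ Icc a b, G.energy (x t) (derivWithin x (Icc a b) t) = 1 := by
  obtain ⟨h1, h2⟩ := exists_hasDerivWithinAt_of_local_second_difference hab hx
    fun t₀ ht₀ => hδ.second_difference_le hx hU hiso ht₀
  refine ⟨h1, h2, fun t ht => ?_⟩
  obtain ⟨ε, hε, C, hC, m, hm, hest⟩ := hδ.exists_chord_estimate hx hU hiso ht
  obtain ⟨-, hch⟩ := hest t ht (by simpa using hε.le)
  have hsl : Tendsto (slope x t) (𝓝[Icc a b \ {t}] t) (𝓝 (derivWithin x (Icc a b) t)) :=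
    hasDerivWithinAt_iff_tendsto_slope.1 (h2 t ht)
  have hne : (𝓝[Icc a b \ {t}] t).NeBot :=
     accPt_principal_iff_nhdsWithin.1
      (uniqueDiffWithinAt_iff_accPt.1 (uniqueDiffOn_Icc hab t ht))
  have hr : Tendsto (fun s => |s - t|) (𝓝[Icc a b \ {t}] t) (𝓝 0) := by
    have : Tendsto (fun s => |s - t|) (𝓝 t) (𝓝 |t - t|) :=
      (continuous_abs.comp (continuous_id.sub continuous_const)).tendsto t
    rw [sub_self, abs_zero] at this
    exact this.mono_left nhdsWithin_le_nhds
  have hE : Tendsto (fun s => √(G.energy (x t) (slope x t s))) (𝓝[Icc a b \ {t}] t)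
      (𝓝 √(G.energy (x t) (derivWithin x (Icc a b) t))) := by
    have hc : Continuous fun v => G.energy (x t) v := by
      unfold energy; fun_prop
    exact ((Real.continuous_sqrt.comp hc).tendsto _).comp hsl
  have hev : ∀ᶠ s in 𝓝[Icc a b \ {t}] t,
      (1 - C * |s - t|) * √(G.energy (x t) (slope x t s)) ≤ 1 ∧
      1 ≤ (1 + C * |s - t|) * √(G.energy (x t) (slope x t s)) := by
    filter_upwards [self_mem_nhdsWithin,
      mem_nhdsWithin_of_mem_nhds (Metric.closedBall_mem_nhds t hε)] with s hs hsε
    have hst : s - t ≠ 0 := sub_ne_zero.2 hs.2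
    have hpos : 0 < |s - t| := abs_pos.2 hst
    rw [Metric.mem_closedBall, Real.dist_eq] at hsε
    have h3 := hch t ht s hs.1 (by simpa using hε.le) hsε |s - t| hpos (by simp) le_rfl
    have e : √(G.energy (x t) (x s - x t)) = |s - t| * √(G.energy (x t) (slope x t s)) := by
      rw [show x s - x t = (s - t) • slope x t s from (sub_smul_slope x t s).symm,
        energy_smul, Real.sqrt_mul (sq_nonneg _), Real.sqrt_sq_eq_abs]
    rw [e, abs_sub_comm t s] at h3
    constructor
    · refine le_of_mul_le_mul_left ?_ hpos
      linarith [h3.1]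
    · refine le_of_mul_le_mul_left ?_ hpos
      linarith [h3.2]
  have l1 : Tendsto (fun s => (1 - C * |s - t|) * √(G.energy (x t) (slope x t s)))
      (𝓝[Icc a b \ {t}] t) (𝓝 √(G.energy (x t) (derivWithin x (Icc a b) t))) := by
    simpa using ((hr.const_mul C).const_sub 1).mul hE
  have l2 : Tendsto (fun s => (1 + C * |s - t|) * √(G.energy (x t) (slope x t s)))
      (𝓝[Icc a b \ {t}] t) (𝓝 √(G.energy (x t) (derivWithin x (Icc a b) t))) := by
    simpa using ((hr.const_mul C).const_add 1).mul hE
  have h5 := le_antisymm (le_of_tendsto l1 (hev.mono fun s hs => hs.1))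
    (ge_of_tendsto l2 (hev.mono fun s hs => hs.2))
  rwa [Real.sqrt_eq_one] at h5

end Isometric

end IsChartDist

end WeightedMetric
end

noncomputable section
open scoped Topology

/-! ### Uniform Taylor expansions -/

section Taylor

open Filter

lemma eventually_abs_sub_le {e₁ : ℝ → ℝ → ℝ} {s₀ a b : ℝ} (hs₀ : 0 < s₀)
    (hc : ContinuousOn (fun p : ℝ × ℝ => e₁ p.1 p.2) (Icc (-s₀) s₀ ×ˢ Icc a b)) {ε : ℝ}
    (hε : 0 < ε) : ∀ᶠ s in 𝓝 0, ∀ t ∈ Icc a b, |e₁ s t - e₁ 0 t| ≤ ε := by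
  have hK : IsCompact (Icc (-s₀) s₀ ×ˢ Icc a b) := isCompact_Icc.prod isCompact_Icc
  obtain ⟨η, hη, h⟩ := Metric.uniformContinuousOn_iff.1
    (hK.uniformContinuousOn_of_continuous hc) ε hε
  filter_upwards [Metric.ball_mem_nhds 0 hη, Icc_mem_nhds (neg_neg_of_pos hs₀) hs₀]
    with s hs hs' t ht
  rw [← Real.dist_eq]
  refine (h (s, t) ⟨hs', ht⟩ (0, t) ⟨⟨by linarith, hs₀.le⟩, ht⟩ ?_).le
  rw [Prod.dist_eq, dist_self]
  exact max_lt hs hη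

/-- First order Taylor expansion, uniform in the parameter `t`. -/
lemma eventually_abs_taylor_one_le {e e₁ : ℝ → ℝ → ℝ} {s₀ a b : ℝ} (hs₀ : 0 < s₀)
    (he : ∀ s ∈ Icc (-s₀) s₀, ∀ t ∈ Ioo a b, HasDerivAt (fun s => e s t) (e₁ s t) s)
    (hc : ContinuousOn (fun p : ℝ × ℝ => e₁ p.1 p.2) (Icc (-s₀) s₀ ×ˢ Icc a b)) {ε : ℝ}
    (hε : 0 < ε) : ∀ᶠ s in 𝓝 0, ∀ t ∈ Ioo a b, |e s t - e 0 t - s * e₁ 0 t| ≤ ε * |s| := by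
  obtain ⟨η, hη, h⟩ := Metric.eventually_nhds_iff_ball.1
    ((eventually_abs_sub_le hs₀ hc hε).and (Icc_mem_nhds (neg_neg_of_pos hs₀) hs₀))
  filter_upwards [Metric.ball_mem_nhds 0 hη] with s hs t ht
  have hd : ∀ z ∈ Metric.ball (0 : ℝ) η, HasDerivWithinAt (fun z => e z t - z * e₁ 0 t)
      (e₁ z t - e₁ 0 t) (Metric.ball (0 : ℝ) η) z := fun z hz => by
    have h1 := (he z (h z hz).2 t ht).fun_sub ((hasDerivAt_id' z).mul_const (e₁ 0 t))
    exact (h1.congr_deriv (by ring)).hasDerivWithinAt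
  have := (convex_ball (0 : ℝ) η).norm_image_sub_le_of_norm_hasDerivWithin_le hd
    (fun z hz => (h z hz).1 t (Ioo_subset_Icc_self ht)) (Metric.mem_ball_self hη) hs
  simp only [zero_mul, sub_zero, Real.norm_eq_abs] at this
  convert this using 2
  ring

/-- Second order Taylor expansion of the second difference, uniform in the parameter `t`. -/
lemma eventually_abs_taylor_two_le {e e₁ e₂ : ℝ → ℝ → ℝ} {s₀ a b : ℝ} (hs₀ : 0 < s₀)
    (he : ∀ s ∈ Icc (-s₀) s₀, ∀ t ∈ Ioo a b, HasDerivAt (fun s => e s t) (e₁ s t) s)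
    (he₁ : ∀ s ∈ Icc (-s₀) s₀, ∀ t ∈ Ioo a b, HasDerivAt (fun s => e₁ s t) (e₂ s t) s)
    (hc : ContinuousOn (fun p : ℝ × ℝ => e₂ p.1 p.2) (Icc (-s₀) s₀ ×ˢ Icc a b)) {ε : ℝ}
    (hε : 0 < ε) : ∀ᶠ s in 𝓝 0, ∀ t ∈ Ioo a b,
      |e s t + e (-s) t - 2 * e 0 t - s ^ 2 * e₂ 0 t| ≤ ε * s ^ 2 := by
  obtain ⟨η, hη, h⟩ := Metric.eventually_nhds_iff_ball.1
    ((eventually_abs_taylor_one_le hs₀ he₁ hc (half_pos hε)).and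
      (Icc_mem_nhds (neg_neg_of_pos hs₀) hs₀))
  filter_upwards [Metric.ball_mem_nhds 0 hη] with s hs t ht
  have hsub : uIcc 0 s ⊆ Metric.ball (0 : ℝ) η := by
    rw [← segment_eq_uIcc]
    exact (convex_ball (0 : ℝ) η).segment_subset (Metric.mem_ball_self hη) hs
  have hneg : ∀ z ∈ Metric.ball (0 : ℝ) η, -z ∈ Metric.ball (0 : ℝ) η := fun z hz => by
    simpa using hz
  have hd : ∀ z ∈ uIcc 0 s, HasDerivWithinAt (fun z => e z t + e (-z) t - z ^ 2 * e₂ 0 t)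
      (e₁ z t - e₁ (-z) t - 2 * z * e₂ 0 t) (uIcc 0 s) z := fun z hz => by
    have hz' := hsub hz
    have h1 := he z (h z hz').2 t ht
    have h2 := (he (-z) (h _ (hneg z hz')).2 t ht).scomp z (hasDerivAt_neg z)
    have h3 := ((h1.add h2).sub (((hasDerivAt_id z).pow 2).mul_const (e₂ 0 t))).hasDerivWithinAt
      (s := uIcc 0 s)
    refine (h3.congr_deriv ?_).congr (fun w _ => rfl) rfl
    simp
    ring
  have hb : ∀ z ∈ uIcc 0 s, ‖e₁ z t - e₁ (-z) t - 2 * z * e₂ 0 t‖ ≤ ε * |s| := fun z hz => by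
    have hz' := hsub hz
    have h1 := (h z hz').1 t ht
    have h2 := (h _ (hneg z hz')).1 t ht
    rw [abs_neg] at h2
    have h3 : |z| ≤ |s| := by
      have := abs_sub_left_of_mem_uIcc hz
      simpa using this
    rw [Real.norm_eq_abs]
    calc |e₁ z t - e₁ (-z) t - 2 * z * e₂ 0 t|
        = |(e₁ z t - e₁ 0 t - z * e₂ 0 t) - (e₁ (-z) t - e₁ 0 t - -z * e₂ 0 t)| := by
          congr 1; ring
      _ ≤ ε / 2 * |z| + ε / 2 * |z| := (abs_sub _ _).trans (add_le_add h1 h2)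
      _ = ε * |z| := by ring
      _ ≤ _ := by gcongr
  have := (convex_uIcc 0 s).norm_image_sub_le_of_norm_hasDerivWithin_le hd hb left_mem_uIcc
    right_mem_uIcc
  simp only [neg_zero, sub_zero, Real.norm_eq_abs] at this
  calc _ = |e s t + e (-s) t - s ^ 2 * e₂ 0 t - (e 0 t + e 0 t - 0 ^ 2 * e₂ 0 t)| := by
        congr 1; ring
    _ ≤ _ := this
    _ = ε * (|s| * |s|) := by ring
    _ = ε * s ^ 2 := by rw [← sq, sq_abs]

end Taylor

/-! ### Variations of a curve -/

namespace WeightedMetric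

open Filter MeasureTheory

variable {E : Type*} [NormedAddCommGroup E] [NormedSpace ℝ E] {U O : Set E}

/-- The variation `x + s V + ½ s² W` of a curve `x`, within the coordinate domain; `u`, `V₁` and
`W₁` are the derivatives of `x`, `V` and `W`. -/
structure Variation (U O : Set E) (a b : ℝ) where
  /-- the curve -/
  x : ℝ → E
  /-- the velocity of the curve -/
  u : ℝ → E
  /-- the variation field -/
  V : ℝ → E
  /-- the derivative of the variation field -/
  V₁ : ℝ → E
  /-- the acceleration of the variation -/
  W : ℝ → E
  /-- the derivative of the acceleration -/
  W₁ : ℝ → E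
  lt : a < b
  hasDeriv_x : ∀ t ∈ Icc a b, HasDerivWithinAt x (u t) (Icc a b) t
  hasDeriv_V : ∀ t ∈ Icc a b, HasDerivWithinAt V (V₁ t) (Icc a b) t
  hasDeriv_W : ∀ t ∈ Icc a b, HasDerivWithinAt W (W₁ t) (Icc a b) t
  continuousOn_u : ContinuousOn u (Icc a b)
  continuousOn_V₁ : ContinuousOn V₁ (Icc a b)
  continuousOn_W₁ : ContinuousOn W₁ (Icc a b)
  /-- the range of the variation parameter -/
  s₀ : ℝ
  s₀_pos : 0 < s₀
  mem_U : ∀ s ∈ Icc (-s₀) s₀, ∀ t ∈ Icc a b, x t + s • V t + (s ^ 2 / 2) • W t ∈ U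
  mem_O : ∀ s ∈ Icc (-s₀) s₀, ∀ t ∈ Ioo a b, x t + s • V t + (s ^ 2 / 2) • W t ∈ O

namespace Variation

variable {a b : ℝ} (γ : Variation U O a b)

/-- The varied curve. -/
def c (s t : ℝ) : E := γ.x t + s • γ.V t + (s ^ 2 / 2) • γ.W t

/-- The derivative of the varied curve in the direction of the parameter. -/
def cs (s t : ℝ) : E := γ.V t + s • γ.W t

/-- The velocity of the varied curve. -/
def p (s t : ℝ) : E := γ.u t + s • γ.V₁ t + (s ^ 2 / 2) • γ.W₁ t

/-- The derivative of the velocity in the direction of the parameter. -/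
def ps (s t : ℝ) : E := γ.V₁ t + s • γ.W₁ t

lemma hasDerivWithinAt_c (s : ℝ) {t : ℝ} (ht : t ∈ Icc a b) :
    HasDerivWithinAt (γ.c s) (γ.p s t) (Icc a b) t :=
  ((γ.hasDeriv_x t ht).add ((γ.hasDeriv_V t ht).const_smul s)).add
    ((γ.hasDeriv_W t ht).const_smul (s ^ 2 / 2))

lemma hasDerivAt_quadratic (A B C : E) (s : ℝ) :
    HasDerivAt (fun s : ℝ => A + s • B + (s ^ 2 / 2) • C) (B + s • C) s := by
  have h1 := (hasDerivAt_id s).smul_const B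
  have h2 := (((hasDerivAt_id s).pow 2).div_const 2).smul_const C
  have h3 := (h1.const_add A).add h2
  refine (h3.congr_deriv ?_)
  simp

lemma hasDerivAt_c (s t : ℝ) : HasDerivAt (fun s => γ.c s t) (γ.cs s t) s :=
  hasDerivAt_quadratic _ _ _ _

lemma hasDerivAt_p (s t : ℝ) : HasDerivAt (fun s => γ.p s t) (γ.ps s t) s :=
  hasDerivAt_quadratic _ _ _ _

lemma hasDerivAt_cs (s t : ℝ) : HasDerivAt (fun s => γ.cs s t) (γ.W t) s := by
  have := ((hasDerivAt_id s).smul_const (γ.W t)).const_add (γ.V t)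
  rwa [one_smul] at this

lemma hasDerivAt_ps (s t : ℝ) : HasDerivAt (fun s => γ.ps s t) (γ.W₁ t) s := by
  have := ((hasDerivAt_id s).smul_const (γ.W₁ t)).const_add (γ.V₁ t)
  rwa [one_smul] at this

variable (G : WeightedMetric U O)

/-- The covariant derivative of the velocity in the direction of the parameter. -/
def P₁ (s t : ℝ) : E := γ.ps s t + G.Γ (γ.c s t) (γ.cs s t) (γ.p s t)

/-- The second covariant derivative of the velocity in the direction of the parameter. -/
def P₂ (s t : ℝ) : E :=
  γ.W₁ t + (G.dΓ (γ.c s t) (γ.cs s t) (γ.cs s t) (γ.p s t) + G.Γ (γ.c s t) (γ.W t) (γ.p s t) +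
    G.Γ (γ.c s t) (γ.cs s t) (γ.ps s t)) + G.Γ (γ.c s t) (γ.cs s t) (γ.P₁ G s t)

/-- Half of the energy density. -/
def e (s t : ℝ) : ℝ := 1 / 2 * G.energy (γ.c s t) (γ.p s t)

/-- The derivative of half the energy density in the direction of the parameter. -/
def e₁ (s t : ℝ) : ℝ :=
  G.f (γ.c s t) * G.df (γ.c s t) (γ.cs s t) * G.g (γ.c s t) (γ.p s t) (γ.p s t) +
    G.f (γ.c s t) ^ 2 * G.g (γ.c s t) (γ.P₁ G s t) (γ.p s t)

/-- The second derivative of half the energy density in the direction of the parameter. -/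
def e₂ (s t : ℝ) : ℝ :=
  (G.df (γ.c s t) (γ.cs s t) ^ 2 + G.f (γ.c s t) *
      (G.ddf (γ.c s t) (γ.cs s t) (γ.cs s t) + G.df (γ.c s t) (γ.W t))) *
      G.g (γ.c s t) (γ.p s t) (γ.p s t) +
    4 * (G.f (γ.c s t) * G.df (γ.c s t) (γ.cs s t)) * G.g (γ.c s t) (γ.P₁ G s t) (γ.p s t) +
    G.f (γ.c s t) ^ 2 * (G.g (γ.c s t) (γ.P₂ G s t) (γ.p s t) +
      G.g (γ.c s t) (γ.P₁ G s t) (γ.P₁ G s t))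

lemma hasDerivAt_e {s t : ℝ} (h : γ.c s t ∈ O) :
    HasDerivAt (fun s => γ.e G s t) (γ.e₁ G s t) s := by
  have hf := G.hasDerivAt_f (c := fun s => γ.c s t) h (γ.hasDerivAt_c s t)
  have hg := G.hasDerivAt_g (c := fun s => γ.c s t) (a := fun s => γ.p s t)
    (b := fun s => γ.p s t) h (γ.hasDerivAt_c s t) (γ.hasDerivAt_p s t) (γ.hasDerivAt_p s t)
  refine (((hf.fun_pow 2).fun_mul hg).const_mul (1 / 2)).congr_deriv ?_
  rw [G.g_symm _ (γ.p s t) (_ + _)]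
  simp only [e₁, P₁]
  push_cast
  ring

lemma hasDerivAt_e₁ {s t : ℝ} (h : γ.c s t ∈ O) :
    HasDerivAt (fun s => γ.e₁ G s t) (γ.e₂ G s t) s := by
  have hc := γ.hasDerivAt_c s t
  have hp := γ.hasDerivAt_p s t
  have hf := G.hasDerivAt_f (c := fun s => γ.c s t) h hc
  have hdf := G.hasDerivAt_df (c := fun s => γ.c s t) (a := fun s => γ.cs s t) h hc
    (γ.hasDerivAt_cs s t)
  have hΓ := G.hasDerivAt_Γ (c := fun s => γ.c s t) (a := fun s => γ.cs s t)
    (b := fun s => γ.p s t) h hc (γ.hasDerivAt_cs s t) hp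
  have hP₁ : HasDerivAt (fun s => γ.P₁ G s t) _ s := (γ.hasDerivAt_ps s t).fun_add hΓ
  have hg := G.hasDerivAt_g (c := fun s => γ.c s t) (a := fun s => γ.p s t)
    (b := fun s => γ.p s t) h hc hp hp
  have hg₁ := G.hasDerivAt_g (c := fun s => γ.c s t) (a := fun s => γ.P₁ G s t)
    (b := fun s => γ.p s t) h hc hP₁ hp
  refine (((hf.fun_mul hdf).fun_mul hg).fun_add ((hf.fun_pow 2).fun_mul hg₁)).congr_deriv ?_
  rw [G.g_symm _ (γ.p s t) (_ + _)]
  simp only [e₂, P₂, P₁]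
  push_cast
  ring

section Continuity

/-- The parameter domain of the variation. -/
abbrev dom : Set (ℝ × ℝ) := Icc (-γ.s₀) γ.s₀ ×ˢ Icc a b

lemma continuousOn_comp_snd {A : ℝ → E} (hA : ContinuousOn A (Icc a b)) :
    ContinuousOn (fun q : ℝ × ℝ => A q.2) γ.dom :=
  hA.comp continuousOn_snd fun _ hq => hq.2

lemma continuousOn_quadratic {A B C : ℝ → E} (hA : ContinuousOn A (Icc a b))
    (hB : ContinuousOn B (Icc a b)) (hC : ContinuousOn C (Icc a b)) :
    ContinuousOn (fun q : ℝ × ℝ => A q.2 + q.1 • B q.2 + (q.1 ^ 2 / 2) • C q.2) γ.dom :=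
  ((γ.continuousOn_comp_snd hA).add (continuousOn_fst.smul (γ.continuousOn_comp_snd hB))).add
    (((continuousOn_fst.pow 2).div_const 2).smul (γ.continuousOn_comp_snd hC))

lemma continuousOn_linear {A B : ℝ → E} (hA : ContinuousOn A (Icc a b))
    (hB : ContinuousOn B (Icc a b)) :
    ContinuousOn (fun q : ℝ × ℝ => A q.2 + q.1 • B q.2) γ.dom :=
  (γ.continuousOn_comp_snd hA).add (continuousOn_fst.smul (γ.continuousOn_comp_snd hB))

lemma continuousOn_x : ContinuousOn γ.x (Icc a b) := fun t ht =>
  (γ.hasDeriv_x t ht).continuousWithinAt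

lemma continuousOn_V : ContinuousOn γ.V (Icc a b) := fun t ht =>
  (γ.hasDeriv_V t ht).continuousWithinAt

lemma continuousOn_W : ContinuousOn γ.W (Icc a b) := fun t ht =>
  (γ.hasDeriv_W t ht).continuousWithinAt

lemma continuousOn_c : ContinuousOn (fun q : ℝ × ℝ => γ.c q.1 q.2) γ.dom :=
  γ.continuousOn_quadratic γ.continuousOn_x γ.continuousOn_V γ.continuousOn_W

lemma continuousOn_p : ContinuousOn (fun q : ℝ × ℝ => γ.p q.1 q.2) γ.dom :=
  γ.continuousOn_quadratic γ.continuousOn_u γ.continuousOn_V₁ γ.continuousOn_W₁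

lemma continuousOn_cs : ContinuousOn (fun q : ℝ × ℝ => γ.cs q.1 q.2) γ.dom :=
  γ.continuousOn_linear γ.continuousOn_V γ.continuousOn_W

lemma continuousOn_ps : ContinuousOn (fun q : ℝ × ℝ => γ.ps q.1 q.2) γ.dom :=
  γ.continuousOn_linear γ.continuousOn_V₁ γ.continuousOn_W₁

end Continuity

end Variation

section Comp

variable (G : WeightedMetric U O) {X : Type*} [TopologicalSpace X] {s : Set X} {y α β w : X → E}

lemma continuousOn_g_comp (hy : ContinuousOn y s) (hα : ContinuousOn α s) (hβ : ContinuousOn β s)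
    (hU : ∀ q ∈ s, y q ∈ U) : ContinuousOn (fun q => G.g (y q) (α q) (β q)) s :=
  G.continuousOn_g.comp (f := fun q => (y q, α q, β q)) (hy.prodMk (hα.prodMk hβ))
    fun q hq => ⟨hU q hq, mem_univ _⟩

lemma continuousOn_Γ_comp (hy : ContinuousOn y s) (hα : ContinuousOn α s) (hβ : ContinuousOn β s)
    (hU : ∀ q ∈ s, y q ∈ U) : ContinuousOn (fun q => G.Γ (y q) (α q) (β q)) s :=
  G.continuousOn_Γ.comp (f := fun q => (y q, α q, β q)) (hy.prodMk (hα.prodMk hβ))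
    fun q hq => ⟨hU q hq, mem_univ _⟩

lemma continuousOn_ddf_comp (hy : ContinuousOn y s) (hα : ContinuousOn α s)
    (hβ : ContinuousOn β s) (hU : ∀ q ∈ s, y q ∈ U) :
    ContinuousOn (fun q => G.ddf (y q) (α q) (β q)) s :=
  G.continuousOn_ddf.comp (f := fun q => (y q, α q, β q)) (hy.prodMk (hα.prodMk hβ))
    fun q hq => ⟨hU q hq, mem_univ _⟩

lemma continuousOn_dΓ_comp (hy : ContinuousOn y s) (hα : ContinuousOn α s)
    (hβ : ContinuousOn β s) (hw : ContinuousOn w s) (hU : ∀ q ∈ s, y q ∈ U) :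
    ContinuousOn (fun q => G.dΓ (y q) (α q) (β q) (w q)) s :=
  G.continuousOn_dΓ.comp (f := fun q => (y q, α q, β q, w q))
    (hy.prodMk (hα.prodMk (hβ.prodMk hw))) fun q hq => ⟨hU q hq, mem_univ _⟩

lemma continuousOn_f_comp (hy : ContinuousOn y s) (hU : ∀ q ∈ s, y q ∈ U) :
    ContinuousOn (fun q => G.f (y q)) s :=
  G.continuousOn_f.comp hy hU

lemma continuousOn_df_comp (hy : ContinuousOn y s) (hα : ContinuousOn α s)
    (hU : ∀ q ∈ s, y q ∈ U) : ContinuousOn (fun q => G.df (y q) (α q)) s :=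
  G.continuousOn_df.comp (f := fun q => (y q, α q)) (hy.prodMk hα)
    fun q hq => ⟨hU q hq, mem_univ _⟩

end Comp

namespace Variation

variable {a b : ℝ} (γ : Variation U O a b) (G : WeightedMetric U O)

lemma c_mem_U : ∀ q ∈ γ.dom, γ.c q.1 q.2 ∈ U := fun q hq => γ.mem_U q.1 hq.1 q.2 hq.2

lemma continuousOn_P₁ : ContinuousOn (fun q : ℝ × ℝ => γ.P₁ G q.1 q.2) γ.dom :=
  γ.continuousOn_ps.add (G.continuousOn_Γ_comp γ.continuousOn_c γ.continuousOn_cs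
    γ.continuousOn_p γ.c_mem_U)

lemma continuousOn_P₂ : ContinuousOn (fun q : ℝ × ℝ => γ.P₂ G q.1 q.2) γ.dom :=
  ((γ.continuousOn_comp_snd γ.continuousOn_W₁).add (((G.continuousOn_dΓ_comp γ.continuousOn_c
    γ.continuousOn_cs γ.continuousOn_cs γ.continuousOn_p γ.c_mem_U).add
    (G.continuousOn_Γ_comp γ.continuousOn_c (γ.continuousOn_comp_snd γ.continuousOn_W)
      γ.continuousOn_p γ.c_mem_U)).add
    (G.continuousOn_Γ_comp γ.continuousOn_c γ.continuousOn_cs γ.continuousOn_ps γ.c_mem_U))).add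
    (G.continuousOn_Γ_comp γ.continuousOn_c γ.continuousOn_cs (γ.continuousOn_P₁ G) γ.c_mem_U)

lemma continuousOn_e : ContinuousOn (fun q : ℝ × ℝ => γ.e G q.1 q.2) γ.dom :=
  continuousOn_const.mul (((G.continuousOn_f_comp γ.continuousOn_c γ.c_mem_U).pow 2).mul
    (G.continuousOn_g_comp γ.continuousOn_c γ.continuousOn_p γ.continuousOn_p γ.c_mem_U))

lemma continuousOn_e₁ : ContinuousOn (fun q : ℝ × ℝ => γ.e₁ G q.1 q.2) γ.dom :=
  have hc := γ.continuousOn_c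
  have hU := γ.c_mem_U
  (((G.continuousOn_f_comp hc hU).mul (G.continuousOn_df_comp hc γ.continuousOn_cs hU)).mul
    (G.continuousOn_g_comp hc γ.continuousOn_p γ.continuousOn_p hU)).add
    (((G.continuousOn_f_comp hc hU).pow 2).mul
      (G.continuousOn_g_comp hc (γ.continuousOn_P₁ G) γ.continuousOn_p hU))

lemma continuousOn_e₂ : ContinuousOn (fun q : ℝ × ℝ => γ.e₂ G q.1 q.2) γ.dom :=
  have hc := γ.continuousOn_c
  have hU := γ.c_mem_U
  have hf := G.continuousOn_f_comp hc hU
  have hdf := G.continuousOn_df_comp hc γ.continuousOn_cs hU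
  ((((hdf.pow 2).add (hf.mul ((G.continuousOn_ddf_comp hc γ.continuousOn_cs γ.continuousOn_cs
    hU).add (G.continuousOn_df_comp hc (γ.continuousOn_comp_snd γ.continuousOn_W) hU)))).mul
    (G.continuousOn_g_comp hc γ.continuousOn_p γ.continuousOn_p hU)).add
    ((continuousOn_const.mul (hf.mul hdf)).mul
      (G.continuousOn_g_comp hc (γ.continuousOn_P₁ G) γ.continuousOn_p hU))).add
    ((hf.pow 2).mul ((G.continuousOn_g_comp hc (γ.continuousOn_P₂ G) γ.continuousOn_p hU).add
      (G.continuousOn_g_comp hc (γ.continuousOn_P₁ G) (γ.continuousOn_P₁ G) hU)))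

lemma continuousOn_slice {h : ℝ × ℝ → ℝ} (hh : ContinuousOn h γ.dom) {s : ℝ}
    (hs : s ∈ Icc (-γ.s₀) γ.s₀) : ContinuousOn (fun t => h (s, t)) (Icc a b) :=
  hh.comp (f := fun t => (s, t)) (by fun_prop) fun t ht => ⟨hs, ht⟩

lemma zero_mem : (0 : ℝ) ∈ Icc (-γ.s₀) γ.s₀ := ⟨by linarith [γ.s₀_pos], γ.s₀_pos.le⟩

lemma eventually_mem : ∀ᶠ s in 𝓝 (0 : ℝ), s ∈ Icc (-γ.s₀) γ.s₀ :=
  Icc_mem_nhds (by linarith [γ.s₀_pos]) γ.s₀_pos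

variable {H : Set E} {δ : E → E → ℝ}

/-- By the inequality `√F ≤ (F + 1) / 2` the energy bounds the distance. -/
lemma dist_le_integral (hδ : G.IsChartDist H δ) {s : ℝ} (hs : s ∈ Icc (-γ.s₀) γ.s₀) :
    δ (γ.c s a) (γ.c s b) ≤ (∫ t in a..b, γ.e G s t) + (b - a) / 2 := by
  have hcs : ContinuousOn (γ.c s) (Icc a b) := fun t ht =>
    (γ.hasDerivWithinAt_c s ht).continuousWithinAt
  have hps : ContinuousOn (γ.p s) (Icc a b) :=
    γ.continuousOn_p.comp (f := fun t => (s, t)) (by fun_prop) fun t ht => ⟨hs, ht⟩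
  have h1 := hδ.le_integral γ.lt (fun t ht => γ.hasDerivWithinAt_c s ht) hps
    fun t ht => γ.mem_U s hs t ht
  have hi : IntervalIntegrable (fun t => γ.e G s t) volume a b :=
    (γ.continuousOn_slice (γ.continuousOn_e G) hs).intervalIntegrable_of_Icc γ.lt.le
  have hi' : IntervalIntegrable (fun t => √(G.energy (γ.c s t) (γ.p s t))) volume a b :=
    (RiemannCoord.continuousOn_sqrt_comp (Q := G.energy) G.continuousOn_energy hcs hps
      fun t ht => γ.mem_U s hs t ht).intervalIntegrable_of_Icc γ.lt.le
  have h2 := intervalIntegral.integral_mono_on γ.lt.le hi'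
    (hi.add (intervalIntegrable_const (c := (1 / 2 : ℝ)))) (fun t ht => by
      have h3 : √(G.energy (γ.c s t) (γ.p s t)) ^ 2 = G.energy (γ.c s t) (γ.p s t) :=
        Real.sq_sqrt (G.energy_nonneg (γ.mem_U s hs t ht) (γ.p s t))
      have h4 := sq_nonneg (√(G.energy (γ.c s t) (γ.p s t)) - 1)
      change √(G.energy (γ.c s t) (γ.p s t)) ≤ γ.e G s t + 1 / 2
      have h5 : γ.e G s t = 1 / 2 * √(G.energy (γ.c s t) (γ.p s t)) ^ 2 := by
        rw [h3]; rfl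
      rw [h5]
      linarith)
  refine h1.trans (h2.trans_eq ?_)
  rw [intervalIntegral.integral_add hi intervalIntegrable_const,
    intervalIntegral.integral_const, smul_eq_mul]
  ring

end Variation

end WeightedMetric
end

noncomputable section
open scoped Topology

/-! ### First and second variation -/

namespace WeightedMetric

open Filter MeasureTheory

variable {E : Type*} [NormedAddCommGroup E] [NormedSpace ℝ E] {U O : Set E}

namespace Variation

variable {a b : ℝ} (γ : Variation U O a b) (G : WeightedMetric U O) {H : Set E} {δ : E → E → ℝ}

@[simp] lemma c_zero (t : ℝ) : γ.c 0 t = γ.x t := by simp [c]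

@[simp] lemma p_zero (t : ℝ) : γ.p 0 t = γ.u t := by simp [p]

@[simp] lemma cs_zero (t : ℝ) : γ.cs 0 t = γ.V t := by simp [cs]

@[simp] lemma ps_zero (t : ℝ) : γ.ps 0 t = γ.V₁ t := by simp [ps]

lemma intervalIntegrable_slice {h : ℝ × ℝ → ℝ} (hh : ContinuousOn h γ.dom) {s : ℝ}
    (hs : s ∈ Icc (-γ.s₀) γ.s₀) : IntervalIntegrable (fun t => h (s, t)) volume a b :=
  (γ.continuousOn_slice hh hs).intervalIntegrable_of_Icc γ.lt.le

lemma integral_e_zero (hunit : ∀ t ∈ Icc a b, G.energy (γ.x t) (γ.u t) = 1) :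
    ∫ t in a..b, γ.e G 0 t = (b - a) / 2 := by
  have : ∫ t in a..b, γ.e G 0 t = ∫ _ in a..b, (1 / 2 : ℝ) := by
    refine intervalIntegral.integral_congr fun t ht => ?_
    rw [uIcc_of_le γ.lt.le] at ht
    simp [e, hunit t ht]
  rw [this, intervalIntegral.integral_const, smul_eq_mul]
  ring

/-- The first variation of a curve that realizes the distance vanishes. -/
lemma integral_e₁_eq_zero (hδ : G.IsChartDist H δ)
    (hunit : ∀ t ∈ Icc a b, G.energy (γ.x t) (γ.u t) = 1)
    (hmin : ∀ᶠ s in 𝓝 0, b - a ≤ δ (γ.c s a) (γ.c s b)) :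
    ∫ t in a..b, γ.e₁ G 0 t = 0 := by
  set I := ∫ t in a..b, γ.e₁ G 0 t
  have hab := sub_pos.2 γ.lt
  have hi0 := γ.intervalIntegrable_slice (γ.continuousOn_e G) γ.zero_mem
  have hi1 := γ.intervalIntegrable_slice (γ.continuousOn_e₁ G) γ.zero_mem
  have key : ∀ ε > 0, ∀ᶠ s in 𝓝 0, 0 ≤ s * I + ε * |s| * (b - a) := by
    intro ε hε
    have htay := eventually_abs_taylor_one_le γ.s₀_pos
      (fun s hs t ht => γ.hasDerivAt_e G (γ.mem_O s hs t ht)) (γ.continuousOn_e₁ G) hε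
    filter_upwards [htay, hmin, γ.eventually_mem] with s hs hm hmem
    have his := γ.intervalIntegrable_slice (γ.continuousOn_e G) hmem
    have h1 := intervalIntegral.integral_mono_on_of_le_Ioo γ.lt.le his
      ((hi0.add (hi1.const_mul s)).add (intervalIntegrable_const (c := ε * |s|)))
      (fun t ht => by
        have := (abs_le.1 (hs t ht)).2
        change γ.e G s t ≤ γ.e G 0 t + s * γ.e₁ G 0 t + ε * |s|
        linarith)
    rw [intervalIntegral.integral_add (hi0.add (hi1.const_mul s)) intervalIntegrable_const,
      intervalIntegral.integral_add hi0 (hi1.const_mul s), intervalIntegral.integral_const_mul,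
      intervalIntegral.integral_const, smul_eq_mul] at h1
    have h2 := γ.dist_le_integral G hδ hmem
    have h3 := γ.integral_e_zero G hunit
    simp only at h1
    linarith
  have hle : ∀ ε > 0, |I| ≤ ε * (b - a) := by
    intro ε hε
    obtain ⟨η, hη, h⟩ := Metric.eventually_nhds_iff_ball.1 (key ε hε)
    have hη2 : 0 < η / 2 := by positivity
    have h1 := h (η / 2) (by rw [mem_ball_zero_iff, Real.norm_of_nonneg hη2.le]; linarith)
    have h2 := h (-(η / 2)) (by
      rw [mem_ball_zero_iff, norm_neg, Real.norm_of_nonneg hη2.le]; linarith)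
    rw [abs_neg] at h2
    rw [abs_of_pos hη2] at h1 h2
    rw [abs_le]
    constructor <;> refine le_of_mul_le_mul_left ?_ hη2 <;> linarith
  refine abs_eq_zero.1 (le_antisymm (le_of_forall_pos_le_add fun ε hε => ?_) (abs_nonneg _))
  have := hle (ε / (b - a)) (by positivity)
  rw [div_mul_cancel₀ _ hab.ne'] at this
  linarith

/-- The second variation bounds the distances of the ends of the varied curves. -/
lemma eventually_dist_add_dist_le (hδ : G.IsChartDist H δ)
    (hunit : ∀ t ∈ Icc a b, G.energy (γ.x t) (γ.u t) = 1) {ε : ℝ} (hε : 0 < ε) :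
    ∀ᶠ s in 𝓝 0, δ (γ.c s a) (γ.c s b) + δ (γ.c (-s) a) (γ.c (-s) b) ≤
      2 * (b - a) + s ^ 2 * ((∫ t in a..b, γ.e₂ G 0 t) + ε) := by
  have hab := sub_pos.2 γ.lt
  have hi0 := γ.intervalIntegrable_slice (γ.continuousOn_e G) γ.zero_mem
  have hi2 := γ.intervalIntegrable_slice (γ.continuousOn_e₂ G) γ.zero_mem
  have htay := eventually_abs_taylor_two_le γ.s₀_pos
    (fun s hs t ht => γ.hasDerivAt_e G (γ.mem_O s hs t ht))
    (fun s hs t ht => γ.hasDerivAt_e₁ G (γ.mem_O s hs t ht)) (γ.continuousOn_e₂ G)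
    (div_pos hε hab)
  filter_upwards [htay, γ.eventually_mem] with s hs hmem
  have hmem' : -s ∈ Icc (-γ.s₀) γ.s₀ := ⟨by linarith [hmem.2], by linarith [hmem.1]⟩
  have his := γ.intervalIntegrable_slice (γ.continuousOn_e G) hmem
  have his' := γ.intervalIntegrable_slice (γ.continuousOn_e G) hmem'
  have h1 := intervalIntegral.integral_mono_on_of_le_Ioo γ.lt.le (his.add his')
    (((hi0.const_mul 2).add (hi2.const_mul (s ^ 2))).add
      (intervalIntegrable_const (c := ε / (b - a) * s ^ 2)))
    (fun t ht => by
      have := (abs_le.1 (hs t ht)).2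
      change γ.e G s t + γ.e G (-s) t ≤
        2 * γ.e G 0 t + s ^ 2 * γ.e₂ G 0 t + ε / (b - a) * s ^ 2
      linarith)
  rw [intervalIntegral.integral_add ((hi0.const_mul 2).add (hi2.const_mul (s ^ 2)))
    intervalIntegrable_const, intervalIntegral.integral_add (hi0.const_mul 2)
    (hi2.const_mul (s ^ 2)), intervalIntegral.integral_const_mul,
    intervalIntegral.integral_const_mul, intervalIntegral.integral_const, smul_eq_mul,
    intervalIntegral.integral_add his his'] at h1
  have h2 := γ.dist_le_integral G hδ hmem
  have h2' := γ.dist_le_integral G hδ hmem'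
  have h3 := γ.integral_e_zero G hunit
  have h4 : (b - a) * (ε / (b - a) * s ^ 2) = s ^ 2 * ε := by field_simp
  simp only at h1
  rw [h4, h3] at h1
  linarith

end Variation

end WeightedMetric

/-! ### The lemma of du Bois-Reymond -/

section DuBoisReymond

open MeasureTheory

/-- If `A` is the derivative of `P` in the weak sense, then it is the derivative of `P`. -/
lemma hasDerivAt_of_forall_integral_eq_zero {A P : ℝ → ℝ} {a b : ℝ} (hab : a < b)
    (hA : ContinuousOn A (Icc a b)) (hP : ContinuousOn P (Icc a b))
    (h : ∀ η η₁ : ℝ → ℝ, (∀ t, HasDerivAt η (η₁ t) t) → Continuous η₁ → η a = 0 → η b = 0 →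
      ∫ t in a..b, (η t * A t + η₁ t * P t) = 0) :
    ∀ t ∈ Ioo a b, HasDerivAt P (A t) t := by
  set A' : ℝ → ℝ := IccExtend hab.le ((Icc a b).domRestrict A) with hA'
  set P' : ℝ → ℝ := IccExtend hab.le ((Icc a b).domRestrict P) with hP'
  have hAc : Continuous A' := hA.domRestrict.Icc_extend'
  have hPc : Continuous P' := hP.domRestrict.Icc_extend'
  have hAA : ∀ t ∈ Icc a b, A' t = A t := fun t ht => by
    rw [hA', IccExtend_of_mem _ _ ht]; rfl
  have hPP : ∀ t ∈ Icc a b, P' t = P t := fun t ht => by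
    rw [hP', IccExtend_of_mem _ _ ht]; rfl
  set Q : ℝ → ℝ := fun t => ∫ τ in a..t, A' τ
  have hQd : ∀ t, HasDerivAt Q (A' t) t := fun t => (hAc.integral_hasStrictDerivAt a t).hasDerivAt
  have hQc : Continuous Q := continuous_iff_continuousAt.2 fun t => (hQd t).continuousAt
  set μ : ℝ := (∫ τ in a..b, (P' τ - Q τ)) / (b - a) with hμ
  set R : ℝ → ℝ := fun t => P' t - Q t - μ with hR
  have hRc : Continuous R := (hPc.sub hQc).sub continuous_const
  set η : ℝ → ℝ := fun t => ∫ τ in a..t, R τ with hη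
  have hηd : ∀ t, HasDerivAt η (R t) t := fun t => (hRc.integral_hasStrictDerivAt a t).hasDerivAt
  have hηc : Continuous η := continuous_iff_continuousAt.2 fun t => (hηd t).continuousAt
  have hηa : η a = 0 := by simp [hη]
  have hηb : η b = 0 := by
    simp only [hη, hR]
    have hPQ : Continuous fun t => P' t - Q t := hPc.sub hQc
    rw [intervalIntegral.integral_sub (hPQ.intervalIntegrable _ _)
      intervalIntegrable_const, intervalIntegral.integral_const, smul_eq_mul, hμ,
      mul_div_cancel₀ _ (sub_pos.2 hab).ne', sub_self]
  have h1 := h η R hηd hRc hηa hηb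
  have h2 : ∫ t in a..b, (η t * A' t + R t * P' t) = 0 := by
    rw [← h1]
    refine intervalIntegral.integral_congr fun t ht => ?_
    rw [uIcc_of_le hab.le] at ht
    simp only [hAA t ht, hPP t ht]
  have h3 : ∫ t in a..b, (R t * (Q t + μ) + η t * A' t) = 0 := by
    rw [intervalIntegral.integral_eq_sub_of_hasDerivAt
      (fun t _ => (hηd t).fun_mul ((hQd t).add_const μ))
      ((by fun_prop : Continuous _).intervalIntegrable _ _), hηa, hηb]
    ring
  have h4 : ∫ t in a..b, R t ^ 2 = 0 := by
    have : ∀ t, R t ^ 2 = (η t * A' t + R t * P' t) - (R t * (Q t + μ) + η t * A' t) := by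
      intro t
      simp only [hR]
      ring
    simp only [this]
    rw [intervalIntegral.integral_sub ((by fun_prop : Continuous _).intervalIntegrable _ _)
      ((by fun_prop : Continuous _).intervalIntegrable _ _), h2, h3, sub_zero]
  have h5 : ∀ t ∈ Icc a b, R t = 0 := by
    intro t ht
    by_contra hne
    have := intervalIntegral.integral_pos hab ((hRc.pow 2).continuousOn)
      (fun _ _ => sq_nonneg _) ⟨t, ht, lt_of_le_of_ne (sq_nonneg _) (Ne.symm (pow_ne_zero 2 hne))⟩
    exact this.ne' h4
  intro t ht
  have h6 : HasDerivAt (fun s => Q s + μ) (A t) t := by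
    rw [← hAA t (Ioo_subset_Icc_self ht)]
    exact (hQd t).add_const μ
  refine h6.congr_of_eventuallyEq ?_
  filter_upwards [Ioo_mem_nhds ht.1 ht.2] with s hs
  have h7 := h5 s (Ioo_subset_Icc_self hs)
  have h8 := hPP s (Ioo_subset_Icc_self hs)
  simp only [hR] at h7
  linarith

end DuBoisReymond

namespace WeightedMetric

open Filter MeasureTheory

variable {E : Type*} [NormedAddCommGroup E] [NormedSpace ℝ E] {U O : Set E}
  {G : WeightedMetric U O} {H : Set E} {δ : E → E → ℝ}

section EulerLagrange

variable {x u : ℝ → E} {a b : ℝ} (hx : ∀ t ∈ Icc a b, HasDerivWithinAt x (u t) (Icc a b) t)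
  (hu : ContinuousOn u (Icc a b)) (hU : ∀ t ∈ Icc a b, x t ∈ U) (hO : ∀ t ∈ Ioo a b, x t ∈ O)
  (hunit : ∀ t ∈ Icc a b, G.energy (x t) (u t) = 1)

/-- The variation by multiples of a constant vector. -/
def constVariation (hab : a < b) (hx : ∀ t ∈ Icc a b, HasDerivWithinAt x (u t) (Icc a b) t)
    (hu : ContinuousOn u (Icc a b)) {η η₁ : ℝ → ℝ} (hη : ∀ t, HasDerivAt η (η₁ t) t)
    (hη₁ : Continuous η₁) (w : E) {s₀ : ℝ} (hs₀ : 0 < s₀)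
    (hmU : ∀ s ∈ Icc (-s₀) s₀, ∀ t ∈ Icc a b, x t + (s * η t) • w ∈ U)
    (hmO : ∀ s ∈ Icc (-s₀) s₀, ∀ t ∈ Ioo a b, x t + (s * η t) • w ∈ O) : Variation U O a b where
  x := x
  u := u
  V := fun t => η t • w
  V₁ := fun t => η₁ t • w
  W := fun _ => 0
  W₁ := fun _ => 0
  lt := hab
  hasDeriv_x := hx
  hasDeriv_V := fun t _ => ((hη t).smul_const w).hasDerivWithinAt
  hasDeriv_W := fun t _ => hasDerivWithinAt_const _ _ _
  continuousOn_u := hu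
  continuousOn_V₁ := (hη₁.smul continuous_const).continuousOn
  continuousOn_W₁ := continuousOn_const
  s₀ := s₀
  s₀_pos := hs₀
  mem_U := fun s hs t ht => by simpa [smul_smul] using hmU s hs t ht
  mem_O := fun s hs t ht => by simpa [smul_smul] using hmO s hs t ht

variable (G) in
/-- The right hand side of the Euler-Lagrange equation of the energy density `½ f² g(v, v)`, tested
with `w`; the derivative of `g` is expressed by `Γ`. -/
def force (y v w : E) : ℝ :=
  G.f y * G.df y w * G.g y v v + G.f y ^ 2 * G.g y (G.Γ y w v) v

variable (G) in
/-- The component of the momentum of the velocity `v` in the direction `w`, for `½ f² g(v, v)`. -/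
def momentum (y v w : E) : ℝ := G.f y ^ 2 * G.g y v w

include hu hU in
lemma continuousOn_force (hx : ContinuousOn x (Icc a b)) (w : E) :
    ContinuousOn (fun t => G.force (x t) (u t) w) (Icc a b) :=
  (((G.continuousOn_f_comp hx hU).mul (G.continuousOn_df_comp hx continuousOn_const hU)).mul
    (G.continuousOn_g_comp hx hu hu hU)).add (((G.continuousOn_f_comp hx hU).pow 2).mul
      (G.continuousOn_g_comp hx (G.continuousOn_Γ_comp hx continuousOn_const hu hU) hu hU))

include hu hU in
lemma continuousOn_momentum (hx : ContinuousOn x (Icc a b)) (w : E) :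
    ContinuousOn (fun t => G.momentum (x t) (u t) w) (Icc a b) :=
  ((G.continuousOn_f_comp hx hU).pow 2).mul (G.continuousOn_g_comp hx hu continuousOn_const hU)

lemma constVariation_e₁ (hab : a < b) {η η₁ : ℝ → ℝ} (hη : ∀ t, HasDerivAt η (η₁ t) t)
    (hη₁ : Continuous η₁) (w : E) {s₀ : ℝ} (hs₀ : 0 < s₀)
    (hmU : ∀ s ∈ Icc (-s₀) s₀, ∀ t ∈ Icc a b, x t + (s * η t) • w ∈ U)
    (hmO : ∀ s ∈ Icc (-s₀) s₀, ∀ t ∈ Ioo a b, x t + (s * η t) • w ∈ O) (t : ℝ) :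
    (constVariation hab hx hu hη hη₁ w hs₀ hmU hmO).e₁ G 0 t =
      η t * G.force (x t) (u t) w + η₁ t * G.momentum (x t) (u t) w := by
  simp only [Variation.e₁, Variation.P₁, Variation.c_zero, Variation.cs_zero, Variation.p_zero,
    Variation.ps_zero, constVariation, force, momentum, map_smul, smul_apply, map_add, add_apply,
    smul_eq_mul, G.g_symm (x t) w (u t)]
  ring

include hx hu hU hO hunit

/-- The Euler-Lagrange equation: a unit speed curve that realizes the distance has a
differentiable momentum. -/
lemma hasDerivAt_momentum (hδ : G.IsChartDist H δ)
    (hiso : ∀ s ∈ Icc a b, ∀ t ∈ Icc a b, δ (x s) (x t) = |s - t|) (w : E) :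
    ∀ t ∈ Ioo a b, HasDerivAt (fun t => G.momentum (x t) (u t) w) (G.force (x t) (u t) w) t := by
  intro t₀ ht₀
  -- On a smaller interval the curve keeps a distance from the boundary of the domain, so that it
  -- can be varied in any direction.
  obtain ⟨a', ha'⟩ := exists_between ht₀.1
  obtain ⟨b', hb'⟩ := exists_between ht₀.2
  have hab' : a' < b' := ha'.2.trans hb'.1
  have hsub : Icc a' b' ⊆ Icc a b := Icc_subset_Icc ha'.1.le hb'.2.le
  have hsubO : Icc a' b' ⊆ Ioo a b := fun t ht => ⟨ha'.1.trans_le ht.1, ht.2.trans_lt hb'.2⟩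
  have hxc : ContinuousOn x (Icc a' b') := fun t ht =>
    (hx t (hsub ht)).continuousWithinAt.mono hsub
  refine hasDerivAt_of_forall_integral_eq_zero hab'
    (continuousOn_force (hu.mono hsub) (fun t ht => hU t (hsub ht)) hxc w)
    (continuousOn_momentum (hu.mono hsub) (fun t ht => hU t (hsub ht)) hxc w) ?_ t₀
    ⟨ha'.2, hb'.1⟩
  intro η η₁ hη hη₁ hηa hηb
  have hηc : Continuous η := continuous_iff_continuousAt.2 fun t => (hη t).continuousAt
  obtain ⟨ρ, hρ, hρO⟩ := (isCompact_Icc.image_of_continuousOn hxc).exists_thickening_subset_open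
    G.isOpen_O (by rintro _ ⟨t, ht, rfl⟩; exact hO t (hsubO ht))
  obtain ⟨B, hB⟩ := (isCompact_Icc (a := a') (b := b')).exists_bound_of_continuousOn
    ((hηc.smul (continuous_const (y := w))).continuousOn)
  set s₀ := ρ / (2 * (|B| + 1)) with hs₀
  have hs₀p : 0 < s₀ := by positivity
  have hmO : ∀ s ∈ Icc (-s₀) s₀, ∀ t ∈ Icc a' b', x t + (s * η t) • w ∈ O := by
    intro s hs t ht
    refine hρO (Metric.mem_thickening_iff.2 ⟨x t, mem_image_of_mem _ ht, ?_⟩)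
    rw [dist_eq_norm, add_sub_cancel_left, mul_smul, norm_smul, Real.norm_eq_abs]
    calc |s| * ‖η t • w‖ ≤ s₀ * (|B| + 1) := by
          gcongr
          · exact abs_le.2 hs
          · exact (hB t ht).trans ((le_abs_self B).trans (by linarith))
      _ = ρ / 2 := by rw [hs₀]; field_simp
      _ < ρ := by linarith
  have hx' : ∀ t ∈ Icc a' b', HasDerivWithinAt x (u t) (Icc a' b') t := fun t ht =>
    (hx t (hsub ht)).mono hsub
  have hmU : ∀ s ∈ Icc (-s₀) s₀, ∀ t ∈ Icc a' b', x t + (s * η t) • w ∈ U :=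
    fun s hs t ht => G.O_subset (hmO s hs t ht)
  have hmO' : ∀ s ∈ Icc (-s₀) s₀, ∀ t ∈ Ioo a' b', x t + (s * η t) • w ∈ O :=
    fun s hs t ht => hmO s hs t (Ioo_subset_Icc_self ht)
  have h1 := (constVariation hab' hx' (hu.mono hsub) hη hη₁ w hs₀p hmU hmO').integral_e₁_eq_zero
    G hδ (fun t ht => hunit t (hsub ht)) (Eventually.of_forall fun s => by
      simp only [Variation.c, constVariation, hηa, hηb, zero_smul, smul_zero, add_zero]
      rw [hiso a' (hsub (left_mem_Icc.2 hab'.le)) b' (hsub (right_mem_Icc.2 hab'.le)),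
        abs_sub_comm]
      exact le_abs_self _)
  simpa only [constVariation_e₁ hx' (hu.mono hsub)] using h1

/-- A curve that realizes the distance to a hypersurface starts perpendicularly to it. -/
lemma momentum_eq_zero_of_left (hδ : G.IsChartDist H δ) (hab : a < b) {ξ : E} {s₀ : ℝ}
    (hs₀ : 0 < s₀) (hmU : ∀ s ∈ Icc (-s₀) s₀, ∀ t ∈ Icc a b, x t + s • ξ ∈ U)
    (hmO : ∀ s ∈ Icc (-s₀) s₀, ∀ t ∈ Ioo a b, x t + s • ξ ∈ O)
    (hmin : ∀ s ∈ Icc (-s₀) s₀, ∀ t ∈ Icc a b, t - a ≤ δ (x a + s • ξ) (x t)) :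
    G.momentum (x a) (u a) ξ = 0 := by
  have hxc : ContinuousOn x (Icc a b) := fun t ht => (hx t ht).continuousWithinAt
  have hAc := continuousOn_force (G := G) hu hU hxc ξ
  have hPc := continuousOn_momentum (G := G) hu hU hxc ξ
  obtain ⟨B, hB⟩ := (isCompact_Icc (a := a) (b := b)).exists_bound_of_continuousOn hAc
  set P' : ℝ → ℝ := IccExtend hab.le ((Icc a b).domRestrict
    (fun t => G.momentum (x t) (u t) ξ)) with hP'
  have hPc' : Continuous P' := hPc.domRestrict.Icc_extend'
  have hPP : ∀ t ∈ Icc a b, P' t = G.momentum (x t) (u t) ξ := fun t ht => by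
    rw [hP', IccExtend_of_mem _ _ ht]; rfl
  have hlim : Tendsto (fun h : ℝ => h⁻¹ • ∫ τ in a..a + h, P' τ) (𝓝[>] 0)
      (𝓝 (G.momentum (x a) (u a) ξ)) := by
    have h1 : HasDerivAt (fun z => ∫ τ in a..z, P' τ) (P' a) a :=
      (hPc'.integral_hasStrictDerivAt a a).hasDerivAt
    rw [← hPP a (left_mem_Icc.2 hab.le)]
    simpa using h1.tendsto_slope_zero_right
  have hbound : ∀ᶠ h : ℝ in 𝓝[>] 0, ‖h⁻¹ • ∫ τ in a..a + h, P' τ‖ ≤ B * h := by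
    filter_upwards [Ioo_mem_nhdsGT (sub_pos.2 hab)] with h hh
    have hh0 : 0 < h := hh.1
    have hsub : Icc a (a + h) ⊆ Icc a b := Icc_subset_Icc_right (by linarith [hh.2])
    have hsub' : Ioo a (a + h) ⊆ Ioo a b := Ioo_subset_Ioo_right (by linarith [hh.2])
    -- The variation moves the left end by `s ξ` and fixes the point at time `a + h`. Its first
    -- variation expresses the mean of the momentum over `[a, a + h]` by the force, up to `O(h)`.
    have hη : ∀ t, HasDerivAt (fun t => 1 - h⁻¹ * (t - a)) (-h⁻¹) t := fun t => by
      have := (((hasDerivAt_id' t).sub_const a).const_mul h⁻¹).const_sub 1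
      simpa using this
    have hηI : ∀ s ∈ Icc (-s₀) s₀, ∀ t ∈ Icc a (a + h),
        s * (1 - h⁻¹ * (t - a)) ∈ Icc (-s₀) s₀ := by
      intro s hs t ht
      have h1 : 0 ≤ h⁻¹ * (t - a) := mul_nonneg (by positivity) (by linarith [ht.1])
      have h2 : h⁻¹ * (t - a) ≤ 1 := by
        rw [inv_mul_le_iff₀ hh0]; linarith [ht.2]
      have hs' : |s| ≤ s₀ := abs_le.2 hs
      refine abs_le.1 (?_ : |s * (1 - h⁻¹ * (t - a))| ≤ s₀)
      rw [abs_mul, abs_of_nonneg (show 0 ≤ 1 - h⁻¹ * (t - a) by linarith)]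
      exact (mul_le_of_le_one_right (abs_nonneg s) (by linarith)).trans hs'
    have hx' : ∀ t ∈ Icc a (a + h), HasDerivWithinAt x (u t) (Icc a (a + h)) t := fun t ht =>
      (hx t (hsub ht)).mono hsub
    have hmU' : ∀ s ∈ Icc (-s₀) s₀, ∀ t ∈ Icc a (a + h), x t + (s * (1 - h⁻¹ * (t - a))) • ξ ∈ U :=
      fun s hs t ht => hmU _ (hηI s hs t ht) t (hsub ht)
    have hmO' : ∀ s ∈ Icc (-s₀) s₀, ∀ t ∈ Ioo a (a + h), x t + (s * (1 - h⁻¹ * (t - a))) • ξ ∈ O :=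
      fun s hs t ht => hmO _ (hηI s hs t (Ioo_subset_Icc_self ht)) t (hsub' ht)
    have h1 := (constVariation (by linarith) hx' (hu.mono hsub) hη continuous_const ξ hs₀ hmU'
      hmO').integral_e₁_eq_zero G hδ (fun t ht => hunit t (hsub ht)) (by
        filter_upwards [Icc_mem_nhds (neg_neg_of_pos hs₀) hs₀] with s hs
        have := hmin s hs (a + h) ⟨by linarith, by linarith [hh.2]⟩
        simpa [Variation.c, constVariation, hh0.ne'] using this)
    simp only [constVariation_e₁ hx' (hu.mono hsub)] at h1
    have hi1 : IntervalIntegrable (fun t => (1 - h⁻¹ * (t - a)) * G.force (x t) (u t) ξ) volume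
        a (a + h) := by
      refine ContinuousOn.intervalIntegrable_of_Icc (by linarith) ?_
      exact (by fun_prop : Continuous fun t : ℝ => 1 - h⁻¹ * (t - a)).continuousOn.mul
        (hAc.mono hsub)
    have hi2 : IntervalIntegrable (fun t => -h⁻¹ * G.momentum (x t) (u t) ξ) volume
        a (a + h) :=
      ContinuousOn.intervalIntegrable_of_Icc (by linarith)
        (continuousOn_const.mul (hPc.mono hsub))
    rw [intervalIntegral.integral_add hi1 hi2, intervalIntegral.integral_const_mul] at h1
    have h2 : ∫ τ in a..a + h, P' τ = ∫ τ in a..a + h, G.momentum (x τ) (u τ) ξ := by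
      refine intervalIntegral.integral_congr fun t ht => ?_
      rw [uIcc_of_le (by linarith)] at ht
      exact hPP t (hsub ht)
    have h3 : h⁻¹ • ∫ τ in a..a + h, P' τ =
        ∫ t in a..a + h, (1 - h⁻¹ * (t - a)) * G.force (x t) (u t) ξ := by
      rw [h2, smul_eq_mul]; linarith
    rw [h3]
    have h4 := intervalIntegral.norm_integral_le_of_norm_le_const (a := a) (b := a + h) (C := B)
      (f := fun t => (1 - h⁻¹ * (t - a)) * G.force (x t) (u t) ξ) (fun t ht => by
        rw [uIoc_of_le (by linarith)] at ht
        have ht' : t ∈ Icc a (a + h) := Ioc_subset_Icc_self ht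
        have k1 : 0 ≤ h⁻¹ * (t - a) := mul_nonneg (by positivity) (by linarith [ht.1])
        have k2 : h⁻¹ * (t - a) ≤ 1 := by
          rw [inv_mul_le_iff₀ hh0]; linarith [ht.2]
        rw [norm_mul, Real.norm_of_nonneg (show 0 ≤ 1 - h⁻¹ * (t - a) by linarith)]
        exact (mul_le_of_le_one_left (norm_nonneg _) (by linarith)).trans (hB t (hsub ht')))
    rwa [add_sub_cancel_left, abs_of_pos hh0] at h4
  have h0 : Tendsto (fun h : ℝ => B * h) (𝓝[>] 0) (𝓝 0) := by
    have : Tendsto (fun h : ℝ => B * h) (𝓝 0) (𝓝 (B * 0)) := (continuous_const_mul B).tendsto 0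
    rw [mul_zero] at this
    exact this.mono_left nhdsWithin_le_nhds
  exact tendsto_nhds_unique hlim (squeeze_zero_norm' hbound h0)

end EulerLagrange

end WeightedMetric
end

noncomputable section
open scoped Topology

/-! ### Frames along geodesics -/

section LinearODE

open Metric
open scoped NNReal

/-- A linear differential equation with coefficients bounded by `C` has solutions on intervals of
length at most `1 / (2C)`. -/
lemma exists_solution_of_linear {E : Type*} [NormedAddCommGroup E] [NormedSpace ℝ E]
    [CompleteSpace E] {A : ℝ → E →ₗ[ℝ] E} {a b C : ℝ} (hab : a ≤ b) (hC : 0 < C)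
    (hA : ∀ t ∈ Icc a b, ∀ v, ‖A t v‖ ≤ C * ‖v‖) (hc : ∀ v, ContinuousOn (fun t => A t v) (Icc a b))
    (hlen : b - a ≤ 1 / (2 * C)) (v₀ : E) :
    ∃ V : ℝ → E, V a = v₀ ∧ ∀ t ∈ Icc a b, HasDerivWithinAt V (A t (V t)) (Icc a b) t := by
  have hP : IsPicardLindelof (fun t v => A t v) (⟨a, left_mem_Icc.2 hab⟩ : Icc a b) v₀
      (⟨‖v₀‖ + 1, by positivity⟩ : ℝ≥0) 0 (⟨C * (2 * (‖v₀‖ + 1)), by positivity⟩ : ℝ≥0)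
      (⟨C, hC.le⟩ : ℝ≥0) := by
    refine ⟨fun t ht => LipschitzOnWith.of_dist_le_mul fun v _ w _ => ?_, fun v _ => hc v,
      fun t ht v hv => ?_, ?_⟩
    · rw [dist_eq_norm, dist_eq_norm, ← map_sub]
      exact hA t ht _
    · refine (hA t ht v).trans ?_
      change C * ‖v‖ ≤ C * (2 * (‖v₀‖ + 1))
      have h1 : ‖v - v₀‖ ≤ ‖v₀‖ + 1 := by
        rw [← dist_eq_norm]
        exact hv
      have h2 : ‖v‖ ≤ ‖v₀‖ + ‖v - v₀‖ := by
        simpa using norm_add_le v₀ (v - v₀)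
      gcongr
      linarith [norm_nonneg v₀]
    · change C * (2 * (‖v₀‖ + 1)) * max (b - a) (a - a) ≤ (‖v₀‖ + 1) - 0
      rw [max_eq_left (by linarith)]
      calc C * (2 * (‖v₀‖ + 1)) * (b - a) ≤ C * (2 * (‖v₀‖ + 1)) * (1 / (2 * C)) := by gcongr
        _ = (‖v₀‖ + 1) - 0 := by field_simp; ring
  obtain ⟨V, h0, hV⟩ := hP.exists_eq_forall_mem_Icc_hasDerivWithinAt₀
  exact ⟨V, h0, hV⟩

end LinearODE

lemma eq_left_of_hasDerivAt_zero {h : ℝ → ℝ} {a b : ℝ} (hc : ContinuousOn h (Icc a b))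
    (hd : ∀ t ∈ Ioo a b, HasDerivAt h 0 t) : ∀ t ∈ Icc a b, h t = h a := by
  intro t ht
  rcases ht.1.eq_or_lt with rfl | hat
  · rfl
  obtain ⟨c, -, hc'⟩ := exists_hasDerivAt_eq_slope h (fun _ => 0) hat
    (hc.mono (Icc_subset_Icc_right ht.2)) fun s hs => hd s ⟨hs.1, hs.2.trans_le ht.2⟩
  have h1 : t - a ≠ 0 := (sub_pos.2 hat).ne'
  field_simp at hc'
  linarith

namespace WeightedMetric

open Filter

variable {E : Type*} [NormedAddCommGroup E] [NormedSpace ℝ E] {U O : Set E}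
  (G : WeightedMetric U O)

/-- The Hessian of the weight. -/
def hess (y v w : E) : ℝ := G.ddf y v w - G.df y (G.Γ y v w)

/-- The vectors `V 0`, `V 1` are orthogonal to `u` and, for the metric `f g`, orthonormal. -/
structure IsFrame (y u : E) (V : Fin 2 → E) : Prop where
  orth : ∀ a b, G.f y * G.g y (V a) (V b) = if a = b then 1 else 0
  perp : ∀ a, G.g y (V a) u = 0

variable {G}

/-- The expansion of a vector in a frame, in dimension three. -/
lemma IsFrame.expand {y u : E} {V : Fin 2 → E} (h : G.IsFrame y u V)
    (hdim : Module.finrank ℝ E = 3) (hu : G.energy y u = 1) (z : E) :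
    z = ∑ a, (G.f y * G.g y (V a) z) • V a + (G.f y ^ 2 * G.g y u z) • u := by
  have : FiniteDimensional ℝ E := Module.finite_of_finrank_pos (by omega)
  have h00 := h.orth 0 0
  have h01 := h.orth 0 1
  have h10 := h.orth 1 0
  have h11 := h.orth 1 1
  have hp0 := h.perp 0
  have hp1 := h.perp 1
  have hp0' : G.g y u (V 0) = 0 := by rw [G.g_symm, hp0]
  have hp1' : G.g y u (V 1) = 0 := by rw [G.g_symm, hp1]
  rw [energy] at hu
  simp only [if_true, Fin.isValue, zero_ne_one, one_ne_zero, if_false] at h00 h01 h10 h11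
  have key : ∀ (c₀ c₁ c₂ : ℝ) (z : E), c₀ • V 0 + c₁ • V 1 + c₂ • u = z →
      c₀ = G.f y * G.g y (V 0) z ∧ c₁ = G.f y * G.g y (V 1) z ∧ c₂ = G.f y ^ 2 * G.g y u z := by
    rintro c₀ c₁ c₂ z rfl
    simp only [map_add, map_smul, smul_eq_mul, hp0, hp1, hp0', hp1']
    refine ⟨?_, ?_, ?_⟩
    · linear_combination (-c₀) * h00 - c₁ * h01
    · linear_combination (-c₀) * h10 - c₁ * h11
    · linear_combination (-c₂) * hu
  have hli : LinearIndependent ℝ ![V 0, V 1, u] := by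
    rw [Fintype.linearIndependent_iff]
    intro c hc
    rw [Fin.sum_univ_three] at hc
    obtain ⟨h0, h1, h2⟩ := key (c 0) (c 1) (c 2) 0 hc
    simp only [map_zero, mul_zero] at h0 h1 h2
    intro i
    fin_cases i <;> assumption
  have hspan := hli.span_eq_top_of_card_eq_finrank' (by simp [hdim])
  have hz : z ∈ Submodule.span ℝ (range ![V 0, V 1, u]) := hspan ▸ Submodule.mem_top
  obtain ⟨c, hc⟩ := (Submodule.mem_span_range_iff_exists_fun ℝ).1 hz
  rw [Fin.sum_univ_three] at hc
  obtain ⟨h0, h1, h2⟩ := key (c 0) (c 1) (c 2) z hc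
  rw [Fin.sum_univ_two, ← h0, ← h1, ← h2]
  exact hc.symm

variable (G) in
/-- A curve with unit speed for the conformal metric `f² g` that is a geodesic for it. The
geodesic equation is written with the covariant derivative for `g`. -/
structure Geodesic (x u : ℝ → E) (a b : ℝ) : Prop where
  lt : a < b
  mem_U : ∀ t ∈ Icc a b, x t ∈ U
  mem_O : ∀ t ∈ Ioo a b, x t ∈ O
  hasDeriv : ∀ t ∈ Icc a b, HasDerivWithinAt x (u t) (Icc a b) t
  continuousOn : ContinuousOn u (Icc a b)
  unit : ∀ t ∈ Icc a b, G.energy (x t) (u t) = 1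
  exists_accel : ∀ t ∈ Ioo a b, ∃ u', HasDerivAt u u' t ∧ ∀ w,
    G.g (x t) (u' + G.Γ (x t) (u t) (u t)) w = (G.f (x t))⁻¹ ^ 3 * G.df (x t) w -
      2 * (G.f (x t))⁻¹ * G.df (x t) (u t) * G.g (x t) (u t) w

namespace Geodesic

variable {x u : ℝ → E} {a b : ℝ} (γ : G.Geodesic x u a b)

include γ

lemma continuousOn_x : ContinuousOn x (Icc a b) := fun t ht => (γ.hasDeriv t ht).continuousWithinAt

lemma hasDerivAt {t : ℝ} (ht : t ∈ Ioo a b) : HasDerivAt x (u t) t :=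
  (γ.hasDeriv t (Ioo_subset_Icc_self ht)).hasDerivAt (Icc_mem_nhds ht.1 ht.2)

end Geodesic

variable (G) in
/-- The right hand side of the equation `D_u V = -½ (df(u)/f) V - (df(V)/f) u` for the variation
fields, as an equation for the coordinates of `V`. -/
def fieldMap (y u : E) : E →ₗ[ℝ] E where
  toFun V := -G.Γ y u V - (1 / 2 * (G.df y u / G.f y)) • V - (G.df y V / G.f y) • u
  map_add' v w := by simp only [map_add, add_div, add_smul, smul_add]; abel
  map_smul' r v := by
    simp only [map_smul, smul_eq_mul, RingHom.id_apply, smul_sub, smul_neg, smul_smul]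
    congr 2
    · ring_nf
    · ring

lemma fieldMap_apply (y u V : E) : G.fieldMap y u V =
    -G.Γ y u V - (1 / 2 * (G.df y u / G.f y)) • V - (G.df y V / G.f y) • u := rfl

lemma continuousOn_fieldMap {X : Type*} [TopologicalSpace X] {s : Set X} {y u V : X → E}
    (hy : ContinuousOn y s) (hu : ContinuousOn u s) (hV : ContinuousOn V s)
    (hU : ∀ q ∈ s, y q ∈ U) : ContinuousOn (fun q => G.fieldMap (y q) (u q) (V q)) s := by
  have hf := G.continuousOn_f_comp hy hU
  have hne : ∀ q ∈ s, G.f (y q) ≠ 0 := fun q hq => (G.f_pos _ (hU q hq)).ne'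
  exact (((G.continuousOn_Γ_comp hy hu hV hU).neg.sub ((continuousOn_const.mul
    ((G.continuousOn_df_comp hy hu hU).div hf hne)).smul hV)).sub
    (((G.continuousOn_df_comp hy hV hU).div hf hne).smul hu))

lemma exists_fieldMap_bound [ProperSpace E] {x u : ℝ → E} {a b : ℝ} (hx : ContinuousOn x (Icc a b))
    (hu : ContinuousOn u (Icc a b)) (hU : ∀ t ∈ Icc a b, x t ∈ U) :
    ∃ C > 0, ∀ t ∈ Icc a b, ∀ v, ‖G.fieldMap (x t) (u t) v‖ ≤ C * ‖v‖ := by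
  have hK : IsCompact (Icc a b ×ˢ Metric.sphere (0 : E) 1) :=
    isCompact_Icc.prod (isCompact_sphere 0 1)
  have hc : ContinuousOn (fun q : ℝ × E => G.fieldMap (x q.1) (u q.1) q.2)
      (Icc a b ×ˢ Metric.sphere (0 : E) 1) :=
    continuousOn_fieldMap (hx.comp continuousOn_fst fun q hq => hq.1)
      (hu.comp continuousOn_fst fun q hq => hq.1) continuousOn_snd fun q hq => hU _ hq.1
  obtain ⟨C, hC⟩ := hK.exists_bound_of_continuousOn hc
  refine ⟨|C| + 1, by positivity, fun t ht v => ?_⟩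
  rcases eq_or_ne v 0 with rfl | hv
  · simp
  have hv' : 0 < ‖v‖ := norm_pos_iff.2 hv
  have h1 := hC (t, ‖v‖⁻¹ • v) ⟨ht, by simp [norm_smul, hv'.ne']⟩
  simp only [map_smul, norm_smul, norm_inv, norm_norm] at h1
  rw [inv_mul_le_iff₀ hv'] at h1
  calc _ ≤ ‖v‖ * C := h1
    _ ≤ ‖v‖ * (|C| + 1) := by gcongr; linarith [le_abs_self C]
    _ = _ := mul_comm _ _

namespace Geodesic

variable {x u : ℝ → E} {a b : ℝ} (γ : G.Geodesic x u a b) {V : Fin 2 → ℝ → E}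
  (hV : ∀ i, ∀ t ∈ Icc a b, HasDerivWithinAt (V i) (G.fieldMap (x t) (u t) (V i t)) (Icc a b) t)

include γ hV

lemma hasDerivAt_field (i : Fin 2) {t : ℝ} (ht : t ∈ Ioo a b) :
    HasDerivAt (V i) (G.fieldMap (x t) (u t) (V i t)) t :=
  (hV i t (Ioo_subset_Icc_self ht)).hasDerivAt (Icc_mem_nhds ht.1 ht.2)

lemma continuousOn_field (i : Fin 2) : ContinuousOn (V i) (Icc a b) := fun t ht =>
  (hV i t ht).continuousWithinAt

/-- The equation for the variation fields preserves frames. -/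
lemma isFrame (h0 : G.IsFrame (x a) (u a) fun i => V i a) {t : ℝ} (ht : t ∈ Icc a b) :
    G.IsFrame (x t) (u t) fun i => V i t := by
  have hxc := γ.continuousOn_x
  have hVc := γ.continuousOn_field hV
  have hf := G.continuousOn_f_comp hxc γ.mem_U
  have hne : ∀ t ∈ Icc a b, G.f (x t) ≠ 0 := fun t ht => (G.f_pos _ (γ.mem_U t ht)).ne'
  have hperp : ∀ i, ∀ t ∈ Icc a b, G.g (x t) (V i t) (u t) = 0 := by
    intro i t ht
    -- The quantity `g(V, u)² f⁵` is constant along the geodesic.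
    have hcont : ContinuousOn (fun t => G.g (x t) (V i t) (u t) ^ 2 * G.f (x t) ^ 5) (Icc a b) :=
      ((G.continuousOn_g_comp hxc (hVc i) γ.continuousOn γ.mem_U).pow 2).mul (hf.pow 5)
    have h1 := eq_left_of_hasDerivAt_zero hcont (fun t ht => by
      obtain ⟨u', hu', hacc⟩ := γ.exists_accel t ht
      have hgd := G.hasDerivAt_g (γ.mem_O t ht) (γ.hasDerivAt ht) (γ.hasDerivAt_field hV i ht) hu'
      have hfd := G.hasDerivAt_f (γ.mem_O t ht) (γ.hasDerivAt ht)
      refine ((hgd.fun_pow 2).fun_mul (hfd.fun_pow 5)).congr_deriv ?_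
      have hF := hne t (Ioo_subset_Icc_self ht)
      have hu1 := γ.unit t (Ioo_subset_Icc_self ht)
      rw [energy] at hu1
      have hq : G.g (x t) (u t) (u t) = (G.f (x t))⁻¹ ^ 2 := by
        field_simp
        linarith
      rw [G.g_symm _ (V i t) (u' + _), hacc, fieldMap_apply]
      simp only [map_add, map_sub, map_neg, map_smul, sub_apply, add_apply, neg_apply, smul_apply,
        smul_eq_mul, hq, G.g_symm _ (u t) (V i t)]
      push_cast
      field_simp
      ring) t ht
    have h2 : G.g (x a) (V i a) (u a) = 0 := h0.perp i
    have h3 : G.g (x t) (V i t) (u t) ^ 2 * G.f (x t) ^ 5 = 0 := by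
      refine Eq.trans h1 ?_
      rw [h2]
      ring
    rcases mul_eq_zero.1 h3 with h4 | h4
    · exact pow_eq_zero_iff (two_ne_zero) |>.1 h4
    · exact absurd (pow_eq_zero_iff (by norm_num) |>.1 h4) (hne t ht)
  refine ⟨fun i j => ?_, fun i => hperp i t ht⟩
  rw [← h0.orth i j]
  refine eq_left_of_hasDerivAt_zero (h := fun t => G.f (x t) * G.g (x t) (V i t) (V j t))
    (hf.mul (G.continuousOn_g_comp hxc (hVc i) (hVc j) γ.mem_U)) (fun t ht => ?_) t ht
  have hgd := G.hasDerivAt_g (γ.mem_O t ht) (γ.hasDerivAt ht) (γ.hasDerivAt_field hV i ht)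
    (γ.hasDerivAt_field hV j ht)
  have hfd := G.hasDerivAt_f (γ.mem_O t ht) (γ.hasDerivAt ht)
  refine (hfd.fun_mul hgd).congr_deriv ?_
  have hF := hne t (Ioo_subset_Icc_self ht)
  have hi := hperp i t (Ioo_subset_Icc_self ht)
  have hj := hperp j t (Ioo_subset_Icc_self ht)
  rw [fieldMap_apply, fieldMap_apply]
  simp only [map_add, map_sub, map_neg, map_smul, sub_apply, add_apply, neg_apply, smul_apply,
    smul_eq_mul, hi, G.g_symm _ (u t) (V j t), hj]
  field_simp
  ring

end Geodesic

end WeightedMetric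
end

noncomputable section
open scoped Topology

/-! ### The second variation -/

namespace WeightedMetric

open Filter MeasureTheory

variable {E : Type*} [NormedAddCommGroup E] [NormedSpace ℝ E] {U O : Set E}
  {G : WeightedMetric U O}

lemma dΓ_symm {y : E} (hy : y ∈ O) (w a b : E) : G.dΓ y w a b = G.dΓ y w b a := by
  have hy' : y + (0 : ℝ) • w ∈ O := by simpa using hy
  have h1 := G.hasDerivAt_Γ hy' (hasDerivAt_line y w) (hasDerivAt_const 0 a)
    (hasDerivAt_const 0 b)
  have h2 := G.hasDerivAt_Γ hy' (hasDerivAt_line y w) (hasDerivAt_const 0 b)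
    (hasDerivAt_const 0 a)
  simp only [G.Γ_symm _ b a] at h2
  simpa using h1.unique h2

variable (G) in
/-- The second derivative of half the energy density along a variation with field `V` and
acceleration `W`, at a point of a curve with velocity `u`. -/
def secondEnergy (y u V V₁ W W₁ : E) : ℝ :=
  (G.df y V ^ 2 + G.f y * (G.ddf y V V + G.df y W)) * G.g y u u +
    4 * (G.f y * G.df y V) * G.g y (V₁ + G.Γ y V u) u +
    G.f y ^ 2 * (G.g y (W₁ + (G.dΓ y V V u + G.Γ y W u + G.Γ y V V₁) +
      G.Γ y V (V₁ + G.Γ y V u)) u + G.g y (V₁ + G.Γ y V u) (V₁ + G.Γ y V u))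

lemma Variation.e₂_zero {a b : ℝ} (γ : Variation U O a b) (t : ℝ) :
    γ.e₂ G 0 t = G.secondEnergy (γ.x t) (γ.u t) (γ.V t) (γ.V₁ t) (γ.W t) (γ.W₁ t) := by
  simp only [Variation.e₂, Variation.P₁, Variation.P₂, Variation.c_zero, Variation.cs_zero,
    Variation.p_zero, Variation.ps_zero, secondEnergy]

variable (G) in
/-- The term that the second variation contributes at an end of the curve. -/
def endTerm (y u : E) (V W : Fin 2 → E) : ℝ :=
  ∑ i, G.f y ^ 2 * G.g y (W i + G.Γ y (V i) (V i)) u - G.df y u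

variable (G) in
/-- The positivity of `Ric(f u, f u) - f⁻¹ Δf + ½ |∇ ln f|²` for the unit vectors `f u`, divided by
`f` and expanded in a frame `V 0`, `V 1`, `u`. -/
def IsPositive : Prop :=
  ∀ y ∈ O, ∀ u V, G.energy y u = 1 → G.IsFrame y u V →
    0 < G.f y ^ 2 * ∑ i, G.g y (G.curv y (V i) u u) (V i) - (G.f y)⁻¹ * ∑ i, G.hess y (V i) (V i)
      - G.hess y u u + 1 / 2 * (G.f y)⁻¹ ^ 3 *
        (G.f y * ∑ i, G.df y (V i) ^ 2 + G.f y ^ 2 * G.df y u ^ 2)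

/-- A vector of unit length for `f² g` has length `f⁻¹` for `g`. -/
lemma g_unit {y u : E} (hy : y ∈ U) (hu : G.energy y u = 1) : G.g y u u = (G.f y)⁻¹ ^ 2 := by
  have := (G.f_pos y hy).ne'
  rw [energy] at hu
  field_simp
  linarith

/-- For the variation fields of a frame, the second derivative of half the energy density is the
derivative of `f² g(W + Γ(V, V), u)` up to terms without second derivatives of the variation. -/
lemma secondEnergy_fieldMap {y u V : E} (hy : y ∈ O) (hu : G.energy y u = 1)
    (hVV : G.f y * G.g y V V = 1) (hVu : G.g y V u = 0) (W W₁ : E) :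
    G.secondEnergy y u V (G.fieldMap y u V) W W₁ =
      G.f y ^ 2 * G.g y (W₁ + (G.dΓ y u V V + G.Γ y (G.fieldMap y u V) V +
        G.Γ y V (G.fieldMap y u V)) + G.Γ y u (W + G.Γ y V V)) u +
      (G.f y)⁻¹ * G.df y (W + G.Γ y V V) +
      (-2 * (G.f y)⁻¹ ^ 2 * G.df y V ^ 2 + (G.f y)⁻¹ * G.hess y V V +
        1 / 4 * G.df y u ^ 2 * (G.f y)⁻¹ - G.f y ^ 2 * G.g y (G.curv y V u u) V) := by
  have hU := G.O_subset hy
  have hf := (G.f_pos y hU).ne'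
  have hq := G.g_unit hU hu
  have hVV' : G.g y V V = (G.f y)⁻¹ := by field_simp; linarith
  have hP₁ : G.fieldMap y u V + G.Γ y V u =
      -(1 / 2 * (G.df y u / G.f y)) • V - (G.df y V / G.f y) • u := by
    rw [fieldMap_apply, G.Γ_symm y V u]
    simp only [neg_smul]
    abel
  -- The two orders of the second derivatives differ by a curvature term.
  have hR := G.curv_skew hy V u u V
  have hP₂ : W₁ + (G.dΓ y V V u + G.Γ y W u + G.Γ y V (G.fieldMap y u V)) +
      G.Γ y V (G.fieldMap y u V + G.Γ y V u) =
      (W₁ + (G.dΓ y u V V + G.Γ y (G.fieldMap y u V) V +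
        G.Γ y V (G.fieldMap y u V)) + G.Γ y u (W + G.Γ y V V)) + G.curv y V u V := by
    rw [curv, dΓ_symm hy V V u, G.Γ_symm y W u, G.Γ_symm y V u,
      G.Γ_symm y (G.fieldMap y u V) V]
    simp only [map_add]
    abel
  rw [secondEnergy, hP₂, hP₁]
  have hgg : G.g y (-(1 / 2 * (G.df y u / G.f y)) • V - (G.df y V / G.f y) • u)
      (-(1 / 2 * (G.df y u / G.f y)) • V - (G.df y V / G.f y) • u) =
      (1 / 2 * (G.df y u / G.f y)) ^ 2 * (G.f y)⁻¹ + (G.df y V / G.f y) ^ 2 * (G.f y)⁻¹ ^ 2 := by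
    simp only [map_sub, map_smul, sub_apply, smul_apply, smul_eq_mul, hVV', hVu,
      G.g_symm y u V, hq]
    ring
  have hgu : G.g y (-(1 / 2 * (G.df y u / G.f y)) • V - (G.df y V / G.f y) • u) u =
      -(G.df y V / G.f y) * (G.f y)⁻¹ ^ 2 := by
    simp only [map_sub, map_smul, sub_apply, smul_apply, smul_eq_mul, hVu, hq]
    ring
  rw [hgg, hgu, map_add (G.g y) _ (G.curv y V u V), add_apply, hq, hess, map_add (G.df y) W]
  have hR' : G.g y (G.curv y V u V) u = -G.g y (G.curv y V u u) V := by linarith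
  rw [hR']
  field_simp
  ring

namespace Geodesic

variable {x u : ℝ → E} {a b : ℝ} (γ : G.Geodesic x u a b)

include γ

/-- The end term grows faster than the second variation of the energy. -/
lemma exists_hasDerivAt_endTerm (hdim : Module.finrank ℝ E = 3) (hpos : G.IsPositive)
    {V W W₁ : Fin 2 → ℝ → E}
    (hV : ∀ i, ∀ t ∈ Icc a b, HasDerivWithinAt (V i) (G.fieldMap (x t) (u t) (V i t)) (Icc a b) t)
    (hW : ∀ i, ∀ t ∈ Icc a b, HasDerivWithinAt (W i) (W₁ i t) (Icc a b) t)
    {t : ℝ} (ht : t ∈ Ioo a b) (hfr : G.IsFrame (x t) (u t) fun i => V i t) :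
    ∃ B', HasDerivAt (fun t => G.endTerm (x t) (u t) (fun i => V i t) fun i => W i t) B' t ∧
      ∑ i, G.secondEnergy (x t) (u t) (V i t) (G.fieldMap (x t) (u t) (V i t)) (W i t) (W₁ i t)
        < B' := by
  have hO := γ.mem_O t ht
  have hU := γ.mem_U t (Ioo_subset_Icc_self ht)
  have hunit := γ.unit t (Ioo_subset_Icc_self ht)
  have hf := G.f_pos _ hU
  have hf' := hf.ne'
  have hq := G.g_unit hU hunit
  obtain ⟨u', hu', hacc⟩ := γ.exists_accel t ht
  have hx' := γ.hasDerivAt ht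
  have hV' := fun i => γ.hasDerivAt_field hV i ht
  have hW' : ∀ i, HasDerivAt (W i) (W₁ i t) t := fun i =>
    (hW i t (Ioo_subset_Icc_self ht)).hasDerivAt (Icc_mem_nhds ht.1 ht.2)
  have hfd := G.hasDerivAt_f hO hx'
  have hdfd := G.hasDerivAt_df hO hx' hu'
  have hAd : ∀ i, HasDerivAt (fun t => W i t + G.Γ (x t) (V i t) (V i t)) _ t := fun i =>
    (hW' i).fun_add (G.hasDerivAt_Γ hO hx' (hV' i) (hV' i))
  have hgd := fun i => G.hasDerivAt_g hO hx' (hAd i) hu'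
  refine ⟨_, ((HasDerivAt.fun_sum fun i _ => (hfd.fun_pow 2).fun_mul (hgd i))).fun_sub hdfd, ?_⟩
  have hse := fun i => secondEnergy_fieldMap hO hunit (by simpa using hfr.orth i i) (hfr.perp i)
    (W i t) (W₁ i t)
  -- The geodesic equation gives `D_u u` in the frame, and hence `df(D_u u)`.
  have hDu := hfr.expand hdim hunit (u' + G.Γ (x t) (u t) (u t))
  simp only [G.g_symm _ _ (u' + G.Γ (x t) (u t) (u t)), hacc] at hDu
  have hdfDu : G.df (x t) (u' + G.Γ (x t) (u t) (u t)) =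
      (G.f (x t))⁻¹ ^ 2 * ∑ i, G.df (x t) (V i t) ^ 2 - (G.f (x t))⁻¹ * G.df (x t) (u t) ^ 2 := by
    rw [hDu]
    simp only [map_add, map_smul, smul_eq_mul, G.g_symm _ (u t) (V _ t), hfr.perp, hq,
      Fin.sum_univ_two]
    field_simp
    ring
  have hP := hpos _ hO _ _ hunit hfr
  simp only [hse, G.g_symm _ (_ + G.Γ (x t) (V _ t) (V _ t)) (u' + G.Γ (x t) (u t) (u t)), hacc]
  -- The difference of the two sides is the positive quantity of `IsPositive` plus
  -- `½ f⁻² ∑ df(Vᵢ)²`.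
  have hφ : 0 ≤ ∑ i, G.df (x t) (V i t) ^ 2 := Finset.sum_nonneg fun i _ => sq_nonneg _
  have hddf : G.ddf (x t) (u t) (u t) + G.df (x t) u' =
      G.hess (x t) (u t) (u t) + G.df (x t) (u' + G.Γ (x t) (u t) (u t)) := by
    rw [hess, map_add]; ring
  rw [hddf, hdfDu]
  simp only [G.g_symm _ (u t) (W _ t + _)]
  rw [← sub_pos] at hP ⊢
  have hpos2 : 0 < (G.f (x t))⁻¹ ^ 2 := by positivity
  have := mul_nonneg hpos2.le hφ
  simp only [Fin.sum_univ_two] at hP hφ this ⊢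
  refine lt_of_lt_of_eq (add_pos_of_pos_of_nonneg hP (by linarith :
    0 ≤ 1 / 2 * ((G.f (x t))⁻¹ ^ 2 * (G.df (x t) (V 0 t) ^ 2 + G.df (x t) (V 1 t) ^ 2)))) ?_
  push_cast
  field_simp
  ring

end Geodesic

end WeightedMetric
end

noncomputable section
open scoped Topology

/-! ### Variations that stay in the half-space -/

section Domination

open Filter Asymptotics

/-- A function that vanishes at those ends of an interval at which the positive function `y`
vanishes to first order is dominated by `y`. -/
lemma exists_abs_le_mul {y v : ℝ → ℝ} {a b : ℝ}
    (hy : ContinuousOn y (Icc a b)) (hv : ContinuousOn v (Icc a b))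
    (hpos : ∀ t ∈ Icc a b, 0 ≤ y t)
    (hend : ∀ t ∈ Icc a b, y t = 0 → v t = 0 ∧ (∃ v', HasDerivWithinAt v v' (Icc a b) t) ∧
      ∃ y', y' ≠ 0 ∧ HasDerivWithinAt y y' (Icc a b) t) :
    ∃ C, ∀ t ∈ Icc a b, |v t| ≤ C * y t := by
  have hloc : ∀ t ∈ Icc a b, v =O[𝓝[Icc a b] t] y := by
    intro t ht
    rcases (hpos t ht).eq_or_lt with h0 | h0
    · obtain ⟨hvt, ⟨v', hv'⟩, y', hy'0, hy'⟩ := hend t ht h0.symm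
      have hp : Tendsto (fun τ => (τ, t)) (𝓝[Icc a b] t) (𝓝[Icc a b] t ×ˢ pure t) :=
        tendsto_id.prodMk tendsto_const_pure
      have h1 : (fun τ => v τ - v t) =O[𝓝[Icc a b] t] fun τ => τ - t :=
        hv'.isBigO_sub.comp_tendsto hp
      have h2 : (fun τ => τ - t) =O[𝓝[Icc a b] t] fun τ => y τ - y t :=
        (hy'.isTheta_sub hy'0).isBigO_symm.comp_tendsto hp
      simpa [hvt, ← h0] using h1.trans h2
    · have h1 : v =O[𝓝[Icc a b] t] (fun _ => (1 : ℝ)) :=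
        (hv t ht).isBigO_one ℝ
      have h2 : (fun _ => (1 : ℝ)) =O[𝓝[Icc a b] t] y := by
        refine IsBigO.of_bound (2 / y t) ?_
        filter_upwards [(hy t ht).eventually (lt_mem_nhds (half_lt_self h0))] with τ hτ
        rw [norm_one, Real.norm_of_nonneg (by linarith), div_mul_eq_mul_div, le_div_iff₀ h0]
        linarith
      exact h1.trans h2
  have hind : ∃ C, ∀ t ∈ Icc a b, t ∈ Icc a b → |v t| ≤ C * y t := by
    refine isCompact_Icc.induction_on (p := fun s => ∃ C, ∀ t ∈ s, t ∈ Icc a b → |v t| ≤ C * y t)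
      ⟨0, by simp⟩ (fun s t hst ⟨C, hC⟩ => ⟨C, fun τ hτ => hC τ (hst hτ)⟩) ?_ ?_
    · rintro s t ⟨C, hC⟩ ⟨D, hD⟩
      refine ⟨max C D, fun τ hτ hI => ?_⟩
      rcases hτ with hτ | hτ
      · exact (hC τ hτ hI).trans (mul_le_mul_of_nonneg_right (le_max_left _ _) (hpos τ hI))
      · exact (hD τ hτ hI).trans (mul_le_mul_of_nonneg_right (le_max_right _ _) (hpos τ hI))
    · intro t ht
      obtain ⟨C, hC⟩ := (hloc t ht).bound
      refine ⟨_, hC, C, fun τ hτ hI => ?_⟩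
      have h1 : ‖v τ‖ ≤ C * ‖y τ‖ := hτ
      rwa [Real.norm_of_nonneg (hpos τ hI)] at h1
  obtain ⟨C, hC⟩ := hind
  exact ⟨C, fun t ht => hC t ht ht⟩

end Domination

namespace WeightedMetric

open Filter MeasureTheory

variable {E : Type*} [NormedAddCommGroup E] [NormedSpace ℝ E] {U O : Set E}
  {G : WeightedMetric U O} {ℓ : E →L[ℝ] ℝ} {δ : E → E → ℝ}

/-- The half-space on which `ℓ` is nonnegative. -/
abbrev halfSpace (ℓ : E →L[ℝ] ℝ) : Set E := {y | 0 ≤ ℓ y}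

/-- If the fields `V` and `W` are tangent to the boundary where `x` meets it, then the small
variations of `x` stay in the coordinate domain. -/
lemma exists_mem_of_dominated (hδ : G.IsChartDist (halfSpace ℓ) δ)
    (hO : ∀ y ∈ U, 0 < ℓ y → y ∈ O) {x V W : ℝ → E} {a b : ℝ}
    (hx : ContinuousOn x (Icc a b)) (hV : ContinuousOn V (Icc a b))
    (hW : ContinuousOn W (Icc a b)) (hU : ∀ t ∈ Icc a b, x t ∈ U)
    (hpos : ∀ t ∈ Ioo a b, 0 < ℓ (x t)) {C D : ℝ}
    (hVC : ∀ t ∈ Icc a b, |ℓ (V t)| ≤ C * ℓ (x t))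
    (hWD : ∀ t ∈ Icc a b, |ℓ (W t)| ≤ D * ℓ (x t)) :
    ∃ s₀ : ℝ, 0 < s₀ ∧ (∀ s ∈ Icc (-s₀) s₀, ∀ t ∈ Icc a b, x t + s • V t + (s ^ 2 / 2) • W t ∈ U) ∧
      ∀ s ∈ Icc (-s₀) s₀, ∀ t ∈ Ioo a b, x t + s • V t + (s ^ 2 / 2) • W t ∈ O := by
  -- The variations stay near the curve, hence in an open set that cuts out `U` from the
  -- half-space; that they stay in the half-space is the point of the domination hypotheses.
  have hopen : ∃ U' : Set E, IsOpen U' ∧ U ⊆ U' ∧ U' ∩ halfSpace ℓ ⊆ U := by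
    refine ⟨interior (U ∪ (halfSpace ℓ)ᶜ), isOpen_interior, fun y hy => ?_, fun y hy => ?_⟩
    · rw [mem_interior_iff_mem_nhds]
      have := mem_nhdsWithin_iff_eventually.1 (hδ.mem_nhdsWithin y hy)
      filter_upwards [this] with z hz
      by_cases h : z ∈ halfSpace ℓ
      · exact Or.inl (hz h)
      · exact Or.inr h
    · rcases interior_subset hy.1 with h | h
      · exact h
      · exact absurd hy.2 h
  obtain ⟨U', hU'o, hUU', hU'⟩ := hopen
  obtain ⟨ρ, hρ, hρU⟩ := (isCompact_Icc.image_of_continuousOn hx).exists_thickening_subset_open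
    hU'o (by rintro _ ⟨t, ht, rfl⟩; exact hUU' (hU t ht))
  obtain ⟨B₁, hB₁⟩ := isCompact_Icc.exists_bound_of_continuousOn hV
  obtain ⟨B₂, hB₂⟩ := isCompact_Icc.exists_bound_of_continuousOn hW
  have hlim1 : Tendsto (fun s : ℝ => |s| * B₁ + s ^ 2 / 2 * B₂) (𝓝 0) (𝓝 0) := by
    have : Continuous fun s : ℝ => |s| * B₁ + s ^ 2 / 2 * B₂ := by fun_prop
    simpa using this.tendsto 0
  have hlim2 : Tendsto (fun s : ℝ => |s| * C + s ^ 2 / 2 * D) (𝓝 0) (𝓝 0) := by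
    have : Continuous fun s : ℝ => |s| * C + s ^ 2 / 2 * D := by fun_prop
    simpa using this.tendsto 0
  obtain ⟨s₀, hs₀, hs⟩ := Metric.eventually_nhds_iff_ball.1
    ((hlim1.eventually (gt_mem_nhds hρ)).and (hlim2.eventually (gt_mem_nhds one_pos)))
  have hmem : ∀ s ∈ Icc (-(s₀ / 2)) (s₀ / 2), s ∈ Metric.ball (0 : ℝ) s₀ := fun s hs => by
    rw [mem_ball_zero_iff, Real.norm_eq_abs]
    exact (abs_le.2 hs).trans_lt (half_lt_self hs₀)
  have hℓ : ∀ s ∈ Icc (-(s₀ / 2)) (s₀ / 2), ∀ t ∈ Icc a b,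
      (1 - (|s| * C + s ^ 2 / 2 * D)) * ℓ (x t) ≤ ℓ (x t + s • V t + (s ^ 2 / 2) • W t) := by
    intro s hs' t ht
    simp only [map_add, map_smul, smul_eq_mul]
    have h1 : |s * ℓ (V t)| ≤ |s| * (C * ℓ (x t)) := by
      rw [abs_mul]
      exact mul_le_mul_of_nonneg_left (hVC t ht) (abs_nonneg s)
    have h2 : |s ^ 2 / 2 * ℓ (W t)| ≤ s ^ 2 / 2 * (D * ℓ (x t)) := by
      rw [abs_mul, abs_of_nonneg (by positivity : 0 ≤ s ^ 2 / 2)]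
      exact mul_le_mul_of_nonneg_left (hWD t ht) (by positivity)
    have h3 := (abs_le.1 h1).1
    have h4 := (abs_le.1 h2).1
    linarith
  have hmU : ∀ s ∈ Icc (-(s₀ / 2)) (s₀ / 2), ∀ t ∈ Icc a b,
      x t + s • V t + (s ^ 2 / 2) • W t ∈ U := by
    intro s hs' t ht
    obtain ⟨h1, h2⟩ := hs s (hmem s hs')
    refine hU' ⟨hρU (Metric.mem_thickening_iff.2 ⟨x t, mem_image_of_mem _ ht, ?_⟩), ?_⟩
    · rw [dist_eq_norm, show x t + s • V t + (s ^ 2 / 2) • W t - x t =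
        s • V t + (s ^ 2 / 2) • W t by abel]
      refine (norm_add_le _ _).trans_lt (lt_of_le_of_lt ?_ h1)
      rw [norm_smul, norm_smul, Real.norm_eq_abs, Real.norm_of_nonneg (by positivity)]
      exact add_le_add (mul_le_mul_of_nonneg_left (hB₁ t ht) (abs_nonneg s))
        (mul_le_mul_of_nonneg_left (hB₂ t ht) (by positivity))
    · exact (mul_nonneg (by linarith) (hδ.subset (hU t ht))).trans (hℓ s hs' t ht)
  refine ⟨s₀ / 2, by positivity, hmU, fun s hs' t ht => ?_⟩
  have ht' := Ioo_subset_Icc_self ht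
  exact hO _ (hmU s hs' t ht') ((mul_pos (by linarith [(hs s (hmem s hs')).2])
    (hpos t ht)).trans_le (hℓ s hs' t ht'))

variable (G) in
/-- The condition that is carried along the geodesic: `V` is a frame, and the sum of the values of
`ϕ` at the points `y ± s V i + ½ s² W i` exceeds `4 t` by at most `s²` times the end term minus
`κ`, up to a small error. -/
structure Barrier (ϕ : E → ℝ) (t κ : ℝ) (y u : E) (V W : Fin 2 → E) : Prop where
  isFrame : G.IsFrame y u V
  eventually_le : ∀ ε > 0, ∀ᶠ s in 𝓝 (0 : ℝ),
    ∑ i, (ϕ (y + s • V i + (s ^ 2 / 2) • W i) + ϕ (y + (-s) • V i + ((-s) ^ 2 / 2) • W i)) ≤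
      4 * t + s ^ 2 * (G.endTerm y u V W - κ + ε)

/-- Along a geodesic the constant `κ` increases, by the second variation. The acceleration of the
variation is interpolated linearly between its given value and zero. -/
lemma Geodesic.exists_barrier [FiniteDimensional ℝ E] {x u : ℝ → E} {a b : ℝ}
    (γ : G.Geodesic x u a b)
    (hδ : G.IsChartDist (halfSpace ℓ) δ) (hO : ∀ y ∈ U, 0 < ℓ y → y ∈ O)
    (hO' : ∀ y ∈ O, 0 < ℓ y)
    (hdim : Module.finrank ℝ E = 3) (hpos : G.IsPositive) {C : ℝ} (hC : 0 < C)
    (hbound : ∀ t ∈ Icc a b, ∀ v, ‖G.fieldMap (x t) (u t) v‖ ≤ C * ‖v‖)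
    (hlen : b - a ≤ 1 / (2 * C)) {ϕ : E → ℝ} (hϕ : ∀ y ∈ U, ∀ z ∈ U, ϕ z ≤ ϕ y + δ y z)
    (htrans : ∀ t ∈ Icc a b, ℓ (x t) = 0 → ℓ (u t) ≠ 0 ∧ ∀ v, G.g (x t) v (u t) = 0 → ℓ v = 0)
    {V₀ W₀ : Fin 2 → E} (hW₀ : ℓ (x a) = 0 → W₀ = 0) {κ : ℝ}
    (hbar : G.Barrier ϕ a κ (x a) (u a) V₀ W₀) :
    ∃ V, ∃ κ' > κ, G.Barrier ϕ b κ' (x b) (u b) V 0 := by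
  have : CompleteSpace E := FiniteDimensional.complete ℝ E
  have hab := γ.lt
  have hxc := γ.continuousOn_x
  have hpos0 : ∀ t ∈ Icc a b, 0 ≤ ℓ (x t) := fun t ht => hδ.subset (γ.mem_U t ht)
  have hℓx : ∀ t ∈ Icc a b, HasDerivWithinAt (fun t => ℓ (x t)) (ℓ (u t)) (Icc a b) t :=
    fun t ht => ℓ.hasFDerivAt.comp_hasDerivWithinAt t (γ.hasDeriv t ht)
  choose V hVa hV using fun i => exists_solution_of_linear hab.le hC hbound
    (fun v => continuousOn_fieldMap (G := G) hxc γ.continuousOn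
      (continuousOn_const (c := v)) γ.mem_U) hlen (V₀ i)
  have hVc := fun i => γ.continuousOn_field hV i
  have hfr : ∀ t ∈ Icc a b, G.IsFrame (x t) (u t) fun i => V i t := fun t ht =>
    γ.isFrame hV (by simpa only [hVa] using hbar.isFrame) ht
  -- The acceleration vanishes at time `b`, so that at the final end of the whole curve the varied
  -- points, which move in tangential directions, lie on the boundary.
  set W : Fin 2 → ℝ → E := fun i t => ((b - t) / (b - a)) • W₀ i with hWdef
  set W₁ : Fin 2 → ℝ → E := fun i _ => (-1 / (b - a)) • W₀ i
  have hba : b - a ≠ 0 := (sub_pos.2 hab).ne'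
  have hW : ∀ i, ∀ t ∈ Icc a b, HasDerivWithinAt (W i) (W₁ i t) (Icc a b) t := fun i t _ =>
    ((((hasDerivAt_id' t).const_sub b).div_const (b - a)).smul_const (W₀ i)).hasDerivWithinAt
  have hWa : ∀ i, W i a = W₀ i := fun i => by simp [hWdef, hba]
  have hWb : ∀ i, W i b = 0 := fun i => by simp [hWdef]
  have hWc : ∀ i, ContinuousOn (W i) (Icc a b) := fun i t ht => (hW i t ht).continuousWithinAt
  have hℓW : ∀ i t, ℓ (W i t) = (b - t) / (b - a) * ℓ (W₀ i) := fun i t => by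
    simp [hWdef]
  have hWD : ∀ i, ∃ D, ∀ t ∈ Icc a b, |ℓ (W i t)| ≤ D * ℓ (x t) := fun i => by
    refine exists_abs_le_mul (v := fun t => ℓ (W i t)) (ℓ.continuous.comp_continuousOn hxc)
      (ℓ.continuous.comp_continuousOn (hWc i)) hpos0 fun t ht h0 => ⟨?_, ⟨_,
        ℓ.hasFDerivAt.comp_hasDerivWithinAt t (hW i t ht)⟩, _, (htrans t ht h0).1, hℓx t ht⟩
    rcases ht.1.eq_or_lt with rfl | h1
    · simp [hWdef, hW₀ h0]
    rcases ht.2.eq_or_lt with rfl | h2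
    · simp [hWb]
    · exact absurd h0 (hO' _ (γ.mem_O t ⟨h1, h2⟩)).ne'
  have hVD : ∀ i, ∃ D, ∀ t ∈ Icc a b, |ℓ (V i t)| ≤ D * ℓ (x t) := fun i =>
    exists_abs_le_mul (v := fun t => ℓ (V i t)) (ℓ.continuous.comp_continuousOn hxc)
      (ℓ.continuous.comp_continuousOn (hVc i)) hpos0 fun t ht h0 =>
        ⟨(htrans t ht h0).2 _ ((hfr t ht).perp i), ⟨_,
        ℓ.hasFDerivAt.comp_hasDerivWithinAt t (hV i t ht)⟩, _, (htrans t ht h0).1, hℓx t ht⟩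
  choose D hD using hWD
  choose D' hD' using hVD
  choose s₀ hs₀ hmU hmO using fun i => exists_mem_of_dominated hδ hO hxc (hVc i) (hWc i) γ.mem_U
    (fun t ht => hO' _ (γ.mem_O t ht)) (hD' i) (hD i)
  let Φ : Fin 2 → Variation U O a b := fun i =>
    { x := x, u := u, V := V i, V₁ := fun t => G.fieldMap (x t) (u t) (V i t), W := W i,
      W₁ := W₁ i, lt := hab, hasDeriv_x := γ.hasDeriv, hasDeriv_V := hV i, hasDeriv_W := hW i,
      continuousOn_u := γ.continuousOn,
      continuousOn_V₁ := continuousOn_fieldMap hxc γ.continuousOn (hVc i) γ.mem_U,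
      continuousOn_W₁ := continuousOn_const, s₀ := s₀ i, s₀_pos := hs₀ i, mem_U := hmU i,
      mem_O := hmO i }
  set B : ℝ → ℝ := fun t => G.endTerm (x t) (u t) (fun i => V i t) fun i => W i t with hB
  set e : Fin 2 → ℝ → ℝ := fun i t => (Φ i).e₂ G 0 t
  have hec : ∀ i, ContinuousOn (e i) (Icc a b) := fun i =>
    (Φ i).continuousOn_slice ((Φ i).continuousOn_e₂ G) (Φ i).zero_mem
  have hei : ∀ i, IntervalIntegrable (e i) volume a b := fun i =>
    (hec i).intervalIntegrable_of_Icc hab.le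
  have hBc : ContinuousOn B (Icc a b) := by
    refine (continuousOn_finsetSum _ fun i _ => ?_).sub
      (G.continuousOn_df_comp hxc γ.continuousOn γ.mem_U)
    exact ((G.continuousOn_f_comp hxc γ.mem_U).pow 2).mul (G.continuousOn_g_comp hxc
      ((hWc i).add (G.continuousOn_Γ_comp hxc (hVc i) (hVc i) γ.mem_U)) γ.continuousOn γ.mem_U)
  -- The gain in `κ` is the difference between the growth of the end term and the second variation.
  have hlt : ∑ i, ∫ t in a..b, e i t < B b - B a := by
    rw [← intervalIntegral.integral_finsetSum fun i _ => hei i]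
    have hsc : ContinuousOn (fun t => ∑ i, e i t) (Icc a b) :=
      continuousOn_finsetSum _ fun i _ => hec i
    have hint : ContinuousOn (fun z => ∫ t in a..z, ∑ i, e i t) (Icc a b) := by
      have := intervalIntegral.continuousOn_primitive_interval (μ := volume) (a := a) (b := b)
        (f := fun t => ∑ i, e i t) (by rw [uIcc_of_le hab.le]; exact hsc.integrableOn_Icc)
      rwa [uIcc_of_le hab.le] at this
    have hanti : StrictMonoOn (fun z => B z - ∫ t in a..z, ∑ i, e i t) (Icc a b) := by
      refine strictMonoOn_of_deriv_pos (convex_Icc a b) (hBc.sub hint) fun t ht => ?_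
      rw [interior_Icc] at ht
      obtain ⟨B', hB', hlt⟩ := γ.exists_hasDerivAt_endTerm hdim hpos hV hW ht
        (hfr t (Ioo_subset_Icc_self ht))
      have h1 : HasDerivAt (fun z => ∫ t in a..z, ∑ i, e i t) (∑ i, e i t) t := by
        have hnh : Icc a b ∈ 𝓝 t := Icc_mem_nhds ht.1 ht.2
        refine intervalIntegral.integral_hasDerivAt_right ?_ ?_ (hsc.continuousAt hnh)
        · exact (hsc.mono (Icc_subset_Icc_right ht.2.le)).intervalIntegrable_of_Icc ht.1.le
        · exact hsc.stronglyMeasurableAtFilter_nhdsWithin measurableSet_Icc t |>.filter_mono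
            (by rw [nhdsWithin_eq_nhds.2 hnh])
      rw [(hB'.fun_sub h1).deriv, sub_pos]
      refine lt_of_eq_of_lt (Finset.sum_congr rfl fun i _ => ?_) hlt
      exact (Φ i).e₂_zero t
    have := hanti (left_mem_Icc.2 hab.le) (right_mem_Icc.2 hab.le) hab
    simp only [intervalIntegral.integral_same, sub_zero] at this
    linarith
  refine ⟨fun i => V i b, κ + (B b - B a - ∑ i, ∫ t in a..b, e i t), by linarith,
    hfr b (right_mem_Icc.2 hab.le), fun ε hε => ?_⟩
  have hBa : G.endTerm (x a) (u a) V₀ W₀ = B a := by simp only [hB, hVa, hWa]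
  have hBb : G.endTerm (x b) (u b) (fun i => V i b) 0 = B b := by
    simp only [hB, hWb]; rfl
  have hev := fun i => (Φ i).eventually_dist_add_dist_le G hδ γ.unit (ε := ε / 4) (by positivity)
  filter_upwards [hbar.eventually_le (ε / 4) (by positivity), hev 0, hev 1,
    (Φ 0).eventually_mem, (Φ 1).eventually_mem] with s h1 h20 h21 hs0 hs1
  have hmem : ∀ i, s ∈ Icc (-s₀ i) (s₀ i) := Fin.forall_fin_two.2 ⟨hs0, hs1⟩
  have hmem' : ∀ i, -s ∈ Icc (-s₀ i) (s₀ i) := fun i =>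
    ⟨by linarith [(hmem i).2], by linarith [(hmem i).1]⟩
  -- By the triangle inequality `ϕ` grows at most by the distance of the ends of the varied curve.
  have hstep : ∀ i, ∀ σ ∈ Icc (-s₀ i) (s₀ i), ϕ (x b + σ • V i b + (σ ^ 2 / 2) • (0 : E)) ≤
      ϕ (x a + σ • V₀ i + (σ ^ 2 / 2) • W₀ i) + δ ((Φ i).c σ a) ((Φ i).c σ b) := by
    intro i σ hσ
    have := hϕ _ (hmU i σ hσ a (left_mem_Icc.2 hab.le)) _ (hmU i σ hσ b (right_mem_Icc.2 hab.le))
    rw [hVa, hWa, hWb] at this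
    simpa only [Variation.c, Φ, hVa, hWa, hWb] using this
  rw [hBa] at h1
  rw [hBb]
  have e0 := hstep 0 s (hmem 0)
  have e1 := hstep 1 s (hmem 1)
  have e2 := hstep 0 (-s) (hmem' 0)
  have e3 := hstep 1 (-s) (hmem' 1)
  simp only [Fin.sum_univ_two, Pi.zero_apply] at h1 ⊢
  have h20' : _ ≤ 2 * (b - a) + s ^ 2 * ((∫ t in a..b, e 0 t) + ε / 4) := h20
  have h21' : _ ≤ 2 * (b - a) + s ^ 2 * ((∫ t in a..b, e 1 t) + ε / 4) := h21
  nlinarith [sq_nonneg s]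

end WeightedMetric
end

noncomputable section
open scoped Topology

/-! ### Change of coordinates -/

section TaylorCurve

open Filter

variable {E : Type*} [NormedAddCommGroup E] [NormedSpace ℝ E]

/-- Taylor's formula of second order for a map along a curve `s ↦ y + s V + ½ s² W`. -/
lemma eventually_norm_comp_quadratic_sub_le {τ : E → E} {y : E} (hτ : ContDiffAt ℝ 2 τ y)
    (V W : E) {ε : ℝ} (hε : 0 < ε) : ∀ᶠ s in 𝓝 (0 : ℝ),
      ‖τ (y + s • V + (s ^ 2 / 2) • W) - (τ y + s • fderiv ℝ τ y V + (s ^ 2 / 2) •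
        (fderiv ℝ (fderiv ℝ τ) y V V + fderiv ℝ τ y W))‖ ≤ ε * s ^ 2 := by
  set c : ℝ → E := fun s => y + s • V + (s ^ 2 / 2) • W with hc
  have hcd : ∀ s, HasDerivAt c (V + s • W) s := fun s =>
    WeightedMetric.Variation.hasDerivAt_quadratic y V W s
  have hc0 : c 0 = y := by simp [hc]
  have hcc : ContinuousAt c 0 := (hcd 0).continuousAt
  have hev : ∀ᶠ z in 𝓝 y, ContDiffAt ℝ 2 τ z := hτ.eventually (by simp)
  have hdd : HasFDerivAt (fderiv ℝ τ) (fderiv ℝ (fderiv ℝ τ) y) (c 0) := by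
    rw [hc0]
    exact ((hτ.fderiv_right (m := 1) (by norm_num)).differentiableAt (by simp)).hasFDerivAt
  have h1 : HasDerivAt (fun s => fderiv ℝ τ (c s) (V + s • W))
      (fderiv ℝ (fderiv ℝ τ) y V V + fderiv ℝ τ y W) 0 := by
    have ha : HasDerivAt (fun s => fderiv ℝ τ (c s)) (fderiv ℝ (fderiv ℝ τ) y V) 0 := by
      have := HasFDerivAt.comp_hasDerivAt (f := c) (0 : ℝ) hdd (hcd 0)
      rw [zero_smul, add_zero] at this
      exact this
    have hb : HasDerivAt (fun s : ℝ => V + s • W) W 0 := by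
      simpa using ((hasDerivAt_id' (0 : ℝ)).smul_const W).const_add V
    have := ha.clm_apply hb
    simpa [hc0] using this
  have h2 : ∀ᶠ s in 𝓝 (0 : ℝ), ‖fderiv ℝ τ (c s) (V + s • W) - fderiv ℝ τ y V -
      s • (fderiv ℝ (fderiv ℝ τ) y V V + fderiv ℝ τ y W)‖ ≤ ε * ‖s‖ := by
    have := (hasDerivAt_iff_isLittleO_nhds_zero.1 h1).def hε
    filter_upwards [this] with s hs
    simpa [hc0] using hs
  have h3 : ∀ᶠ s in 𝓝 (0 : ℝ), ContDiffAt ℝ 2 τ (c s) :=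
    hcc.eventually (by rw [hc0]; exact hev)
  obtain ⟨ρ, hρ, hball⟩ := Metric.eventually_nhds_iff_ball.1 (h2.and h3)
  filter_upwards [Metric.ball_mem_nhds (0 : ℝ) hρ] with s hs
  set r : ℝ → E := fun s => τ (c s) - (τ y + s • fderiv ℝ τ y V + (s ^ 2 / 2) •
        (fderiv ℝ (fderiv ℝ τ) y V V + fderiv ℝ τ y W)) with hr
  have hseg : ∀ σ ∈ segment ℝ 0 s, ‖σ‖ ≤ ‖s‖ := by
    rintro _ ⟨α, β, hα, hβ, hαβ, rfl⟩
    rw [smul_zero, zero_add, norm_smul, Real.norm_of_nonneg hβ]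
    exact mul_le_of_le_one_left (norm_nonneg s) (by linarith)
  have hrd : ∀ σ ∈ segment ℝ 0 s, HasDerivWithinAt r (fderiv ℝ τ (c σ) (V + σ • W) -
      (fderiv ℝ τ y V + σ • (fderiv ℝ (fderiv ℝ τ) y V V + fderiv ℝ τ y W))) (segment ℝ 0 s) σ := by
    intro σ hσ
    have hσb : σ ∈ Metric.ball (0 : ℝ) ρ := by
      rw [mem_ball_zero_iff] at hs ⊢
      exact (hseg σ hσ).trans_lt hs
    have hd : HasFDerivAt τ (fderiv ℝ τ (c σ)) (c σ) :=
      ((hball σ hσb).2.differentiableAt (by simp)).hasFDerivAt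
    exact ((HasFDerivAt.comp_hasDerivAt (f := c) σ hd (hcd σ)).fun_sub
      (WeightedMetric.Variation.hasDerivAt_quadratic _ _ _ σ)).hasDerivWithinAt
  have hbd := (convex_segment (0 : ℝ) s).norm_image_sub_le_of_norm_hasDerivWithin_le
    (C := ε * ‖s‖) hrd (fun σ hσ => by
      have hσb : σ ∈ Metric.ball (0 : ℝ) ρ := by
        rw [mem_ball_zero_iff] at hs ⊢
        exact (hseg σ hσ).trans_lt hs
      rw [← sub_sub]
      exact (hball σ hσb).1.trans (mul_le_mul_of_nonneg_left (hseg σ hσ) hε.le))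
    (left_mem_segment ℝ 0 s) (right_mem_segment ℝ 0 s)
  have hr0 : r 0 = 0 := by simp [hr, hc0]
  rw [hr0, sub_zero, sub_zero, mul_assoc, Real.norm_eq_abs, abs_mul_abs_self, ← sq] at hbd
  exact hbd

end TaylorCurve

namespace WeightedMetric

open Filter

variable {E : Type*} [NormedAddCommGroup E] [NormedSpace ℝ E] {U O U' O' : Set E}
  {G : WeightedMetric U O} {G' : WeightedMetric U' O'}

variable (G G') in
/-- The map `τ` is an isometry near `y` that respects the weights. -/
structure IsIsometryAt (τ : E → E) (y : E) : Prop where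
  mem : y ∈ O
  mem' : τ y ∈ O'
  contDiffAt : ContDiffAt ℝ 2 τ y
  map_g : ∀ᶠ z in 𝓝 y, ∀ a b, G'.g (τ z) (fderiv ℝ τ z a) (fderiv ℝ τ z b) = G.g z a b
  map_f : ∀ᶠ z in 𝓝 y, G'.f (τ z) = G.f z

namespace IsIsometryAt

variable {τ : E → E} {y : E} (h : G.IsIsometryAt G' τ y)

include h

lemma hasFDerivAt : HasFDerivAt τ (fderiv ℝ τ y) y :=
  (h.contDiffAt.differentiableAt (by simp)).hasFDerivAt

lemma hasDerivAt_line (w : E) : HasDerivAt (fun s : ℝ => τ (y + s • w)) (fderiv ℝ τ y w) 0 := by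
  have h1 : HasFDerivAt τ (fderiv ℝ τ y) (y + (0 : ℝ) • w) := by simpa using h.hasFDerivAt
  exact HasFDerivAt.comp_hasDerivAt (f := fun s : ℝ => y + s • w) (0 : ℝ) h1
    (WeightedMetric.hasDerivAt_line y w)

lemma tendsto_line (w : E) : Tendsto (fun s : ℝ => y + s • w) (𝓝 0) (𝓝 y) := by
  have := (WeightedMetric.hasDerivAt_line y w).continuousAt.tendsto
  simpa using this

lemma map_df (w : E) : G'.df (τ y) (fderiv ℝ τ y w) = G.df y w := by
  have h1 := G'.hasDerivAt_f (c := fun s : ℝ => τ (y + s • w)) (t := 0)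
    (by simpa using h.mem') (h.hasDerivAt_line w)
  have h2 := G.hasDerivAt_f (c := fun s : ℝ => y + s • w) (t := 0) (by simpa using h.mem)
    (WeightedMetric.hasDerivAt_line y w)
  have h3 := h1.congr_of_eventuallyEq (f₁ := fun s : ℝ => G.f (y + s • w))
    (((h.tendsto_line w).eventually h.map_f).mono fun s hs => hs.symm)
  simpa using h3.unique h2

/-- The derivative of the metric coefficients in two coordinate systems. -/
lemma map_deriv_g (w a b : E) :
    G'.g (τ y) (fderiv ℝ (fderiv ℝ τ) y w a + G'.Γ (τ y) (fderiv ℝ τ y w) (fderiv ℝ τ y a))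
        (fderiv ℝ τ y b) +
      G'.g (τ y) (fderiv ℝ τ y a)
        (fderiv ℝ (fderiv ℝ τ) y w b + G'.Γ (τ y) (fderiv ℝ τ y w) (fderiv ℝ τ y b)) =
    G.g y (G.Γ y w a) b + G.g y a (G.Γ y w b) := by
  have hdd : HasFDerivAt (fderiv ℝ τ) (fderiv ℝ (fderiv ℝ τ) y) (y + (0 : ℝ) • w) := by
    rw [zero_smul, add_zero]
    exact ((h.contDiffAt.fderiv_right (m := 1) (by norm_num)).differentiableAt
      (by simp)).hasFDerivAt
  have hD : ∀ a, HasDerivAt (fun s : ℝ => fderiv ℝ τ (y + s • w) a)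
      (fderiv ℝ (fderiv ℝ τ) y w a) 0 := fun a => by
    have := (HasFDerivAt.comp_hasDerivAt (f := fun s : ℝ => y + s • w) (0 : ℝ) hdd
      (WeightedMetric.hasDerivAt_line y w)).clm_apply (hasDerivAt_const 0 a)
    simpa using this
  have h1 := G'.hasDerivAt_g (c := fun s : ℝ => τ (y + s • w)) (t := 0)
    (by simpa using h.mem') (h.hasDerivAt_line w) (hD a) (hD b)
  have h2 := G.hasDerivAt_g (c := fun s : ℝ => y + s • w) (t := 0) (by simpa using h.mem)
    (WeightedMetric.hasDerivAt_line y w) (hasDerivAt_const 0 a) (hasDerivAt_const 0 b)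
  have h3 := h1.congr_of_eventuallyEq (f₁ := fun s : ℝ => G.g (y + s • w) a b)
    (((h.tendsto_line w).eventually h.map_g).mono fun s hs => (hs a b).symm)
  simpa using h3.unique h2

/-- The transformation rule of the Christoffel symbols. -/
lemma map_Γ (w a b : E) :
    G'.g (τ y) (fderiv ℝ (fderiv ℝ τ) y w a + G'.Γ (τ y) (fderiv ℝ τ y w) (fderiv ℝ τ y a))
      (fderiv ℝ τ y b) = G.g y (G.Γ y w a) b := by
  have hsym := h.contDiffAt.isSymmSndFDerivAt (by simp)
  -- The difference of the two sides is symmetric in `w`, `a` and skew-symmetric in `a`, `b`.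
  have key : ∀ w a b, G'.g (τ y) (fderiv ℝ (fderiv ℝ τ) y w a + G'.Γ (τ y) (fderiv ℝ τ y w)
      (fderiv ℝ τ y a)) (fderiv ℝ τ y b) - G.g y (G.Γ y w a) b =
      -(G'.g (τ y) (fderiv ℝ (fderiv ℝ τ) y w b + G'.Γ (τ y) (fderiv ℝ τ y w)
      (fderiv ℝ τ y b)) (fderiv ℝ τ y a) - G.g y (G.Γ y w b) a) := by
    intro w a b
    have := h.map_deriv_g w a b
    rw [G'.g_symm _ (fderiv ℝ τ y a), G.g_symm y a] at this
    linarith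
  have ksym : ∀ w a b, G'.g (τ y) (fderiv ℝ (fderiv ℝ τ) y w a + G'.Γ (τ y) (fderiv ℝ τ y w)
      (fderiv ℝ τ y a)) (fderiv ℝ τ y b) - G.g y (G.Γ y w a) b =
      G'.g (τ y) (fderiv ℝ (fderiv ℝ τ) y a w + G'.Γ (τ y) (fderiv ℝ τ y a)
      (fderiv ℝ τ y w)) (fderiv ℝ τ y b) - G.g y (G.Γ y a w) b := by
    intro w a b
    rw [hsym w a, G'.Γ_symm _ (fderiv ℝ τ y w), G.Γ_symm _ w]
  linarith [key w a b, ksym w b a, key b w a, ksym b a w, key a b w, ksym a w b]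

/-- The transform of a frame is a frame. -/
lemma isFrame {u : E} {V : Fin 2 → E} (hV : G.IsFrame y u V) :
    G'.IsFrame (τ y) (fderiv ℝ τ y u) fun i => fderiv ℝ τ y (V i) := by
  refine ⟨fun i j => ?_, fun i => ?_⟩
  · rw [h.map_f.self_of_nhds, h.map_g.self_of_nhds, hV.orth]
  · rw [h.map_g.self_of_nhds, hV.perp]

/-- The end term of the second variation does not depend on the coordinates. -/
lemma endTerm_eq (u : E) (V W : Fin 2 → E) :
    G'.endTerm (τ y) (fderiv ℝ τ y u) (fun i => fderiv ℝ τ y (V i))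
      (fun i => fderiv ℝ (fderiv ℝ τ) y (V i) (V i) + fderiv ℝ τ y (W i)) = G.endTerm y u V W := by
  rw [endTerm, endTerm, h.map_f.self_of_nhds, h.map_df]
  congr 1
  refine Finset.sum_congr rfl fun i _ => ?_
  rw [add_right_comm, map_add (G'.g (τ y)), add_apply, h.map_Γ, h.map_g.self_of_nhds,
    map_add (G.g y), add_apply, add_comm]

/-- The transform of a barrier is a barrier. -/
lemma exists_barrier {ϕ ϕ' : E → ℝ} {K : ℝ}
    (hϕ : ∀ᶠ z in 𝓝 y, ϕ' (τ z) = ϕ z)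
    (hlip : ∀ᶠ p : E × E in 𝓝 (τ y, τ y), ϕ' p.2 ≤ ϕ' p.1 + K * ‖p.2 - p.1‖)
    {t κ : ℝ} {u : E} {V W : Fin 2 → E} (hbar : G.Barrier ϕ t κ y u V W) :
    ∃ V' W', G'.Barrier ϕ' t κ (τ y) (fderiv ℝ τ y u) V' W' := by
  refine ⟨fun i => fderiv ℝ τ y (V i),
    fun i => fderiv ℝ (fderiv ℝ τ) y (V i) (V i) + fderiv ℝ τ y (W i), h.isFrame hbar.isFrame,
    fun ε hε => ?_⟩
  rw [h.endTerm_eq]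
  set K' := |K| + 1
  have hK'0 : 0 < K' := by positivity
  have hev : ∀ i, ∀ᶠ s in 𝓝 (0 : ℝ), ϕ' (τ y + s • fderiv ℝ τ y (V i) + (s ^ 2 / 2) •
      (fderiv ℝ (fderiv ℝ τ) y (V i) (V i) + fderiv ℝ τ y (W i))) ≤
      ϕ (y + s • V i + (s ^ 2 / 2) • W i) + ε / 8 * s ^ 2 := by
    intro i
    have hc : Tendsto (fun s : ℝ => y + s • V i + (s ^ 2 / 2) • W i) (𝓝 0) (𝓝 y) := by
      have : Continuous fun s : ℝ => y + s • V i + (s ^ 2 / 2) • W i := by fun_prop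
      simpa using this.tendsto 0
    have hc' : Tendsto (fun s : ℝ => τ y + s • fderiv ℝ τ y (V i) + (s ^ 2 / 2) •
        (fderiv ℝ (fderiv ℝ τ) y (V i) (V i) + fderiv ℝ τ y (W i))) (𝓝 0) (𝓝 (τ y)) := by
      have : Continuous fun s : ℝ => τ y + s • fderiv ℝ τ y (V i) + (s ^ 2 / 2) •
        (fderiv ℝ (fderiv ℝ τ) y (V i) (V i) + fderiv ℝ τ y (W i)) := by fun_prop
      simpa using this.tendsto 0
    have hτc : Tendsto (fun s : ℝ => τ (y + s • V i + (s ^ 2 / 2) • W i)) (𝓝 0) (𝓝 (τ y)) :=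
      h.contDiffAt.continuousAt.tendsto.comp hc
    -- The quadratic curve in the new coordinates follows the image of the old one up to `o(s²)`.
    filter_upwards [hc.eventually hϕ, (hτc.prodMk_nhds hc').eventually hlip,
      eventually_norm_comp_quadratic_sub_le h.contDiffAt (V i) (W i)
        (by positivity : 0 < ε / 8 / K')] with s h1 h2 h3
    rw [norm_sub_rev] at h3
    rw [h1] at h2
    refine h2.trans (add_le_add le_rfl ?_)
    calc _ ≤ K' * (ε / 8 / K' * s ^ 2) :=
          mul_le_mul (by linarith [le_abs_self K]) h3 (norm_nonneg _) hK'0.le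
      _ = ε / 8 * s ^ 2 := by field_simp
  have hneg : Tendsto (fun s : ℝ => -s) (𝓝 0) (𝓝 0) := by
    simpa using (continuous_neg (G := ℝ)).tendsto 0
  filter_upwards [hev 0, hev 1, hneg.eventually (hev 0), hneg.eventually (hev 1),
    hbar.eventually_le (ε / 2) (by positivity)] with s h1 h2 h3 h4 h5
  simp only [Fin.sum_univ_two] at h5 ⊢
  nlinarith [sq_nonneg s]

end IsIsometryAt

/-- A function that is 1-Lipschitz for the distance is locally Lipschitz in coordinates. -/
lemma IsChartDist.exists_lipschitz [ProperSpace E] {H : Set E} {δ : E → E → ℝ}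
    (hδ : G.IsChartDist H δ)
    {y : E} (hy : y ∈ O) {ϕ : E → ℝ} (hϕ : ∀ y ∈ U, ∀ z ∈ U, ϕ z ≤ ϕ y + δ y z) :
    ∃ K, ∀ᶠ p : E × E in 𝓝 (y, y), ϕ p.2 ≤ ϕ p.1 + K * ‖p.2 - p.1‖ := by
  obtain ⟨C, hC, ρ, hρ, _, _, h⟩ := hδ.exists_local_estimate (G.O_subset hy)
  obtain ⟨_, _, B, hB, hbd⟩ := G.exists_energy_bounds (isCompact_singleton (x := y))
    (singleton_subset_iff.2 (G.O_subset hy))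
  have hmem : Metric.ball y ρ ∩ O ∈ 𝓝 y :=
    inter_mem (Metric.ball_mem_nhds y hρ) (G.isOpen_O.mem_nhds hy)
  refine ⟨(1 + C * ρ) * B, ?_⟩
  filter_upwards [prod_mem_nhds hmem hmem] with p hp
  have h1 := G.O_subset hp.1.2
  have h2 := G.O_subset hp.2.2
  have h3 := ((h y ⟨Metric.mem_ball_self hρ, G.O_subset hy⟩).2 p.1 ⟨hp.1.1, h1⟩ p.2
    ⟨hp.2.1, h2⟩ ρ hρ (by rw [← dist_eq_norm]; exact (Metric.mem_ball.1 hp.1.1).le)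
    (by rw [← dist_eq_norm]; exact (Metric.mem_ball.1 hp.2.1).le)).2
  have h4 : √(G.energy y (p.2 - p.1)) ≤ B * ‖p.2 - p.1‖ := by
    refine Real.sqrt_le_iff.2 ⟨by positivity, ?_⟩
    rw [mul_pow]
    exact (hbd y rfl _).2
  refine (hϕ _ h1 _ h2).trans (add_le_add le_rfl (h3.trans ?_))
  rw [mul_assoc]
  exact mul_le_mul_of_nonneg_left h4 (by positivity)

end WeightedMetric
end

noncomputable section
open scoped Topology

/-! ### Minimizing curves between parts of the boundary -/

namespace RiemannCoord

open Manifold Filter WeightedMetric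

variable {n : ℕ} [NeZero n] {M : Type*} [TopologicalSpace M]
  [ChartedSpace (EuclideanHalfSpace n) M] [IsManifold (𝓡∂ n) ∞ M]
  [RiemannianBundle (fun x : M => TangentSpace (𝓡∂ n) x)]
  [IsContMDiffRiemannianBundle (𝓡∂ n) ∞ (EuclideanSpace ℝ (Fin n))
    (fun x : M => TangentSpace (𝓡∂ n) x)]
  {f : M → ℝ} {hf : ContMDiff (𝓡∂ n) 𝓘(ℝ, ℝ) ∞ f} {hpos : ∀ p, 0 < f p}

/-- The coordinate that vanishes on the boundary. -/
abbrev normalCoord : EuclideanSpace ℝ (Fin n) →L[ℝ] ℝ := EuclideanSpace.proj 0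

lemma range_eq_halfSpace : range (𝓡∂ n) = halfSpace (normalCoord (n := n)) := range_model

/-- In a chart, the conformal distance has the properties from which geodesics are studied. -/
lemma LengthDist.isChartDist (D : ConformalDist hf hpos) (x₀ : M) :
    (chartMetric x₀ hf hpos).IsChartDist (halfSpace (normalCoord (n := n)))
      fun y z => D.d ((extChartAt (𝓡∂ n) x₀).symm y) ((extChartAt (𝓡∂ n) x₀).symm z) where
  convex := by
    rw [← range_eq_halfSpace]
    exact (𝓡∂ n).convex_range
  isClosed := by
    rw [← range_eq_halfSpace]
    exact (𝓡∂ n).isClosed_range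
  subset := by
    rw [← range_eq_halfSpace]
    exact extChartAt_target_subset_range x₀
  mem_nhdsWithin y hy := by
    rw [← range_eq_halfSpace]
    exact target_mem_nhdsWithin x₀ hy
  le_integral := D.le_integral x₀
  local_lower := D.local_lower x₀
  lipschitz y hy := by
    rw [← range_eq_halfSpace]
    exact exists_lipschitz_energy hf hpos x₀ hy

/-- A curve that realizes the distance `L` of two parts of the boundary, parametrized by arc length
for the conformal metric. -/
structure Minimizer (D : ConformalDist hf hpos) (C₁ C₂ : Set M) (L : ℝ) (γ : ℝ → M) : Prop where
  pos : 0 < L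
  isClosed_left : IsClosed C₁
  isClosed_right : IsClosed C₂
  disjoint : Disjoint C₁ C₂
  union_eq : C₁ ∪ C₂ = (𝓡∂ n).boundary M
  zero_mem : γ 0 ∈ C₁
  end_mem : γ L ∈ C₂
  continuousOn : ContinuousOn γ (Icc 0 L)
  isometric : ∀ s ∈ Icc 0 L, ∀ t ∈ Icc 0 L, D.d (γ s) (γ t) = |s - t|
  notMem : ∀ t ∈ Ioo 0 L, γ t ∉ C₁ ∪ C₂
  le_dist : ∀ p ∈ C₁, ∀ q ∈ C₂, L ≤ D.d p q

/-- The coordinates of a curve in the preferred chart at `x₀`. -/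
abbrev coordCurve (x₀ : M) (γ : ℝ → M) (t : ℝ) : EuclideanSpace ℝ (Fin n) :=
  extChartAt (𝓡∂ n) x₀ (γ t)

/-- The velocity, in the preferred chart at `x₀`, of a curve on `[0, L]`. -/
abbrev coordVel (x₀ : M) (γ : ℝ → M) (L t : ℝ) : EuclideanSpace ℝ (Fin n) :=
  derivWithin (coordCurve (n := n) x₀ γ) (Icc 0 L) t

lemma extChartAt_zero_nonneg (x₀ p : M) : 0 ≤ extChartAt (𝓡∂ n) x₀ p 0 := by
  have : extChartAt (𝓡∂ n) x₀ p ∈ range (𝓡∂ n) := by simp [extChartAt]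
  rw [range_model] at this
  exact this

lemma mem_boundary_iff (x₀ : M) {p : M} (hp : p ∈ (chartAt (EuclideanHalfSpace n) x₀).source) :
    p ∈ (𝓡∂ n).boundary M ↔ extChartAt (𝓡∂ n) x₀ p 0 = 0 := by
  have : IsManifold (𝓡∂ n) 1 M := IsManifold.of_le (n := ∞) (by simp)
  have h1 := (𝓡∂ n).isInteriorPoint_iff_of_mem_atlas (n := 1) one_ne_zero
    (chart_mem_atlas (EuclideanHalfSpace n) x₀) hp
  have hmem : extChartAt (𝓡∂ n) x₀ p ∈ (extChartAt (𝓡∂ n) x₀).target :=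
    (extChartAt (𝓡∂ n) x₀).map_source (by rwa [extChartAt_source])
  have h2 : extChartAt (𝓡∂ n) x₀ p ∈ interior (extChartAt (𝓡∂ n) x₀).target ↔
      0 < extChartAt (𝓡∂ n) x₀ p 0 := by
    refine ⟨fun h => ?_, fun h => mem_interior_iff_mem_nhds.2 (target_mem_nhds x₀ ⟨hmem, h⟩)⟩
    have h3 := interior_mono (extChartAt_target_subset_range x₀) h
    rw [range_model, interior_halfSpace] at h3
    exact h3
  have h4 : p ∈ (𝓡∂ n).boundary M ↔ ¬ (𝓡∂ n).IsInteriorPoint p :=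
    ((𝓡∂ n).isInteriorPoint_iff_not_isBoundaryPoint p).not_left.symm
  rw [h4, h1]
  refine (not_congr h2).trans ?_
  have h5 := extChartAt_zero_nonneg (n := n) x₀ p
  exact ⟨fun h => le_antisymm (not_lt.1 h) h5, fun h => by rw [h]; exact lt_irrefl _⟩

namespace Minimizer

variable {D : ConformalDist hf hpos} {C₁ C₂ : Set M} {L : ℝ} {γ : ℝ → M}
  (hγ : Minimizer D C₁ C₂ L γ)

include hγ

/-- The same curve, run backwards. -/
lemma reverse : Minimizer D C₂ C₁ L fun t => γ (L - t) where
  pos := hγ.pos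
  isClosed_left := hγ.isClosed_right
  isClosed_right := hγ.isClosed_left
  disjoint := hγ.disjoint.symm
  union_eq := by rw [union_comm, hγ.union_eq]
  zero_mem := by simpa using hγ.end_mem
  end_mem := by simpa using hγ.zero_mem
  continuousOn := hγ.continuousOn.comp (by fun_prop) fun t ht =>
    ⟨by linarith [ht.2], by linarith [ht.1]⟩
  isometric s hs t ht := by
    rw [hγ.isometric _ ⟨by linarith [hs.2], by linarith [hs.1]⟩ _
      ⟨by linarith [ht.2], by linarith [ht.1]⟩, abs_sub_comm]
    congr 1
    ring
  notMem t ht := by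
    rw [union_comm]
    exact hγ.notMem _ ⟨by linarith [ht.2], by linarith [ht.1]⟩
  le_dist p hp q hq := by
    rw [D.symm]
    exact hγ.le_dist q hq p hp

lemma continuousOn_coordCurve {x₀ : M} {s : Set ℝ} (hs : s ⊆ Icc 0 L)
    (hsrc : ∀ t ∈ s, γ t ∈ (chartAt (EuclideanHalfSpace n) x₀).source) :
    ContinuousOn (coordCurve (n := n) x₀ γ) s := by
  refine (continuousOn_extChartAt (I := 𝓡∂ n) x₀).comp (hγ.continuousOn.mono hs) fun t ht => ?_
  rw [extChartAt_source]
  exact hsrc t ht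

lemma coordCurve_mem {x₀ : M} {t : ℝ}
    (hsrc : γ t ∈ (chartAt (EuclideanHalfSpace n) x₀).source) :
    coordCurve (n := n) x₀ γ t ∈ (extChartAt (𝓡∂ n) x₀).target :=
  (extChartAt (𝓡∂ n) x₀).map_source (by rwa [extChartAt_source])

lemma symm_coordCurve {x₀ : M} {t : ℝ}
    (hsrc : γ t ∈ (chartAt (EuclideanHalfSpace n) x₀).source) :
    (extChartAt (𝓡∂ n) x₀).symm (coordCurve (n := n) x₀ γ t) = γ t :=
  (extChartAt (𝓡∂ n) x₀).left_inv (by rwa [extChartAt_source])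

lemma coordCurve_pos {x₀ : M} {t : ℝ} (ht : t ∈ Ioo 0 L)
    (hsrc : γ t ∈ (chartAt (EuclideanHalfSpace n) x₀).source) :
    0 < coordCurve (n := n) x₀ γ t 0 := by
  refine lt_of_le_of_ne (extChartAt_zero_nonneg x₀ _) fun h => hγ.notMem t ht ?_
  rw [hγ.union_eq, mem_boundary_iff x₀ hsrc]
  exact h.symm

/-- Minimizing curves are continuously differentiable in charts and have unit speed. -/
lemma regular {x₀ : M} {t : ℝ} (ht : t ∈ Icc 0 L)
    (hsrc : γ t ∈ (chartAt (EuclideanHalfSpace n) x₀).source) :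
    HasDerivWithinAt (coordCurve (n := n) x₀ γ) (coordVel (n := n) x₀ γ L t) (Icc 0 L) t ∧
      ContinuousWithinAt (coordVel (n := n) x₀ γ L) (Icc 0 L) t ∧
      (chartMetric x₀ hf hpos).energy (coordCurve (n := n) x₀ γ t)
        (coordVel (n := n) x₀ γ L t) = 1 := by
  have hnhds : γ ⁻¹' (chartAt (EuclideanHalfSpace n) x₀).source ∈ 𝓝[Icc 0 L] t :=
    (hγ.continuousOn t ht).preimage_mem_nhdsWithin
      ((chartAt (EuclideanHalfSpace n) x₀).open_source.mem_nhds hsrc)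
  obtain ⟨ε, hε, hsub⟩ := Metric.mem_nhdsWithin_iff.1 hnhds
  set α := max 0 (t - ε / 2) with hα
  set β := min L (t + ε / 2) with hβ
  have hαβ : α < β := by
    rw [hα, hβ, max_lt_iff, lt_min_iff, lt_min_iff]
    exact ⟨⟨hγ.pos, by linarith [ht.1]⟩, by linarith [ht.2], by linarith⟩
  have hI : Icc α β ⊆ Icc 0 L := Icc_subset_Icc (le_max_left _ _) (min_le_left _ _)
  have htI : t ∈ Icc α β := ⟨max_le ht.1 (by linarith), le_min ht.2 (by linarith)⟩
  have hIs : ∀ τ ∈ Icc α β, γ τ ∈ (chartAt (EuclideanHalfSpace n) x₀).source := fun τ hτ =>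
    hsub ⟨by
      rw [Metric.mem_ball, Real.dist_eq, abs_lt]
      constructor
      · linarith [(le_max_right 0 (t - ε / 2)).trans hτ.1]
      · linarith [hτ.2.trans (min_le_right L (t + ε / 2))], hI hτ⟩
  have hmem : Icc α β ∈ 𝓝[Icc 0 L] t := by
    filter_upwards [self_mem_nhdsWithin, mem_nhdsWithin_of_mem_nhds
      (Icc_mem_nhds (show t - ε / 2 < t by linarith) (show t < t + ε / 2 by linarith))] with τ h1 h2
    exact ⟨max_le h1.1 h2.1, le_min h1.2 h2.2⟩
  obtain ⟨h1, h2, h3⟩ := (D.isChartDist x₀).hasDerivWithinAt_of_isometric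
    (hγ.continuousOn_coordCurve hI hIs) (fun τ hτ => hγ.coordCurve_mem (hIs τ hτ))
    (fun s hs τ hτ => by
      rw [hγ.symm_coordCurve (hIs s hs), hγ.symm_coordCurve (hIs τ hτ)]
      exact hγ.isometric s (hI hs) τ (hI hτ)) hαβ
  have huniq := uniqueDiffOn_Icc hγ.pos
  have heq : ∀ᶠ τ in 𝓝[Icc 0 L] t, coordVel (n := n) x₀ γ L τ =
      derivWithin (coordCurve (n := n) x₀ γ) (Icc α β) τ := by
    have := eventually_eventually_nhdsWithin.2 hmem
    filter_upwards [this, hmem, self_mem_nhdsWithin] with τ hτ hτI hτL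
    exact ((h2 τ hτI).mono_of_mem_nhdsWithin hτ).derivWithin (huniq τ hτL)
  have het := heq.self_of_nhdsWithin ht
  rw [het]
  refine ⟨(h2 t htI).mono_of_mem_nhdsWithin hmem, ?_, h3 t htI⟩
  exact ((h1 t htI).mono_of_mem_nhdsWithin hmem).congr_of_eventuallyEq heq het

variable {x₀ : M} {a b : ℝ}

/-- Minimizing curves are geodesics. -/
lemma geodesic (ha : 0 ≤ a) (hab : a < b) (hb : b ≤ L)
    (hsrc : ∀ t ∈ Icc a b, γ t ∈ (chartAt (EuclideanHalfSpace n) x₀).source) :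
    (chartMetric x₀ hf hpos).Geodesic (coordCurve (n := n) x₀ γ) (coordVel (n := n) x₀ γ L)
      a b := by
  have hI : Icc a b ⊆ Icc 0 L := Icc_subset_Icc ha hb
  have hx : ∀ t ∈ Icc a b, HasDerivWithinAt (coordCurve (n := n) x₀ γ)
      (coordVel (n := n) x₀ γ L t) (Icc a b) t :=
    fun t ht => (hγ.regular (hI ht) (hsrc t ht)).1.mono hI
  have hu : ContinuousOn (coordVel (n := n) x₀ γ L) (Icc a b) := fun t ht =>
    (hγ.regular (hI ht) (hsrc t ht)).2.1.mono hI
  have hunit : ∀ t ∈ Icc a b, (chartMetric x₀ hf hpos).energy (coordCurve (n := n) x₀ γ t)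
      (coordVel (n := n) x₀ γ L t) = 1 := fun t ht => (hγ.regular (hI ht) (hsrc t ht)).2.2
  have hU : ∀ t ∈ Icc a b, coordCurve (n := n) x₀ γ t ∈ (extChartAt (𝓡∂ n) x₀).target := fun t ht =>
    hγ.coordCurve_mem (hsrc t ht)
  have hO : ∀ t ∈ Ioo a b, coordCurve (n := n) x₀ γ t ∈ interiorTarget x₀ := fun t ht =>
    ⟨hU t (Ioo_subset_Icc_self ht), hγ.coordCurve_pos ⟨ha.trans_lt ht.1, ht.2.trans_le hb⟩
      (hsrc t (Ioo_subset_Icc_self ht))⟩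
  refine ⟨hab, hU, hO, hx, hu, hunit, fun t ht => ?_⟩
  have htI := Ioo_subset_Icc_self ht
  have hxt : HasDerivAt (coordCurve (n := n) x₀ γ) (coordVel (n := n) x₀ γ L t) t :=
    (hx t htI).hasDerivAt (Icc_mem_nhds ht.1 ht.2)
  have hmom := fun w => hasDerivAt_momentum hx hu hU hO hunit (D.isChartDist x₀)
    (fun s hs τ hτ => by
      rw [hγ.symm_coordCurve (hsrc s hs), hγ.symm_coordCurve (hsrc τ hτ)]
      exact hγ.isometric s (hI hs) τ (hI hτ)) w t ht
  set G := chartMetric x₀ hf hpos with hG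
  set x := coordCurve (n := n) x₀ γ
  set u := coordVel (n := n) x₀ γ L
  -- The velocity is recovered from the momentum by the inverse matrix of the metric.
  have hdiff : ∀ k, DifferentiableAt ℝ (fun t => u t k) t := by
    intro k
    have hform : ∀ s ∈ Icc a b, u s k = (G.f (x s) ^ 2)⁻¹ * ∑ j,
        (gram (chartAt (EuclideanHalfSpace n) x₀) (x s))⁻¹ k j *
          G.momentum (x s) (u s) (EuclideanSpace.single j 1) := by
      intro s hs
      have hne : G.f (x s) ≠ 0 := (G.f_pos _ (hU s hs)).ne'
      have h1 : ∀ j, G.momentum (x s) (u s) (EuclideanSpace.single j 1) = G.f (x s) ^ 2 *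
          (gram (chartAt (EuclideanHalfSpace n) x₀) (x s)).mulVec (u s).ofLp j := by
        intro j
        have : G.g (x s) (u s) (EuclideanSpace.single j 1) =
            pullForm (chartAt (EuclideanHalfSpace n) x₀) (x s) (EuclideanSpace.single j 1)
              (u s) := pullForm_symm _ _ _ _
        rw [momentum, this, pullForm_apply]
        simp [Matrix.mulVec, dotProduct]
      have h2 : (gram (chartAt (EuclideanHalfSpace n) x₀) (x s))⁻¹.mulVec
          ((gram (chartAt (EuclideanHalfSpace n) x₀) (x s)).mulVec (u s).ofLp) = (u s).ofLp := by
        rw [Matrix.mulVec_mulVec, Matrix.nonsing_inv_mul _ (isUnit_gram_det x₀ (hU s hs)),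
          Matrix.one_mulVec]
      have h3 := congrFun h2 k
      rw [Matrix.mulVec, dotProduct] at h3
      rw [← h3]
      simp only [h1, Finset.mul_sum]
      refine Finset.sum_congr rfl fun j _ => ?_
      field_simp
    have hev : (fun s => u s k) =ᶠ[𝓝 t] fun s => (G.f (x s) ^ 2)⁻¹ * ∑ j,
        (gram (chartAt (EuclideanHalfSpace n) x₀) (x s))⁻¹ k j *
          G.momentum (x s) (u s) (EuclideanSpace.single j 1) := by
      filter_upwards [Icc_mem_nhds ht.1 ht.2] with s hs using hform s hs
    refine DifferentiableAt.congr_of_eventuallyEq ?_ hev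
    refine DifferentiableAt.fun_mul (DifferentiableAt.fun_inv
      ((G.hasDerivAt_f (hO t ht) hxt).differentiableAt.fun_pow 2)
      (pow_ne_zero 2 (G.f_pos _ (hU t htI)).ne')) (DifferentiableAt.fun_sum fun j _ => ?_)
    exact (hasDerivAt_comp_coordDiff (contDiffOn_gram_inv x₀ k j) (hO t ht)
      hxt).differentiableAt.fun_mul (hmom _).differentiableAt
  have hud : DifferentiableAt ℝ u t := (differentiableAt_euclidean).2 hdiff
  refine ⟨deriv u t, hud.hasDerivAt, fun w => ?_⟩
  have h1 := ((G.hasDerivAt_f (hO t ht) hxt).fun_pow 2).fun_mul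
    (G.hasDerivAt_g (hO t ht) hxt hud.hasDerivAt (hasDerivAt_const t w))
  have h2 := h1.unique (hmom w)
  have hq := G.g_unit (hU t htI) (hunit t htI)
  have hne : G.f (x t) ≠ 0 := (G.f_pos _ (hU t htI)).ne'
  rw [force, G.Γ_symm _ w (u t), G.g_symm _ (G.Γ (x t) (u t) w) (u t), hq] at h2
  simp only [zero_add] at h2
  push_cast at h2
  have h3 : G.f (x t) ^ 2 * G.g (x t) (deriv u t + G.Γ (x t) (u t) (u t)) w =
      G.f (x t) * G.df (x t) w * (G.f (x t))⁻¹ ^ 2 -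
        2 * G.f (x t) * G.df (x t) (u t) * G.g (x t) (u t) w := by
    linear_combination h2
  have h4 : G.g (x t) (deriv u t + G.Γ (x t) (u t) (u t)) w = (G.f (x t) ^ 2)⁻¹ *
      (G.f (x t) ^ 2 * G.g (x t) (deriv u t + G.Γ (x t) (u t) (u t)) w) := by
    field_simp
  rw [h4, h3]
  field_simp

end Minimizer

end RiemannCoord
end

noncomputable section
open scoped Topology

/-! ### Curvature, Laplacian and mean curvature in a frame -/

namespace RiemannCoord

open Manifold Filter WeightedMetric

variable {M : Type*} [TopologicalSpace M]
  [ChartedSpace (EuclideanHalfSpace 3) M] [IsManifold (𝓡∂ 3) ∞ M]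
  [RiemannianBundle (fun x : M => TangentSpace (𝓡∂ 3) x)]
  [IsContMDiffRiemannianBundle (𝓡∂ 3) ∞ (EuclideanSpace ℝ (Fin 3))
    (fun x : M => TangentSpace (𝓡∂ 3) x)]
  {f : M → ℝ} {hf : ContMDiff (𝓡∂ 3) 𝓘(ℝ, ℝ) ∞ f} {hpos : ∀ p, 0 < f p}

section Frame

variable {x₀ : M} {y u : EuclideanSpace ℝ (Fin 3)} {V : Fin 2 → EuclideanSpace ℝ (Fin 3)}
  (hy : y ∈ (extChartAt (𝓡∂ 3) x₀).target) (hu : (chartMetric x₀ hf hpos).energy y u = 1)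
  (hV : (chartMetric x₀ hf hpos).IsFrame y u V)

include hu hV

/-- The trace of an endomorphism in a frame. -/
lemma sum_apply_single (T : EuclideanSpace ℝ (Fin 3) →ₗ[ℝ] EuclideanSpace ℝ (Fin 3)) :
    ∑ k, T (EuclideanSpace.single k 1) k =
      (chartMetric x₀ hf hpos).f y * ∑ i, (chartMetric x₀ hf hpos).g y (V i) (T (V i)) +
        (chartMetric x₀ hf hpos).f y ^ 2 * (chartMetric x₀ hf hpos).g y u (T u) := by
  set G := chartMetric x₀ hf hpos
  have h1 : ∀ k : Fin 3, T (EuclideanSpace.single k 1) k =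
      ∑ i, G.f y * (T (V i) k * G.g y (V i) (EuclideanSpace.single k 1)) +
        G.f y ^ 2 * (T u k * G.g y u (EuclideanSpace.single k 1)) := by
    intro k
    conv_lhs => rw [hV.expand (by simp) hu (EuclideanSpace.single k (1 : ℝ))]
    simp only [map_add, map_smul, PiLp.add_apply, PiLp.smul_apply, smul_eq_mul,
      Fin.sum_univ_two]
    ring
  have h2 : ∀ v w : EuclideanSpace ℝ (Fin 3),
      ∑ k, w k * G.g y v (EuclideanSpace.single k 1) = G.g y v w := by
    intro v w
    conv_rhs => rw [← sum_smul_single w, map_sum]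
    simp
  simp only [h1, Finset.sum_add_distrib]
  rw [Finset.sum_comm]
  simp only [← Finset.mul_sum, h2]

include hy

/-- The inverse matrix of the metric in a frame. -/
lemma gram_inv_eq (k l : Fin 3) : (gram (chartAt (EuclideanHalfSpace 3) x₀) y)⁻¹ k l =
    (chartMetric x₀ hf hpos).f y * ∑ i, V i k * V i l +
      (chartMetric x₀ hf hpos).f y ^ 2 * (u k * u l) := by
  set G := chartMetric x₀ hf hpos
  set S : Matrix (Fin 3) (Fin 3) ℝ := fun k l =>
    G.f y * ∑ i, V i k * V i l + G.f y ^ 2 * (u k * u l) with hS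
  have hg : ∀ v : EuclideanSpace ℝ (Fin 3), ∀ m : Fin 3, G.g y v (EuclideanSpace.single m 1) =
      ∑ l, v l * gram (chartAt (EuclideanHalfSpace 3) x₀) y l m := by
    intro v m
    change pullForm _ _ _ _ = _
    rw [pullForm_apply]
    simp [mul_comm]
  have hinv : S * gram (chartAt (EuclideanHalfSpace 3) x₀) y = 1 := by
    ext k m
    rw [Matrix.mul_apply]
    have h1 := hV.expand (by simp) hu (EuclideanSpace.single m (1 : ℝ))
    have h2 := congrArg (fun v : EuclideanSpace ℝ (Fin 3) => v k) h1
    simp only [PiLp.add_apply, PiLp.smul_apply, smul_eq_mul, Fin.sum_univ_two] at h2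
    rw [Matrix.one_apply]
    have h3 : (EuclideanSpace.single m (1 : ℝ) : EuclideanSpace ℝ (Fin 3)) k =
        if k = m then 1 else 0 := by
      simp
    rw [← h3, h2]
    simp only [hg, hS, Fin.sum_univ_two, Fin.sum_univ_three]
    ring
  rw [Matrix.inv_eq_left_inv hinv]

/-- The contraction of a bilinear form with the metric, in a frame. -/
lemma sum_gram_inv_mul (A : Fin 3 → Fin 3 → ℝ) :
    ∑ i, ∑ j, (gram (chartAt (EuclideanHalfSpace 3) x₀) y)⁻¹ i j * A i j =
      (chartMetric x₀ hf hpos).f y * ∑ a, ∑ i, ∑ j, A i j * (V a i * V a j) +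
      (chartMetric x₀ hf hpos).f y ^ 2 * ∑ i, ∑ j, A i j * (u i * u j) := by
  simp only [gram_inv_eq hy hu hV, Fin.sum_univ_two, Fin.sum_univ_three]
  ring

end Frame

lemma hess_eq (x₀ : M) (y v w : EuclideanSpace ℝ (Fin 3)) :
    (chartMetric x₀ hf hpos).hess y v w = ∑ i, ∑ j,
      (pderiv i (pderiv j (read (chartAt (EuclideanHalfSpace 3) x₀) f)) y -
        ∑ k, christoffel (chartAt (EuclideanHalfSpace 3) x₀) k i j y *
          pderiv k (read (chartAt (EuclideanHalfSpace 3) x₀) f) y) * (v i * w j) := by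
  change coordHess _ y v w - coordDiff _ y (christoffelMap _ y v w) = _
  rw [coordHess_apply, coordDiff_apply]
  simp only [christoffelMap_coord, coordDiff_apply, Fin.sum_univ_three]
  ring

lemma christoffelMapDeriv_add (φ : OpenPartialHomeomorph M (EuclideanHalfSpace 3))
    (y a b : EuclideanSpace ℝ (Fin 3)) : christoffelMapDeriv φ y (a + b) =
      christoffelMapDeriv φ y a + christoffelMapDeriv φ y b := by
  refine ContinuousLinearMap.ext fun u => ContinuousLinearMap.ext fun v => PiLp.ext fun k => ?_
  change _ = christoffelMapDeriv φ y a u v k + christoffelMapDeriv φ y b u v k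
  simp only [christoffelMapDeriv_coord, map_add, add_mul, Finset.sum_add_distrib]

lemma christoffelMapDeriv_smul (φ : OpenPartialHomeomorph M (EuclideanHalfSpace 3)) (r : ℝ)
    (y a : EuclideanSpace ℝ (Fin 3)) : christoffelMapDeriv φ y (r • a) =
      r • christoffelMapDeriv φ y a := by
  refine ContinuousLinearMap.ext fun u => ContinuousLinearMap.ext fun v => PiLp.ext fun k => ?_
  change _ = r * christoffelMapDeriv φ y a u v k
  simp only [christoffelMapDeriv_coord, map_smul, smul_eq_mul, mul_assoc, Finset.mul_sum]

/-- The Ricci tensor is the trace of the curvature. -/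
lemma sum_curv_single (x₀ : M) (y u : EuclideanSpace ℝ (Fin 3)) :
    ∑ k, (chartMetric x₀ hf hpos).curv y (EuclideanSpace.single k 1) u u k =
      ∑ i, ∑ j, ricciComp (chartAt (EuclideanHalfSpace 3) x₀) i j y * u i * u j := by
  set φ := chartAt (EuclideanHalfSpace 3) x₀
  have h1 : ∀ k : Fin 3, (chartMetric x₀ hf hpos).curv y (EuclideanSpace.single k 1) u u k =
      ∑ i, ∑ j, ((pderiv k (christoffel φ k i j) y - pderiv j (christoffel φ k i k) y) +
        ∑ l, (christoffel φ k k l y * christoffel φ l i j y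
          - christoffel φ k j l y * christoffel φ l i k y)) * u i * u j := by
    intro k
    change (christoffelMapDeriv φ y (EuclideanSpace.single k 1) u u - christoffelMapDeriv φ y u
      (EuclideanSpace.single k 1) u + (christoffelMap φ y (EuclideanSpace.single k 1)
      (christoffelMap φ y u u) - christoffelMap φ y u
      (christoffelMap φ y (EuclideanSpace.single k 1) u))) k = _
    have e1 : christoffelMapDeriv φ y (EuclideanSpace.single k 1) u u k =
        ∑ i, ∑ j, pderiv k (christoffel φ k i j) y * u i * u j := by
      rw [christoffelMapDeriv_coord]
      simp [coordDiff_apply, mul_assoc]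
    have e2 : christoffelMapDeriv φ y u (EuclideanSpace.single k 1) u k =
        ∑ i, ∑ j, pderiv j (christoffel φ k i k) y * u i * u j := by
      rw [christoffelMapDeriv_coord]
      simp only [coordDiff_apply, PiLp.single_apply, ite_mul, one_mul, zero_mul, mul_ite, mul_zero,
        Finset.sum_ite_irrel, Finset.sum_const_zero, Finset.sum_ite_eq', Finset.mem_univ, if_true]
      refine Finset.sum_congr rfl fun i _ => ?_
      rw [Finset.sum_mul]
      refine Finset.sum_congr rfl fun j _ => ?_
      rw [show christoffel φ k k i = christoffel φ k i k from
        funext fun z => christoffel_symm φ k k i z]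
      ring
    have e3 : christoffelMap φ y (EuclideanSpace.single k 1) (christoffelMap φ y u u) k =
        ∑ i, ∑ j, (∑ l, christoffel φ k k l y * christoffel φ l i j y) * u i * u j := by
      rw [christoffelMap_coord]
      simp only [christoffelMap_coord, PiLp.single_apply, ite_mul, one_mul, zero_mul, mul_ite,
        mul_zero, Finset.sum_ite_irrel, Finset.sum_const_zero, Finset.sum_ite_eq',
        Finset.mem_univ, if_true]
      simp only [Fin.sum_univ_three]
      ring
    have e4 : christoffelMap φ y u (christoffelMap φ y (EuclideanSpace.single k 1) u) k =
        ∑ i, ∑ j, (∑ l, christoffel φ k j l y * christoffel φ l i k y) * u i * u j := by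
      rw [christoffelMap_coord]
      simp only [christoffelMap_coord, PiLp.single_apply, ite_mul, one_mul, zero_mul, mul_ite,
        mul_zero, Finset.sum_ite_irrel, Finset.sum_const_zero, Finset.sum_ite_eq',
        Finset.mem_univ, if_true, christoffel_symm φ _ k]
      simp only [Fin.sum_univ_three]
      ring
    rw [PiLp.add_apply, PiLp.sub_apply, PiLp.sub_apply, e1, e2, e3, e4]
    simp only [← Finset.sum_sub_distrib, ← Finset.sum_add_distrib]
    refine Finset.sum_congr rfl fun i _ => Finset.sum_congr rfl fun j _ => ?_
    rw [Finset.sum_sub_distrib]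
    ring
  simp only [h1]
  rw [Finset.sum_comm]
  refine Finset.sum_congr rfl fun i _ => ?_
  rw [Finset.sum_comm]
  refine Finset.sum_congr rfl fun j _ => ?_
  rw [ricciComp, ← Finset.sum_mul, ← Finset.sum_mul, Finset.sum_add_distrib]

lemma pderiv_log (x₀ : M) {y : EuclideanSpace ℝ (Fin 3)}
    (hy : y ∈ (extChartAt (𝓡∂ 3) x₀).target) (hf : ContMDiff (𝓡∂ 3) 𝓘(ℝ, ℝ) ∞ f)
    (hpos : ∀ p, 0 < f p) (i : Fin 3) :
    pderiv i (read (chartAt (EuclideanHalfSpace 3) x₀) fun x => Real.log (f x)) y =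
      (read (chartAt (EuclideanHalfSpace 3) x₀) f y)⁻¹ *
        pderiv i (read (chartAt (EuclideanHalfSpace 3) x₀) f) y := by
  have hyr := extChartAt_target_subset_range x₀ hy
  have hd : DifferentiableWithinAt ℝ (read (chartAt (EuclideanHalfSpace 3) x₀) f)
      (range (𝓡∂ 3)) y :=
    (((contDiffOn_read x₀ hf) y hy).mono_of_mem_nhdsWithin
      (target_mem_nhdsWithin x₀ hy)).differentiableWithinAt (by simp)
  have h := fderivWithin.log hd (hpos _).ne' ((𝓡∂ 3).uniqueDiffOn y hyr)
  rw [pderiv, pderiv]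
  rw [show (read (chartAt (EuclideanHalfSpace 3) x₀) fun x => Real.log (f x)) =
    fun z => Real.log (read (chartAt (EuclideanHalfSpace 3) x₀) f z) from rfl, h]
  simp

/-- A tangent vector with given coordinates. -/
lemma exists_tangent (x₀ : M) {y : EuclideanSpace ℝ (Fin 3)}
    (hy : y ∈ (extChartAt (𝓡∂ 3) x₀).target) (w : EuclideanSpace ℝ (Fin 3)) :
    ∃ v : TangentSpace (𝓡∂ 3) ((extChartAt (𝓡∂ 3) x₀).symm y),
      (∀ i, comp (chartAt (EuclideanHalfSpace 3) x₀) _ v i = w i) ∧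
      ‖v‖ ^ 2 = pullForm (chartAt (EuclideanHalfSpace 3) x₀) y w w := by
  have : IsManifold (𝓡∂ 3) 1 M := IsManifold.of_le (n := ∞) (by simp)
  refine ⟨mfderivWithin 𝓘(ℝ, EuclideanSpace ℝ (Fin 3)) (𝓡∂ 3) (extChartAt (𝓡∂ 3) x₀).symm
    (range (𝓡∂ 3)) y w, fun i => ?_, ?_⟩
  · have h := mfderiv_extChartAt_comp_mfderivWithin_extChartAt_symm (I := 𝓡∂ 3) hy
    have h1 := congrArg (fun T => (show EuclideanSpace ℝ (Fin 3) from T w) i) h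
    exact h1
  · rw [pullForm_eq_inner, ← real_inner_self_eq_norm_sq]
    rfl

/-- The curvature condition, expanded in frames. -/
lemma isPositive (x₀ : M) (hcurv : ∀ φ ∈ IsManifold.maximalAtlas (𝓡∂ 3) ∞ M, ∀ p ∈ φ.source,
      ∀ v : TangentSpace (𝓡∂ 3) p, ‖v‖ = 1 →
        0 < ricci φ p v - (f p)⁻¹ * laplacian φ f p
          + 1 / 2 * gradNormSq φ (fun x => Real.log (f x)) p) :
    (chartMetric x₀ hf hpos).IsPositive := by
  intro y hyO u V hu hV
  have hy := (chartMetric x₀ hf hpos).O_subset hyO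
  set φ := chartAt (EuclideanHalfSpace 3) x₀ with hφ
  set p := (extChartAt (𝓡∂ 3) x₀).symm y
  have hpy : φ.extend (𝓡∂ 3) p = y := (extChartAt (𝓡∂ 3) x₀).right_inv hy
  have hps : p ∈ φ.source := by
    rw [hφ, ← extChartAt_source (𝓡∂ 3)]
    exact (extChartAt (𝓡∂ 3) x₀).map_target hy
  have hfp : (chartMetric x₀ hf hpos).f y = f p := rfl
  have hfpos := hpos p
  obtain ⟨v, hv, hnorm⟩ := exists_tangent x₀ hy (f p • u)
  have hunit : ‖v‖ = 1 := by
    have h1 : ‖v‖ ^ 2 = 1 := by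
      rw [hnorm]
      have h2 : f p ^ 2 * pullForm φ y u u = 1 := hu
      simp only [map_smul, smul_apply, smul_eq_mul]
      linarith
    exact (pow_eq_one_iff_of_nonneg (norm_nonneg v) two_ne_zero).1 h1
  have hmain := hcurv φ (IsManifold.chart_mem_maximalAtlas x₀) p hps v hunit
  have hric : ricci φ p v = f p ^ 2 * (f p * ∑ i,
      (chartMetric x₀ hf hpos).g y ((chartMetric x₀ hf hpos).curv y (V i) u u) (V i)) := by
    let T : EuclideanSpace ℝ (Fin 3) →ₗ[ℝ] EuclideanSpace ℝ (Fin 3) :=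
      { toFun := fun z => (chartMetric x₀ hf hpos).curv y z u u
        map_add' := fun a b => by
          have hd : (chartMetric x₀ hf hpos).dΓ y (a + b) = (chartMetric x₀ hf hpos).dΓ y a +
              (chartMetric x₀ hf hpos).dΓ y b := christoffelMapDeriv_add φ y a b
          simp only [curv, map_add, add_apply, hd]
          abel
        map_smul' := fun r a => by
          have hd : (chartMetric x₀ hf hpos).dΓ y (r • a) =
              r • (chartMetric x₀ hf hpos).dΓ y a := christoffelMapDeriv_smul φ r y a
          simp only [curv, map_smul, smul_apply, hd, RingHom.id_apply, smul_sub, smul_add] }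
    have h1 := sum_apply_single hu hV T
    have h2 : T u = 0 := by
      change (chartMetric x₀ hf hpos).curv y u u u = 0
      simp [curv]
    rw [h2, map_zero, mul_zero, add_zero] at h1
    have h3 : ∑ k, T (EuclideanSpace.single k 1) k =
      ∑ i, ∑ j, ricciComp φ i j y * u i * u j := sum_curv_single x₀ y u
    rw [h3] at h1
    have h4 : ricci φ p v = f p ^ 2 * ∑ i, ∑ j, ricciComp φ i j y * u i * u j := by
      rw [ricci, hpy, Finset.mul_sum]
      refine Finset.sum_congr rfl fun i _ => ?_
      rw [Finset.mul_sum]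
      refine Finset.sum_congr rfl fun j _ => ?_
      rw [hv, hv]
      simp only [PiLp.smul_apply, smul_eq_mul]
      ring
    rw [h4, h1]
    congr 2
    exact Finset.sum_congr rfl fun i _ => (chartMetric x₀ hf hpos).g_symm _ _ _
  have hlap : laplacian φ f p = f p * ∑ i, (chartMetric x₀ hf hpos).hess y (V i) (V i) +
      f p ^ 2 * (chartMetric x₀ hf hpos).hess y u u := by
    rw [laplacian, hpy, sum_gram_inv_mul hy hu hV]
    simp only [hess_eq]
    rfl
  have hgrad : gradNormSq φ (fun x => Real.log (f x)) p = (f p)⁻¹ ^ 2 * (f p *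
      ∑ i, (chartMetric x₀ hf hpos).df y (V i) ^ 2 +
      f p ^ 2 * (chartMetric x₀ hf hpos).df y u ^ 2) := by
    have hdf : ∀ w, (chartMetric x₀ hf hpos).df y w = ∑ i, pderiv i (read φ f) y * w i :=
      fun w => coordDiff_apply _ _ _
    have hlog : ∀ i, pderiv i (read φ fun x => Real.log (f x)) y =
        (f p)⁻¹ * pderiv i (read φ f) y := pderiv_log x₀ hy hf hpos
    simp only [gradNormSq, hpy, hlog, mul_assoc]
    have := sum_gram_inv_mul hy hu hV fun i j => (f p)⁻¹ * (pderiv i (read φ f) y *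
      ((f p)⁻¹ * pderiv j (read φ f) y))
    refine this.trans ?_
    simp only [hdf, hfp, Fin.sum_univ_two, Fin.sum_univ_three]
    ring
  rw [hric, hlap, hgrad] at hmain
  rw [hfp]
  refine pos_of_mul_pos_right (lt_of_lt_of_eq hmain ?_) hfpos.le
  have := hfpos.ne'
  field_simp
  ring

end RiemannCoord
end

noncomputable section
open scoped Topology

/-! ### The ends of a minimizing curve -/

namespace RiemannCoord

open Manifold Filter WeightedMetric

variable {M : Type*} [TopologicalSpace M]
  [ChartedSpace (EuclideanHalfSpace 3) M] [IsManifold (𝓡∂ 3) ∞ M]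
  [RiemannianBundle (fun x : M => TangentSpace (𝓡∂ 3) x)]
  [IsContMDiffRiemannianBundle (𝓡∂ 3) ∞ (EuclideanSpace ℝ (Fin 3))
    (fun x : M => TangentSpace (𝓡∂ 3) x)]
  {f : M → ℝ} {hf : ContMDiff (𝓡∂ 3) 𝓘(ℝ, ℝ) ∞ f} {hpos : ∀ p, 0 < f p}

section Transversal

variable {x₀ : M} {y u : EuclideanSpace ℝ (Fin 3)}

/-- A unit vector that is perpendicular to the boundary and does not point out of it is a multiple
of the unit normal. -/
lemma eq_normal_of_perp (hy : y ∈ (extChartAt (𝓡∂ 3) x₀).target)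
    (hu : (chartMetric x₀ hf hpos).energy y u = 1) (hu0 : 0 ≤ u 0)
    (hperp : ∀ ξ : EuclideanSpace ℝ (Fin 3), ξ 0 = 0 → (chartMetric x₀ hf hpos).g y u ξ = 0) :
    (∀ k, (chartMetric x₀ hf hpos).f y * u k =
      -normal (chartAt (EuclideanHalfSpace 3) x₀) y k) ∧ u 0 ≠ 0 ∧
    ∀ v : EuclideanSpace ℝ (Fin 3), (chartMetric x₀ hf hpos).g y v u = 0 → v 0 = 0 := by
  set G := chartMetric x₀ hf hpos with hG
  set A := gram (chartAt (EuclideanHalfSpace 3) x₀) y with hA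
  have hfp : 0 < G.f y := G.f_pos y hy
  set lam := G.g y u (EuclideanSpace.single 0 1)
  have hgv : ∀ v : EuclideanSpace ℝ (Fin 3), G.g y u v = lam * v 0 := by
    intro v
    have h1 := hperp (v - v 0 • EuclideanSpace.single 0 (1 : ℝ)) (by simp)
    rw [map_sub, map_smul, smul_eq_mul] at h1
    linarith
  have hmul : A.mulVec u.ofLp = fun k => if k = 0 then lam else 0 := by
    funext k
    have h1 : A.mulVec u.ofLp k = G.g y u (EuclideanSpace.single k 1) := by
      have : G.g y u (EuclideanSpace.single k 1) =
          pullForm (chartAt (EuclideanHalfSpace 3) x₀) y (EuclideanSpace.single k 1) u :=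
        pullForm_symm _ _ _ _
      rw [this, pullForm_apply]
      simp [Matrix.mulVec, dotProduct, hA]
    rw [h1, hgv]
    simp [eq_comm]
  have huk : ∀ k, u k = A⁻¹ k 0 * lam := by
    intro k
    have h1 : A⁻¹.mulVec (A.mulVec u.ofLp) = u.ofLp := by
      rw [Matrix.mulVec_mulVec, Matrix.nonsing_inv_mul _ (isUnit_gram_det x₀ hy),
        Matrix.one_mulVec]
    rw [← h1, hmul]
    simp [Matrix.mulVec, dotProduct]
  have hen : G.f y ^ 2 * (lam * (A⁻¹ 0 0 * lam)) = 1 := by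
    rw [← huk 0, ← hgv u]
    exact hu
  have hlam0 : lam ≠ 0 := by
    rintro h
    simp [h] at hen
  have hA0 : 0 < A⁻¹ 0 0 := by
    by_contra h
    have : G.f y ^ 2 * (lam * (A⁻¹ 0 0 * lam)) = A⁻¹ 0 0 * (G.f y * lam) ^ 2 := by ring
    have := mul_nonpos_of_nonpos_of_nonneg (not_lt.1 h) (sq_nonneg (G.f y * lam))
    linarith
  have hlampos : 0 < lam := by
    refine lt_of_le_of_ne ?_ hlam0.symm
    have h1 := huk 0
    by_contra h
    have := mul_neg_of_pos_of_neg hA0 (not_le.1 h)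
    linarith
  have hsq : G.f y * lam * √(A⁻¹ 0 0) = 1 := by
    have h1 : (G.f y * lam * √(A⁻¹ 0 0)) ^ 2 = 1 := by
      rw [mul_pow, Real.sq_sqrt hA0.le]
      linarith
    exact (pow_eq_one_iff_of_nonneg (by positivity) two_ne_zero).1 h1
  refine ⟨fun k => ?_, ?_, fun v hv => ?_⟩
  · rw [huk, normal, ← hA]
    have : √(A⁻¹ 0 0) ≠ 0 := (Real.sqrt_pos.2 hA0).ne'
    field_simp
    linear_combination A⁻¹ k 0 * hsq
  · rw [huk]
    exact (mul_pos hA0 hlampos).ne'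
  · rw [G.g_symm, hgv] at hv
    exact (mul_eq_zero.1 hv).resolve_left hlam0

/-- At an end of the curve, perpendicular to the boundary, the end term vanishes because of the
boundary condition. -/
lemma endTerm_eq_zero {V : Fin 2 → EuclideanSpace ℝ (Fin 3)}
    (hy : y ∈ (extChartAt (𝓡∂ 3) x₀).target)
    (hu : (chartMetric x₀ hf hpos).energy y u = 1)
    (hV : (chartMetric x₀ hf hpos).IsFrame y u V) {σ : ℝ} (hσ : σ ^ 2 = 1)
    (hn : ∀ k, (chartMetric x₀ hf hpos).f y * u k =
      σ * normal (chartAt (EuclideanHalfSpace 3) x₀) y k)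
    (hbd : normalDeriv (chartAt (EuclideanHalfSpace 3) x₀) f ((extChartAt (𝓡∂ 3) x₀).symm y) =
      -f ((extChartAt (𝓡∂ 3) x₀).symm y) * meanCurvature (chartAt (EuclideanHalfSpace 3) x₀)
        ((extChartAt (𝓡∂ 3) x₀).symm y)) :
    (chartMetric x₀ hf hpos).endTerm y u V 0 = 0 := by
  set φ := chartAt (EuclideanHalfSpace 3) x₀ with hφ
  set p := (extChartAt (𝓡∂ 3) x₀).symm y
  have hpy : φ.extend (𝓡∂ 3) p = y := (extChartAt (𝓡∂ 3) x₀).right_inv hy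
  have hfp : (chartMetric x₀ hf hpos).f y = f p := rfl
  have hfpos : 0 < f p := hpos p
  rw [hfp] at hn
  have hη : ∀ k, normal φ y k = σ * (f p * u k) := fun k => by
    rw [hn, ← mul_assoc, ← sq, hσ, one_mul]
  have hH : meanCurvature φ p = f p * ∑ a, ∑ i, ∑ j, secondForm φ i j y * (V a i * V a j) := by
    rw [meanCurvature, hpy]
    have h1 : ∀ i j, (gram φ y)⁻¹ i j - normal φ y i * normal φ y j =
        f p * ∑ a, V a i * V a j := by
      intro i j
      rw [gram_inv_eq hy hu hV i j, hη, hη, hfp]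
      linear_combination (-(f p ^ 2 * (u i * u j))) * hσ
    simp only [h1, Fin.sum_univ_two, Fin.sum_univ_three]
    ring
  have hsec : ∀ a, (chartMetric x₀ hf hpos).g y ((chartMetric x₀ hf hpos).Γ y (V a) (V a)) u =
      -(σ * (f p)⁻¹) * ∑ i, ∑ j, secondForm φ i j y * (V a i * V a j) := by
    intro a
    rw [(chartMetric x₀ hf hpos).g_symm]
    change pullForm φ y u (christoffelMap φ y (V a) (V a)) = _
    have hu' : ∀ k, u k = σ * (f p)⁻¹ * normal φ y k := fun k => by
      rw [hη]
      field_simp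
      linear_combination (-(u k)) * hσ
    rw [pullForm_apply]
    simp only [christoffelMap_coord, secondForm, hu', Fin.sum_univ_three]
    ring
  have hdf : (chartMetric x₀ hf hpos).df y u = σ * (f p)⁻¹ * normalDeriv φ f p := by
    change coordDiff _ y u = _
    rw [coordDiff_apply, normalDeriv, hpy, Finset.mul_sum]
    refine Finset.sum_congr rfl fun k _ => ?_
    rw [hη]
    field_simp
    linear_combination (-(pderiv k (read φ f) y * u k)) * hσ
  rw [endTerm, hdf, hbd, hH]
  simp only [Pi.zero_apply, zero_add, hsec, hfp, ← Finset.mul_sum]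
  field_simp
  ring

end Transversal

namespace Minimizer

variable {D : ConformalDist hf hpos} {C₁ C₂ : Set M} {L : ℝ} {γ : ℝ → M}
  (hγ : Minimizer D C₁ C₂ L γ)

include hγ

lemma zero_mem_Icc : (0 : ℝ) ∈ Icc 0 L := ⟨le_rfl, hγ.pos.le⟩

lemma end_mem_Icc : L ∈ Icc 0 L := ⟨hγ.pos.le, le_rfl⟩

lemma coord_zero {x₀ : M} (hsrc : γ 0 ∈ (chartAt (EuclideanHalfSpace 3) x₀).source) :
    coordCurve (n := 3) x₀ γ 0 0 = 0 := by
  rw [← mem_boundary_iff x₀ hsrc, ← hγ.union_eq]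
  exact Or.inl hγ.zero_mem

/-- The boundary points near the left end of the curve belong to the left part. -/
lemma eventually_mem_left {x₀ : M} (hsrc : γ 0 ∈ (chartAt (EuclideanHalfSpace 3) x₀).source) :
    ∀ᶠ z in 𝓝 (coordCurve (n := 3) x₀ γ 0), z 0 = 0 → (extChartAt (𝓡∂ 3) x₀).symm z ∈ C₁ := by
  have hmem := hγ.coordCurve_mem hsrc
  have hc : ContinuousWithinAt (extChartAt (𝓡∂ 3) x₀).symm (range (𝓡∂ 3))
      (coordCurve (n := 3) x₀ γ 0) :=
    (((continuousOn_extChartAt_symm x₀) _ hmem).mono_of_mem_nhdsWithin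
      (target_mem_nhdsWithin x₀ hmem))
  have hn : C₂ᶜ ∈ 𝓝 ((extChartAt (𝓡∂ 3) x₀).symm (coordCurve (n := 3) x₀ γ 0)) := by
    rw [hγ.symm_coordCurve hsrc]
    exact hγ.isClosed_right.isOpen_compl.mem_nhds
      (fun h => hγ.disjoint.le_bot ⟨hγ.zero_mem, h⟩)
  have h1 := mem_nhdsWithin_iff_eventually.1 (inter_mem (hc.preimage_mem_nhdsWithin hn)
    (target_mem_nhdsWithin x₀ hmem))
  filter_upwards [h1] with z hz hz0
  obtain ⟨hz1, hz2⟩ := hz (by rw [range_model]; exact hz0.ge)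
  have hs : (extChartAt (𝓡∂ 3) x₀).symm z ∈ (chartAt (EuclideanHalfSpace 3) x₀).source := by
    rw [← extChartAt_source (𝓡∂ 3)]
    exact (extChartAt (𝓡∂ 3) x₀).map_target hz2
  have hb := (mem_boundary_iff x₀ hs).2 (by rw [(extChartAt (𝓡∂ 3) x₀).right_inv hz2]; exact hz0)
  rw [← hγ.union_eq] at hb
  exact hb.resolve_right hz1

/-- The curve is contained in the chart for a short time. -/
lemma exists_chart_left {x₀ : M} (hsrc : γ 0 ∈ (chartAt (EuclideanHalfSpace 3) x₀).source) :
    ∃ b, 0 < b ∧ b ≤ L ∧ ∀ t ∈ Icc 0 b, γ t ∈ (chartAt (EuclideanHalfSpace 3) x₀).source := by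
  have hnhds : γ ⁻¹' (chartAt (EuclideanHalfSpace 3) x₀).source ∈ 𝓝[Icc 0 L] 0 :=
    (hγ.continuousOn 0 hγ.zero_mem_Icc).preimage_mem_nhdsWithin
      ((chartAt (EuclideanHalfSpace 3) x₀).open_source.mem_nhds hsrc)
  obtain ⟨ε, hε, hsub⟩ := Metric.mem_nhdsWithin_iff.1 hnhds
  refine ⟨min L (ε / 2), lt_min hγ.pos (by positivity), min_le_left _ _, fun t ht =>
    hsub ⟨?_, ht.1, ht.2.trans (min_le_left _ _)⟩⟩
  rw [mem_ball_zero_iff, Real.norm_of_nonneg ht.1]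
  linarith [ht.2.trans (min_le_right L (ε / 2))]

/-- The curve starts perpendicularly to the boundary. -/
lemma perp_left {x₀ : M} (hsrc : γ 0 ∈ (chartAt (EuclideanHalfSpace 3) x₀).source)
    {ξ : EuclideanSpace ℝ (Fin 3)} (hξ : ξ 0 = 0) :
    (chartMetric x₀ hf hpos).g (coordCurve (n := 3) x₀ γ 0) (coordVel (n := 3) x₀ γ L 0) ξ = 0 := by
  obtain ⟨b, hb0, hbL, hb⟩ := hγ.exists_chart_left hsrc
  have hgeo := hγ.geodesic le_rfl hb0 hbL hb
  have hI : Icc 0 b ⊆ Icc 0 L := Icc_subset_Icc_right hbL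
  obtain ⟨s₁, hs₁, hmU, hmO⟩ := exists_mem_of_dominated (G := chartMetric x₀ hf hpos)
    (V := fun _ => ξ) (W := fun _ => 0) (C := 0) (D := 0) (D.isChartDist x₀)
    (fun y hy h => ⟨hy, h⟩) hgeo.continuousOn_x continuousOn_const continuousOn_const hgeo.mem_U
    (fun t ht => (hgeo.mem_O t ht).2) (by simp [hξ]) (by simp)
  simp only [smul_zero, add_zero] at hmU hmO
  -- Translation by a vector tangent to the boundary keeps the left end in `C₁`.
  have hev : ∀ᶠ s : ℝ in 𝓝 0, (extChartAt (𝓡∂ 3) x₀).symm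
      (coordCurve (n := 3) x₀ γ 0 + s • ξ) ∈ C₁ := by
    have hc : Tendsto (fun s : ℝ => coordCurve (n := 3) x₀ γ 0 + s • ξ) (𝓝 0)
        (𝓝 (coordCurve (n := 3) x₀ γ 0)) := by
      have : Continuous fun s : ℝ => coordCurve (n := 3) x₀ γ 0 + s • ξ := by fun_prop
      simpa using this.tendsto 0
    filter_upwards [hc.eventually (hγ.eventually_mem_left hsrc)] with s hs
    exact hs (by simp [hξ, hγ.coord_zero hsrc])
  obtain ⟨s₂, hs₂, hball⟩ := Metric.eventually_nhds_iff_ball.1 hev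
  set s₀ := min s₁ (s₂ / 2)
  have hs₀p : 0 < s₀ := lt_min hs₁ (by positivity)
  have hsub : Icc (-s₀) s₀ ⊆ Icc (-s₁) s₁ :=
    Icc_subset_Icc (neg_le_neg (min_le_left _ _)) (min_le_left _ _)
  have hmom := momentum_eq_zero_of_left hgeo.hasDeriv hgeo.continuousOn hgeo.mem_U hgeo.mem_O
    hgeo.unit (D.isChartDist x₀) hb0 (ξ := ξ) hs₀p (fun s hs => hmU s (hsub hs))
    (fun s hs => hmO s (hsub hs)) fun s hs t ht => by
      have h1 := hball s (by
        rw [mem_ball_zero_iff, Real.norm_eq_abs]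
        have := abs_le.2 hs
        have := this.trans (min_le_right s₁ (s₂ / 2))
        linarith)
      rw [hγ.symm_coordCurve (hb t ht)]
      have h2 := hγ.le_dist _ h1 _ hγ.end_mem
      have h3 := D.triangle ((extChartAt (𝓡∂ 3) x₀).symm (coordCurve (n := 3) x₀ γ 0 + s • ξ))
        (γ t) (γ L)
      have h4 := hγ.isometric t (hI ht) L hγ.end_mem_Icc
      rw [abs_of_nonpos (by linarith [(hI ht).2])] at h4
      linarith
  rw [momentum] at hmom
  exact (mul_eq_zero.1 hmom).resolve_left
    (pow_ne_zero 2 ((chartMetric x₀ hf hpos).f_pos _ (hγ.coordCurve_mem hsrc)).ne')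

/-- The initial velocity is the inner normal. -/
lemma normal_left {x₀ : M} (hsrc : γ 0 ∈ (chartAt (EuclideanHalfSpace 3) x₀).source) :
    (∀ k, (chartMetric x₀ hf hpos).f (coordCurve (n := 3) x₀ γ 0) *
        coordVel (n := 3) x₀ γ L 0 k =
      -normal (chartAt (EuclideanHalfSpace 3) x₀) (coordCurve (n := 3) x₀ γ 0) k) ∧
    coordVel (n := 3) x₀ γ L 0 0 ≠ 0 ∧ ∀ v : EuclideanSpace ℝ (Fin 3),
      (chartMetric x₀ hf hpos).g (coordCurve (n := 3) x₀ γ 0) v (coordVel (n := 3) x₀ γ L 0) = 0 →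
        v 0 = 0 := by
  obtain ⟨h1, -, h3⟩ := hγ.regular hγ.zero_mem_Icc hsrc
  refine eq_normal_of_perp (hγ.coordCurve_mem hsrc) h3 ?_ fun ξ hξ => hγ.perp_left hsrc hξ
  have hd : HasDerivWithinAt (fun t => coordCurve (n := 3) x₀ γ t 0)
      (coordVel (n := 3) x₀ γ L 0 0) (Icc 0 L) 0 :=
    (EuclideanSpace.proj (𝕜 := ℝ) (0 : Fin 3)).hasFDerivAt.comp_hasDerivWithinAt 0 h1
  have hlim := hasDerivWithinAt_iff_tendsto_slope.1 hd
  have hne : (𝓝[Icc 0 L \ {0}] (0 : ℝ)).NeBot := accPt_principal_iff_nhdsWithin.1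
      (uniqueDiffWithinAt_iff_accPt.1 (uniqueDiffOn_Icc hγ.pos 0 hγ.zero_mem_Icc))
  refine ge_of_tendsto hlim ?_
  filter_upwards [self_mem_nhdsWithin] with t ht
  rw [slope_def_field, hγ.coord_zero hsrc, sub_zero, sub_zero]
  exact div_nonneg (extChartAt_zero_nonneg x₀ _) ht.1.1

lemma reverse_coordVel {x₀ : M} (hsrc : γ L ∈ (chartAt (EuclideanHalfSpace 3) x₀).source) :
    coordVel (n := 3) x₀ (fun t => γ (L - t)) L 0 = -coordVel (n := 3) x₀ γ L L := by
  have h1 := (hγ.regular hγ.end_mem_Icc hsrc).1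
  have h2 : HasDerivWithinAt (fun t : ℝ => L - t) (-1) (Icc 0 L) 0 :=
    ((hasDerivAt_id' (0 : ℝ)).const_sub L).hasDerivWithinAt
  have h3 : HasDerivWithinAt (coordCurve (n := 3) x₀ γ) (coordVel (n := 3) x₀ γ L L) (Icc 0 L)
      ((fun t : ℝ => L - t) 0) := by simpa using h1
  have h4 := h3.scomp (0 : ℝ) h2 fun t ht => ⟨by linarith [ht.2], by linarith [ht.1]⟩
  rw [neg_one_smul] at h4
  exact h4.derivWithin (uniqueDiffOn_Icc hγ.pos 0 hγ.zero_mem_Icc)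

/-- The final velocity is the outer normal. -/
lemma normal_right {x₀ : M} (hsrc : γ L ∈ (chartAt (EuclideanHalfSpace 3) x₀).source) :
    (∀ k, (chartMetric x₀ hf hpos).f (coordCurve (n := 3) x₀ γ L) *
        coordVel (n := 3) x₀ γ L L k =
      normal (chartAt (EuclideanHalfSpace 3) x₀) (coordCurve (n := 3) x₀ γ L) k) ∧
    coordVel (n := 3) x₀ γ L L 0 ≠ 0 ∧ ∀ v : EuclideanSpace ℝ (Fin 3),
      (chartMetric x₀ hf hpos).g (coordCurve (n := 3) x₀ γ L) v (coordVel (n := 3) x₀ γ L L) = 0 →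
        v 0 = 0 := by
  have h := hγ.reverse.normal_left (x₀ := x₀) (by simpa using hsrc)
  rw [hγ.reverse_coordVel hsrc] at h
  simp only [coordCurve, sub_zero, PiLp.neg_apply, mul_neg, neg_inj, ne_eq, neg_eq_zero,
    map_neg] at h
  exact h

end Minimizer

end RiemannCoord
end

noncomputable section
open scoped Topology

/-! ### Transition maps -/

namespace RiemannCoord

open Manifold Filter WeightedMetric

variable {n : ℕ} [NeZero n] {M : Type*} [TopologicalSpace M]
  [ChartedSpace (EuclideanHalfSpace n) M] [IsManifold (𝓡∂ n) ∞ M]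
  [RiemannianBundle (fun x : M => TangentSpace (𝓡∂ n) x)]
  [IsContMDiffRiemannianBundle (𝓡∂ n) ∞ (EuclideanSpace ℝ (Fin n))
    (fun x : M => TangentSpace (𝓡∂ n) x)]
  {f : M → ℝ} {hf : ContMDiff (𝓡∂ n) 𝓘(ℝ, ℝ) ∞ f} {hpos : ∀ p, 0 < f p}

/-- The vector of the model space that represents the tangent vector with coordinates `a`. -/
def tangentRep (x₀ : M) (y a : EuclideanSpace ℝ (Fin n)) : EuclideanSpace ℝ (Fin n) :=
  mfderivWithin 𝓘(ℝ, EuclideanSpace ℝ (Fin n)) (𝓡∂ n) (extChartAt (𝓡∂ n) x₀).symm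
    (range (𝓡∂ n)) y a

lemma pullForm_eq_inner_of_eq (x₀ : M) {y : EuclideanSpace ℝ (Fin n)} {q : M}
    (hq : (extChartAt (𝓡∂ n) x₀).symm y = q) (a b : EuclideanSpace ℝ (Fin n)) :
    pullForm (chartAt (EuclideanHalfSpace n) x₀) y a b =
      inner ℝ (show TangentSpace (𝓡∂ n) q from tangentRep x₀ y a)
        (show TangentSpace (𝓡∂ n) q from tangentRep x₀ y b) := by
  subst hq
  exact pullForm_eq_inner _ _ _ _

/-- The transition map from the preferred chart at `x₀` to the one at `x₁`. -/
def transition (x₀ x₁ : M) (z : EuclideanSpace ℝ (Fin n)) : EuclideanSpace ℝ (Fin n) :=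
  extChartAt (𝓡∂ n) x₁ ((extChartAt (𝓡∂ n) x₀).symm z)

section

variable {x₀ x₁ : M} {z : EuclideanSpace ℝ (Fin n)}

lemma contDiffAt_transition (hz : z ∈ interiorTarget x₀)
    (hz' : (extChartAt (𝓡∂ n) x₀).symm z ∈ (chartAt (EuclideanHalfSpace n) x₁).source) :
    ContDiffAt ℝ ∞ (transition (n := n) x₀ x₁) z := by
  have h := contDiffWithinAt_ext_coord_change (I := 𝓡∂ n) (n := ∞) x₁ x₀ (y := z)
    ⟨hz.1, by rw [← extChartAt_source (𝓡∂ n)] at hz'; exact hz'⟩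
  exact h.contDiffAt (range_mem_nhds hz.2)

/-- Points near an interior point of an overlap of charts are interior points of the overlap. -/
lemma eventually_mem_overlap (hz : z ∈ interiorTarget x₀)
    (hz' : (extChartAt (𝓡∂ n) x₀).symm z ∈ (chartAt (EuclideanHalfSpace n) x₁).source) :
    ∀ᶠ w in 𝓝 z, w ∈ interiorTarget x₀ ∧
      (extChartAt (𝓡∂ n) x₀).symm w ∈ (chartAt (EuclideanHalfSpace n) x₁).source := by
  have hc : ContinuousAt (extChartAt (𝓡∂ n) x₀).symm z :=
    ((continuousOn_extChartAt_symm x₀).continuousAt (target_mem_nhds x₀ hz))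
  filter_upwards [(isOpen_interiorTarget x₀).mem_nhds hz, hc.preimage_mem_nhds
    ((chartAt (EuclideanHalfSpace n) x₁).open_source.mem_nhds hz')] with w h1 h2 using ⟨h1, h2⟩

lemma symm_transition
    (hz' : (extChartAt (𝓡∂ n) x₀).symm z ∈ (chartAt (EuclideanHalfSpace n) x₁).source) :
    (extChartAt (𝓡∂ n) x₁).symm (transition x₀ x₁ z) = (extChartAt (𝓡∂ n) x₀).symm z :=
  (extChartAt (𝓡∂ n) x₁).left_inv (by rwa [extChartAt_source])

lemma transition_mem (hz : z ∈ interiorTarget x₀)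
    (hz' : (extChartAt (𝓡∂ n) x₀).symm z ∈ (chartAt (EuclideanHalfSpace n) x₁).source) :
    transition x₀ x₁ z ∈ interiorTarget x₁ := by
  have hs : (extChartAt (𝓡∂ n) x₀).symm z ∈ (chartAt (EuclideanHalfSpace n) x₀).source := by
    rw [← extChartAt_source (𝓡∂ n)]
    exact (extChartAt (𝓡∂ n) x₀).map_target hz.1
  refine ⟨(extChartAt (𝓡∂ n) x₁).map_source (by rwa [extChartAt_source]), ?_⟩
  refine lt_of_le_of_ne (extChartAt_zero_nonneg x₁ _) fun h => ?_
  have h1 := (mem_boundary_iff x₁ hz').2 h.symm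
  rw [mem_boundary_iff x₀ hs, (extChartAt (𝓡∂ n) x₀).right_inv hz.1] at h1
  exact (ne_of_gt hz.2) h1

/-- The derivative of a transition map relates the coordinates of the same tangent vector. -/
lemma tangentRep_transition (hz : z ∈ interiorTarget x₀)
    (hz' : (extChartAt (𝓡∂ n) x₀).symm z ∈ (chartAt (EuclideanHalfSpace n) x₁).source)
    (a : EuclideanSpace ℝ (Fin n)) :
    tangentRep x₁ (transition x₀ x₁ z) (fderiv ℝ (transition x₀ x₁) z a) = tangentRep x₀ z a := by
  have hm := transition_mem hz hz'
  have h1 : HasMFDerivAt 𝓘(ℝ, EuclideanSpace ℝ (Fin n)) 𝓘(ℝ, EuclideanSpace ℝ (Fin n))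
      (transition (n := n) x₀ x₁) z (fderiv ℝ (transition x₀ x₁) z) :=
    (((contDiffAt_transition hz hz').differentiableAt (by simp)).hasFDerivAt).hasMFDerivAt
  have h2 : ∀ (x : M) {w : EuclideanSpace ℝ (Fin n)} (_ : w ∈ interiorTarget x),
      HasMFDerivAt 𝓘(ℝ, EuclideanSpace ℝ (Fin n)) (𝓡∂ n) (extChartAt (𝓡∂ n) x).symm w
      (mfderivWithin 𝓘(ℝ, EuclideanSpace ℝ (Fin n)) (𝓡∂ n) (extChartAt (𝓡∂ n) x).symm
        (range (𝓡∂ n)) w) := by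
    intro x w hw
    have : IsManifold (𝓡∂ n) 1 M := IsManifold.of_le (n := ∞) (by simp)
    exact (mdifferentiableWithinAt_extChartAt_symm hw.1).hasMFDerivWithinAt.hasMFDerivAt
      (range_mem_nhds hw.2)
  have h3 := (h2 x₁ hm).comp z h1
  have hev : (extChartAt (𝓡∂ n) x₀).symm =ᶠ[𝓝 z]
      (extChartAt (𝓡∂ n) x₁).symm ∘ transition x₀ x₁ := by
    filter_upwards [eventually_mem_overlap hz hz'] with w hw
    exact (symm_transition hw.2).symm
  have h4 := h3.congr_of_eventuallyEq hev
  have h5 := hasMFDerivAt_unique (h2 x₀ hz) h4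
  exact (congrArg (fun T : EuclideanSpace ℝ (Fin n) →L[ℝ] EuclideanSpace ℝ (Fin n) => T a) h5).symm

/-- Transition maps are isometries. -/
lemma isIsometryAt_transition (hz : z ∈ interiorTarget x₀)
    (hz' : (extChartAt (𝓡∂ n) x₀).symm z ∈ (chartAt (EuclideanHalfSpace n) x₁).source) :
    (chartMetric x₀ hf hpos).IsIsometryAt (chartMetric x₁ hf hpos) (transition x₀ x₁) z where
  mem := hz
  mem' := transition_mem hz hz'
  contDiffAt := contDiffAt_infty.1 (contDiffAt_transition hz hz') 2
  map_g := by
    filter_upwards [eventually_mem_overlap hz hz'] with w hw a b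
    change pullForm _ _ _ _ = pullForm _ _ _ _
    rw [pullForm_eq_inner_of_eq x₁ (symm_transition hw.2), pullForm_eq_inner_of_eq x₀ rfl,
      tangentRep_transition hw.1 hw.2, tangentRep_transition hw.1 hw.2]
  map_f := by
    filter_upwards [eventually_mem_overlap hz hz'] with w hw
    exact congrArg f (symm_transition hw.2)

end

end RiemannCoord
end

noncomputable section
open scoped Topology

/-! ### The contradiction -/

namespace WeightedMetric

/-- Every pair of linearly independent vectors orthogonal to `u` yields a frame, by the
Gram-Schmidt process. -/
lemma exists_isFrame {E : Type*} [NormedAddCommGroup E] [NormedSpace ℝ E] {U O : Set E}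
    {G : WeightedMetric U O} {y u : E} (hy : y ∈ U) {p q : E}
    (hpq : LinearIndependent ℝ ![p, q]) (hp : G.g y p u = 0) (hq : G.g y q u = 0) :
    ∃ V, G.IsFrame y u V := by
  have hf := G.f_pos y hy
  rw [LinearIndependent.pair_iff] at hpq
  have hp0 : p ≠ 0 := by
    rintro rfl
    exact one_ne_zero (hpq 1 0 (by simp)).1
  have hpp := G.g_pos y hy p hp0
  set w := q - (G.g y p q / G.g y p p) • p with hw
  have hw0 : w ≠ 0 := by
    intro h
    have := hpq (-(G.g y p q / G.g y p p)) 1 (by rw [← h, hw]; simp only [neg_smul, one_smul]; abel)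
    exact one_ne_zero this.2
  have hww := G.g_pos y hy w hw0
  have hpw : G.g y p w = 0 := by
    rw [hw, map_sub, map_smul, smul_eq_mul]
    field_simp
    ring
  have hwp : G.g y w p = 0 := by rw [G.g_symm, hpw]
  have hwu : G.g y w u = 0 := by
    rw [hw]
    simp [hp, hq]
  have hs : ∀ r, 0 < r → G.f y * ((√(G.f y * r))⁻¹ * ((√(G.f y * r))⁻¹ * r)) = 1 := by
    intro r hr
    have h1 : √(G.f y * r) ^ 2 = G.f y * r := Real.sq_sqrt (by positivity)
    have h2 : √(G.f y * r) ≠ 0 := (Real.sqrt_pos.2 (by positivity)).ne'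
    field_simp
    linarith
  refine ⟨![(√(G.f y * G.g y p p))⁻¹ • p, (√(G.f y * G.g y w w))⁻¹ • w],
    Fin.forall_fin_two.2 ⟨Fin.forall_fin_two.2 ⟨?_, ?_⟩, Fin.forall_fin_two.2 ⟨?_, ?_⟩⟩,
    Fin.forall_fin_two.2 ⟨?_, ?_⟩⟩
  · simpa using hs _ hpp
  · simp [hpw]
  · simp [hwp]
  · simpa using hs _ hww
  · simp [hp]
  · simp [hwu]

end WeightedMetric

namespace RiemannCoord

open Manifold Filter WeightedMetric

variable {M : Type*} [TopologicalSpace M]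
  [ChartedSpace (EuclideanHalfSpace 3) M] [IsManifold (𝓡∂ 3) ∞ M]
  [RiemannianBundle (fun x : M => TangentSpace (𝓡∂ 3) x)]
  [IsContMDiffRiemannianBundle (𝓡∂ 3) ∞ (EuclideanSpace ℝ (Fin 3))
    (fun x : M => TangentSpace (𝓡∂ 3) x)]
  {f : M → ℝ} {hf : ContMDiff (𝓡∂ 3) 𝓘(ℝ, ℝ) ∞ f} {hpos : ∀ p, 0 < f p}

/-- The distance from a point to a set. -/
def LengthDist.distTo (D : ConformalDist hf hpos) (C : Set M) (p : M) : ℝ :=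
  sInf (D.d p '' C)

namespace LengthDist

variable (D : ConformalDist hf hpos) {C : Set M}

lemma bddBelow_image (p : M) : BddBelow (D.d p '' C) :=
  ⟨0, by rintro _ ⟨q, -, rfl⟩; exact D.nonneg p q⟩

lemma distTo_le_add (hC : C.Nonempty) (p q : M) : D.distTo C q ≤ D.distTo C p + D.d p q := by
  rw [← sub_le_iff_le_add]
  refine le_csInf (hC.image _) ?_
  rintro _ ⟨r, hr, rfl⟩
  have h1 : D.distTo C q ≤ D.d q r := csInf_le (D.bddBelow_image q) (mem_image_of_mem _ hr)
  have h2 := D.triangle q p r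
  rw [D.symm q p] at h2
  linarith

lemma distTo_nonpos {p : M} (hp : p ∈ C) : D.distTo C p ≤ 0 := by
  rw [← D.self_eq_zero p]
  exact csInf_le (D.bddBelow_image p) (mem_image_of_mem _ hp)

end LengthDist

namespace Minimizer

variable {D : ConformalDist hf hpos} {C₁ C₂ : Set M} {L : ℝ} {γ : ℝ → M}

/-- There is a barrier with constant `κ` at time `t`, in every chart around the point `γ t`. -/
def HasBarrier (_ : Minimizer D C₁ C₂ L γ) (t κ : ℝ) : Prop :=
  ∀ x₀ : M, γ t ∈ (chartAt (EuclideanHalfSpace 3) x₀).source → ∃ V W,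
    (chartMetric x₀ hf hpos).Barrier (fun y => D.distTo C₁ ((extChartAt (𝓡∂ 3) x₀).symm y)) t κ
      (coordCurve (n := 3) x₀ γ t) (coordVel (n := 3) x₀ γ L t) V W ∧ (t = 0 → W = 0)

variable (hγ : Minimizer D C₁ C₂ L γ)

include hγ

lemma le_distTo {p : M} (hp : p ∈ C₂) : L ≤ D.distTo C₁ p := by
  refine le_csInf (Set.Nonempty.image _ ⟨_, hγ.zero_mem⟩) ?_
  rintro _ ⟨q, hq, rfl⟩
  rw [D.symm]
  exact hγ.le_dist q hq p hp

/-- At the left end there is a barrier with `κ = 0`. -/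
lemma hasBarrier_zero
    (hbdry : ∀ φ ∈ IsManifold.maximalAtlas (𝓡∂ 3) ∞ M, ∀ p ∈ φ.source,
      p ∈ (𝓡∂ 3).boundary M → normalDeriv φ f p = -f p * meanCurvature φ p) :
    hγ.HasBarrier 0 0 := by
  intro x₀ hsrc
  set y := coordCurve (n := 3) x₀ γ 0 with hy
  set u := coordVel (n := 3) x₀ γ L 0
  have hyU := hγ.coordCurve_mem hsrc
  -- Since `u` is normal to the boundary, frames consist of tangential vectors.
  obtain ⟨hn, hu0, hv0⟩ := hγ.normal_left hsrc
  have hli : LinearIndependent ℝ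
      ![(EuclideanSpace.single 1 1 : EuclideanSpace ℝ (Fin 3)), EuclideanSpace.single 2 1] := by
    rw [LinearIndependent.pair_iff]
    intro s t hst
    have h1 := congrArg (fun v : EuclideanSpace ℝ (Fin 3) => v 1) hst
    have h2 := congrArg (fun v : EuclideanSpace ℝ (Fin 3) => v 2) hst
    simp at h1 h2
    exact ⟨h1, h2⟩
  obtain ⟨V, hV⟩ := exists_isFrame (G := chartMetric x₀ hf hpos) hyU (u := u) hli
    (by rw [(chartMetric x₀ hf hpos).g_symm]; exact hγ.perp_left hsrc (by simp))
    (by rw [(chartMetric x₀ hf hpos).g_symm]; exact hγ.perp_left hsrc (by simp))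
  refine ⟨V, 0, ⟨hV, fun ε hε => ?_⟩, fun _ => rfl⟩
  have hend : (chartMetric x₀ hf hpos).endTerm y u V 0 = 0 := by
    refine endTerm_eq_zero hyU (hγ.regular hγ.zero_mem_Icc hsrc).2.2 hV (σ := -1) (by norm_num)
      (fun k => by rw [hn k]; ring) ?_
    rw [hγ.symm_coordCurve hsrc]
    exact hbdry _ (IsManifold.chart_mem_maximalAtlas x₀) _ hsrc
      (hγ.union_eq ▸ Or.inl hγ.zero_mem)
  rw [hend]
  have hle : ∀ i, ∀ᶠ s in 𝓝 (0 : ℝ), D.distTo C₁ ((extChartAt (𝓡∂ 3) x₀).symm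
      (y + s • V i + (s ^ 2 / 2) • (0 : EuclideanSpace ℝ (Fin 3)))) ≤ 0 := by
    intro i
    have hc : Tendsto (fun s : ℝ => y + s • V i + (s ^ 2 / 2) • (0 : EuclideanSpace ℝ (Fin 3)))
        (𝓝 0) (𝓝 y) := by
      have : Continuous fun s : ℝ => y + s • V i + (s ^ 2 / 2) •
        (0 : EuclideanSpace ℝ (Fin 3)) := by fun_prop
      simpa using this.tendsto 0
    filter_upwards [hc.eventually (hγ.eventually_mem_left hsrc)] with s hs
    refine D.distTo_nonpos (hs ?_)
    have h1 : (V i) 0 = 0 := hv0 _ (hV.perp i)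
    have h2 : y 0 = 0 := hγ.coord_zero hsrc
    simp [h1, h2]
  have hneg : Tendsto (fun s : ℝ => -s) (𝓝 0) (𝓝 0) := by
    simpa using (continuous_neg (G := ℝ)).tendsto 0
  filter_upwards [hle 0, hle 1, hneg.eventually (hle 0), hneg.eventually (hle 1)] with s a b c d
  simp only [Fin.sum_univ_two, Pi.zero_apply]
  nlinarith [sq_nonneg s]

/-- At interior points it suffices to have a barrier in one chart. -/
lemma hasBarrier_of_chart {t κ : ℝ} (ht : t ∈ Ioo 0 L) {x₀ : M}
    (hsrc : γ t ∈ (chartAt (EuclideanHalfSpace 3) x₀).source)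
    {V W : Fin 2 → EuclideanSpace ℝ (Fin 3)} (hbar : (chartMetric x₀ hf hpos).Barrier
      (fun y => D.distTo C₁ ((extChartAt (𝓡∂ 3) x₀).symm y)) t κ
      (coordCurve (n := 3) x₀ γ t) (coordVel (n := 3) x₀ γ L t) V W) :
    hγ.HasBarrier t κ := by
  intro x₁ hsrc₁
  have htI := Ioo_subset_Icc_self ht
  have hz : coordCurve (n := 3) x₀ γ t ∈ interiorTarget x₀ :=
    ⟨hγ.coordCurve_mem hsrc, hγ.coordCurve_pos ht hsrc⟩
  have hz' : (extChartAt (𝓡∂ 3) x₀).symm (coordCurve (n := 3) x₀ γ t) ∈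
      (chartAt (EuclideanHalfSpace 3) x₁).source := by rwa [hγ.symm_coordCurve hsrc]
  have hiso := isIsometryAt_transition (hf := hf) (hpos := hpos) hz hz'
  have hτ : transition x₀ x₁ (coordCurve (n := 3) x₀ γ t) = coordCurve (n := 3) x₁ γ t := by
    rw [transition, hγ.symm_coordCurve hsrc]
  have hvel : fderiv ℝ (transition x₀ x₁) (coordCurve (n := 3) x₀ γ t)
      (coordVel (n := 3) x₀ γ L t) = coordVel (n := 3) x₁ γ L t := by
    have h1 := hiso.hasFDerivAt.comp_hasDerivWithinAt t (hγ.regular htI hsrc).1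
    have hev : coordCurve (n := 3) x₁ γ =ᶠ[𝓝[Icc 0 L] t]
        transition x₀ x₁ ∘ coordCurve (n := 3) x₀ γ := by
      filter_upwards [(hγ.continuousOn t htI).preimage_mem_nhdsWithin
        ((chartAt (EuclideanHalfSpace 3) x₀).open_source.mem_nhds hsrc)] with s hs
      change _ = transition x₀ x₁ (coordCurve (n := 3) x₀ γ s)
      rw [transition, hγ.symm_coordCurve hs]
    have h2 := h1.congr_of_eventuallyEq hev hτ.symm
    exact (h2.derivWithin (uniqueDiffOn_Icc hγ.pos t htI)).symm
  obtain ⟨K, hK⟩ := (D.isChartDist x₁).exists_lipschitz (transition_mem hz hz')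
    (ϕ := fun y => D.distTo C₁ ((extChartAt (𝓡∂ 3) x₁).symm y))
    fun y _ z _ => D.distTo_le_add ⟨_, hγ.zero_mem⟩ _ _
  obtain ⟨V', W', h⟩ := hiso.exists_barrier
    (ϕ' := fun y => D.distTo C₁ ((extChartAt (𝓡∂ 3) x₁).symm y)) (by
    filter_upwards [eventually_mem_overlap hz hz'] with w hw
    exact congrArg (D.distTo C₁) (symm_transition hw.2)) hK hbar
  rw [hvel, hτ] at h
  exact ⟨V', W', h, fun h0 => absurd h0 ht.1.ne'⟩

/-- There is no barrier with positive constant at the right end. -/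
lemma not_barrier_end
    (hbdry : ∀ φ ∈ IsManifold.maximalAtlas (𝓡∂ 3) ∞ M, ∀ p ∈ φ.source,
      p ∈ (𝓡∂ 3).boundary M → normalDeriv φ f p = -f p * meanCurvature φ p) {x₀ : M}
    (hsrc : γ L ∈ (chartAt (EuclideanHalfSpace 3) x₀).source) {κ : ℝ} (hκ : 0 < κ)
    {V : Fin 2 → EuclideanSpace ℝ (Fin 3)} (hbar : (chartMetric x₀ hf hpos).Barrier
      (fun y => D.distTo C₁ ((extChartAt (𝓡∂ 3) x₀).symm y)) L κ
      (coordCurve (n := 3) x₀ γ L) (coordVel (n := 3) x₀ γ L L) V 0) : False := by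
  set y := coordCurve (n := 3) x₀ γ L with hy
  set u := coordVel (n := 3) x₀ γ L L
  have hyU := hγ.coordCurve_mem hsrc
  obtain ⟨hn, hu0, hv0⟩ := hγ.normal_right hsrc
  have hrsrc : (fun t => γ (L - t)) 0 ∈ (chartAt (EuclideanHalfSpace 3) x₀).source := by
    simpa using hsrc
  have hend : (chartMetric x₀ hf hpos).endTerm y u V 0 = 0 := by
    refine endTerm_eq_zero hyU (hγ.regular hγ.end_mem_Icc hsrc).2.2 hbar.isFrame (σ := 1)
      (by norm_num) (fun k => by rw [hn k]; ring) ?_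
    rw [hγ.symm_coordCurve hsrc]
    exact hbdry _ (IsManifold.chart_mem_maximalAtlas x₀) _ hsrc
      (hγ.union_eq ▸ Or.inr hγ.end_mem)
  have hyr : coordCurve (n := 3) x₀ (fun t => γ (L - t)) 0 = y := by simp [hy, coordCurve]
  have hle : ∀ i, ∀ᶠ s in 𝓝 (0 : ℝ), L ≤ D.distTo C₁ ((extChartAt (𝓡∂ 3) x₀).symm
      (y + s • V i + (s ^ 2 / 2) • (0 : EuclideanSpace ℝ (Fin 3)))) := by
    intro i
    have hc : Tendsto (fun s : ℝ => y + s • V i + (s ^ 2 / 2) • (0 : EuclideanSpace ℝ (Fin 3)))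
        (𝓝 0) (𝓝 y) := by
      have : Continuous fun s : ℝ => y + s • V i + (s ^ 2 / 2) •
        (0 : EuclideanSpace ℝ (Fin 3)) := by fun_prop
      simpa using this.tendsto 0
    have h0 := hγ.reverse.eventually_mem_left hrsrc
    rw [hyr] at h0
    filter_upwards [hc.eventually h0] with s hs
    refine hγ.le_distTo (hs ?_)
    have h1 : (V i) 0 = 0 := hv0 _ (hbar.isFrame.perp i)
    have h2 : y 0 = 0 := by rw [← hyr]; exact hγ.reverse.coord_zero hrsrc
    simp [h1, h2]
  have hneg : Tendsto (fun s : ℝ => -s) (𝓝 0) (𝓝 0) := by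
    simpa using (continuous_neg (G := ℝ)).tendsto 0
  -- The four varied points have distance at least `L` from `C₁`, so the sum is at least `4 L`.
  have hall : ∀ᶠ s in 𝓝 (0 : ℝ), 0 ≤ s ^ 2 * (0 - κ + κ / 2) := by
    filter_upwards [hle 0, hle 1, hneg.eventually (hle 0), hneg.eventually (hle 1),
      hbar.eventually_le (κ / 2) (by positivity)] with s a b c d e
    rw [hend] at e
    simp only [Fin.sum_univ_two, Pi.zero_apply] at e
    linarith
  obtain ⟨s, hs, hs0⟩ := ((hall.filter_mono nhdsWithin_le_nhds).and
    (self_mem_nhdsWithin (a := (0 : ℝ)) (s := Ioi 0))).exists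
  have : 0 < s ^ 2 := pow_pos hs0 2
  nlinarith

/-- The time interval is covered by intervals along which barriers improve. -/
lemma exists_barrier_step (hG : ∀ x₀, (chartMetric x₀ hf hpos).IsPositive) {t : ℝ}
    (ht : t ∈ Icc 0 L) : ∃ r > 0, ∀ a b, a ∈ Icc 0 L → b ∈ Icc 0 L → a ∈ Metric.ball t r →
      b ∈ Metric.ball t r → a < b → ∀ κ, hγ.HasBarrier a κ → ∃ κ' > κ, ∃ x₀,
      γ b ∈ (chartAt (EuclideanHalfSpace 3) x₀).source ∧ ∃ V, (chartMetric x₀ hf hpos).Barrier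
      (fun y => D.distTo C₁ ((extChartAt (𝓡∂ 3) x₀).symm y)) b κ'
      (coordCurve (n := 3) x₀ γ b) (coordVel (n := 3) x₀ γ L b) V 0 := by
  set x₀ := γ t
  have hnhds : γ ⁻¹' (chartAt (EuclideanHalfSpace 3) x₀).source ∈ 𝓝[Icc 0 L] t :=
    (hγ.continuousOn t ht).preimage_mem_nhdsWithin
      ((chartAt (EuclideanHalfSpace 3) x₀).open_source.mem_nhds (mem_chart_source _ _))
  obtain ⟨ε, hε, hsub⟩ := Metric.mem_nhdsWithin_iff.1 hnhds
  set α := max 0 (t - ε / 2) with hα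
  set β := min L (t + ε / 2) with hβ
  have hαβ : α < β := by
    rw [hα, hβ, max_lt_iff, lt_min_iff, lt_min_iff]
    exact ⟨⟨hγ.pos, by linarith [ht.1]⟩, by linarith [ht.2], by linarith⟩
  have hIs : ∀ τ ∈ Icc α β, γ τ ∈ (chartAt (EuclideanHalfSpace 3) x₀).source := fun τ hτ =>
    hsub ⟨by
      rw [Metric.mem_ball, Real.dist_eq, abs_lt]
      constructor
      · linarith [(le_max_right 0 (t - ε / 2)).trans hτ.1]
      · linarith [hτ.2.trans (min_le_right L (t + ε / 2))],
      (le_max_left _ _).trans hτ.1, hτ.2.trans (min_le_left _ _)⟩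
  have hgeo := hγ.geodesic (le_max_left _ _) hαβ (min_le_left _ _) hIs
  -- The bound `C` is uniform near `t`, so the linear equations for the fields can be solved on all
  -- intervals of length at most `1 / (2C)` near `t`.
  obtain ⟨C, hC, hbd⟩ := exists_fieldMap_bound (G := chartMetric x₀ hf hpos) hgeo.continuousOn_x
    hgeo.continuousOn hgeo.mem_U
  refine ⟨min (ε / 2) (1 / (4 * C)), lt_min (by positivity) (by positivity), ?_⟩
  intro a b haL hbL ha hb hab κ hbar
  rw [Metric.mem_ball, Real.dist_eq, abs_lt, lt_min_iff] at ha hb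
  obtain ⟨ha1, ha2, ha3⟩ := ha
  obtain ⟨hb1, hb2, hb3⟩ := hb
  have hm1 := min_le_left (ε / 2) (1 / (4 * C))
  have hm2 := min_le_right (ε / 2) (1 / (4 * C))
  have hsubI : Icc a b ⊆ Icc α β :=
    Icc_subset_Icc (max_le haL.1 (by linarith)) (le_min hbL.2 (by linarith))
  have hsrc : ∀ τ ∈ Icc a b, γ τ ∈ (chartAt (EuclideanHalfSpace 3) x₀).source := fun τ hτ =>
    hIs τ (hsubI hτ)
  have haI : a ∈ Icc a b := left_mem_Icc.2 hab.le
  have hbI : b ∈ Icc a b := right_mem_Icc.2 hab.le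
  obtain ⟨V₀, W₀, hbar₀, hW₀⟩ := hbar x₀ (hsrc a haI)
  have hends : ∀ τ ∈ Icc a b, coordCurve (n := 3) x₀ γ τ 0 = 0 → τ = 0 ∨ τ = L := by
    intro τ hτ h0
    rcases (haL.1.trans hτ.1).eq_or_lt with h1 | h1
    · exact Or.inl h1.symm
    rcases (hτ.2.trans hbL.2).eq_or_lt with h2 | h2
    · exact Or.inr h2
    · exact absurd h0 (hγ.coordCurve_pos ⟨h1, h2⟩ (hsrc τ hτ)).ne'
  obtain ⟨V, κ', hκ', h⟩ := (hγ.geodesic haL.1 hab hbL.2 hsrc).exists_barrier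
    (D.isChartDist x₀) (fun y hy h => ⟨hy, h⟩) (fun y hy => hy.2) (by simp) (hG x₀) hC
    (fun τ hτ => hbd τ (hsubI hτ))
    (by
      have : 1 / (2 * C) = 1 / (4 * C) + 1 / (4 * C) := by field_simp; norm_num
      linarith)
    (ϕ := fun y => D.distTo C₁ ((extChartAt (𝓡∂ 3) x₀).symm y))
    (fun y _ z _ => D.distTo_le_add ⟨_, hγ.zero_mem⟩ _ _)
    (fun τ hτ h0 => by
      rcases hends τ hτ h0 with rfl | rfl
      · exact (hγ.normal_left (hsrc _ hτ)).2
      · exact (hγ.normal_right (hsrc _ hτ)).2)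
    (fun h0 => by
      rcases hends a haI h0 with h1 | h1
      · exact hW₀ h1
      · exact absurd hab (not_lt.2 (by rw [h1]; exact hbL.2)))
    hbar₀
  exact ⟨κ', hκ', x₀, hsrc b hbI, V, h⟩

/-- Under the curvature and boundary conditions there are no minimizing curves between parts of
the boundary. -/
lemma false_of_isPositive (hG : ∀ x₀, (chartMetric x₀ hf hpos).IsPositive)
    (hbdry : ∀ φ ∈ IsManifold.maximalAtlas (𝓡∂ 3) ∞ M, ∀ p ∈ φ.source,
      p ∈ (𝓡∂ 3).boundary M → normalDeriv φ f p = -f p * meanCurvature φ p) : False := by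
  -- The interval `[0, L]` is divided into `N` equal parts, each of which is short enough for one
  -- step in a chart. The constant is `0` at the start, and every step increases it.
  choose! r hr hstep using fun t (ht : t ∈ Icc 0 L) => hγ.exists_barrier_step hG ht
  obtain ⟨δ, hδ, hleb⟩ := lebesgue_number_lemma_of_metric (s := Icc 0 L)
    (c := fun t : Icc 0 L => Metric.ball (t : ℝ) (r t)) isCompact_Icc
    (fun t => Metric.isOpen_ball)
    fun t ht => mem_iUnion.2 ⟨⟨t, ht⟩, Metric.mem_ball_self (hr t ht)⟩
  have hLpos := hγ.pos
  obtain ⟨N, hN⟩ := exists_nat_gt (L / δ)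
  have hN0 : (0 : ℝ) < N := (div_pos hLpos hδ).trans hN
  have hLN : L / N < δ := by
    rw [div_lt_iff₀ hδ] at hN
    rw [div_lt_iff₀ hN0]
    linarith
  have hmem : ∀ k : ℕ, k ≤ N → L * k / N ∈ Icc 0 L := fun k hk => by
    have hk' : (k : ℝ) ≤ N := by exact_mod_cast hk
    refine ⟨by positivity, ?_⟩
    rw [div_le_iff₀ hN0]
    gcongr
  have hone : ∀ k : ℕ, k + 1 ≤ N → ∀ κ, hγ.HasBarrier (L * k / N) κ → ∃ κ' > κ, ∃ x₀,
      γ (L * (k + 1 : ℕ) / N) ∈ (chartAt (EuclideanHalfSpace 3) x₀).source ∧ ∃ V,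
      (chartMetric x₀ hf hpos).Barrier
      (fun y => D.distTo C₁ ((extChartAt (𝓡∂ 3) x₀).symm y)) (L * (k + 1 : ℕ) / N) κ'
      (coordCurve (n := 3) x₀ γ (L * (k + 1 : ℕ) / N))
      (coordVel (n := 3) x₀ γ L (L * (k + 1 : ℕ) / N)) V 0 := by
    intro k hk κ hbar
    have ha := hmem k (by omega)
    have hb := hmem (k + 1) hk
    obtain ⟨t, ht⟩ := hleb _ ha
    have hdiff : L * (k + 1 : ℕ) / N - L * k / N = L / N := by push_cast; ring
    refine hstep t t.2 _ _ ha hb (ht (Metric.mem_ball_self hδ)) (ht ?_) ?_ κ hbar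
    · rw [Metric.mem_ball, Real.dist_eq, hdiff, abs_of_pos (by positivity)]
      exact hLN
    · have : 0 < L / N := by positivity
      linarith
  have hind : ∀ k : ℕ, k < N → ∃ κ, 0 ≤ κ ∧ hγ.HasBarrier (L * k / N) κ := by
    intro k
    induction k with
    | zero =>
      intro _
      refine ⟨0, le_rfl, ?_⟩
      simpa using hγ.hasBarrier_zero hbdry
    | succ k ih =>
      intro hk
      obtain ⟨κ, hκ, hbar⟩ := ih (by omega)
      obtain ⟨κ', hκ', x₀, hsrc, V, h⟩ := hone k hk.le κ hbar
      refine ⟨κ', hκ.trans hκ'.le, hγ.hasBarrier_of_chart ⟨by positivity, ?_⟩ hsrc h⟩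
      rw [div_lt_iff₀ hN0]
      have : ((k + 1 : ℕ) : ℝ) < N := by exact_mod_cast hk
      gcongr
  have hNpos : 0 < N := by exact_mod_cast hN0
  obtain ⟨κ, hκ, hbar⟩ := hind (N - 1) (by omega)
  obtain ⟨κ', hκ', x₀, hsrc, V, h⟩ := hone (N - 1) (by omega) κ hbar
  have hNN : L * (N - 1 + 1 : ℕ) / N = L := by
    rw [Nat.sub_add_cancel hNpos]
    field_simp
  rw [hNN] at hsrc h
  exact hγ.not_barrier_end hbdry hsrc (hκ.trans_lt hκ') h

end Minimizer

end RiemannCoord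
end

theorem theorem1p7 {M : Type*} [TopologicalSpace M] [T2Space M] [CompactSpace M]
    [ConnectedSpace M] [ChartedSpace (EuclideanHalfSpace 3) M] [IsManifold (𝓡∂ 3) ∞ M]
    [RiemannianBundle (fun x : M => TangentSpace (𝓡∂ 3) x)]
    [IsContMDiffRiemannianBundle (𝓡∂ 3) ∞ (EuclideanSpace ℝ (Fin 3))
      (fun x : M => TangentSpace (𝓡∂ 3) x)]
    (hbd : ((𝓡∂ 3).boundary M).Nonempty)
    (f : M → ℝ) (hf : ContMDiff (𝓡∂ 3) 𝓘(ℝ, ℝ) ∞ f) (hpos : ∀ p, 0 < f p)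
    (hcurv : ∀ φ ∈ IsManifold.maximalAtlas (𝓡∂ 3) ∞ M, ∀ p ∈ φ.source,
      ∀ v : TangentSpace (𝓡∂ 3) p, ‖v‖ = 1 →
        0 < RiemannCoord.ricci φ p v - (f p)⁻¹ * RiemannCoord.laplacian φ f p
          + 1 / 2 * RiemannCoord.gradNormSq φ (fun x => Real.log (f x)) p)
    (hbdry : ∀ φ ∈ IsManifold.maximalAtlas (𝓡∂ 3) ∞ M, ∀ p ∈ φ.source,
      p ∈ (𝓡∂ 3).boundary M →
        RiemannCoord.normalDeriv φ f p = -f p * RiemannCoord.meanCurvature φ p) :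
    IsConnected ((𝓡∂ 3).boundary M) := by
  have : IsManifold (𝓡∂ 3) 1 M := IsManifold.of_le (n := ∞) (by simp)
  refine ⟨hbd, isPreconnected_closed_iff.2 fun t t' ht ht' hcov hn hn' => ?_⟩
  by_contra hemp
  have hcl : IsClosed ((𝓡∂ 3).boundary M) := (𝓡∂ 3).isClosed_boundary (n := 1) one_ne_zero
  have hdisj : Disjoint ((𝓡∂ 3).boundary M ∩ t) ((𝓡∂ 3).boundary M ∩ t') :=
    Set.disjoint_left.2 fun p hp hp' => hemp ⟨p, hp.1, hp.2, hp'.2⟩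
  obtain ⟨D⟩ := RiemannCoord.nonempty_conformalDist hf hpos
  obtain ⟨L, hL, x, h0, hLx, hcont, hiso, hnot, hle⟩ :=
    D.exists_minimizer (hcl.inter ht) (hcl.inter ht') hn hn' hdisj
  have hmin : RiemannCoord.Minimizer D _ _ L x :=
    { pos := hL
      isClosed_left := hcl.inter ht
      isClosed_right := hcl.inter ht'
      disjoint := hdisj
      union_eq := by rw [← Set.inter_union_distrib_left, Set.inter_eq_left]; exact hcov
      zero_mem := h0
      end_mem := hLx
      continuousOn := hcont
      isometric := hiso
      notMem := hnot
      le_dist := hle }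
  exact hmin.false_of_isPositive (fun x₀ => RiemannCoord.isPositive x₀ hcurv) hbdry
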